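/- Lemma. For every integer $d\ge 3$ and all real numbers $M,K,S_0\ge 0$ there is a constant $C>0$, depending only on $d,M,K,S_0$, such that the following holds. Use cylindrical coordinates on $\mathbb R^d$: $r=(x_1^2+\dots+x_{d-1}^2)^{1/2}$, $z=x_d$, $e^r=(x_1,\dots,x_{d-1},0)/r$, $e^z=(0,\dots,0,1)$, and let $\Pi=\{(r,z): r\ge 0,\ z\in\mathbb R\}$. Let $s>1+d/2$, $0<T\le\infty$, and let $u\in C([0,T);H^s(\mathbb R^d))\cap C^1([0,T);H^{s-1}(\mathbb R^d))$ be a solution of the incompressible Euler equations $\partial_t u+(u\cdot\nabla)u+\nabla p=0$, $\nabla\cdot u=0$ in $\mathbb R^d$ which is axisymmetric and swirl-free at every time, $u=u^r(t,r,z)e^r+u^z(t,r,z)e^z$. Let $\omega=\partial_z u^r-\partial_r u^z$ be its scalar vorticity and $\omega_0=\omega(0)$. Assume that $\omega_0\ge 0$, that $\omega_0$ is compactly supported in $\mathbb R^d$, and that $$\|r\,\omega_0\|_{L^1(\mathbb R^d)}=M,\qquad \|r^{-(d-2)}\omega_0\|_{L^\infty(\mathbb R^d)}=K,\qquad \sup\{r>0:(r,z)\in\operatorname{supp}\omega_0\}=S_0$$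 (the supremum is read as $0$ if $\omega_0\equiv 0$). Then for every integer $p\ge 1$, every $t\in[0,T)$ and every $r>0$ with $r\ge 2S_0$, the function $\omega(t)$ is integrable on $\{(\bar r,\bar z)\in\Pi:\bar r\ge r\}$ and $$m_r(t):=\iint_{\{(\bar r,\bar z)\in\Pi:\ \bar r\ge r\}}\omega(t,\bar r,\bar z)\,d\bar z\,d\bar r\ \le\ \frac{C^p\,p^p\,t^p}{r^{p(d+1)+d-1}} .$$ -/

import Mathlib

open MeasureTheory TemperedDistribution Set
open scoped SchwartzMap ENNReal NNReal

noncomputable section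

/-- The Euclidean space `ℝ^d`. -/
abbrev RSpace (d : ℕ) := EuclideanSpace ℝ (Fin d)

/-! ### Curves with values in the Sobolev space `H^s` -/

/-- `v ∈ C^k(I; H^s(ℝ^d))`, for `s ≥ 0` and a real-valued `v t x`.
The space `H^s` is identified with `L^2` through the Bessel potential of order `s`, which is a
bijection from `H^s` onto `L^2` and carries the `H^s` norm (up to equivalence) to the `L^2` norm: `f t` is the
(complexified) `L^2` class of `v t`, and `g t` is the image of `v t` in `L^2`. -/
def IsSobolevCurve {d : ℕ} (s : ℝ) (k : ℕ) (I : Set ℝ) (v : ℝ → RSpace d → ℝ) : Prop :=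
  ∃ f g : ℝ → Lp ℂ 2 (volume : Measure (RSpace d)),
    ContDiffOn ℝ k g I ∧
    ∀ t ∈ I, (f t =ᵐ[volume] fun x => ((v t x : ℝ) : ℂ)) ∧
      besselPotential (RSpace d) ℂ s (f t : 𝓢'(RSpace d, ℂ)) = (g t : 𝓢'(RSpace d, ℂ))

/-! ### The incompressible Euler equations -/

/-- The time interval `[0, T)`, where `T` may be `⊤`. -/
def timeInterval (T : EReal) : Set ℝ := {t : ℝ | 0 ≤ t ∧ (t : EReal) < T}

/-- The divergence of a vector field on `ℝ^d`. -/
def divergence {d : ℕ} (v : RSpace d → RSpace d) (x : RSpace d) : ℝ :=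
  ∑ i : Fin d, (fderiv ℝ v x (EuclideanSpace.single i (1 : ℝ))) i

/-- `u` is a solution on `[0, T)` of the incompressible Euler equations
`∂_t u + (u · ∇) u + ∇ p = 0`, `∇ · u = 0` in `ℝ^d`, in the class
`C([0, T); H^s) ∩ C^1([0, T); H^{s-1})`. Each `u t` is taken to be the `C^1` representative of its
class (there is one as soon as `s > 1 + d / 2`), so that the equations hold pointwise. -/
structure IsEulerSolution {d : ℕ} (s : ℝ) (T : EReal) (u : ℝ → RSpace d → RSpace d) : Prop where
  contDiff : ∀ t ∈ timeInterval T, ContDiff ℝ 1 (u t)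
  sobolev : ∀ i : Fin d, IsSobolevCurve s 0 (timeInterval T) (fun t x => u t x i)
  sobolev_deriv : ∀ i : Fin d, IsSobolevCurve (s - 1) 1 (timeInterval T) (fun t x => u t x i)
  momentum : ∃ p : ℝ → RSpace d → ℝ, ∀ t ∈ timeInterval T, ContDiff ℝ 1 (p t) ∧
    ∀ x, HasDerivWithinAt (fun τ => u τ x)
      (-(fderiv ℝ (u t) x (u t x)) - gradient (p t) x) (timeInterval T) t
  div_free : ∀ t ∈ timeInterval T, ∀ x, divergence (u t) x = 0

/-! ### Cylindrical coordinates and axisymmetric, swirl-free fields -/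

section Cylindrical

variable {d : ℕ} [NeZero d]

variable (d) in
/-- The index of the axial coordinate `z`: the last coordinate of `ℝ^d`. -/
def axisIdx : Fin d := ⟨d - 1, Nat.sub_lt (NeZero.pos d) Nat.one_pos⟩

/-- The coordinate `z` of a point. -/
def axialCoord (x : RSpace d) : ℝ := x (axisIdx d)

/-- The coordinate `r` of a point: its distance to the `z`-axis. -/
def cylRadius (x : RSpace d) : ℝ :=
  Real.sqrt (∑ i ∈ Finset.univ.erase (axisIdx d), x i ^ 2)

/-- The point of the meridional plane spanned by the first and the last coordinate axis which has
cylindrical coordinates `(r, z)`. There the unit vector `e^r` is the first coordinate vector. -/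
def meridianPoint (r z : ℝ) : RSpace d :=
  EuclideanSpace.single (0 : Fin d) r + EuclideanSpace.single (axisIdx d) z

/-- The component `v^r(r, z)` of an axisymmetric field. -/
def radialComp (v : RSpace d → RSpace d) (r z : ℝ) : ℝ := v (meridianPoint r z) 0

/-- The component `v^z(r, z)` of an axisymmetric field. -/
def axialComp (v : RSpace d → RSpace d) (r z : ℝ) : ℝ := v (meridianPoint r z) (axisIdx d)

/-- `v = v^r(r, z) e^r + v^z(r, z) e^z`, with `e^r = (x_1, …, x_{d-1}, 0) / r`. On the axis
`r = 0` this says that the components of `v` orthogonal to the axis vanish. -/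
def IsAxisymmetricSwirlFree (v : RSpace d → RSpace d) : Prop :=
  ∀ x : RSpace d,
    (∀ i : Fin d, i ≠ axisIdx d →
      v x i = radialComp v (cylRadius x) (axialCoord x) * (x i / cylRadius x)) ∧
    v x (axisIdx d) = axialComp v (cylRadius x) (axialCoord x)

/-- The scalar vorticity `ω = ∂_z v^r - ∂_r v^z`, as a function of `(r, z)`. -/
def scalarVorticity (v : RSpace d → RSpace d) (r z : ℝ) : ℝ :=
  deriv (fun ζ => radialComp v r ζ) z - deriv (fun ρ => axialComp v ρ z) r

/-- A function of `(r, z)` as a function on `ℝ^d`. -/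
def cylLift (f : ℝ → ℝ → ℝ) (x : RSpace d) : ℝ := f (cylRadius x) (axialCoord x)

variable (d) in
/-- `sup {r > 0 : (r, z) ∈ supp f}`, the radial size of the (closed) support of `f(r, z)`, regarded
as a function on `ℝ^d`; it is `0` if `f` vanishes identically. -/
def radialSupportSize (f : ℝ → ℝ → ℝ) : ℝ :=
  sSup {r : ℝ | 0 < r ∧ ∃ x ∈ tsupport (cylLift f : RSpace d → ℝ), cylRadius x = r}

end Cylindrical

/-- `A_r = {(r', z') ∈ Π : r' ≥ r}`, where `Π = {(r', z') : r' ≥ 0}`. -/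
def outerRegion (r : ℝ) : Set (ℝ × ℝ) := {q | 0 ≤ q.1 ∧ r ≤ q.1}

/-- The vorticity mass `∬_{A_r} f(r', z') dz' dr'` at distance at least `r` from the axis. -/
def outerMass (f : ℝ → ℝ → ℝ) (r : ℝ) : ℝ := ∫ q in outerRegion r, f q.1 q.2

end

/-! In the meridional half-plane the vorticity obeys the conservation law ∂_t ω + ∂_r(u^r ω) +
∂_z(u^z ω) = 0, so nonnegative vorticity is carried like a density. Two global facts are available:
ω stays nonnegative (`vort_nonneg`), and the impulse ∬ r^(d-1) ω never exceeds its initial value I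
(`impulse_le`). By Chebyshev the mass beyond radius α is then at most I / α^(d-1).

Mass reaches large radii only by radial transport. If φ is a smooth step that rises from 0 to 1 on
[α, α + h], then d/dt ∬ φ ω = ∬ φ' u^r ω. The heart of the proof is `exists_transport_bound`: when α
is comparable to δ, the right side is at most C I / (h^2 δ^(d-1)) times the mass beyond α. To see
this, u^r is expressed through ω by the Biot–Savart law, which makes the integral quadratic in ω
with an odd kernel of size |x - y|^(-(d-1)). Symmetrising in x and y replaces the weight g(x) by a
difference g(x) - g(y) and gains a factor |r_x - r_y|, and |r_x - r_y| / |x - y|^(d-1) has bounded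
averages over the rotations about the axis (`exists_sphere_integral_le`, `abs_near_integral_le`).
Vorticity close to the axis is paired with its reflection across the axis, and the cancellation
produces a factor r_y, that is, the impulse density (`abs_far_integral_le`).

The bound is iterated over p shells of width h = r / (4p) between r and r/2. With N_j the smoothed
mass beyond the j-th radius, N_j' ≤ L N_{j+1} with L of order p^2 / r^(d+1), and N_j(0) = 0 because
r/2 ≥ S₀. Integrating p times in time and using Chebyshev for N_p gives r^(-(d-1)) (L t)^p / p!, and
p^(2p) / p! ≤ e^p p^p finishes (`exists_outer_vort_le`).

A good part of the work is regularity. The velocity is only C^1 in space and ω only continuous, so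
the vorticity equation is used in weak form, positivity goes through a renormalisation argument in
the style of DiPerna and Lions, and the Biot–Savart law is proved for a regularised kernel with
bounds that do not depend on the regularisation. -/

set_option linter.unusedSectionVars false

noncomputable section

/-! ### Sobolev embedding into bounded continuous functions by the Fourier transform. -/

section SobolevEmbedding

open FourierTransform BoundedContinuousFunction

variable {E : Type*} [NormedAddCommGroup E] [InnerProductSpace ℝ E] [FiniteDimensional ℝ E]
  [MeasurableSpace E] [BorelSpace E]

/-- Multiplication by a fixed `L^p` function, as a continuous map between Lebesgue spaces. -/
def lpSMulCLM {p q r : ℝ≥0∞} [p.HolderTriple q r] [Fact (1 ≤ q)] [Fact (1 ≤ r)]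
    (g : Lp ℂ p (volume : Measure E)) :
    Lp ℂ q (volume : Measure E) →L[ℂ] Lp ℂ r (volume : Measure E) :=
  LinearMap.mkContinuous
    { toFun := fun f => g • f
      map_add' := fun f₁ f₂ => Lp.add_smul g f₁ f₂
      map_smul' := fun c f => by simpa using (Lp.smul_comm c g f).symm }
    ‖g‖ fun f => Lp.norm_smul_le g f

theorem lpSMulCLM_apply {p q r : ℝ≥0∞} [p.HolderTriple q r] [Fact (1 ≤ q)] [Fact (1 ≤ r)]
    (g : Lp ℂ p (volume : Measure E)) (f : Lp ℂ q (volume : Measure E)) :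
    (lpSMulCLM g f : Lp ℂ r (volume : Measure E)) = g • f := rfl

/-- The symbol of the inverse Bessel potential. -/
def besselSymbol (E : Type*) [NormedAddCommGroup E] (σ : ℝ) (x : E) : ℂ :=
  ((1 + ‖x‖ ^ 2) ^ (-σ / 2) : ℝ)

theorem besselSymbol_hasTemperateGrowth (σ : ℝ) :
    (besselSymbol E σ).HasTemperateGrowth := by
  unfold besselSymbol
  fun_prop

/-- The square of the symbol is (1 + |x|^2)^(-σ), which is integrable precisely because 2σ exceeds
the dimension. -/
theorem memLp_besselSymbol {σ : ℝ} (hσ : Module.finrank ℝ E < 2 * σ) :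
    MemLp (besselSymbol E σ) 2 (volume : Measure E) := by
  have : MemLp (fun x : E ↦ (1 + ‖x‖ ^ 2) ^ (-σ / 2)) 2 := by
    constructor
    · have : (fun x : E ↦ (1 + ‖x‖ ^ 2) ^ (-σ / 2)).HasTemperateGrowth := by
        fun_prop
      exact this.1.continuous.aestronglyMeasurable
    · rw [eLpNorm_lt_top_iff_lintegral_rpow_enorm_lt_top (by norm_num) (by norm_num)]
      suffices h : ∫⁻ a : E, ENNReal.ofReal ‖(1 + ‖a‖ ^ 2) ^ (-σ)‖ < ⊤ from by
        norm_cast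
        simp_rw [ofReal_norm] at h
        simp_rw [← enorm_pow]
        convert h
        rw [← Real.rpow_mul_natCast (by positivity)]
        simp
      apply ((integrable_rpow_neg_one_add_norm_sq hσ).congr _).lintegral_lt_top
      filter_upwards with x
      rw [Real.norm_eq_abs, abs_eq_self.mpr (by positivity)]
      congr
      ring
  exact this.ofReal

/-- The Sobolev embedding: the inverse Bessel potential as a map from `L^2` to the bounded
continuous functions. -/
def sobolevEmb (E : Type*) [NormedAddCommGroup E] [InnerProductSpace ℝ E] [FiniteDimensional ℝ E]
    [MeasurableSpace E] [BorelSpace E] {σ : ℝ} (hσ : Module.finrank ℝ E < 2 * σ) :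
    Lp ℂ 2 (volume : Measure E) →L[ℂ] (E →ᵇ ℂ) :=
  Real.Lp.fourierTransformInvCLM E ℂ ∘L lpSMulCLM (q := 2) (memLp_besselSymbol hσ).toLp ∘L
    fourierCLM ℂ (Lp ℂ 2 (volume : Measure E))

theorem continuous_integral_schwartz_smul (g : 𝓢(E, ℂ)) :
    Continuous fun b : E →ᵇ ℂ => ∫ x, g x • b x := by
  have hg : Integrable (fun x => g x) (volume : Measure E) := g.integrable
  have hi : ∀ b : E →ᵇ ℂ, Integrable (fun x => g x • b x) (volume : Measure E) := fun b => by
    simpa [mul_comm] using hg.bdd_mul (c := ‖b‖) b.continuous.aestronglyMeasurable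
      (Filter.Eventually.of_forall b.norm_coe_le_norm)
  refine (LinearMap.mkContinuous (𝕜 := ℂ) (𝕜₂ := ℂ) (σ := RingHom.id ℂ)
    { toFun := fun b : E →ᵇ ℂ => ∫ x, g x • b x
      map_add' := fun b c => by
        simp only [BoundedContinuousFunction.coe_add, Pi.add_apply, smul_add]
        exact integral_add (hi b) (hi c)
      map_smul' := fun a b => by
        simp only [BoundedContinuousFunction.coe_smul, RingHom.id_apply, ← integral_smul]
        exact integral_congr_ae (Filter.Eventually.of_forall fun x => smul_comm _ _ _) }
    (∫ x, ‖g x‖) fun b => ?_).continuous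
  calc ‖∫ x, g x • b x‖ ≤ ∫ x, ‖g x‖ * ‖b‖ := by
        refine norm_integral_le_of_norm_le (hg.norm.mul_const _)
          (Filter.Eventually.of_forall fun x => ?_)
        rw [norm_smul]
        gcongr
        exact b.norm_coe_le_norm x
    _ = _ := by rw [integral_mul_const]

/-- Both sides are continuous in `h`, the left one for weak convergence of distributions and the
right one through the embedding. Schwartz functions are dense in L^2, and for them the identity is
the multiplier calculus. -/
theorem besselPotential_neg_apply_eq_integral {σ : ℝ} (hσ : Module.finrank ℝ E < 2 * σ)
    (h : Lp ℂ 2 (volume : Measure E)) (g : 𝓢(E, ℂ)) :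
    besselPotential E ℂ (-σ) (h : 𝓢'(E, ℂ)) g = ∫ x, g x • sobolevEmb E hσ h x := by
  refine DenseRange.induction_on
    (p := fun h : Lp ℂ 2 (volume : Measure E) =>
      besselPotential E ℂ (-σ) (h : 𝓢'(E, ℂ)) g = ∫ x, g x • sobolevEmb E hσ h x)
    (SchwartzMap.denseRange_toLpCLM (p := 2) ENNReal.ofNat_ne_top) h ?_ ?_
  · apply isClosed_eq
    · have h1 : Continuous fun h : Lp ℂ 2 (volume : Measure E) =>
          besselPotential E ℂ (-σ) (h : 𝓢'(E, ℂ)) :=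
        (besselPotential E ℂ (-σ) ∘L Lp.toTemperedDistributionCLM ℂ volume 2).continuous
      exact (PointwiseConvergenceCLM.evalCLM (RingHom.id ℂ) ℂ g).continuous.comp h1
    · exact (continuous_integral_schwartz_smul g).comp (sobolevEmb E hσ).continuous
  · intro φ
    have hb := besselSymbol_hasTemperateGrowth (E := E) σ
    have e1 : besselPotential E ℂ (-σ) = fourierMultiplierCLM ℂ (besselSymbol E σ) := rfl
    rw [e1]
    simp only [SchwartzMap.toLpCLM_apply, Lp.toTemperedDistribution_toLp_eq]
    rw [fourierMultiplierCLM_toTemperedDistributionCLM_eq hb]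
    refine (SchwartzMap.toTemperedDistributionCLM_apply_apply volume _ _).trans ?_
    refine integral_congr_ae (Filter.Eventually.of_forall fun x => ?_)
    simp only [SchwartzMap.fourierMultiplierCLM_apply, sobolevEmb, ContinuousLinearMap.comp_apply,
      Real.Lp.fourierTransformInvCLM_apply, Real.Lp.fourierTransformInv_apply, lpSMulCLM_apply,
      fourierCLM_apply, SchwartzMap.toLp_fourier_eq, SchwartzMap.fourierInv_coe]
    congr 1
    refine Real.fourierInv_congr_ae ?_ x
    filter_upwards [Lp.coeFn_lpSMul (r := 1) (memLp_besselSymbol hσ).toLp ((𝓕 φ).toLp 2),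
      (memLp_besselSymbol hσ).coeFn_toLp, (𝓕 φ).coeFn_toLp 2 volume] with y h1 h2 h3
    rw [h1]
    simp [h2, h3, SchwartzMap.smulLeftCLM_apply_apply hb]

/-- Inverting the Bessel potential writes `f` as a distribution that is integration against a
continuous function; testing with compactly supported smooth functions identifies the two almost
everywhere. -/
theorem ae_eq_sobolevEmb {σ : ℝ} (hσ : Module.finrank ℝ E < 2 * σ)
    {f h : Lp ℂ 2 (volume : Measure E)}
    (hfh : besselPotential E ℂ σ (f : 𝓢'(E, ℂ)) = (h : 𝓢'(E, ℂ))) :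
    f =ᵐ[volume] sobolevEmb E hσ h := by
  have h1 : besselPotential E ℂ (-σ) (h : 𝓢'(E, ℂ)) = f := by
    rw [besselPotential_neg_apply_eq_iff, hfh]
  refine ae_eq_of_integral_contDiff_smul_eq ((Lp.memLp f).locallyIntegrable (by norm_num))
    (sobolevEmb E hσ h).continuous.locallyIntegrable fun g hg hgc => ?_
  have hg₁ : HasCompactSupport (Complex.ofRealCLM ∘ g) := hgc.comp_left rfl
  have hg₂ : ContDiff ℝ (⊤ : ℕ∞) (Complex.ofRealCLM ∘ g) := by fun_prop
  have := besselPotential_neg_apply_eq_integral hσ h (hg₁.toSchwartzMap hg₂)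
  rw [h1, Lp.toTemperedDistribution_apply] at this
  simpa using this

end SobolevEmbedding

/-! ### From curves in H^s to curves of bounded continuous functions and L^2 bounds. -/

section SobolevCurves

open FourierTransform BoundedContinuousFunction

section Multiplier

variable {E : Type*} [NormedAddCommGroup E] [InnerProductSpace ℝ E] [FiniteDimensional ℝ E]
  [MeasurableSpace E] [BorelSpace E]

/-- The Fourier multiplier with a bounded symbol, as an operator on `L^2`. -/
def l2Multiplier {g : E → ℂ} (hg : MemLp g ∞ (volume : Measure E)) :
    Lp ℂ 2 (volume : Measure E) →L[ℂ] Lp ℂ 2 (volume : Measure E) :=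
  fourierInvCLM ℂ (Lp ℂ 2 (volume : Measure E)) ∘L lpSMulCLM (q := 2) hg.toLp ∘L
    fourierCLM ℂ (Lp ℂ 2 (volume : Measure E))

theorem l2Multiplier_toTemperedDistribution {g : E → ℂ} (hg : MemLp g ∞ (volume : Measure E))
    (hg' : g.HasTemperateGrowth) (h : Lp ℂ 2 (volume : Measure E)) :
    ((l2Multiplier hg h : Lp ℂ 2 (volume : Measure E)) : 𝓢'(E, ℂ)) =
      fourierMultiplierCLM ℂ g (h : 𝓢'(E, ℂ)) := by
  rw [fourierMultiplierCLM_apply, Lp.fourier_toTemperedDistribution_eq,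
    ← Lp.toTemperedDistribution_smul_eq (r := 2) hg' hg, Lp.fourierInv_toTemperedDistribution_eq]
  rfl

/-- The symbol of the composition of a directional derivative with an inverse Bessel potential. -/
def derivSymbol (σ : ℝ) (m x : E) : ℂ :=
  (2 * Real.pi * Complex.I) * ((inner ℝ x m : ℝ) * besselSymbol E σ x)

theorem derivSymbol_hasTemperateGrowth (σ : ℝ) (m : E) :
    (derivSymbol σ m).HasTemperateGrowth := by
  unfold derivSymbol besselSymbol
  fun_prop

/-- One order of smoothing compensates one derivative: |x| (1 + |x|^2)^(-1/2) ≤ 1. -/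
theorem norm_derivSymbol_le {σ : ℝ} (hσ : 1 ≤ σ) (m x : E) :
    ‖derivSymbol σ m x‖ ≤ 2 * Real.pi * ‖m‖ := by
  have h1 : ‖derivSymbol σ m x‖ = 2 * Real.pi * (|inner ℝ x m| * (1 + ‖x‖ ^ 2) ^ (-σ / 2)) := by
    unfold derivSymbol besselSymbol
    simp only [norm_mul, Complex.norm_real, Complex.norm_I, Complex.norm_ofNat, Real.norm_eq_abs,
      abs_of_pos Real.pi_pos]
    rw [abs_of_nonneg (a := (1 + ‖x‖ ^ 2) ^ (-σ / 2)) (by positivity)]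
    ring
  have h2 : (1 + ‖x‖ ^ 2) ^ (-σ / 2) ≤ (1 + ‖x‖ ^ 2) ^ (-(1 / 2) : ℝ) :=
    Real.rpow_le_rpow_of_exponent_le (by nlinarith [sq_nonneg ‖x‖]) (by linarith)
  have h3 : ‖x‖ * (1 + ‖x‖ ^ 2) ^ (-(1 / 2) : ℝ) ≤ 1 := by
    rw [Real.rpow_neg (by positivity), ← Real.sqrt_eq_rpow, ← div_eq_mul_inv]
    refine div_le_one_of_le₀ (Real.le_sqrt_of_sq_le (by linarith)) (Real.sqrt_nonneg _)
  rw [h1]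
  have h4 : |inner ℝ x m| * (1 + ‖x‖ ^ 2) ^ (-σ / 2) ≤ ‖m‖ := by
    calc |inner ℝ x m| * (1 + ‖x‖ ^ 2) ^ (-σ / 2)
        ≤ (‖x‖ * ‖m‖) * (1 + ‖x‖ ^ 2) ^ (-(1 / 2) : ℝ) := by
          gcongr
          exact abs_real_inner_le_norm x m
      _ = ‖m‖ * (‖x‖ * (1 + ‖x‖ ^ 2) ^ (-(1 / 2) : ℝ)) := by ring
      _ ≤ ‖m‖ * 1 := by gcongr
      _ = ‖m‖ := mul_one _
  gcongr

theorem memLp_derivSymbol {σ : ℝ} (hσ : 1 ≤ σ) (m : E) :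
    MemLp (derivSymbol σ m) ∞ (volume : Measure E) :=
  memLp_top_of_bound (derivSymbol_hasTemperateGrowth σ m).1.continuous.aestronglyMeasurable
    _ (Filter.Eventually.of_forall (norm_derivSymbol_le hσ m))

theorem memLp_besselSymbol_top {σ : ℝ} (hσ : 0 ≤ σ) :
    MemLp (besselSymbol E σ) ∞ (volume : Measure E) := by
  refine memLp_top_of_bound
    (besselSymbol_hasTemperateGrowth (E := E) σ).1.continuous.aestronglyMeasurable 1
    (Filter.Eventually.of_forall fun x => ?_)
  unfold besselSymbol
  rw [Complex.norm_real, Real.norm_eq_abs, abs_of_nonneg (by positivity)]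
  exact Real.rpow_le_one_of_one_le_of_nonpos (by nlinarith [sq_nonneg ‖x‖]) (by linarith)

theorem toTemperedDistribution_injective {f g : Lp ℂ 2 (volume : Measure E)}
    (h : (f : 𝓢'(E, ℂ)) = g) : f = g := by
  have := Lp.ker_toTemperedDistributionCLM_eq_bot (F := ℂ) (μ := (volume : Measure E)) (p := 2)
  exact LinearMap.ker_eq_bot.1 this h

theorem eq_l2Multiplier_besselSymbol {σ : ℝ} (hσ : 0 ≤ σ) {f h : Lp ℂ 2 (volume : Measure E)}
    (hfh : besselPotential E ℂ σ (f : 𝓢'(E, ℂ)) = (h : 𝓢'(E, ℂ))) :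
    f = l2Multiplier (memLp_besselSymbol_top hσ) h := by
  refine toTemperedDistribution_injective ?_
  rw [l2Multiplier_toTemperedDistribution _ (besselSymbol_hasTemperateGrowth σ)]
  have h1 : besselPotential E ℂ (-σ) (h : 𝓢'(E, ℂ)) = f := by
    rw [besselPotential_neg_apply_eq_iff, hfh]
  exact h1.symm

open LineDeriv in
theorem lineDeriv_eq_l2Multiplier {σ : ℝ} (hσ : 1 ≤ σ) (m : E)
    {f h : Lp ℂ 2 (volume : Measure E)}
    (hfh : besselPotential E ℂ σ (f : 𝓢'(E, ℂ)) = (h : 𝓢'(E, ℂ))) :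
    ∂_{m} (f : 𝓢'(E, ℂ)) =
      (l2Multiplier (memLp_derivSymbol hσ m) h : Lp ℂ 2 (volume : Measure E)) := by
  have h1 : besselPotential E ℂ (-σ) (h : 𝓢'(E, ℂ)) = f := by
    rw [besselPotential_neg_apply_eq_iff, hfh]
  have hb := besselSymbol_hasTemperateGrowth (E := E) σ
  have e1 : besselPotential E ℂ (-σ) = fourierMultiplierCLM ℂ (besselSymbol E σ) := rfl
  rw [l2Multiplier_toTemperedDistribution _ (derivSymbol_hasTemperateGrowth σ m),
    lineDeriv_eq_fourierMultiplierCLM, ← h1, e1,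
    fourierMultiplierCLM_fourierMultiplierCLM_apply hb (by fun_prop)]
  have e2 : derivSymbol σ m = (2 * Real.pi * Complex.I) •
      (besselSymbol E σ * fun x : E => ((inner ℝ x m : ℝ) : ℂ)) := by
    ext x
    simp only [derivSymbol, Pi.smul_apply, Pi.mul_apply, smul_eq_mul]
    ring
  rw [e2, fourierMultiplierCLM_smul (by fun_prop)]
  rfl

/-- A derivative of an H^σ function lies in H^(σ-1), and its L^2 image there is a bounded multiplier
of the same `h`. This allows the embedding to be applied at order σ - 1. -/
theorem besselPotential_l2Multiplier_derivSymbol {σ : ℝ} (hσ : 1 ≤ σ) (m : E)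
    (h : Lp ℂ 2 (volume : Measure E)) :
    besselPotential E ℂ (σ - 1)
      (l2Multiplier (memLp_derivSymbol hσ m) h : Lp ℂ 2 (volume : Measure E)) =
      (l2Multiplier (memLp_derivSymbol le_rfl m) h : Lp ℂ 2 (volume : Measure E)) := by
  rw [l2Multiplier_toTemperedDistribution _ (derivSymbol_hasTemperateGrowth σ m),
    l2Multiplier_toTemperedDistribution _ (derivSymbol_hasTemperateGrowth 1 m), besselPotential,
    fourierMultiplierCLM_fourierMultiplierCLM_apply (derivSymbol_hasTemperateGrowth σ m)
      (by fun_prop)]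
  refine congrArg (fun g => fourierMultiplierCLM ℂ g (h : 𝓢'(E, ℂ))) (funext fun x => ?_)
  simp only [derivSymbol, besselSymbol, Pi.mul_apply]
  have : ((1 + ‖x‖ ^ 2) ^ (-1 / 2 : ℝ) : ℝ) =
      (1 + ‖x‖ ^ 2) ^ (-σ / 2) * (1 + ‖x‖ ^ 2) ^ ((σ - 1) / 2) := by
    rw [← Real.rpow_add (by positivity)]
    congr 1
    ring
  rw [this]
  push_cast
  ring

open LineDeriv in
-- Integration by parts against test functions identifies the distributional derivative with the
-- classical one.
theorem ae_eq_fderiv_of_lineDeriv_eq {f k : Lp ℂ 2 (volume : Measure E)} {m : E} {v : E → ℝ}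
    (hv : ContDiff ℝ 1 v) (hf : f =ᵐ[volume] fun x => ((v x : ℝ) : ℂ))
    (hk : ∂_{m} (f : 𝓢'(E, ℂ)) = k) :
    k =ᵐ[volume] fun x => ((fderiv ℝ v x m : ℝ) : ℂ) := by
  have hc : Continuous fun x => fderiv ℝ v x m :=
    (hv.continuous_fderiv (by norm_num)).clm_apply continuous_const
  refine ae_eq_of_integral_contDiff_smul_eq ((Lp.memLp k).locallyIntegrable (by norm_num))
    (Complex.continuous_ofReal.comp hc).locallyIntegrable fun g hg hgc => ?_
  have hg₁ : HasCompactSupport (Complex.ofRealCLM ∘ g) := hgc.comp_left rfl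
  have hg₂ : ContDiff ℝ (⊤ : ℕ∞) (Complex.ofRealCLM ∘ g) := by fun_prop
  have h1 := congrArg (fun D : 𝓢'(E, ℂ) => D (hg₁.toSchwartzMap hg₂)) hk
  simp only [TemperedDistribution.lineDerivOp_apply_apply, Lp.toTemperedDistribution_apply] at h1
  have hgd : Differentiable ℝ g := hg.differentiable (by norm_num)
  have hg1 : Continuous fun x => fderiv ℝ g x m :=
    (hg.continuous_fderiv (by norm_num)).clm_apply continuous_const
  have hg1c : HasCompactSupport fun x => fderiv ℝ g x m := hgc.fderiv_apply (𝕜 := ℝ) m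
  have h2 : ∫ x, v x * fderiv ℝ g x m = -∫ x, fderiv ℝ v x m * g x := by
    refine integral_mul_fderiv_eq_neg_fderiv_mul_of_integrable ?_ ?_ ?_
      (fun x _ => (hv.differentiable (by norm_num)).differentiableAt) (fun x _ => hgd x)
    · exact (hc.mul hg.continuous).integrable_of_hasCompactSupport hgc.mul_left
    · exact (hv.continuous.mul hg1).integrable_of_hasCompactSupport hg1c.mul_left
    · exact (hv.continuous.mul hg.continuous).integrable_of_hasCompactSupport hgc.mul_left
  have h3 : ∫ x, (g x) • (k x) = -∫ x, ((fderiv ℝ g x m : ℝ) : ℂ) * f x := by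
    have e : ∀ x, (∂_{m} (hg₁.toSchwartzMap hg₂)) x = ((fderiv ℝ g x m : ℝ) : ℂ) := fun x => by
      rw [SchwartzMap.lineDerivOp_apply_eq_fderiv]
      change fderiv ℝ (Complex.ofRealCLM ∘ g) x m = _
      rw [(Complex.ofRealCLM.hasFDerivAt.comp x (hgd x).hasFDerivAt).fderiv]
      rfl
    have e' : ∀ x, (hg₁.toSchwartzMap hg₂) x = ((g x : ℝ) : ℂ) := fun x => rfl
    simp only [_root_.neg_apply, e, e', smul_eq_mul, neg_mul, integral_neg] at h1
    rw [h1]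
    exact integral_congr_ae (Filter.Eventually.of_forall fun x => by simp)
  rw [h3]
  have h4 : ∫ x, ((fderiv ℝ g x m : ℝ) : ℂ) * f x = ((∫ x, v x * fderiv ℝ g x m : ℝ) : ℂ) := by
    rw [← integral_complex_ofReal]
    refine integral_congr_ae ?_
    filter_upwards [hf] with x hx
    rw [hx]; push_cast; ring
  rw [h4, h2]
  push_cast
  rw [neg_neg, ← integral_complex_ofReal]
  refine integral_congr_ae (Filter.Eventually.of_forall fun x => ?_)
  simp [mul_comm]

end Multiplier

/-- Two continuous functions that agree almost everywhere agree everywhere, so the continuous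
representative can be read off pointwise. -/
theorem eq_re_sobolevEmb {d : ℕ} {σ : ℝ} (hσ : Module.finrank ℝ (RSpace d) < 2 * σ)
    {f h : Lp ℂ 2 (volume : Measure (RSpace d))} {v : RSpace d → ℝ} (hv : Continuous v)
    (hf : f =ᵐ[volume] fun x => ((v x : ℝ) : ℂ))
    (hfh : besselPotential (RSpace d) ℂ σ (f : 𝓢'(RSpace d, ℂ)) = (h : 𝓢'(RSpace d, ℂ)))
    (x : RSpace d) : v x = (sobolevEmb (RSpace d) hσ h x).re := by
  have h1 : (fun x => ((v x : ℝ) : ℂ)) = sobolevEmb (RSpace d) hσ h :=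
    Continuous.ae_eq_iff_eq volume (Complex.continuous_ofReal.comp hv)
      (sobolevEmb (RSpace d) hσ h).continuous |>.1 (hf.symm.trans (ae_eq_sobolevEmb hσ hfh))
  rw [← h1]
  simp

/-- The real part of a bounded continuous function. -/
def reBCF (d : ℕ) : (RSpace d →ᵇ ℂ) →L[ℝ] (RSpace d →ᵇ ℝ) :=
  Complex.reCLM.compLeftContinuousBounded (RSpace d)

theorem eLpNorm_of_ae_eq_ofReal {d : ℕ} {k : Lp ℂ 2 (volume : Measure (RSpace d))}
    {v : RSpace d → ℝ} (hk : k =ᵐ[volume] fun x => ((v x : ℝ) : ℂ)) :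
    eLpNorm v 2 volume = ENNReal.ofReal ‖k‖ := by
  rw [Lp.norm_def, ENNReal.ofReal_toReal (Lp.memLp k).2.ne, eLpNorm_congr_ae hk]
  exact eLpNorm_congr_norm_ae (Filter.Eventually.of_forall fun x => by simp)

/-- Values and L^2 norms are both obtained from the curve `g` by fixed continuous maps, hence
inherit its continuity in time. -/
theorem exists_continuousOn_bcf {d : ℕ} {s : ℝ} (hs : 1 + (d : ℝ) / 2 < s) {I : Set ℝ}
    {v : ℝ → RSpace d → ℝ} (hv : ∀ t ∈ I, ContDiff ℝ 1 (v t)) (h : IsSobolevCurve s 0 I v) :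
    (∃ F : ℝ → RSpace d →ᵇ ℝ, ContinuousOn F I ∧ ∀ t ∈ I, ∀ x, F t x = v t x) ∧
    (∃ N : ℝ → ℝ, ContinuousOn N I ∧ ∀ t ∈ I, eLpNorm (v t) 2 volume = ENNReal.ofReal (N t)) := by
  obtain ⟨f, g, hg, hfg⟩ := h
  have hgc : ContinuousOn g I := hg.continuousOn
  have hσ : (Module.finrank ℝ (RSpace d) : ℝ) < 2 * s := by
    simp only [finrank_euclideanSpace, Fintype.card_fin]; linarith
  have hs0 : 0 ≤ s := by have : (0 : ℝ) ≤ d := Nat.cast_nonneg d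
                         linarith
  refine ⟨⟨fun t => reBCF d (sobolevEmb (RSpace d) hσ (g t)), ?_, fun t ht x => ?_⟩,
    ⟨fun t => ‖l2Multiplier (memLp_besselSymbol_top hs0) (g t)‖, ?_, fun t ht => ?_⟩⟩
  · exact ((reBCF d).continuous.comp (sobolevEmb (RSpace d) hσ).continuous).comp_continuousOn hgc
  · exact (eq_re_sobolevEmb hσ (hv t ht).continuous (hfg t ht).1 (hfg t ht).2 x).symm
  · exact (l2Multiplier (memLp_besselSymbol_top hs0)).continuous.norm.comp_continuousOn hgc
  · beta_reduce
    rw [← eq_l2Multiplier_besselSymbol hs0 (hfg t ht).2]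
    exact eLpNorm_of_ae_eq_ofReal (hfg t ht).1

theorem exists_continuousOn_bcf_fderiv {d : ℕ} {s : ℝ} (hs : 1 + (d : ℝ) / 2 < s) {I : Set ℝ}
    {v : ℝ → RSpace d → ℝ} (hv : ∀ t ∈ I, ContDiff ℝ 1 (v t)) (h : IsSobolevCurve s 0 I v)
    (m : RSpace d) :
    (∃ F : ℝ → RSpace d →ᵇ ℝ, ContinuousOn F I ∧ ∀ t ∈ I, ∀ x, F t x = fderiv ℝ (v t) x m) ∧
    (∃ N : ℝ → ℝ, ContinuousOn N I ∧
      ∀ t ∈ I, eLpNorm (fun x => fderiv ℝ (v t) x m) 2 volume = ENNReal.ofReal (N t)) := by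
  obtain ⟨f, g, hg, hfg⟩ := h
  have hgc : ContinuousOn g I := hg.continuousOn
  have hσ : (Module.finrank ℝ (RSpace d) : ℝ) < 2 * (s - 1) := by
    simp only [finrank_euclideanSpace, Fintype.card_fin]; linarith
  have hs1 : 1 ≤ s := by have : (0 : ℝ) ≤ d := Nat.cast_nonneg d
                         linarith
  have hk : ∀ t ∈ I, (l2Multiplier (memLp_derivSymbol hs1 m) (g t) :
      Lp ℂ 2 (volume : Measure (RSpace d))) =ᵐ[volume]
      fun x => ((fderiv ℝ (v t) x m : ℝ) : ℂ) := fun t ht =>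
    ae_eq_fderiv_of_lineDeriv_eq (hv t ht) (hfg t ht).1
      (lineDeriv_eq_l2Multiplier hs1 m (hfg t ht).2)
  refine ⟨⟨fun t => reBCF d (sobolevEmb (RSpace d) hσ
      (l2Multiplier (memLp_derivSymbol le_rfl m) (g t))), ?_, fun t ht x => ?_⟩,
    ⟨fun t => ‖l2Multiplier (memLp_derivSymbol hs1 m) (g t)‖, ?_, fun t ht => ?_⟩⟩
  · exact ((reBCF d).continuous.comp ((sobolevEmb (RSpace d) hσ).continuous.comp
      (l2Multiplier (memLp_derivSymbol le_rfl m)).continuous)).comp_continuousOn hgc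
  · exact (eq_re_sobolevEmb hσ (((hv t ht).continuous_fderiv (by norm_num)).clm_apply
      continuous_const) (hk t ht) (besselPotential_l2Multiplier_derivSymbol hs1 m (g t)) x).symm
  · exact (l2Multiplier (memLp_derivSymbol hs1 m)).continuous.norm.comp_continuousOn hgc
  · exact eLpNorm_of_ae_eq_ofReal (hk t ht)

/-- The embedding followed by evaluation at a point is linear and continuous, so it commutes with
the time derivative of `g`. -/
theorem exists_continuousOn_bcf_hasDerivWithinAt {d : ℕ} {s : ℝ} (hs : (d : ℝ) / 2 < s)
    {I : Set ℝ} (hI : UniqueDiffOn ℝ I) {v : ℝ → RSpace d → ℝ}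
    (hv : ∀ t ∈ I, Continuous (v t)) (h : IsSobolevCurve s 1 I v) :
    ∃ F : ℝ → RSpace d →ᵇ ℝ, ContinuousOn F I ∧
      ∀ t ∈ I, ∀ x, HasDerivWithinAt (fun τ => v τ x) (F t x) I t := by
  obtain ⟨f, g, hg, hfg⟩ := h
  have hσ : (Module.finrank ℝ (RSpace d) : ℝ) < 2 * s := by
    simp only [finrank_euclideanSpace, Fintype.card_fin]; linarith
  let A : Lp ℂ 2 (volume : Measure (RSpace d)) →L[ℝ] (RSpace d →ᵇ ℝ) :=
    reBCF d ∘L (sobolevEmb (RSpace d) hσ).restrictScalars ℝ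
  refine ⟨fun t => A (derivWithin g I t), ?_, fun t ht x => ?_⟩
  · exact A.continuous.comp_continuousOn (hg.continuousOn_derivWithin hI (by norm_num))
  · have h1 : HasDerivWithinAt g (derivWithin g I t) I t :=
      (hg.differentiableOn (by norm_num) t ht).hasDerivWithinAt
    have h2 : HasDerivWithinAt (fun τ => BoundedContinuousFunction.evalCLM ℝ x (A (g τ)))
        (BoundedContinuousFunction.evalCLM ℝ x (A (derivWithin g I t))) I t :=
      ((BoundedContinuousFunction.evalCLM ℝ x) ∘L A).hasFDerivAt.comp_hasDerivWithinAt t h1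
    have h3 : ∀ τ ∈ I, v τ x = BoundedContinuousFunction.evalCLM ℝ x (A (g τ)) := fun τ hτ =>
      eq_re_sobolevEmb hσ (hv τ hτ) (hfg τ hτ).1 (hfg τ hτ).2 x
    exact h2.congr h3 (h3 t ht)

end SobolevCurves

/-! ### Polar and cylindrical coordinates: Lebesgue measure on ℝ^d and r^(d-2) dr dz. -/

section PolarCoordinates

theorem lintegral_polar {n : ℕ} (hn : n ≠ 0) {F : RSpace n → ℝ≥0∞} (hF : Measurable F) :
    ∫⁻ x, F x = ∫⁻ r in Ioi (0 : ℝ), ENNReal.ofReal (r ^ (n - 1)) *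
      ∫⁻ θ : Metric.sphere (0 : RSpace n) 1, F (r • (θ : RSpace n))
        ∂(volume : Measure (RSpace n)).toSphere := by
  have : Nonempty (Fin n) := ⟨⟨0, Nat.pos_of_ne_zero hn⟩⟩
  have : Nontrivial (RSpace n) := by
    refine ⟨⟨EuclideanSpace.single (Classical.arbitrary (Fin n)) (1 : ℝ), 0, fun h => ?_⟩⟩
    have := congrArg norm h
    simp at this
  have mp := (volume : Measure (RSpace n)).measurePreserving_homeomorphUnitSphereProd
  have h1 : ∫⁻ x, F x = ∫⁻ x : ({0}ᶜ : Set (RSpace n)), F x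
      ∂((volume : Measure (RSpace n)).comap (↑)) := by
    have := lintegral_subtype_comap (μ := (volume : Measure (RSpace n)))
      (measurableSet_singleton (0 : RSpace n)).compl F
    rw [this, restrict_compl_singleton]
  have h2 : ∀ x : ({0}ᶜ : Set (RSpace n)), F x = (fun p : Metric.sphere (0 : RSpace n) 1 ×
      Ioi (0 : ℝ) => F ((p.2 : ℝ) • (p.1 : RSpace n))) (homeomorphUnitSphereProd (RSpace n) x) := by
    intro x
    have hx : ‖(x : RSpace n)‖ ≠ 0 := norm_ne_zero_iff.2 x.2
    simp [homeomorphUnitSphereProd_apply_snd_coe, homeomorphUnitSphereProd_apply_fst_coe, smul_smul,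
      hx]
  have hm : Measurable (fun p : Metric.sphere (0 : RSpace n) 1 × Ioi (0 : ℝ) =>
      F ((p.2 : ℝ) • (p.1 : RSpace n))) := by fun_prop
  rw [h1]
  simp_rw [h2]
  rw [mp.lintegral_comp hm, lintegral_prod_symm _ hm.aemeasurable]
  have hf : Module.finrank ℝ (RSpace n) = n := by simp
  rw [hf, Measure.volumeIoiPow, lintegral_withDensity_eq_lintegral_mul _ (by fun_prop)
    (hm.lintegral_prod_left')]
  exact lintegral_subtype_comap (μ := (volume : Measure ℝ)) measurableSet_Ioi
    (fun r => ENNReal.ofReal (r ^ (n - 1)) * ∫⁻ θ : Metric.sphere (0 : RSpace n) 1,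
      F (r • (θ : RSpace n)) ∂(volume : Measure (RSpace n)).toSphere)

/-- The components of a point of `ℝ^(n+1)` orthogonal to the axis. -/
def horizontal {n : ℕ} (x : RSpace (n + 1)) : RSpace n :=
  WithLp.toLp 2 fun i => x (Fin.castSucc i)

/-- The decomposition of `ℝ^(n+1)` into the axial component and the orthogonal ones. -/
def axialSplit (n : ℕ) : RSpace (n + 1) ≃ᵐ ℝ × RSpace n :=
  (MeasurableEquiv.toLp 2 (Fin (n + 1) → ℝ)).symm.trans
    ((MeasurableEquiv.piFinSuccAbove (fun _ => ℝ) (Fin.last n)).trans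
      (MeasurableEquiv.prodCongr (MeasurableEquiv.refl ℝ) (MeasurableEquiv.toLp 2 (Fin n → ℝ))))

theorem axialSplit_apply {n : ℕ} (x : RSpace (n + 1)) :
    axialSplit n x = (axialCoord x, horizontal x) := by
  refine Prod.ext rfl ?_
  ext i
  change x ((Fin.last n).succAbove i) = x i.castSucc
  rw [Fin.succAbove_last]

theorem measurePreserving_axialSplit (n : ℕ) : MeasurePreserving (axialSplit n) := by
  have h1 := EuclideanSpace.volume_preserving_symm_measurableEquiv_toLp (Fin (n + 1))
  have h2 := volume_preserving_piFinSuccAbove (fun _ : Fin (n + 1) => ℝ) (Fin.last n)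
  have h3 : MeasurePreserving (MeasurableEquiv.toLp 2 (Fin n → ℝ)) :=
    (EuclideanSpace.volume_preserving_symm_measurableEquiv_toLp (Fin n)).symm
  exact (((MeasurePreserving.id volume).prod h3).comp h2).comp h1

theorem cylRadius_eq_norm_horizontal {n : ℕ} (x : RSpace (n + 1)) :
    cylRadius x = ‖horizontal x‖ := by
  rw [cylRadius, EuclideanSpace.norm_eq]
  congr 1
  have h : (axisIdx (n + 1)) = Fin.last n := rfl
  have h2 := Finset.add_sum_erase Finset.univ (fun i => x i ^ 2) (Finset.mem_univ (Fin.last n))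
  rw [Fin.sum_univ_castSucc] at h2
  rw [h]
  simp only [horizontal, Real.norm_eq_abs, sq_abs]
  linarith

theorem lintegral_axialSplit {n : ℕ} {F : ℝ × RSpace n → ℝ≥0∞} (hF : Measurable F) :
    ∫⁻ x : RSpace (n + 1), F (axialCoord x, horizontal x) = ∫⁻ z : ℝ, ∫⁻ y : RSpace n, F (z, y) := by
  simp_rw [← axialSplit_apply]
  rw [(measurePreserving_axialSplit n).lintegral_comp hF, Measure.volume_eq_prod,
    lintegral_prod _ hF.aemeasurable]

variable (d : ℕ) [NeZero d]

/-- The cylindrical coordinates of a point. -/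
def cylCoord {d : ℕ} [NeZero d] (x : RSpace d) : ℝ × ℝ := (cylRadius x, axialCoord x)

/-- The area of the unit sphere of `ℝ^(d-1)`. -/
def sphereArea (d : ℕ) : ℝ≥0∞ := (volume : Measure (RSpace (d - 1))).toSphere univ

/-- The measure `r^(d-2) dr dz` on the half-plane `r > 0`. -/
def meridianMeasure (d : ℕ) : Measure (ℝ × ℝ) :=
  (volume.restrict {q : ℝ × ℝ | 0 < q.1}).withDensity fun q => ENNReal.ofReal (q.1 ^ (d - 2))

theorem measurableSet_halfPlane : MeasurableSet {q : ℝ × ℝ | 0 < q.1} :=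
  measurableSet_lt measurable_const measurable_fst

theorem continuous_cylCoord : Continuous (cylCoord : RSpace d → ℝ × ℝ) := by
  unfold cylCoord cylRadius axialCoord
  fun_prop

variable {d}

theorem lintegral_meridianMeasure {f : ℝ × ℝ → ℝ≥0∞} (hf : Measurable f) :
    ∫⁻ q, f q ∂meridianMeasure d =
      ∫⁻ q in {q : ℝ × ℝ | 0 < q.1}, ENNReal.ofReal (q.1 ^ (d - 2)) * f q :=
  lintegral_withDensity_eq_lintegral_mul _ (by fun_prop) hf

/-- Fubini splits off the axial variable, and polar coordinates are used in the remaining d - 1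
variables, whence the power d - 2. -/
theorem lintegral_comp_cylCoord (hd : 2 ≤ d) {f : ℝ × ℝ → ℝ≥0∞} (hf : Measurable f) :
    ∫⁻ x : RSpace d, f (cylCoord x) = sphereArea d * ∫⁻ q, f q ∂meridianMeasure d := by
  obtain ⟨n, rfl⟩ : ∃ n, d = n + 1 := ⟨d - 1, by omega⟩
  have hn : n ≠ 0 := by omega
  have h1 : ∀ x : RSpace (n + 1), f (cylCoord x) =
      (fun p : ℝ × RSpace n => f (‖p.2‖, p.1)) (axialCoord x, horizontal x) := fun x => by
    simp only [cylCoord, cylRadius_eq_norm_horizontal]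
  simp_rw [h1]
  rw [lintegral_axialSplit (F := fun p : ℝ × RSpace n => f (‖p.2‖, p.1)) (by fun_prop),
    lintegral_meridianMeasure hf]
  have h2 : ∀ z : ℝ, ∫⁻ y : RSpace n, f (‖y‖, z) = sphereArea (n + 1) *
      ∫⁻ r in Ioi (0 : ℝ), ENNReal.ofReal (r ^ (n - 1)) * f (r, z) := fun z => by
    rw [lintegral_polar hn (F := fun y => f (‖y‖, z)) (by fun_prop), ← lintegral_const_mul _
      (by fun_prop)]
    refine setLIntegral_congr_fun measurableSet_Ioi fun r hr => ?_
    have : ∀ θ : Metric.sphere (0 : RSpace n) 1, f (‖r • (θ : RSpace n)‖, z) = f (r, z) := by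
      intro θ
      have h3 : ‖(θ : RSpace n)‖ = 1 := by simp
      rw [norm_smul, h3, Real.norm_eq_abs, abs_of_pos hr, mul_one]
    simp only [this, lintegral_const]
    rw [show (volume : Measure (RSpace n)).toSphere univ = sphereArea (n + 1) from rfl]
    ring
  simp_rw [h2]
  rw [lintegral_const_mul _ (by fun_prop)]
  congr 1
  have h4 : volume.restrict {q : ℝ × ℝ | 0 < q.1} =
      (volume.restrict (Ioi (0 : ℝ))).prod (volume : Measure ℝ) := by
    rw [← Measure.restrict_univ (μ := (volume : Measure ℝ)), Measure.prod_restrict,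
      Measure.restrict_univ, ← Measure.volume_eq_prod]
    congr 1
    ext q; simp
  rw [h4, lintegral_prod_symm _ (by fun_prop)]
  rfl

theorem map_cylCoord (hd : 2 ≤ d) :
    Measure.map (cylCoord : RSpace d → ℝ × ℝ) volume = sphereArea d • meridianMeasure d := by
  ext s hs
  rw [Measure.map_apply (continuous_cylCoord d).measurable hs]
  have := lintegral_comp_cylCoord (d := d) hd (f := s.indicator 1) (measurable_one.indicator hs)
  rw [lintegral_indicator_one hs] at this
  rw [Measure.smul_apply, smul_eq_mul, ← this,
    ← lintegral_indicator_one ((continuous_cylCoord d).measurable hs)]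
  rfl

theorem sphereArea_pos (hd : 2 ≤ d) : 0 < (sphereArea d).toReal := by
  have : Nonempty (Fin (d - 1)) := ⟨⟨0, by omega⟩⟩
  refine ENNReal.toReal_pos ?_ (measure_ne_top _ _)
  rw [sphereArea, Measure.toSphere_apply_univ]
  simp only [finrank_euclideanSpace, Fintype.card_fin]
  exact mul_ne_zero (by norm_cast; omega) (Metric.measure_ball_pos _ _ one_pos).ne'

theorem sphereArea_ne_top : sphereArea d ≠ ∞ := measure_ne_top _ _

theorem integrable_comp_cylCoord_iff (hd : 2 ≤ d) {f : ℝ × ℝ → ℝ} (hf : Measurable f) :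
    Integrable (fun x : RSpace d => f (cylCoord x)) ↔ Integrable f (meridianMeasure d) := by
  have h := integrable_map_measure (μ := (volume : Measure (RSpace d)))
    (f := (cylCoord : RSpace d → ℝ × ℝ)) (g := f) hf.aestronglyMeasurable
    (continuous_cylCoord d).aemeasurable
  rw [map_cylCoord hd] at h
  have h0 : sphereArea d ≠ 0 := fun h0 => by
    have := sphereArea_pos hd
    simp [h0] at this
  rw [integrable_smul_measure h0 sphereArea_ne_top] at h
  exact h.symm

theorem integral_comp_cylCoord (hd : 2 ≤ d) {f : ℝ × ℝ → ℝ} (hf : Measurable f) :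
    ∫ x : RSpace d, f (cylCoord x) = (sphereArea d).toReal * ∫ q, f q ∂meridianMeasure d := by
  have h := integral_map (μ := (volume : Measure (RSpace d))) (φ := cylCoord)
    (continuous_cylCoord d).aemeasurable (f := f) hf.aestronglyMeasurable
  rw [← h, map_cylCoord hd, integral_smul_measure, smul_eq_mul]

theorem integral_meridianMeasure (f : ℝ × ℝ → ℝ) :
    ∫ q, f q ∂meridianMeasure d = ∫ q in {q : ℝ × ℝ | 0 < q.1}, q.1 ^ (d - 2) * f q := by
  rw [meridianMeasure, integral_withDensity_eq_integral_toReal_smul (by fun_prop) (by simp)]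
  refine setIntegral_congr_fun measurableSet_halfPlane fun q hq => ?_
  have : 0 < q.1 := hq
  simp only [smul_eq_mul]
  rw [ENNReal.toReal_ofReal (by positivity)]

theorem integrable_meridianMeasure_iff {f : ℝ × ℝ → ℝ} :
    Integrable f (meridianMeasure d) ↔
      IntegrableOn (fun q => q.1 ^ (d - 2) * f q) {q : ℝ × ℝ | 0 < q.1} := by
  rw [meridianMeasure, integrable_withDensity_iff_integrable_smul' (by fun_prop) (by simp)]
  refine integrable_congr ?_
  filter_upwards [ae_restrict_mem measurableSet_halfPlane] with q hq
  have : 0 < q.1 := hq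
  simp only [smul_eq_mul]
  rw [ENNReal.toReal_ofReal (by positivity)]

end PolarCoordinates

/-! ### Calculus of axisymmetric swirl-free fields off the axis. -/

section AxisymmetricFields

variable {d : ℕ} [NeZero d]

theorem axisIdx_ne_zero (hd : 2 ≤ d) : (0 : Fin d) ≠ axisIdx d := by
  intro h
  have := congrArg Fin.val h
  simp [axisIdx] at this
  omega

variable (d) in
/-- The parametrization of the meridional plane, as a linear map. -/
def merMap : ℝ × ℝ →L[ℝ] RSpace d :=
  (ContinuousLinearMap.fst ℝ ℝ ℝ).smulRight (EuclideanSpace.single (0 : Fin d) (1 : ℝ)) +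
    (ContinuousLinearMap.snd ℝ ℝ ℝ).smulRight (EuclideanSpace.single (axisIdx d) (1 : ℝ))

theorem merMap_apply (q : ℝ × ℝ) : merMap d q = meridianPoint q.1 q.2 := by
  ext i
  simp [merMap, meridianPoint]

/-- The radial component of a field, as a function on the meridional plane. -/
def rad (v : RSpace d → RSpace d) (q : ℝ × ℝ) : ℝ := radialComp v q.1 q.2

/-- The axial component of a field, as a function on the meridional plane. -/
def axl (v : RSpace d → RSpace d) (q : ℝ × ℝ) : ℝ := axialComp v q.1 q.2

/-- The scalar vorticity of a field, as a function on the meridional plane. -/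
def vort (v : RSpace d → RSpace d) (q : ℝ × ℝ) : ℝ := scalarVorticity v q.1 q.2

theorem rad_eq (v : RSpace d → RSpace d) (q : ℝ × ℝ) : rad v q = v (merMap d q) 0 := by
  rw [merMap_apply]; rfl

theorem axl_eq (v : RSpace d → RSpace d) (q : ℝ × ℝ) : axl v q = v (merMap d q) (axisIdx d) := by
  rw [merMap_apply]; rfl

variable {v : RSpace d → RSpace d}

theorem hasFDerivAt_comp_merMap (hv : Differentiable ℝ v) (i : Fin d) (q : ℝ × ℝ) :
    HasFDerivAt (fun q => v (merMap d q) i)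
      ((EuclideanSpace.proj i : RSpace d →L[ℝ] ℝ) ∘L (fderiv ℝ v (merMap d q)) ∘L merMap d) q :=
  (EuclideanSpace.proj i : RSpace d →L[ℝ] ℝ).hasFDerivAt.comp q
    (((hv _).hasFDerivAt).comp q (merMap d).hasFDerivAt)

theorem fderiv_rad_apply (hv : Differentiable ℝ v) (q p : ℝ × ℝ) :
    fderiv ℝ (rad v) q p = fderiv ℝ v (merMap d q) (merMap d p) 0 := by
  rw [show rad v = fun q => v (merMap d q) 0 from funext (rad_eq v),
    (hasFDerivAt_comp_merMap hv 0 q).fderiv]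
  rfl

theorem fderiv_axl_apply (hv : Differentiable ℝ v) (q p : ℝ × ℝ) :
    fderiv ℝ (axl v) q p = fderiv ℝ v (merMap d q) (merMap d p) (axisIdx d) := by
  rw [show axl v = fun q => v (merMap d q) (axisIdx d) from funext (axl_eq v),
    (hasFDerivAt_comp_merMap hv (axisIdx d) q).fderiv]
  rfl

theorem contDiff_rad (hv : ContDiff ℝ 1 v) : ContDiff ℝ 1 (rad v) := by
  rw [show rad v = fun q => v (merMap d q) 0 from funext (rad_eq v)]
  exact (EuclideanSpace.proj (0 : Fin d) : RSpace d →L[ℝ] ℝ).contDiff.comp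
    (hv.comp (merMap d).contDiff)

theorem contDiff_axl (hv : ContDiff ℝ 1 v) : ContDiff ℝ 1 (axl v) := by
  rw [show axl v = fun q => v (merMap d q) (axisIdx d) from funext (axl_eq v)]
  exact (EuclideanSpace.proj (axisIdx d) : RSpace d →L[ℝ] ℝ).contDiff.comp
    (hv.comp (merMap d).contDiff)

theorem vort_eq (hv : ContDiff ℝ 1 v) (q : ℝ × ℝ) :
    vort v q = fderiv ℝ (rad v) q (0, 1) - fderiv ℝ (axl v) q (1, 0) := by
  have h1 : HasDerivAt (fun ζ => rad v (q.1, ζ)) (fderiv ℝ (rad v) q (0, 1)) q.2 :=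
    (((contDiff_rad hv).differentiable (by norm_num)) (q.1, q.2)).hasFDerivAt.comp_hasDerivAt q.2
      ((hasDerivAt_const q.2 q.1).prodMk (hasDerivAt_id q.2))
  have h2 : HasDerivAt (fun ρ => axl v (ρ, q.2)) (fderiv ℝ (axl v) q (1, 0)) q.1 := by
    have h3 : HasDerivAt (fun ρ : ℝ => ((ρ, q.2) : ℝ × ℝ)) (1, 0) q.1 :=
      (hasDerivAt_id' q.1).prodMk (hasDerivAt_const q.1 q.2)
    have h4 := (((contDiff_axl hv).differentiable (by norm_num)) (q.1, q.2)).hasFDerivAt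
    exact h4.comp_hasDerivAt q.1 h3
  rw [← h1.deriv, ← h2.deriv]
  rfl

theorem continuous_vort (hv : ContDiff ℝ 1 v) : Continuous (vort v) := by
  rw [show vort v = _ from funext (vort_eq hv)]
  exact (((contDiff_rad hv).continuous_fderiv (by norm_num)).clm_apply continuous_const).sub
    (((contDiff_axl hv).continuous_fderiv (by norm_num)).clm_apply continuous_const)

theorem merMap_apply_zero (hd : 2 ≤ d) (q : ℝ × ℝ) : merMap d q 0 = q.1 := by
  simp [merMap, axisIdx_ne_zero hd]

theorem merMap_apply_axis (hd : 2 ≤ d) (q : ℝ × ℝ) : merMap d q (axisIdx d) = q.2 := by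
  simp [merMap, (axisIdx_ne_zero hd).symm]

theorem merMap_apply_of_ne (q : ℝ × ℝ) {i : Fin d} (h0 : i ≠ 0) (h1 : i ≠ axisIdx d) :
    merMap d q i = 0 := by
  simp [merMap, h0, h1]

theorem cylRadius_merMap (hd : 2 ≤ d) (q : ℝ × ℝ) : cylRadius (merMap d q) = |q.1| := by
  rw [cylRadius, Finset.sum_eq_single (0 : Fin d), merMap_apply_zero hd, Real.sqrt_sq_eq_abs]
  · intro i hi h0
    rw [merMap_apply_of_ne q h0 (Finset.ne_of_mem_erase hi)]
    norm_num
  · intro h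
    exact absurd (Finset.mem_erase.2 ⟨axisIdx_ne_zero hd, Finset.mem_univ _⟩) h

theorem cylCoord_merMap (hd : 2 ≤ d) {q : ℝ × ℝ} (hq : 0 ≤ q.1) : cylCoord (merMap d q) = q := by
  refine Prod.ext ?_ (merMap_apply_axis hd q)
  exact (cylRadius_merMap hd q).trans (abs_of_nonneg hq)

theorem cylRadius_sq (x : RSpace d) :
    cylRadius x ^ 2 = ∑ i ∈ Finset.univ.erase (axisIdx d), x i ^ 2 :=
  Real.sq_sqrt (Finset.sum_nonneg fun _ _ => sq_nonneg _)

theorem cylRadius_nonneg (x : RSpace d) : 0 ≤ cylRadius x := Real.sqrt_nonneg _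

theorem IsAxisymmetricSwirlFree.apply (hax : IsAxisymmetricSwirlFree v) (x : RSpace d) {i : Fin d}
    (hi : i ≠ axisIdx d) : v x i = rad v (cylCoord x) * (x i / cylRadius x) := (hax x).1 i hi

theorem IsAxisymmetricSwirlFree.apply_axis (hax : IsAxisymmetricSwirlFree v) (x : RSpace d) :
    v x (axisIdx d) = axl v (cylCoord x) := (hax x).2

theorem IsAxisymmetricSwirlFree.apply_merMap (hd : 2 ≤ d) (hax : IsAxisymmetricSwirlFree v)
    {q : ℝ × ℝ} (hq : 0 < q.1) : v (merMap d q) = merMap d (rad v q, axl v q) := by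
  ext i
  by_cases h1 : i = axisIdx d
  · subst h1
    rw [merMap_apply_axis hd, axl_eq]
  · rw [hax.apply _ h1, cylCoord_merMap hd hq.le]
    by_cases h0 : i = 0
    · subst h0
      rw [merMap_apply_zero hd, merMap_apply_zero hd, cylRadius_merMap hd, abs_of_pos hq,
        div_self hq.ne', mul_one]
    · rw [merMap_apply_of_ne _ h0 h1, merMap_apply_of_ne _ h0 h1]
      simp

/-- The scalar product of a vector with the radial unit vector `e^r` at `x`. -/
def radialPart (x h : RSpace d) : ℝ :=
  ∑ i ∈ Finset.univ.erase (axisIdx d), x i / cylRadius x * h i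

/-- The radial unit vector `e^r` at `x`. -/
def radialVec (x : RSpace d) : RSpace d :=
  WithLp.toLp 2 fun i => if i = axisIdx d then 0 else x i / cylRadius x

theorem radialVec_apply {x : RSpace d} {i : Fin d} (hi : i ≠ axisIdx d) :
    radialVec x i = x i / cylRadius x := by simp [radialVec, hi]

theorem radialVec_axis (x : RSpace d) : radialVec x (axisIdx d) = 0 := by simp [radialVec]

theorem sum_div_cylRadius_sq {x : RSpace d} (hx : 0 < cylRadius x) :
    ∑ i ∈ Finset.univ.erase (axisIdx d), (x i / cylRadius x) ^ 2 = 1 := by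
  simp_rw [div_pow]
  rw [← Finset.sum_div, ← cylRadius_sq]
  exact div_self (pow_pos hx 2).ne'

theorem hasFDerivAt_cylRadius {x : RSpace d} (hx : 0 < cylRadius x) :
    ∃ R : RSpace d →L[ℝ] ℝ, HasFDerivAt cylRadius R x ∧ ∀ h, R h = radialPart x h := by
  have h1 : HasFDerivAt (fun x : RSpace d => ∑ i ∈ Finset.univ.erase (axisIdx d), x i ^ 2)
      (∑ i ∈ Finset.univ.erase (axisIdx d), (2 * x i) •
        (EuclideanSpace.proj i : RSpace d →L[ℝ] ℝ)) x := by
    refine HasFDerivAt.fun_sum fun i _ => ?_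
    have := ((EuclideanSpace.proj i : RSpace d →L[ℝ] ℝ).hasFDerivAt (x := x)).pow 2
    simpa using this
  have h0 : (∑ i ∈ Finset.univ.erase (axisIdx d), x i ^ 2) ≠ 0 := by
    rw [← cylRadius_sq]; positivity
  refine ⟨_, h1.sqrt h0, fun h => ?_⟩
  have e : Real.sqrt (∑ i ∈ Finset.univ.erase (axisIdx d), x i ^ 2) = cylRadius x := rfl
  simp only [e, FunLike.coe_smul, Pi.smul_apply, sum_apply,
    PiLp.proj_apply, smul_eq_mul, radialPart, Finset.mul_sum]
  refine Finset.sum_congr rfl fun i _ => ?_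
  field_simp

theorem hasFDerivAt_cylCoord {x : RSpace d} (hx : 0 < cylRadius x) :
    ∃ R : RSpace d →L[ℝ] ℝ × ℝ, HasFDerivAt cylCoord R x ∧
      ∀ h, R h = (radialPart x h, h (axisIdx d)) := by
  obtain ⟨R, hR, hR'⟩ := hasFDerivAt_cylRadius hx
  refine ⟨R.prod (EuclideanSpace.proj (axisIdx d)), hR.prodMk
    (EuclideanSpace.proj (axisIdx d) : RSpace d →L[ℝ] ℝ).hasFDerivAt, fun h => ?_⟩
  simp [hR']

theorem fderiv_apply_comp (hv : Differentiable ℝ v) (x h : RSpace d) (i : Fin d) :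
    fderiv ℝ v x h i = fderiv ℝ (fun y => v y i) x h := by
  have := (EuclideanSpace.proj i : RSpace d →L[ℝ] ℝ).hasFDerivAt.comp x (hv x).hasFDerivAt
  have h2 : HasFDerivAt (fun y => v y i) ((EuclideanSpace.proj i : RSpace d →L[ℝ] ℝ) ∘L
    fderiv ℝ v x) x := this
  rw [h2.fderiv]
  rfl

theorem IsAxisymmetricSwirlFree.fderiv_axis (hv : ContDiff ℝ 1 v)
    (hax : IsAxisymmetricSwirlFree v) {x : RSpace d} (hx : 0 < cylRadius x) (h : RSpace d) :
    fderiv ℝ v x h (axisIdx d) =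
      fderiv ℝ (axl v) (cylCoord x) (radialPart x h, h (axisIdx d)) := by
  obtain ⟨R, hR, hR'⟩ := hasFDerivAt_cylCoord hx
  rw [fderiv_apply_comp (hv.differentiable (by norm_num)),
    show (fun y => v y (axisIdx d)) = axl v ∘ cylCoord from funext hax.apply_axis,
    ((((contDiff_axl hv).differentiable (by norm_num)) _).hasFDerivAt.comp x hR).fderiv, ← hR']
  rfl

/-- Product rule for v^r times x_i / r; the second summand is the derivative of the direction, which
sees only the part of `h` tangent to the circle of radius r. -/
theorem IsAxisymmetricSwirlFree.fderiv_horizontal (hv : ContDiff ℝ 1 v)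
    (hax : IsAxisymmetricSwirlFree v) {x : RSpace d} (hx : 0 < cylRadius x) (h : RSpace d)
    {i : Fin d} (hi : i ≠ axisIdx d) :
    fderiv ℝ v x h i =
      fderiv ℝ (rad v) (cylCoord x) (radialPart x h, h (axisIdx d)) * (x i / cylRadius x) +
        rad v (cylCoord x) / cylRadius x * (h i - x i / cylRadius x * radialPart x h) := by
  obtain ⟨R, hR, hR'⟩ := hasFDerivAt_cylCoord hx
  obtain ⟨Q, hQ, hQ'⟩ := hasFDerivAt_cylRadius hx
  have h1 := (((contDiff_rad hv).differentiable (by norm_num)) _).hasFDerivAt.comp x hR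
  have h2 := ((EuclideanSpace.proj i : RSpace d →L[ℝ] ℝ).hasFDerivAt (x := x)).mul
    ((hasDerivAt_inv hx.ne').comp_hasFDerivAt x hQ)
  rw [fderiv_apply_comp (hv.differentiable (by norm_num)),
    show (fun y => v y i) = rad v ∘ cylCoord *
      (⇑(EuclideanSpace.proj i : RSpace d →L[ℝ] ℝ) * (fun y => y⁻¹) ∘ cylRadius) from
      funext fun y => hax.apply y hi, (h1.mul h2).fderiv, ← hR']
  simp only [Pi.mul_apply, Function.comp_apply, PiLp.proj_apply, FunLike.coe_add, FunLike.coe_smul,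
    Pi.add_apply, Pi.smul_apply, ContinuousLinearMap.comp_apply,
    smul_eq_mul, hQ']
  field_simp
  ring

theorem radialPart_single_axis (x : RSpace d) (c : ℝ) :
    radialPart x (EuclideanSpace.single (axisIdx d) c) = 0 := by
  refine Finset.sum_eq_zero fun i hi => ?_
  simp [Finset.ne_of_mem_erase hi]

theorem radialPart_single (x : RSpace d) {i : Fin d} (hi : i ≠ axisIdx d) :
    radialPart x (EuclideanSpace.single i 1) = x i / cylRadius x := by
  rw [radialPart, Finset.sum_eq_single i]
  · simp
  · intro j _ hj; simp [hj]
  · intro h; exact absurd (Finset.mem_erase.2 ⟨hi, Finset.mem_univ _⟩) h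

/-- In the trace the squares (x_i / r)^2 add up to 1, so of the d - 1 horizontal copies of v^r / r
exactly d - 2 survive. -/
theorem IsAxisymmetricSwirlFree.div_eq (hd : 2 ≤ d) (hv : ContDiff ℝ 1 v)
    (hax : IsAxisymmetricSwirlFree v) {x : RSpace d} (hx : 0 < cylRadius x) :
    divergence v x = fderiv ℝ (rad v) (cylCoord x) (1, 0) +
      fderiv ℝ (axl v) (cylCoord x) (0, 1) +
      ((d : ℝ) - 2) * (rad v (cylCoord x) / cylRadius x) := by
  have hs := sum_div_cylRadius_sq hx
  have hlin : ∀ c : ℝ, fderiv ℝ (rad v) (cylCoord x) (c, 0) =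
      c * fderiv ℝ (rad v) (cylCoord x) (1, 0) := fun c => by
    rw [← smul_eq_mul, ← map_smul]; simp
  have h1 : ∀ i ∈ Finset.univ.erase (axisIdx d),
      fderiv ℝ v x (EuclideanSpace.single i (1 : ℝ)) i =
      (fderiv ℝ (rad v) (cylCoord x) (1, 0) - rad v (cylCoord x) / cylRadius x) *
        (x i / cylRadius x) ^ 2 + rad v (cylCoord x) / cylRadius x := by
    intro i hi
    have hi' := Finset.ne_of_mem_erase hi
    rw [hax.fderiv_horizontal hv hx _ hi', radialPart_single x hi']
    simp only [PiLp.single_apply, if_neg hi'.symm, if_true]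
    rw [hlin]
    ring
  rw [divergence, ← Finset.add_sum_erase _ _ (Finset.mem_univ (axisIdx d)),
    Finset.sum_congr rfl h1, Finset.sum_add_distrib, ← Finset.mul_sum, hs,
    hax.fderiv_axis hv hx, radialPart_single_axis, Finset.sum_const,
    Finset.card_erase_of_mem (Finset.mem_univ _), Finset.card_univ, Fintype.card_fin]
  simp only [PiLp.single_apply, if_true, nsmul_eq_mul]
  rw [Nat.cast_sub (by omega)]
  push_cast
  ring

/-- The plane field (v^r, v^z) is not divergence-free; its divergence -(d - 2) v^r / r is what makes
r^(d-2) dr dz the invariant measure. -/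
theorem IsAxisymmetricSwirlFree.div_merid (hd : 2 ≤ d) (hv : ContDiff ℝ 1 v)
    (hax : IsAxisymmetricSwirlFree v) (hdiv : ∀ x, divergence v x = 0) {q : ℝ × ℝ}
    (hq : 0 < q.1) :
    fderiv ℝ (rad v) q (1, 0) + fderiv ℝ (axl v) q (0, 1) + ((d : ℝ) - 2) * (rad v q / q.1) = 0 := by
  have hx : 0 < cylRadius (merMap d q) := by rw [cylRadius_merMap hd]; exact abs_pos.2 hq.ne'
  have := hax.div_eq hd hv hx
  rw [hdiv, cylCoord_merMap hd hq.le, cylRadius_merMap hd, abs_of_pos hq] at this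
  exact this.symm

/-- Together with `curl_horizontal` this says that ω e^r in the axial rows is all that the
antisymmetric part of the gradient contains. -/
theorem IsAxisymmetricSwirlFree.curl_axis (hv : ContDiff ℝ 1 v)
    (hax : IsAxisymmetricSwirlFree v) {x : RSpace d} (hx : 0 < cylRadius x) {i : Fin d}
    (hi : i ≠ axisIdx d) :
    fderiv ℝ v x (EuclideanSpace.single (axisIdx d) 1) i -
      fderiv ℝ v x (EuclideanSpace.single i 1) (axisIdx d) =
      vort v (cylCoord x) * (x i / cylRadius x) := by
  have hlin : ∀ c : ℝ, fderiv ℝ (axl v) (cylCoord x) (c, 0) =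
      c * fderiv ℝ (axl v) (cylCoord x) (1, 0) := fun c => by
    rw [← smul_eq_mul, ← map_smul]; simp
  rw [hax.fderiv_horizontal hv hx _ hi, hax.fderiv_axis hv hx, radialPart_single_axis,
    radialPart_single x hi, vort_eq hv]
  simp only [PiLp.single_apply, if_true, if_neg hi, if_neg hi.symm]
  rw [hlin]
  ring

theorem IsAxisymmetricSwirlFree.curl_horizontal (hv : ContDiff ℝ 1 v)
    (hax : IsAxisymmetricSwirlFree v) {x : RSpace d} (hx : 0 < cylRadius x) {i j : Fin d}
    (hi : i ≠ axisIdx d) (hj : j ≠ axisIdx d) :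
    fderiv ℝ v x (EuclideanSpace.single j 1) i = fderiv ℝ v x (EuclideanSpace.single i 1) j := by
  have hlin : ∀ c : ℝ, fderiv ℝ (rad v) (cylCoord x) (c, 0) =
      c * fderiv ℝ (rad v) (cylCoord x) (1, 0) := fun c => by
    rw [← smul_eq_mul, ← map_smul]; simp
  rw [hax.fderiv_horizontal hv hx _ hi, hax.fderiv_horizontal hv hx _ hj, radialPart_single x hi,
    radialPart_single x hj]
  simp only [PiLp.single_apply, if_neg hi.symm, if_neg hj.symm]
  rw [hlin, hlin (x i / cylRadius x)]
  by_cases hij : i = j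
  · subst hij; ring
  · simp only [if_neg hij, if_neg (Ne.symm hij)]
    ring

theorem norm_radialFrame {x : RSpace d} (hx : 0 < cylRadius x) (p : ℝ × ℝ) :
    ‖p.1 • radialVec x + EuclideanSpace.single (axisIdx d) p.2‖ ^ 2 = p.1 ^ 2 + p.2 ^ 2 := by
  rw [EuclideanSpace.norm_sq_eq, ← Finset.add_sum_erase _ _ (Finset.mem_univ (axisIdx d))]
  have : ∀ i ∈ Finset.univ.erase (axisIdx d),
      ‖(p.1 • radialVec x + EuclideanSpace.single (axisIdx d) p.2) i‖ ^ 2 =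
      p.1 ^ 2 * (x i / cylRadius x) ^ 2 := fun i hi => by
    have hi' := Finset.ne_of_mem_erase hi
    have h2 : (p.1 • radialVec x + EuclideanSpace.single (axisIdx d) p.2) i =
        p.1 * (x i / cylRadius x) := by simp [radialVec_apply hi', hi']
    rw [h2, Real.norm_eq_abs, sq_abs, mul_pow]
  rw [Finset.sum_congr rfl this, ← Finset.mul_sum, sum_div_cylRadius_sq hx]
  simp [radialVec_axis]
  ring

theorem radialPart_radialFrame {x : RSpace d} (hx : 0 < cylRadius x) (p : ℝ × ℝ) :
    radialPart x (p.1 • radialVec x + EuclideanSpace.single (axisIdx d) p.2) = p.1 := by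
  have : ∀ i ∈ Finset.univ.erase (axisIdx d), x i / cylRadius x *
      (p.1 • radialVec x + EuclideanSpace.single (axisIdx d) p.2) i =
      p.1 * (x i / cylRadius x) ^ 2 := fun i hi => by
    have hi' := Finset.ne_of_mem_erase hi
    simp [radialVec_apply hi', hi']
    ring
  rw [radialPart, Finset.sum_congr rfl this, ← Finset.mul_sum, sum_div_cylRadius_sq hx, mul_one]

theorem abs_radialPart_le {x : RSpace d} (hx : 0 < cylRadius x) (h : RSpace d) :
    |radialPart x h| ≤ ‖h‖ := by
  have h1 := Finset.sum_mul_sq_le_sq_mul_sq (Finset.univ.erase (axisIdx d))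
    (fun i => x i / cylRadius x) (fun i => h i)
  rw [sum_div_cylRadius_sq hx, one_mul] at h1
  have h2 : ∑ i ∈ Finset.univ.erase (axisIdx d), h i ^ 2 ≤ ‖h‖ ^ 2 := by
    rw [EuclideanSpace.norm_sq_eq]
    simp only [Real.norm_eq_abs, sq_abs]
    exact Finset.sum_le_univ_sum_of_nonneg fun i => sq_nonneg _
  exact abs_le_of_sq_le_sq (h1.trans h2) (norm_nonneg _)

theorem abs_coord_le_norm (x : RSpace d) (i : Fin d) : |x i| ≤ ‖x‖ := by
  simpa using PiLp.norm_apply_le x i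

theorem IsAxisymmetricSwirlFree.abs_fderiv_axl_le (hv : ContDiff ℝ 1 v)
    (hax : IsAxisymmetricSwirlFree v) {x : RSpace d} (hx : 0 < cylRadius x) {p : ℝ × ℝ}
    (hp : p.1 ^ 2 + p.2 ^ 2 = 1) :
    |fderiv ℝ (axl v) (cylCoord x) p| ≤ ‖fderiv ℝ v x‖ := by
  have h1 := hax.fderiv_axis hv hx (p.1 • radialVec x + EuclideanSpace.single (axisIdx d) p.2)
  rw [radialPart_radialFrame hx] at h1
  have h2 : (p.1 • radialVec x + EuclideanSpace.single (axisIdx d) p.2) (axisIdx d) = p.2 := by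
    simp [radialVec_axis]
  rw [h2] at h1
  have h3 : ‖p.1 • radialVec x + EuclideanSpace.single (axisIdx d) p.2‖ = 1 := by
    have := norm_radialFrame hx p
    rw [hp] at this
    exact (pow_eq_one_iff_of_nonneg (norm_nonneg _) two_ne_zero).1 this
  rw [← h1]
  refine (abs_coord_le_norm _ _).trans (((fderiv ℝ v x).le_opNorm _).trans ?_)
  rw [h3, mul_one]

/-- Along the unit vector p₁ e^r + p₂ e^z the direction e^r does not vary, so the derivative of v^r
is the radial part of the derivative of v. -/
theorem IsAxisymmetricSwirlFree.abs_fderiv_rad_le (hv : ContDiff ℝ 1 v)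
    (hax : IsAxisymmetricSwirlFree v) {x : RSpace d} (hx : 0 < cylRadius x) {p : ℝ × ℝ}
    (hp : p.1 ^ 2 + p.2 ^ 2 = 1) :
    |fderiv ℝ (rad v) (cylCoord x) p| ≤ ‖fderiv ℝ v x‖ := by
  set h := p.1 • radialVec x + EuclideanSpace.single (axisIdx d) p.2 with hh
  have hs := sum_div_cylRadius_sq hx
  have h2 : h (axisIdx d) = p.2 := by simp [hh, radialVec_axis]
  have h1 : radialPart x (fderiv ℝ v x h) = fderiv ℝ (rad v) (cylCoord x) p := by
    have : ∀ i ∈ Finset.univ.erase (axisIdx d), x i / cylRadius x * (fderiv ℝ v x h) i =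
        fderiv ℝ (rad v) (cylCoord x) p * (x i / cylRadius x) ^ 2 := fun i hi => by
      have hi' := Finset.ne_of_mem_erase hi
      rw [hax.fderiv_horizontal hv hx _ hi', h2, radialPart_radialFrame hx]
      have : h i = p.1 * (x i / cylRadius x) := by simp [hh, radialVec_apply hi', hi']
      rw [this]
      ring
    rw [radialPart, Finset.sum_congr rfl this, ← Finset.mul_sum, hs, mul_one]
  have h3 : ‖h‖ = 1 := by
    have := norm_radialFrame hx p
    rw [hp] at this
    exact (pow_eq_one_iff_of_nonneg (norm_nonneg _) two_ne_zero).1 this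
  rw [← h1]
  refine (abs_radialPart_le hx _).trans (((fderiv ℝ v x).le_opNorm _).trans ?_)
  rw [h3, mul_one]

theorem IsAxisymmetricSwirlFree.abs_vort_le (hv : ContDiff ℝ 1 v)
    (hax : IsAxisymmetricSwirlFree v) {x : RSpace d} (hx : 0 < cylRadius x) :
    |vort v (cylCoord x)| ≤ 2 * ‖fderiv ℝ v x‖ := by
  rw [vort_eq hv, two_mul]
  exact (abs_sub _ _).trans (add_le_add (hax.abs_fderiv_rad_le hv hx (by norm_num))
    (hax.abs_fderiv_axl_le hv hx (by norm_num)))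

theorem IsAxisymmetricSwirlFree.abs_rad_le (hax : IsAxisymmetricSwirlFree v) {x : RSpace d}
    (hx : 0 < cylRadius x) : |rad v (cylCoord x)| ≤ ‖v x‖ := by
  have h1 : radialPart x (v x) = rad v (cylCoord x) := by
    have : ∀ i ∈ Finset.univ.erase (axisIdx d), x i / cylRadius x * v x i =
        rad v (cylCoord x) * (x i / cylRadius x) ^ 2 := fun i hi => by
      rw [hax.apply x (Finset.ne_of_mem_erase hi)]
      ring
    rw [radialPart, Finset.sum_congr rfl this, ← Finset.mul_sum, sum_div_cylRadius_sq hx, mul_one]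
  rw [← h1]
  exact abs_radialPart_le hx _

theorem IsAxisymmetricSwirlFree.abs_axl_le (hax : IsAxisymmetricSwirlFree v) (x : RSpace d) :
    |axl v (cylCoord x)| ≤ ‖v x‖ := by
  rw [← hax.apply_axis]
  exact abs_coord_le_norm _ _

/-- The divergence condition expresses (d - 2) v^r / r through two derivatives of the field, and d -
2 ≥ 1. -/
theorem IsAxisymmetricSwirlFree.abs_rad_div_le (hd : 3 ≤ d) (hv : ContDiff ℝ 1 v)
    (hax : IsAxisymmetricSwirlFree v) (hdiv : ∀ x, divergence v x = 0) {x : RSpace d}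
    (hx : 0 < cylRadius x) :
    |rad v (cylCoord x) / cylRadius x| ≤ 2 * ‖fderiv ℝ v x‖ := by
  have h1 := hax.div_merid (q := cylCoord x) (by omega) hv hdiv hx
  have h2 := hax.abs_fderiv_rad_le hv hx (p := (1, 0)) (by norm_num)
  have h3 := hax.abs_fderiv_axl_le hv hx (p := (0, 1)) (by norm_num)
  have h4 : (1 : ℝ) ≤ (d : ℝ) - 2 := by
    have : (3 : ℝ) ≤ d := by exact_mod_cast hd
    linarith
  have h5 : |rad v (cylCoord x) / cylRadius x| ≤
      ((d : ℝ) - 2) * |rad v (cylCoord x) / cylRadius x| := le_mul_of_one_le_left (abs_nonneg _) h4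
  have h6 : ((d : ℝ) - 2) * |rad v (cylCoord x) / cylRadius x| =
      |fderiv ℝ (rad v) (cylCoord x) (1, 0) + fderiv ℝ (axl v) (cylCoord x) (0, 1)| := by
    have h7 : (cylCoord x).1 = cylRadius x := rfl
    have h8 := abs_mul ((d : ℝ) - 2) (rad v (cylCoord x) / cylRadius x)
    rw [abs_of_pos (lt_of_lt_of_le one_pos h4)] at h8
    rw [← h8, ← abs_neg]
    congr 1
    rw [h7] at h1
    linarith
  rw [h6] at h5
  refine h5.trans ((abs_add_le _ _).trans ?_)
  linarith

end AxisymmetricFields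

/-! ### The regularity extracted from the Sobolev hypotheses. -/

section FlowData

open BoundedContinuousFunction

/-- A velocity field, defined for all times, which is `C^1` in space with bounds that do not depend
on time, and solves the Euler equations on `[0, t₁]`. -/
structure IsRegularFlow {d : ℕ} [NeZero d] (t₁ : ℝ) (U : ℝ → RSpace d → RSpace d) : Prop where
  contDiff : ∀ t, ContDiff ℝ 1 (U t)
  axi : ∀ t, IsAxisymmetricSwirlFree (U t)
  div_free : ∀ t x, divergence (U t) x = 0
  cont : Continuous fun p : ℝ × RSpace d => U p.1 p.2
  cont_fderiv : Continuous fun p : ℝ × RSpace d => fderiv ℝ (U p.1) p.2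
  bound : ∃ B : ℝ, ∀ t x, ‖U t x‖ ≤ B ∧ ‖fderiv ℝ (U t) x‖ ≤ B
  bound_l2 : ∃ N : ℝ≥0, ∀ t, eLpNorm (U t) 2 volume ≤ N ∧
    eLpNorm (fun x => fderiv ℝ (U t) x) 2 volume ≤ N
  momentum : ∃ U' : ℝ → RSpace d → RSpace d, Continuous (fun p : ℝ × RSpace d => U' p.1 p.2) ∧
    ∀ t ∈ Icc 0 t₁, (∀ x, HasDerivWithinAt (fun τ => U τ x) (U' t x) (Icc 0 t₁) t) ∧
      ∃ p : RSpace d → ℝ, ContDiff ℝ 1 p ∧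
        ∀ x, U' t x = -(fderiv ℝ (U t) x (U t x)) - gradient p x

variable {d : ℕ}

theorem norm_le_sum_abs (x : RSpace d) : ‖x‖ ≤ ∑ i, |x i| := by
  have h : x = ∑ i, EuclideanSpace.single i (x i) := by
    ext j
    simp [Finset.sum_apply, Pi.single_apply]
  calc ‖x‖ = ‖∑ i, EuclideanSpace.single i (x i)‖ := by rw [← h]
    _ ≤ ∑ i, ‖(EuclideanSpace.single i (x i) : RSpace d)‖ := norm_sum_le _ _
    _ = ∑ i, |x i| := by simp

theorem opNorm_le_sum_entries (A : RSpace d →L[ℝ] RSpace d) :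
    ‖A‖ ≤ ∑ j, ∑ i, |A (EuclideanSpace.single j 1) i| := by
  refine A.opNorm_le_bound (Finset.sum_nonneg fun _ _ => Finset.sum_nonneg fun _ _ => abs_nonneg _)
    fun x => ?_
  have h : x = ∑ j, x j • (EuclideanSpace.single j (1 : ℝ) : RSpace d) := by
    ext k
    simp [Finset.sum_apply, Pi.single_apply]
  calc ‖A x‖ = ‖∑ j, x j • A (EuclideanSpace.single j (1 : ℝ))‖ := by
        conv_lhs => rw [h]
        rw [map_sum]
        simp_rw [map_smul]
    _ ≤ ∑ j, ‖x j • A (EuclideanSpace.single j (1 : ℝ))‖ := norm_sum_le _ _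
    _ ≤ ∑ j, ‖x‖ * ∑ i, |A (EuclideanSpace.single j 1) i| := by
        refine Finset.sum_le_sum fun j _ => ?_
        rw [norm_smul]
        exact mul_le_mul (PiLp.norm_apply_le x j) (norm_le_sum_abs _) (norm_nonneg _) (norm_nonneg _)
    _ = _ := by rw [← Finset.mul_sum, mul_comm]

/-- Derivatives within the interval must be unique, also at its left endpoint, so that the
derivative from the H^(s-1) class can be compared with the one in the momentum equation. -/
theorem uniqueDiffOn_timeInterval {T : EReal} (h : (0 : ℝ) ∈ timeInterval T) :
    UniqueDiffOn ℝ (timeInterval T) := by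
  have h0 : (0 : EReal) < T := by simpa [timeInterval] using h
  induction T with
  | bot => simp at h0
  | top =>
    have : timeInterval ⊤ = Ici 0 := by ext t; simp [timeInterval]
    rw [this]; exact uniqueDiffOn_Ici 0
  | coe T =>
    have : timeInterval (T : EReal) = Ico 0 T := by
      ext t; simp [timeInterval]
    rw [this]; exact uniqueDiffOn_Ico 0 T

theorem Icc_subset_timeInterval {T : EReal} {t₁ : ℝ} (h : t₁ ∈ timeInterval T) :
    Icc 0 t₁ ⊆ timeInterval T := fun _ ht =>
  ⟨ht.1, lt_of_le_of_lt (EReal.coe_le_coe_iff.2 ht.2) h.2⟩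

/-- The projection of the real line onto `[0, t₁]`. -/
def clampTime (t₁ t : ℝ) : ℝ := max 0 (min t t₁)

theorem continuous_clampTime (t₁ : ℝ) : Continuous (clampTime t₁) := by
  unfold clampTime
  fun_prop

theorem clampTime_mem {t₁ : ℝ} (h : 0 ≤ t₁) (t : ℝ) : clampTime t₁ t ∈ Icc 0 t₁ :=
  ⟨le_max_left _ _, max_le h (min_le_right _ _)⟩

theorem clampTime_of_mem {t₁ t : ℝ} (h : t ∈ Icc 0 t₁) : clampTime t₁ t = t := by
  rw [clampTime, min_eq_left h.2, max_eq_right h.1]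

/-- Continuity in time for the sup norm gives joint continuity in time and space. -/
theorem continuous_clamp_bcf {t₁ : ℝ} (h : 0 ≤ t₁) {F : ℝ → RSpace d →ᵇ ℝ}
    (hF : ContinuousOn F (Icc 0 t₁)) :
    Continuous fun p : ℝ × RSpace d => F (clampTime t₁ p.1) p.2 := by
  have h1 : Continuous fun t => F (clampTime t₁ t) :=
    hF.comp_continuous (continuous_clampTime t₁) (clampTime_mem h)
  exact continuous_eval.comp
    ((h1.comp continuous_fst).prodMk continuous_snd)

theorem exists_bound_bcf {t₁ : ℝ} {F : ℝ → RSpace d →ᵇ ℝ} (hF : ContinuousOn F (Icc 0 t₁)) :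
    ∃ B : ℝ, 0 ≤ B ∧ ∀ t ∈ Icc 0 t₁, ∀ x, |F t x| ≤ B := by
  obtain ⟨B, hB⟩ := isCompact_Icc.exists_bound_of_continuousOn hF
  exact ⟨max B 0, le_max_right _ _, fun t ht x =>
    ((F t).norm_coe_le_norm x).trans ((hB t ht).trans (le_max_left _ _))⟩

theorem exists_bound_l2 {t₁ : ℝ} {N : ℝ → ℝ} (hN : ContinuousOn N (Icc 0 t₁)) :
    ∃ B : ℝ≥0, ∀ t ∈ Icc 0 t₁, ENNReal.ofReal (N t) ≤ B := by
  obtain ⟨B, hB⟩ := isCompact_Icc.exists_bound_of_continuousOn hN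
  exact ⟨B.toNNReal, fun t ht => ENNReal.ofReal_le_ofReal ((le_abs_self _).trans (hB t ht))⟩

/-- Clamping time to the compact interval [0, t₁] gives a field defined for all times with bounds
uniform in time; it still solves the equations on [0, t₁], which is all that is used. -/
theorem IsEulerSolution.isRegularFlow [NeZero d] {s : ℝ} (hs : 1 + (d : ℝ) / 2 < s) {T : EReal}
    {u : ℝ → RSpace d → RSpace d} (hu : IsEulerSolution s T u)
    (hax : ∀ t ∈ timeInterval T, IsAxisymmetricSwirlFree (u t)) {t₁ : ℝ}
    (ht₁ : t₁ ∈ timeInterval T) : IsRegularFlow t₁ fun t => u (clampTime t₁ t) := by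
  have h0 : (0 : ℝ) ≤ t₁ := ht₁.1
  have hI := Icc_subset_timeInterval ht₁
  have hcl : ∀ t, clampTime t₁ t ∈ timeInterval T := fun t => hI (clampTime_mem h0 t)
  have hUD := uniqueDiffOn_timeInterval (hI ⟨le_rfl, h0⟩)
  have hci : ∀ i : Fin d, ∀ t ∈ timeInterval T, ContDiff ℝ 1 (fun x => u t x i) := fun i t ht =>
    (EuclideanSpace.proj i : RSpace d →L[ℝ] ℝ).contDiff.comp (hu.contDiff t ht)
  have hd : ∀ t ∈ timeInterval T, Differentiable ℝ (u t) := fun t ht =>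
    (hu.contDiff t ht).differentiable (by norm_num)
  have e1 := fun i => exists_continuousOn_bcf hs (hci i) (hu.sobolev i)
  have e2 := fun i m => exists_continuousOn_bcf_fderiv hs (hci i) (hu.sobolev i) m
  choose F hF hFu using fun i => (e1 i).1
  choose N hN hNu using fun i => (e1 i).2
  choose G hG hGu using fun i m => (e2 i m).1
  choose L hL hLu using fun i m => (e2 i m).2
  choose H hH hHu using fun i => exists_continuousOn_bcf_hasDerivWithinAt (by linarith) hUD
    (fun t ht => (hci i t ht).continuous) (hu.sobolev_deriv i)
  have hGu' : ∀ i m, ∀ t ∈ timeInterval T, ∀ x, fderiv ℝ (u t) x m i = G i m t x :=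
    fun i m t ht x => by rw [hGu i m t ht x, fderiv_apply_comp (hd t ht)]
  refine ⟨fun t => hu.contDiff _ (hcl t), fun t => hax _ (hcl t), fun t => hu.div_free _ (hcl t),
    ?_, ?_, ?_, ?_, ?_⟩
  · have : ∀ i, Continuous fun p : ℝ × RSpace d => u (clampTime t₁ p.1) p.2 i := fun i => by
      have := continuous_clamp_bcf h0 ((hF i).mono hI)
      simpa only [hFu i _ (hcl _)] using this
    exact (PiLp.continuous_toLp 2 (fun _ : Fin d => ℝ)).comp (continuous_pi this)
  · refine continuous_clm_apply.2 fun m => ?_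
    have : ∀ i, Continuous fun p : ℝ × RSpace d => fderiv ℝ (u (clampTime t₁ p.1)) p.2 m i :=
      fun i => by
        have := continuous_clamp_bcf h0 ((hG i m).mono hI)
        simpa only [hGu' i m _ (hcl _)] using this
    exact (PiLp.continuous_toLp 2 (fun _ : Fin d => ℝ)).comp (continuous_pi this)
  · choose B hB0 hB using fun i => exists_bound_bcf ((hF i).mono hI)
    choose B' hB0' hB' using fun i m => exists_bound_bcf ((hG i m).mono hI)
    refine ⟨∑ i, B i + ∑ j, ∑ i, B' i (EuclideanSpace.single j 1), fun t x => ⟨?_, ?_⟩⟩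
    · have h1 : ‖u (clampTime t₁ t) x‖ ≤ ∑ i, B i :=
        (norm_le_sum_abs _).trans (Finset.sum_le_sum fun i _ => by
          rw [← hFu i _ (hcl t)]; exact hB i _ (clampTime_mem h0 t) x)
      have h2 : 0 ≤ ∑ j, ∑ i, B' i (EuclideanSpace.single j 1) :=
        Finset.sum_nonneg fun _ _ => Finset.sum_nonneg fun _ _ => hB0' _ _
      linarith
    · have h1 : ‖fderiv ℝ (u (clampTime t₁ t)) x‖ ≤ ∑ j, ∑ i, B' i (EuclideanSpace.single j 1) :=
        (opNorm_le_sum_entries _).trans (Finset.sum_le_sum fun j _ => Finset.sum_le_sum fun i _ => by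
          rw [hGu' i _ _ (hcl t)]; exact hB' i _ _ (clampTime_mem h0 t) x)
      have h2 : 0 ≤ ∑ i, B i := Finset.sum_nonneg fun _ _ => hB0 _
      linarith
  · choose B hB using fun i => exists_bound_l2 ((hN i).mono hI)
    choose B' hB' using fun i m => exists_bound_l2 ((hL i m).mono hI)
    refine ⟨∑ i, B i + ∑ j, ∑ i, B' i (EuclideanSpace.single j 1), fun t => ⟨?_, ?_⟩⟩
    · have hc : ∀ i, AEStronglyMeasurable (fun x => |u (clampTime t₁ t) x i|) volume := fun i =>
        (hci i _ (hcl t)).continuous.abs.aestronglyMeasurable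
      calc eLpNorm (u (clampTime t₁ t)) 2 volume
          ≤ eLpNorm (fun x => ∑ i, |u (clampTime t₁ t) x i|) 2 volume :=
            eLpNorm_mono_real fun x => norm_le_sum_abs _
        _ = eLpNorm (∑ i, fun x => |u (clampTime t₁ t) x i|) 2 volume := by
            congr 1; ext x; simp
        _ ≤ ∑ i, eLpNorm (fun x => |u (clampTime t₁ t) x i|) 2 volume :=
            eLpNorm_sum_le (fun i _ => hc i) (by norm_num)
        _ ≤ ∑ i, (B i : ℝ≥0∞) := Finset.sum_le_sum fun i _ => by
            refine le_trans (le_of_eq ?_) (hB i _ (clampTime_mem h0 t))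
            rw [← hNu i _ (hcl t)]
            exact eLpNorm_norm (fun x => u (clampTime t₁ t) x i)
        _ ≤ _ := by push_cast; exact le_self_add
    · have hc : ∀ j i, AEStronglyMeasurable (fun x => |fderiv ℝ (u (clampTime t₁ t)) x
          (EuclideanSpace.single j 1) i|) volume := fun j i => by
        simp only [hGu' i _ _ (hcl t)]
        exact (G i _ _).continuous.abs.aestronglyMeasurable
      calc eLpNorm (fun x => fderiv ℝ (u (clampTime t₁ t)) x) 2 volume
          ≤ eLpNorm (fun x => ∑ j, ∑ i, |fderiv ℝ (u (clampTime t₁ t)) x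
              (EuclideanSpace.single j 1) i|) 2 volume :=
            eLpNorm_mono_real fun x => opNorm_le_sum_entries _
        _ = eLpNorm (∑ j, ∑ i, fun x => |fderiv ℝ (u (clampTime t₁ t)) x
              (EuclideanSpace.single j 1) i|) 2 volume := by
            congr 1; ext x; simp
        _ ≤ ∑ j, eLpNorm (∑ i, fun x => |fderiv ℝ (u (clampTime t₁ t)) x
              (EuclideanSpace.single j 1) i|) 2 volume :=
            eLpNorm_sum_le (fun j _ => Finset.aestronglyMeasurable_sum _ fun i _ => hc j i)
              (by norm_num)
        _ ≤ ∑ j, ∑ i, eLpNorm (fun x => |fderiv ℝ (u (clampTime t₁ t)) x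
              (EuclideanSpace.single j 1) i|) 2 volume :=
            Finset.sum_le_sum fun j _ => eLpNorm_sum_le (fun i _ => hc j i) (by norm_num)
        _ ≤ ∑ j, ∑ i, (B' i (EuclideanSpace.single j 1) : ℝ≥0∞) :=
            Finset.sum_le_sum fun j _ => Finset.sum_le_sum fun i _ => by
              refine le_trans (le_of_eq ?_) (hB' i _ _ (clampTime_mem h0 t))
              rw [← hLu i _ _ (hcl t)]
              simp only [fderiv_apply_comp (hd _ (hcl t))]
              exact eLpNorm_norm (fun x => fderiv ℝ (fun y => u (clampTime t₁ t) y i) x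
                (EuclideanSpace.single j 1))
        _ ≤ _ := by push_cast; exact le_add_self
  · obtain ⟨p, hp⟩ := hu.momentum
    refine ⟨fun t x => WithLp.toLp 2 fun i => H i (clampTime t₁ t) x, ?_, fun t ht => ?_⟩
    · exact (PiLp.continuous_toLp 2 (fun _ : Fin d => ℝ)).comp
        (continuous_pi fun i => continuous_clamp_bcf h0 ((hH i).mono hI))
    · have h1 : ∀ x, HasDerivWithinAt (fun τ => u τ x)
          (WithLp.toLp 2 fun i => H i (clampTime t₁ t) x) (timeInterval T) t := fun x => by
        rw [clampTime_of_mem ht, hasDerivWithinAt_iff_hasFDerivWithinAt,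
          hasFDerivWithinAt_euclidean]
        intro i
        have := (hHu i t (hI ht) x).hasFDerivWithinAt
        refine this.congr_fderiv ?_
        ext
        simp
      refine ⟨fun x => ?_, p t, (hp t (hI ht)).1, fun x => ?_⟩
      · refine ((h1 x).mono hI).congr (fun τ hτ => ?_) ?_
        · rw [clampTime_of_mem hτ]
        · rw [clampTime_of_mem ht]
      · beta_reduce
        rw [clampTime_of_mem ht]
        -- The continuous time derivative coming from the Sobolev class equals the right side of the
        -- momentum equation by uniqueness of derivatives. The pressure itself needs no regularity
        -- in time.
        have h2 := (hUD t (hI ht)).eq_deriv _ (h1 x) ((hp t (hI ht)).2 x)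
        rw [clampTime_of_mem ht] at h2
        exact h2

end FlowData

/-! ### The vorticity equation in weak conservation form on the half-plane. -/

section WeakVorticityEquation

/-- The partial derivative with respect to `r`. -/
def dR (f : ℝ × ℝ → ℝ) (q : ℝ × ℝ) : ℝ := fderiv ℝ f q (1, 0)

/-- The partial derivative with respect to `z`. -/
def dZ (f : ℝ × ℝ → ℝ) (q : ℝ × ℝ) : ℝ := fderiv ℝ f q (0, 1)

theorem fderiv_eq_dR_dZ (f : ℝ × ℝ → ℝ) (q p : ℝ × ℝ) :
    fderiv ℝ f q p = p.1 * dR f q + p.2 * dZ f q := by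
  have : p = p.1 • ((1, 0) : ℝ × ℝ) + p.2 • ((0, 1) : ℝ × ℝ) := by
    ext <;> simp
  have h := congrArg (fderiv ℝ f q) this
  rw [map_add, map_smul, map_smul] at h
  exact h

theorem continuous_dR {f : ℝ × ℝ → ℝ} (hf : ContDiff ℝ 1 f) : Continuous (dR f) :=
  (hf.continuous_fderiv (by norm_num)).clm_apply continuous_const

theorem continuous_dZ {f : ℝ × ℝ → ℝ} (hf : ContDiff ℝ 1 f) : Continuous (dZ f) :=
  (hf.continuous_fderiv (by norm_num)).clm_apply continuous_const

theorem contDiff_dR {f : ℝ × ℝ → ℝ} (hf : ContDiff ℝ 2 f) : ContDiff ℝ 1 (dR f) :=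
  (hf.fderiv_right (m := 1) (by norm_num)).clm_apply contDiff_const

theorem contDiff_dZ {f : ℝ × ℝ → ℝ} (hf : ContDiff ℝ 2 f) : ContDiff ℝ 1 (dZ f) :=
  (hf.fderiv_right (m := 1) (by norm_num)).clm_apply contDiff_const

theorem dR_dZ_comm {f : ℝ × ℝ → ℝ} (hf : ContDiff ℝ 2 f) (q : ℝ × ℝ) :
    dR (dZ f) q = dZ (dR f) q := by
  have h1 : DifferentiableAt ℝ (fderiv ℝ f) q :=
    (hf.fderiv_right (m := 1) (by norm_num)).differentiable (by norm_num) q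
  have h2 : ∀ p p', fderiv ℝ (fun q => fderiv ℝ f q p) q p' = fderiv ℝ (fderiv ℝ f) q p' p := by
    intro p p'
    rw [fderiv_clm_apply h1 (differentiableAt_const p)]
    simp
  have h3 : IsSymmSndFDerivAt ℝ f q := hf.contDiffAt.isSymmSndFDerivAt (by simp)
  unfold dR dZ
  rw [h2, h2]
  exact h3 _ _

theorem hasCompactSupport_dR {f : ℝ × ℝ → ℝ} (hf : HasCompactSupport f) :
    HasCompactSupport (dR f) := hf.fderiv_apply (𝕜 := ℝ) _

theorem hasCompactSupport_dZ {f : ℝ × ℝ → ℝ} (hf : HasCompactSupport f) :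
    HasCompactSupport (dZ f) := hf.fderiv_apply (𝕜 := ℝ) _

theorem dR_eq_zero {f : ℝ × ℝ → ℝ} {q : ℝ × ℝ} (hq : q ∉ tsupport f) : dR f q = 0 := by
  rw [dR, fderiv_of_notMem_tsupport ℝ hq]; rfl

theorem dZ_eq_zero {f : ℝ × ℝ → ℝ} {q : ℝ × ℝ} (hq : q ∉ tsupport f) : dZ f q = 0 := by
  rw [dZ, fderiv_of_notMem_tsupport ℝ hq]; rfl

theorem integral_mul_dR {f g : ℝ × ℝ → ℝ} (hf : ContDiff ℝ 1 f) (hg : ContDiff ℝ 1 g)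
    (hfc : HasCompactSupport f) : ∫ q, f q * dR g q = -∫ q, dR f q * g q :=
  integral_mul_fderiv_eq_neg_fderiv_mul_of_integrable
    (((continuous_dR hf).mul hg.continuous).integrable_of_hasCompactSupport
      (hasCompactSupport_dR hfc).mul_right)
    ((hf.continuous.mul (continuous_dR hg)).integrable_of_hasCompactSupport hfc.mul_right)
    ((hf.continuous.mul hg.continuous).integrable_of_hasCompactSupport hfc.mul_right)
    (fun x _ => hf.differentiable (by norm_num) x) (fun x _ => hg.differentiable (by norm_num) x)

theorem integral_mul_dZ {f g : ℝ × ℝ → ℝ} (hf : ContDiff ℝ 1 f) (hg : ContDiff ℝ 1 g)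
    (hfc : HasCompactSupport f) : ∫ q, f q * dZ g q = -∫ q, dZ f q * g q :=
  integral_mul_fderiv_eq_neg_fderiv_mul_of_integrable
    (((continuous_dZ hf).mul hg.continuous).integrable_of_hasCompactSupport
      (hasCompactSupport_dZ hfc).mul_right)
    ((hf.continuous.mul (continuous_dZ hg)).integrable_of_hasCompactSupport hfc.mul_right)
    ((hf.continuous.mul hg.continuous).integrable_of_hasCompactSupport hfc.mul_right)
    (fun x _ => hf.differentiable (by norm_num) x) (fun x _ => hg.differentiable (by norm_num) x)

/-- A gradient has no curl, even when `g` is only C^1: both derivatives are moved to `f`, whose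
mixed derivatives commute. -/
theorem integral_dZ_mul_dR_sub {f g : ℝ × ℝ → ℝ} (hf : ContDiff ℝ 2 f) (hg : ContDiff ℝ 1 g)
    (hfc : HasCompactSupport f) : ∫ q, (dZ f q * dR g q - dR f q * dZ g q) = 0 := by
  have h1 := integral_mul_dR (contDiff_dZ hf) hg (hasCompactSupport_dZ hfc)
  have h2 := integral_mul_dZ (contDiff_dR hf) hg (hasCompactSupport_dR hfc)
  rw [integral_sub, h1, h2]
  · simp_rw [dR_dZ_comm hf]; ring
  · exact ((contDiff_dZ hf).continuous.mul (continuous_dR hg)).integrable_of_hasCompactSupport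
      (hasCompactSupport_dZ hfc).mul_right
  · exact ((contDiff_dR hf).continuous.mul (continuous_dZ hg)).integrable_of_hasCompactSupport
      (hasCompactSupport_dR hfc).mul_right

theorem integral_mul_curl {f a b : ℝ × ℝ → ℝ} (hf : ContDiff ℝ 1 f) (ha : ContDiff ℝ 1 a)
    (hb : ContDiff ℝ 1 b) (hfc : HasCompactSupport f) :
    ∫ q, f q * (dZ a q - dR b q) = ∫ q, (dR f q * b q - dZ f q * a q) := by
  simp_rw [mul_sub]
  rw [integral_sub, integral_sub, integral_mul_dZ hf ha hfc, integral_mul_dR hf hb hfc]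
  · ring
  · exact ((continuous_dR hf).mul hb.continuous).integrable_of_hasCompactSupport
      (hasCompactSupport_dR hfc).mul_right
  · exact ((continuous_dZ hf).mul ha.continuous).integrable_of_hasCompactSupport
      (hasCompactSupport_dZ hfc).mul_right
  · exact (hf.continuous.mul (continuous_dZ ha)).integrable_of_hasCompactSupport hfc.mul_right
  · exact (hf.continuous.mul (continuous_dR hb)).integrable_of_hasCompactSupport hfc.mul_right

variable {d : ℕ} [NeZero d]

theorem vort_eq_dZ_sub_dR {v : RSpace d → RSpace d} (hv : ContDiff ℝ 1 v) (q : ℝ × ℝ) :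
    vort v q = dZ (rad v) q - dR (axl v) q := vort_eq hv q

theorem gradient_apply (p : RSpace d → ℝ) (x : RSpace d) (i : Fin d) :
    gradient p x i = fderiv ℝ p x (EuclideanSpace.single i 1) := by
  have h := InnerProductSpace.toDual_symm_apply (𝕜 := ℝ) (x := EuclideanSpace.single i (1 : ℝ))
    (y := fderiv ℝ p x)
  rw [EuclideanSpace.inner_single_right] at h
  simpa [gradient] using h

theorem merMap_one_zero : merMap d (1, 0) = EuclideanSpace.single (0 : Fin d) (1 : ℝ) := by
  simp [merMap]

theorem merMap_zero_one : merMap d (0, 1) = EuclideanSpace.single (axisIdx d) (1 : ℝ) := by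
  simp [merMap]

/-- In Lamb form the transport term is the gradient of |v|^2 / 2 plus ω (v^z, -v^r). Paired with the
rotated gradient of χ, all gradients drop out and only the flux of ω remains. -/
theorem integral_curl_momentum (hd : 2 ≤ d) {v w : RSpace d → RSpace d} (hv : ContDiff ℝ 1 v)
    (hax : IsAxisymmetricSwirlFree v) {p : RSpace d → ℝ} (hp : ContDiff ℝ 1 p)
    (hw : ∀ x, w x = -(fderiv ℝ v x (v x)) - gradient p x) {χ : ℝ × ℝ → ℝ} (hχ : ContDiff ℝ 2 χ)
    (hχc : HasCompactSupport χ) (hχs : tsupport χ ⊆ {q | 0 < q.1}) :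
    ∫ q, (dR χ q * axl w q - dZ χ q * rad w q) =
      ∫ q, vort v q * (rad v q * dR χ q + axl v q * dZ χ q) := by
  have hvd : Differentiable ℝ v := hv.differentiable (by norm_num)
  have ha := contDiff_rad hv
  have hb := contDiff_axl hv
  have hP : ContDiff ℝ 1 (p ∘ merMap d) := hp.comp (merMap d).contDiff
  -- The Bernoulli function |v|^2 / 2 + p in the meridional plane.
  set Q : ℝ × ℝ → ℝ := fun q =>
    2⁻¹ * (rad v q * rad v q + axl v q * axl v q) + (p ∘ merMap d) q
  have hQc : ContDiff ℝ 1 Q := (contDiff_const.mul ((ha.mul ha).add (hb.mul hb))).add hP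
  have hQd : ∀ q h, fderiv ℝ Q q h = rad v q * fderiv ℝ (rad v) q h +
      axl v q * fderiv ℝ (axl v) q h + fderiv ℝ p (merMap d q) (merMap d h) := fun q h => by
    have d1 := (ha.differentiable (by norm_num) q).hasFDerivAt
    have d2 := (hb.differentiable (by norm_num) q).hasFDerivAt
    have d3 := ((hp.differentiable (by norm_num)) (merMap d q)).hasFDerivAt.comp q
      (merMap d).hasFDerivAt
    have d4 := ((((d1.mul d1).add (d2.mul d2)).const_mul (2⁻¹ : ℝ))).add d3
    have d5 : HasFDerivAt Q _ q := d4
    rw [d5.fderiv]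
    simp
    ring
  rw [← sub_eq_zero, ← integral_sub, ← integral_dZ_mul_dR_sub hχ hQc hχc]
  · refine integral_congr_ae (Filter.Eventually.of_forall fun q => ?_)
    by_cases hq : q ∈ tsupport χ
    · have hq0 : 0 < q.1 := hχs hq
      have e1 : rad w q = -(rad v q * dR (rad v) q + axl v q * dZ (rad v) q) -
          fderiv ℝ p (merMap d q) (EuclideanSpace.single (0 : Fin d) 1) := by
        rw [rad_eq, hw, hax.apply_merMap hd hq0]
        simp only [PiLp.sub_apply, PiLp.neg_apply]
        rw [← fderiv_rad_apply hvd, gradient_apply, fderiv_eq_dR_dZ]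
      have e2 : axl w q = -(rad v q * dR (axl v) q + axl v q * dZ (axl v) q) -
          fderiv ℝ p (merMap d q) (EuclideanSpace.single (axisIdx d) 1) := by
        rw [axl_eq, hw, hax.apply_merMap hd hq0]
        simp only [PiLp.sub_apply, PiLp.neg_apply]
        rw [← fderiv_axl_apply hvd, gradient_apply, fderiv_eq_dR_dZ]
      have e3 := hQd q (1, 0)
      have e4 := hQd q (0, 1)
      rw [merMap_one_zero] at e3
      rw [merMap_zero_one] at e4
      beta_reduce
      rw [e1, e2, vort_eq_dZ_sub_dR hv, show dR Q q = _ from e3, show dZ Q q = _ from e4]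
      simp only [dR, dZ]
      ring
    · simp [dR_eq_zero hq, dZ_eq_zero hq]
  · have hwc : Continuous w := by
      have h1 : Continuous fun x => fderiv ℝ v x (v x) :=
        (hv.continuous_fderiv (by norm_num)).clm_apply hv.continuous
      have h2 : Continuous (gradient p) :=
        (InnerProductSpace.toDual ℝ (RSpace d)).symm.continuous.comp
          (hp.continuous_fderiv (by norm_num))
      rw [show w = _ from funext hw]
      exact h1.neg.sub h2
    have hr : Continuous (rad w) := by
      rw [show rad w = _ from funext (rad_eq w)]; fun_prop
    have hx : Continuous (axl w) := by
      rw [show axl w = _ from funext (axl_eq w)]; fun_prop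
    exact ((((contDiff_dR hχ).continuous.mul hx).integrable_of_hasCompactSupport
      (hasCompactSupport_dR hχc).mul_right)).sub
      (((contDiff_dZ hχ).continuous.mul hr).integrable_of_hasCompactSupport
      (hasCompactSupport_dZ hχc).mul_right)
  · exact ((continuous_vort hv).mul ((ha.continuous.mul (contDiff_dR hχ).continuous).add
      (hb.continuous.mul (contDiff_dZ hχ).continuous))).integrable_of_hasCompactSupport
      (((hasCompactSupport_dR hχc).mul_left.add (hasCompactSupport_dZ hχc).mul_left).mul_left)

/-- The measure `dτ dr dz` on `(0, t] × ℝ²`. -/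
def slab (t : ℝ) : Measure (ℝ × (ℝ × ℝ)) := (volume.restrict (Ioc 0 t)).prod volume

theorem integrable_slab {F : ℝ × (ℝ × ℝ) → ℝ} (hF : Continuous F) {K : Set (ℝ × ℝ)}
    (hK : IsCompact K) (hFK : ∀ τ, ∀ q ∉ K, F (τ, q) = 0) (t : ℝ) : Integrable F (slab t) := by
  have h1 : IntegrableOn F (Icc 0 t ×ˢ K) volume :=
    hF.continuousOn.integrableOn_compact (isCompact_Icc.prod hK)
  have h2 : IntegrableOn F (Icc 0 t ×ˢ univ) volume :=
    h1.of_forall_sdiff_eq_zero (measurableSet_Icc.prod MeasurableSet.univ) fun p hp => by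
      refine hFK p.1 p.2 fun h => hp.2 ⟨hp.1.1, h⟩
  have h3 : IntegrableOn F (Ioc 0 t ×ˢ univ) volume :=
    h2.mono_set (prod_mono Ioc_subset_Icc_self le_rfl)
  rw [slab, ← Measure.restrict_univ (μ := (volume : Measure (ℝ × ℝ))), Measure.prod_restrict,
    ← Measure.volume_eq_prod]
  exact h3

theorem integral_slab {F : ℝ × (ℝ × ℝ) → ℝ} {t : ℝ} (ht : 0 ≤ t) (hF : Integrable F (slab t)) :
    ∫ p, F p ∂slab t = ∫ τ in 0..t, ∫ q, F (τ, q) := by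
  rw [slab, integral_prod _ hF, intervalIntegral.integral_of_le ht]

theorem continuous_rad_flow {U : ℝ → RSpace d → RSpace d}
    (h : Continuous fun p : ℝ × RSpace d => U p.1 p.2) :
    Continuous fun p : ℝ × (ℝ × ℝ) => rad (U p.1) p.2 := by
  simp only [rad_eq]
  have : Continuous fun p : ℝ × (ℝ × ℝ) => U p.1 (merMap d p.2) :=
    h.comp (continuous_fst.prodMk ((merMap d).continuous.comp continuous_snd))
  fun_prop

theorem continuous_axl_flow {U : ℝ → RSpace d → RSpace d}
    (h : Continuous fun p : ℝ × RSpace d => U p.1 p.2) :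
    Continuous fun p : ℝ × (ℝ × ℝ) => axl (U p.1) p.2 := by
  simp only [axl_eq]
  have : Continuous fun p : ℝ × (ℝ × ℝ) => U p.1 (merMap d p.2) :=
    h.comp (continuous_fst.prodMk ((merMap d).continuous.comp continuous_snd))
  fun_prop

namespace IsRegularFlow

variable {t₁ : ℝ} {U : ℝ → RSpace d → RSpace d}

theorem continuous_fderiv_apply (hU : IsRegularFlow t₁ U) (h : ℝ × ℝ) (i : Fin d) :
    Continuous fun p : ℝ × (ℝ × ℝ) => fderiv ℝ (U p.1) (merMap d p.2) (merMap d h) i := by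
  have : Continuous fun p : ℝ × (ℝ × ℝ) => fderiv ℝ (U p.1) (merMap d p.2) :=
    hU.cont_fderiv.comp (continuous_fst.prodMk ((merMap d).continuous.comp continuous_snd))
  fun_prop

theorem continuous_fderiv_rad (hU : IsRegularFlow t₁ U) (h : ℝ × ℝ) :
    Continuous fun p : ℝ × (ℝ × ℝ) => fderiv ℝ (rad (U p.1)) p.2 h := by
  simp only [fderiv_rad_apply ((hU.contDiff _).differentiable (by norm_num))]
  exact hU.continuous_fderiv_apply h _

theorem continuous_fderiv_axl (hU : IsRegularFlow t₁ U) (h : ℝ × ℝ) :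
    Continuous fun p : ℝ × (ℝ × ℝ) => fderiv ℝ (axl (U p.1)) p.2 h := by
  simp only [fderiv_axl_apply ((hU.contDiff _).differentiable (by norm_num))]
  exact hU.continuous_fderiv_apply h _

theorem continuous_rad (hU : IsRegularFlow t₁ U) :
    Continuous fun p : ℝ × (ℝ × ℝ) => rad (U p.1) p.2 := continuous_rad_flow hU.cont

theorem continuous_axl (hU : IsRegularFlow t₁ U) :
    Continuous fun p : ℝ × (ℝ × ℝ) => axl (U p.1) p.2 := continuous_axl_flow hU.cont

theorem continuous_vort (hU : IsRegularFlow t₁ U) :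
    Continuous fun p : ℝ × (ℝ × ℝ) => vort (U p.1) p.2 := by
  simp only [vort_eq (hU.contDiff _)]
  exact (hU.continuous_fderiv_rad _).sub (hU.continuous_fderiv_axl _)

/-- The weak form of the vorticity equation. -/
theorem integral_vort_sub (hd : 2 ≤ d) (hU : IsRegularFlow t₁ U) {χ : ℝ × ℝ → ℝ}
    (hχ : ContDiff ℝ 2 χ) (hχc : HasCompactSupport χ) (hχs : tsupport χ ⊆ {q | 0 < q.1})
    {t : ℝ} (ht : t ∈ Icc 0 t₁) :
    (∫ q, χ q * vort (U t) q) - ∫ q, χ q * vort (U 0) q =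
      ∫ τ in 0..t, ∫ q, vort (U τ) q *
        (rad (U τ) q * dR χ q + axl (U τ) q * dZ χ q) := by
  obtain ⟨U', hU'c, hU'⟩ := hU.momentum
  have hχ1 : ContDiff ℝ 1 χ := hχ.of_le (by norm_num)
  have hr' : Continuous fun p : ℝ × (ℝ × ℝ) => rad (U' p.1) p.2 := continuous_rad_flow hU'c
  have hx' : Continuous fun p : ℝ × (ℝ × ℝ) => axl (U' p.1) p.2 := continuous_axl_flow hU'c
  have hcR := (contDiff_dR hχ).continuous
  have hcZ := (contDiff_dZ hχ).continuous
  -- The vorticity has no time derivative of its own, so its space derivatives are moved to χ and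
  -- the time derivative is taken on the velocity.
  have h1 : ∀ τ, ∫ q, χ q * vort (U τ) q =
      ∫ q, (dR χ q * axl (U τ) q - dZ χ q * rad (U τ) q) := fun τ => by
    simp_rw [vort_eq_dZ_sub_dR (hU.contDiff τ)]
    exact integral_mul_curl hχ1 (contDiff_rad (hU.contDiff τ)) (contDiff_axl (hU.contDiff τ)) hχc
  have hint : ∀ τ, Integrable fun q => dR χ q * axl (U τ) q - dZ χ q * rad (U τ) q := fun τ =>
    (((hcR.mul (contDiff_axl (hU.contDiff τ)).continuous).integrable_of_hasCompactSupport
      (hasCompactSupport_dR hχc).mul_right)).sub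
    (((hcZ.mul (contDiff_rad (hU.contDiff τ)).continuous).integrable_of_hasCompactSupport
      (hasCompactSupport_dZ hχc).mul_right))
  have h2 : ∀ x, U t x - U 0 x = ∫ τ in 0..t, U' τ x := fun x => by
    have hsub : Icc 0 t ⊆ Icc 0 t₁ := Icc_subset_Icc le_rfl ht.2
    refine (intervalIntegral.integral_eq_sub_of_hasDeriv_right_of_le ht.1
      (f := fun τ => U τ x) ?_ (fun τ hτ => ?_) ?_).symm
    · exact (hU.cont.comp (continuous_id.prodMk continuous_const)).continuousOn
    · have := (hU' τ (hsub ⟨hτ.1.le, hτ.2.le⟩)).1 x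
      have hn : Icc 0 t₁ ∈ nhds τ := Icc_mem_nhds hτ.1 (hτ.2.trans_le ht.2)
      exact (this.hasDerivAt hn).hasDerivWithinAt
    · exact (hU'c.comp (continuous_id.prodMk continuous_const)).intervalIntegrable _ _
  have h3 : ∀ q, (dR χ q * axl (U t) q - dZ χ q * rad (U t) q) -
      (dR χ q * axl (U 0) q - dZ χ q * rad (U 0) q) =
      ∫ τ in 0..t, (dR χ q * axl (U' τ) q - dZ χ q * rad (U' τ) q) := fun q => by
    have hi : IntervalIntegrable (fun τ => U' τ (merMap d q)) volume 0 t :=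
      (hU'c.comp (continuous_id.prodMk continuous_const)).intervalIntegrable _ _
    have e : ∀ i : Fin d, U t (merMap d q) i - U 0 (merMap d q) i =
        ∫ τ in 0..t, U' τ (merMap d q) i := fun i => by
      have := (EuclideanSpace.proj i : RSpace d →L[ℝ] ℝ).intervalIntegral_comp_comm hi
      rw [← h2] at this
      exact this.symm
    have c1 : Continuous fun τ => axl (U' τ) q := hx'.comp (continuous_id.prodMk continuous_const)
    have c2 : Continuous fun τ => rad (U' τ) q := hr'.comp (continuous_id.prodMk continuous_const)
    have c3 : Continuous fun τ => dR χ q * axl (U' τ) q := continuous_const.mul c1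
    have c4 : Continuous fun τ => dZ χ q * rad (U' τ) q := continuous_const.mul c2
    rw [intervalIntegral.integral_sub (c3.intervalIntegrable _ _)
      (c4.intervalIntegrable _ _), intervalIntegral.integral_const_mul,
      intervalIntegral.integral_const_mul]
    simp only [axl_eq, rad_eq]
    rw [← e, ← e]
    ring
  have h4 : Integrable (fun p : ℝ × (ℝ × ℝ) =>
      dR χ p.2 * axl (U' p.1) p.2 - dZ χ p.2 * rad (U' p.1) p.2) (slab t) := by
    refine integrable_slab (by fun_prop) hχc.isCompact (fun τ q hq => ?_) t
    simp [dR_eq_zero hq, dZ_eq_zero hq]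
  rw [h1, h1, ← integral_sub (hint t) (hint 0)]
  simp_rw [h3, intervalIntegral.integral_of_le ht.1]
  -- After Fubini, the momentum equation is applied at each fixed time.
  rw [← integral_integral_swap (f := fun τ q => dR χ q * axl (U' τ) q - dZ χ q * rad (U' τ) q) h4]
  refine setIntegral_congr_fun measurableSet_Ioc fun τ hτ => ?_
  obtain ⟨-, p, hp, hpe⟩ := hU' τ ⟨hτ.1.le, hτ.2.trans ht.2⟩
  exact integral_curl_momentum hd (hU.contDiff τ) (hU.axi τ) hp hpe hχ hχc hχs

theorem integral_vort_sub_slab (hd : 2 ≤ d) (hU : IsRegularFlow t₁ U) {χ : ℝ × ℝ → ℝ}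
    (hχ : ContDiff ℝ 2 χ) (hχc : HasCompactSupport χ) (hχs : tsupport χ ⊆ {q | 0 < q.1})
    {t : ℝ} (ht : t ∈ Icc 0 t₁) :
    (∫ q, χ q * vort (U t) q) - ∫ q, χ q * vort (U 0) q =
      ∫ p, vort (U p.1) p.2 * (rad (U p.1) p.2 * dR χ p.2 + axl (U p.1) p.2 * dZ χ p.2)
        ∂slab t := by
  rw [hU.integral_vort_sub hd hχ hχc hχs ht, integral_slab ht.1]
  have := hU.continuous_rad
  have := hU.continuous_axl
  have := hU.continuous_vort
  have hcR := (contDiff_dR hχ).continuous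
  have hcZ := (contDiff_dZ hχ).continuous
  refine integrable_slab (by fun_prop) hχc.isCompact (fun τ q hq => ?_) t
  simp [dR_eq_zero hq, dZ_eq_zero hq]

end IsRegularFlow

end WeakVorticityEquation

/-! ### Mollified vorticity and its transport equation with a commutator. -/

section Mollification

/-- The convolution of `f` with the kernel `g` on the plane. -/
def mollify (g f : ℝ × ℝ → ℝ) (x : ℝ × ℝ) : ℝ := ∫ w, f (x - w) * g w

theorem mollify_eq_convolution (g f : ℝ × ℝ → ℝ) :
    mollify g f = MeasureTheory.convolution f g (ContinuousLinearMap.mul ℝ ℝ) volume := by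
  ext x
  rw [convolution_eq_swap]
  rfl

theorem hasFDerivAt_mollify {g f : ℝ × ℝ → ℝ} (hg : ContDiff ℝ 1 g) (hgc : HasCompactSupport g)
    (hf : Continuous f) (x : ℝ × ℝ) :
    ∃ A : ℝ × ℝ →L[ℝ] ℝ, HasFDerivAt (mollify g f) A x ∧
      ∀ h, A h = mollify (fun q => fderiv ℝ g q h) f x := by
  have h1 := hgc.hasFDerivAt_convolution_right (ContinuousLinearMap.mul ℝ ℝ) (μ := volume)
    hf.locallyIntegrable hg x
  rw [mollify_eq_convolution]
  refine ⟨_, h1, fun h => ?_⟩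
  rw [convolution_precompR_apply _ hf.locallyIntegrable (hgc.fderiv ℝ)
    (hg.continuous_fderiv (by norm_num)), mollify_eq_convolution]

theorem contDiff_mollify {g f : ℝ × ℝ → ℝ} (hg : ContDiff ℝ 1 g) (hgc : HasCompactSupport g)
    (hf : Continuous f) : ContDiff ℝ 1 (mollify g f) := by
  rw [mollify_eq_convolution]
  exact hgc.contDiff_convolution_right _ hf.locallyIntegrable hg

theorem dR_mollify {g f : ℝ × ℝ → ℝ} (hg : ContDiff ℝ 1 g) (hgc : HasCompactSupport g)
    (hf : Continuous f) (x : ℝ × ℝ) : dR (mollify g f) x = mollify (dR g) f x := by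
  obtain ⟨A, hA, hA'⟩ := hasFDerivAt_mollify hg hgc hf x
  rw [dR, hA.fderiv, hA']
  rfl

theorem dZ_mollify {g f : ℝ × ℝ → ℝ} (hg : ContDiff ℝ 1 g) (hgc : HasCompactSupport g)
    (hf : Continuous f) (x : ℝ × ℝ) : dZ (mollify g f) x = mollify (dZ g) f x := by
  obtain ⟨A, hA, hA'⟩ := hasFDerivAt_mollify hg hgc hf x
  rw [dZ, hA.fderiv, hA']
  rfl

theorem continuous_mollify_param {g : ℝ × ℝ → ℝ} (hg : Continuous g) (hgc : HasCompactSupport g)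
    {f : ℝ → ℝ × ℝ → ℝ} (hf : Continuous fun p : ℝ × (ℝ × ℝ) => f p.1 p.2) :
    Continuous fun p : ℝ × (ℝ × ℝ) => mollify g (f p.1) p.2 := by
  have h1 : ∀ p : ℝ × (ℝ × ℝ), mollify g (f p.1) p.2 =
      ∫ w in tsupport g, f p.1 (p.2 - w) * g w := fun p => by
    rw [setIntegral_eq_integral_of_forall_compl_eq_zero]
    · rfl
    · intro w hw
      rw [image_eq_zero_of_notMem_tsupport hw, mul_zero]
  simp_rw [h1]
  refine continuous_parametric_integral_of_continuous
    (f := fun (p : ℝ × (ℝ × ℝ)) w => f p.1 (p.2 - w) * g w) ?_ hgc.isCompact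
  have h2 : Continuous fun p : (ℝ × (ℝ × ℝ)) × (ℝ × ℝ) => f p.1.1 (p.1.2 - p.2) :=
    hf.comp ((continuous_fst.comp continuous_fst).prodMk
      ((continuous_snd.comp continuous_fst).sub continuous_snd))
  exact h2.mul (hg.comp continuous_snd)

theorem integral_mul_comp_sub_left (g f : ℝ × ℝ → ℝ) (x : ℝ × ℝ) :
    ∫ y, g (x - y) * f y = mollify g f x := by
  rw [mollify, ← integral_sub_left_eq_self _ volume x]
  simp [mul_comm]

theorem dR_comp_sub_left {g : ℝ × ℝ → ℝ} (hg : ContDiff ℝ 1 g) (x y : ℝ × ℝ) :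
    dR (fun y => g (x - y)) y = -dR g (x - y) := by
  have h1 : HasFDerivAt (fun y : ℝ × ℝ => x - y) (-ContinuousLinearMap.id ℝ (ℝ × ℝ)) y :=
    (hasFDerivAt_id y).const_sub x
  have h2 := (hg.differentiable (by norm_num) (x - y)).hasFDerivAt.comp y h1
  have h3 : HasFDerivAt (fun y => g (x - y)) _ y := h2
  rw [dR, h3.fderiv]
  simp [dR, -Prod.neg_mk]

theorem dZ_comp_sub_left {g : ℝ × ℝ → ℝ} (hg : ContDiff ℝ 1 g) (x y : ℝ × ℝ) :
    dZ (fun y => g (x - y)) y = -dZ g (x - y) := by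
  have h1 : HasFDerivAt (fun y : ℝ × ℝ => x - y) (-ContinuousLinearMap.id ℝ (ℝ × ℝ)) y :=
    (hasFDerivAt_id y).const_sub x
  have h2 := (hg.differentiable (by norm_num) (x - y)).hasFDerivAt.comp y h1
  have h3 : HasFDerivAt (fun y => g (x - y)) _ y := h2
  rw [dZ, h3.fderiv]
  simp [dZ, -Prod.neg_mk]

variable {d : ℕ} [NeZero d]

/-- The failure of mollification with kernel `g` to commute with transport by `v`. -/
def transportDefect (v : RSpace d → RSpace d) (g : ℝ × ℝ → ℝ) (x : ℝ × ℝ) : ℝ :=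
  rad v x * mollify (dR g) (vort v) x + axl v x * mollify (dZ g) (vort v) x -
    (mollify (dR g) (fun y => vort v y * rad v y) x +
      mollify (dZ g) (fun y => vort v y * axl v y) x)

namespace IsRegularFlow

variable {t₁ : ℝ} {U : ℝ → RSpace d → RSpace d}

theorem continuous_transportDefect (hU : IsRegularFlow t₁ U) {g : ℝ × ℝ → ℝ} (hg : ContDiff ℝ 1 g)
    (hgc : HasCompactSupport g) :
    Continuous fun p : ℝ × (ℝ × ℝ) => transportDefect (U p.1) g p.2 := by
  have h1 := hU.continuous_rad
  have h2 := hU.continuous_axl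
  have h3 := hU.continuous_vort
  have hR := continuous_dR hg
  have hZ := continuous_dZ hg
  have hRc := hasCompactSupport_dR hgc
  have hZc := hasCompactSupport_dZ hgc
  exact ((h1.mul (continuous_mollify_param hR hRc (f := fun τ => vort (U τ)) h3)).add
    (h2.mul (continuous_mollify_param hZ hZc (f := fun τ => vort (U τ)) h3))).sub
    ((continuous_mollify_param hR hRc (f := fun τ y => vort (U τ) y * rad (U τ) y) (h3.mul h1)).add
    (continuous_mollify_param hZ hZc (f := fun τ y => vort (U τ) y * axl (U τ) y) (h3.mul h2)))

/-- The weak equation is tested with y ↦ g(x - y). The point x must keep a distance larger than ε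
from the axis for this test function to be supported in r > 0. -/
theorem mollify_vort_sub (hd : 2 ≤ d) (hU : IsRegularFlow t₁ U) {g : ℝ × ℝ → ℝ}
    (hg : ContDiff ℝ 2 g) (hgc : HasCompactSupport g) {ε : ℝ}
    (hgs : tsupport g ⊆ Metric.closedBall 0 ε) {x : ℝ × ℝ} (hx : ε < x.1) {t : ℝ}
    (ht : t ∈ Icc 0 t₁) :
    mollify g (vort (U t)) x - mollify g (vort (U 0)) x =
      ∫ τ in 0..t, (transportDefect (U τ) g x - (rad (U τ) x * dR (mollify g (vort (U τ))) x +
        axl (U τ) x * dZ (mollify g (vort (U τ))) x)) := by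
  have hg1 : ContDiff ℝ 1 g := hg.of_le (by norm_num)
  have hs : ContDiff ℝ 2 fun y => g (x - y) := hg.comp (contDiff_const.sub contDiff_id)
  have hsc : HasCompactSupport fun y => g (x - y) :=
    hgc.comp_homeomorph (Homeomorph.subLeft x)
  have hss : tsupport (fun y => g (x - y)) ⊆ {q | 0 < q.1} := by
    intro y hy
    have h1 : x - y ∈ tsupport g := by
      have := tsupport_comp_subset_preimage g (f := fun y => x - y) (by fun_prop) hy
      exact this
    have h2 := hgs h1
    rw [mem_closedBall_zero_iff] at h2
    have h3 : |(x - y).1| ≤ ε := (norm_fst_le (x - y)).trans h2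
    have h4 := (abs_le.1 h3).2
    simp only [Prod.fst_sub] at h4
    change 0 < y.1
    linarith
  have h1 := hU.integral_vort_sub hd hs hsc hss ht
  rw [integral_mul_comp_sub_left, integral_mul_comp_sub_left] at h1
  rw [h1]
  refine intervalIntegral.integral_congr fun τ _ => ?_
  have hv := hU.contDiff τ
  have hw := _root_.continuous_vort hv
  have ha := (contDiff_rad hv).continuous
  have hb := (contDiff_axl hv).continuous
  have e : ∀ q, vort (U τ) q * (rad (U τ) q * dR (fun y => g (x - y)) q +
      axl (U τ) q * dZ (fun y => g (x - y)) q) =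
      -(dR g (x - q) * (vort (U τ) q * rad (U τ) q)) -
        dZ g (x - q) * (vort (U τ) q * axl (U τ) q) := fun q => by
    rw [dR_comp_sub_left hg1, dZ_comp_sub_left hg1]; ring
  simp_rw [e]
  have hcs : ∀ {k : ℝ × ℝ → ℝ}, HasCompactSupport k → HasCompactSupport fun y => k (x - y) :=
    fun hk => hk.comp_homeomorph (Homeomorph.subLeft x)
  have cR := continuous_dR hg1
  have cZ := continuous_dZ hg1
  rw [integral_sub, integral_neg, integral_mul_comp_sub_left (dR g) (fun y => vort (U τ) y *
    rad (U τ) y), integral_mul_comp_sub_left (dZ g) (fun y => vort (U τ) y * axl (U τ) y),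
    dR_mollify hg1 hgc hw, dZ_mollify hg1 hgc hw]
  · unfold transportDefect; ring
  · have : Continuous fun q => -(dR g (x - q) * (vort (U τ) q * rad (U τ) q)) := by fun_prop
    refine this.integrable_of_hasCompactSupport ?_
    exact ((hcs (hasCompactSupport_dR hgc)).mul_right).neg
  · have : Continuous fun q => dZ g (x - q) * (vort (U τ) q * axl (U τ) q) := by fun_prop
    exact this.integrable_of_hasCompactSupport (hcs (hasCompactSupport_dZ hgc)).mul_right

/-- At each point the mollified vorticity is a C^1 function of time and of space, so the chain rule
applies to β of it. Integrating the transport term by parts leaves the plane divergence of the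
velocity and the commutator. -/
theorem integral_comp_mollify_sub (hd : 2 ≤ d) (hU : IsRegularFlow t₁ U) {g : ℝ × ℝ → ℝ}
    (hg : ContDiff ℝ 2 g) (hgc : HasCompactSupport g) {ε : ℝ}
    (hgs : tsupport g ⊆ Metric.closedBall 0 ε) {χ : ℝ × ℝ → ℝ} (hχ : ContDiff ℝ 1 χ)
    (hχc : HasCompactSupport χ) (hχs : ∀ q ∈ tsupport χ, ε < q.1) {β β' : ℝ → ℝ}
    (hβ : ∀ s, HasDerivAt β (β' s) s) (hβ' : Continuous β') {t : ℝ} (ht : t ∈ Icc 0 t₁) :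
    (∫ q, χ q * β (mollify g (vort (U t)) q)) - ∫ q, χ q * β (mollify g (vort (U 0)) q) =
      ∫ p, (χ p.2 * β' (mollify g (vort (U p.1)) p.2) * transportDefect (U p.1) g p.2 +
        β (mollify g (vort (U p.1)) p.2) * (rad (U p.1) p.2 * dR χ p.2 +
          axl (U p.1) p.2 * dZ χ p.2 + χ p.2 * (dR (rad (U p.1)) p.2 + dZ (axl (U p.1)) p.2)))
        ∂slab t := by
  have hg1 : ContDiff ℝ 1 g := hg.of_le (by norm_num)
  have hβc : Continuous β := continuous_iff_continuousAt.2 fun s => (hβ s).continuousAt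
  have hβd : ContDiff ℝ 1 β := by
    refine contDiff_one_iff_deriv.2 ⟨fun s => (hβ s).differentiableAt, ?_⟩
    rw [show deriv β = β' from funext fun s => (hβ s).deriv]
    exact hβ'
  have c0 := hU.continuous_rad
  have c1 := hU.continuous_axl
  have c2 := hU.continuous_vort
  have c3 := continuous_mollify_param hg.continuous hgc (f := fun τ => vort (U τ)) c2
  have c4 := hU.continuous_transportDefect hg1 hgc
  have c5 := continuous_mollify_param (continuous_dR hg1) (hasCompactSupport_dR hgc) (f := fun τ => vort (U τ)) c2
  have c6 := continuous_mollify_param (continuous_dZ hg1) (hasCompactSupport_dZ hgc) (f := fun τ => vort (U τ)) c2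
  have c7 := hU.continuous_fderiv_rad (1, 0)
  have c8 := hU.continuous_fderiv_axl (0, 1)
  have c9 := hχ.continuous
  have c10 := continuous_dR hχ
  have c11 := continuous_dZ hχ
  set m : ℝ → ℝ × ℝ → ℝ := fun τ => mollify g (vort (U τ)) with hm
  have hmC : ∀ τ, ContDiff ℝ 1 (m τ) := fun τ =>
    contDiff_mollify hg1 hgc (_root_.continuous_vort (hU.contDiff τ))
  have dRm : ∀ τ x, dR (m τ) x = mollify (dR g) (vort (U τ)) x := fun τ x =>
    dR_mollify hg1 hgc (_root_.continuous_vort (hU.contDiff τ)) x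
  have dZm : ∀ τ x, dZ (m τ) x = mollify (dZ g) (vort (U τ)) x := fun τ x =>
    dZ_mollify hg1 hgc (_root_.continuous_vort (hU.contDiff τ)) x
  set e : ℝ → ℝ × ℝ → ℝ := fun τ x => transportDefect (U τ) g x -
    (rad (U τ) x * dR (m τ) x + axl (U τ) x * dZ (m τ) x) with he
  have ce : Continuous fun p : ℝ × (ℝ × ℝ) => e p.1 p.2 := by
    simp only [he, dRm, dZm]
    exact c4.sub ((c0.mul c5).add (c1.mul c6))
  -- The chain rule in time at a fixed point, with the mollified vorticity written as the primitive
  -- of the continuous function `e`.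
  have hft : ∀ x ∈ tsupport χ, β (m t x) - β (m 0 x) =
      ∫ τ in 0..t, β' (m τ x) * e τ x := by
    intro x hx
    have cx : Continuous fun τ => e τ x := ce.comp (continuous_id.prodMk continuous_const)
    have hM : ∀ τ ∈ Icc 0 t, m τ x = m 0 x + ∫ σ in 0..τ, e σ x := fun τ hτ => by
      have := hU.mollify_vort_sub hd hg hgc hgs (hχs x hx) (t := τ) ⟨hτ.1, hτ.2.trans ht.2⟩
      have : m τ x - m 0 x = ∫ σ in 0..τ, e σ x := this
      linarith
    have hMd : ∀ τ, HasDerivAt (fun τ => β (m 0 x + ∫ σ in 0..τ, e σ x))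
        (β' (m 0 x + ∫ σ in 0..τ, e σ x) * e τ x) τ := fun τ =>
      (hβ _).comp τ ((cx.integral_hasStrictDerivAt 0 τ).hasDerivAt.const_add _)
    have cM : Continuous fun τ => m 0 x + ∫ σ in 0..τ, e σ x :=
      continuous_const.add (intervalIntegral.continuous_primitive
        (fun _ _ => cx.intervalIntegrable _ _) 0)
    have := intervalIntegral.integral_eq_sub_of_hasDerivAt (a := 0) (b := t)
      (fun τ _ => hMd τ) (((hβ'.comp cM).mul cx).intervalIntegrable _ _)
    rw [← hM t ⟨ht.1, le_rfl⟩, intervalIntegral.integral_same, add_zero] at this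
    rw [← this]
    refine intervalIntegral.integral_congr fun τ hτ => ?_
    rw [uIcc_of_le ht.1] at hτ
    rw [hM τ hτ]
  have i1 : Integrable (fun p : ℝ × (ℝ × ℝ) => χ p.2 * (β' (m p.1 p.2) * e p.1 p.2)) (slab t) := by
    refine integrable_slab (K := tsupport χ) (by fun_prop) hχc.isCompact (fun τ q hq => ?_) t
    simp [image_eq_zero_of_notMem_tsupport hq]
  have hI : ∀ τ, Integrable fun q => χ q * β (m τ q) := fun τ =>
    (c9.mul (hβc.comp (hmC τ).continuous)).integrable_of_hasCompactSupport hχc.mul_right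
  have s1 : (∫ q, χ q * β (m t q)) - ∫ q, χ q * β (m 0 q) =
      ∫ p, χ p.2 * (β' (m p.1 p.2) * e p.1 p.2) ∂slab t := by
    rw [← integral_sub (hI t) (hI 0), integral_slab ht.1 i1, intervalIntegral.integral_of_le ht.1,
      integral_integral_swap (f := fun τ q => χ q * (β' (m τ q) * e τ q)) i1]
    refine integral_congr_ae (Filter.Eventually.of_forall fun q => ?_)
    beta_reduce
    rw [integral_const_mul, ← intervalIntegral.integral_of_le ht.1, ← mul_sub]
    by_cases hq : q ∈ tsupport χ
    · rw [hft q hq]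
    · rw [image_eq_zero_of_notMem_tsupport hq, zero_mul, zero_mul]
  have i2 : Integrable (fun p : ℝ × (ℝ × ℝ) => χ p.2 * β' (m p.1 p.2) * transportDefect (U p.1) g p.2 +
        β (m p.1 p.2) * (rad (U p.1) p.2 * dR χ p.2 +
          axl (U p.1) p.2 * dZ χ p.2 + χ p.2 * (dR (rad (U p.1)) p.2 + dZ (axl (U p.1)) p.2)))
        (slab t) := by
    refine integrable_slab (K := tsupport χ) (by unfold dR dZ at *; fun_prop) hχc.isCompact
      (fun τ q hq => ?_) t
    simp [image_eq_zero_of_notMem_tsupport hq, dR_eq_zero hq, dZ_eq_zero hq]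
  rw [s1, integral_slab ht.1 i1, integral_slab ht.1 i2]
  refine intervalIntegral.integral_congr fun τ _ => ?_
  have hA := contDiff_rad (hU.contDiff τ)
  have hB := contDiff_axl (hU.contDiff τ)
  have hG : ContDiff ℝ 1 (fun q => β (m τ q)) := hβd.comp (hmC τ)
  have hGR : ∀ q h, fderiv ℝ (fun q => β (m τ q)) q h = β' (m τ q) * fderiv ℝ (m τ) q h :=
    fun q h => by
      have := (hβ (m τ q)).comp_hasFDerivAt q ((hmC τ).differentiable (by norm_num) q).hasFDerivAt
      have h2 : HasFDerivAt (fun q => β (m τ q)) _ q := this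
      rw [h2.fderiv]; simp
  have hpr : ∀ {k : ℝ × ℝ → ℝ}, ContDiff ℝ 1 k → ∀ q h, fderiv ℝ (fun q => χ q * k q) q h =
      fderiv ℝ χ q h * k q + χ q * fderiv ℝ k q h := fun hk q h => by
    have := ((hχ.differentiable (by norm_num) q).hasFDerivAt.mul
      (hk.differentiable (by norm_num) q).hasFDerivAt)
    have h2 : HasFDerivAt (fun q => χ q * _) _ q := this
    rw [h2.fderiv]; simp; ring
  -- The derivatives leave β(m) and fall on the cutoff times the velocity, which is C^1.
  have j1 := integral_mul_dR (f := fun q => χ q * rad (U τ) q) (hχ.mul hA) hG hχc.mul_right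
  have j2 := integral_mul_dZ (f := fun q => χ q * axl (U τ) q) (hχ.mul hB) hG hχc.mul_right
  have cm : Continuous (m τ) := (hmC τ).continuous
  have hdRm := continuous_dR (hmC τ)
  have hdZm := continuous_dZ (hmC τ)
  have ca := hA.continuous
  have cb := hB.continuous
  have cda := continuous_dR hA
  have cdb := continuous_dZ hB
  have cc : Continuous fun q => transportDefect (U τ) g q :=
    c4.comp (continuous_const.prodMk continuous_id)
  have k1 : Integrable fun q => χ q * β' (m τ q) * transportDefect (U τ) g q :=
    Continuous.integrable_of_hasCompactSupport (by fun_prop) (hχc.mul_right.mul_right)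
  have k2 : Integrable fun q => χ q * rad (U τ) q * (β' (m τ q) * dR (m τ) q) :=
    Continuous.integrable_of_hasCompactSupport (by fun_prop) (hχc.mul_right.mul_right)
  have k3 : Integrable fun q => χ q * axl (U τ) q * (β' (m τ q) * dZ (m τ) q) :=
    Continuous.integrable_of_hasCompactSupport (by fun_prop) (hχc.mul_right.mul_right)
  have k4 : Integrable fun q => (dR χ q * rad (U τ) q + χ q * dR (rad (U τ)) q) * β (m τ q) :=
    Continuous.integrable_of_hasCompactSupport (by fun_prop)
      (((hasCompactSupport_dR hχc).mul_right.add hχc.mul_right).mul_right)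
  have k5 : Integrable fun q => (dZ χ q * axl (U τ) q + χ q * dZ (axl (U τ)) q) * β (m τ q) :=
    Continuous.integrable_of_hasCompactSupport (by fun_prop)
      (((hasCompactSupport_dZ hχc).mul_right.add hχc.mul_right).mul_right)
  have j1' : ∫ q, χ q * rad (U τ) q * (β' (m τ q) * dR (m τ) q) =
      -∫ q, (dR χ q * rad (U τ) q + χ q * dR (rad (U τ)) q) * β (m τ q) := by
    simpa only [dR, hGR, hpr hA] using j1
  have j2' : ∫ q, χ q * axl (U τ) q * (β' (m τ q) * dZ (m τ) q) =
      -∫ q, (dZ χ q * axl (U τ) q + χ q * dZ (axl (U τ)) q) * β (m τ q) := by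
    simpa only [dZ, hGR, hpr hB] using j2
  have k12 : Integrable fun q => χ q * β' (m τ q) * transportDefect (U τ) g q -
      χ q * rad (U τ) q * (β' (m τ q) * dR (m τ) q) := k1.sub k2
  have k14 : Integrable fun q => χ q * β' (m τ q) * transportDefect (U τ) g q +
      (dR χ q * rad (U τ) q + χ q * dR (rad (U τ)) q) * β (m τ q) := k1.add k4
  calc ∫ q, χ q * (β' (m τ q) * e τ q)
      = ∫ q, (χ q * β' (m τ q) * transportDefect (U τ) g q -
          χ q * rad (U τ) q * (β' (m τ q) * dR (m τ) q) -
          χ q * axl (U τ) q * (β' (m τ q) * dZ (m τ) q)) := by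
        refine integral_congr_ae (Filter.Eventually.of_forall fun q => ?_)
        simp only [he]; ring
    _ = (∫ q, χ q * β' (m τ q) * transportDefect (U τ) g q) +
          (∫ q, (dR χ q * rad (U τ) q + χ q * dR (rad (U τ)) q) * β (m τ q)) +
          ∫ q, (dZ χ q * axl (U τ) q + χ q * dZ (axl (U τ)) q) * β (m τ q) := by
        rw [integral_sub k12 k3, integral_sub k1 k2, j1', j2']; ring
    _ = _ := by
        rw [← integral_add k1 k4, ← integral_add k14 k5]
        refine integral_congr_ae (Filter.Eventually.of_forall fun q => ?_)
        beta_reduce; ring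

end IsRegularFlow

end Mollification

/-! ### Vanishing mollification: renormalised solutions and the commutator limit. -/

section Renormalization

open Filter Topology

/-- The rescaled kernel `N^2 ρ(N w)` on the plane. -/
def scaleKernel (N : ℝ) (ρ : ℝ × ℝ → ℝ) (w : ℝ × ℝ) : ℝ := N ^ 2 * ρ (N • w)

theorem integral_comp_scale {N : ℝ} (hN : 0 < N) (F : ℝ × ℝ → ℝ) :
    ∫ w, N ^ 2 * F (N • w) = ∫ w, F w := by
  rw [integral_const_mul, Measure.integral_comp_smul]
  have : Module.finrank ℝ (ℝ × ℝ) = 2 := by simp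
  rw [this, abs_of_pos (by positivity), smul_eq_mul, mul_inv_cancel_left₀ (by positivity)]

theorem mollify_scaleKernel {N : ℝ} (hN : 0 < N) (ρ f : ℝ × ℝ → ℝ) (x : ℝ × ℝ) :
    mollify (scaleKernel N ρ) f x = ∫ w, f (x - N⁻¹ • w) * ρ w := by
  rw [← integral_comp_scale hN, mollify]
  refine integral_congr_ae (Eventually.of_forall fun w => ?_)
  beta_reduce
  rw [smul_smul, inv_mul_cancel₀ hN.ne', one_smul, scaleKernel]
  ring

theorem contDiff_scaleKernel {n : WithTop ℕ∞} {ρ : ℝ × ℝ → ℝ} (hρ : ContDiff ℝ n ρ) (N : ℝ) :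
    ContDiff ℝ n (scaleKernel N ρ) :=
  contDiff_const.mul (hρ.comp (contDiff_const_smul N))

theorem hasCompactSupport_scaleKernel {ρ : ℝ × ℝ → ℝ} (hρ : HasCompactSupport ρ) {N : ℝ}
    (hN : 0 < N) : HasCompactSupport (scaleKernel N ρ) :=
  (hρ.comp_homeomorph (Homeomorph.smulOfNeZero N hN.ne')).mul_left

theorem tsupport_scaleKernel_subset {ρ : ℝ × ℝ → ℝ} {R : ℝ}
    (hρ : tsupport ρ ⊆ Metric.closedBall 0 R) {N : ℝ} (hN : 0 < N) :
    tsupport (scaleKernel N ρ) ⊆ Metric.closedBall 0 (R / N) := by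
  refine closure_minimal (fun w hw => ?_) Metric.isClosed_closedBall
  have h1 : ρ (N • w) ≠ 0 := fun h => hw (by simp [scaleKernel, h])
  have h2 := hρ (subset_tsupport _ h1)
  rw [mem_closedBall_zero_iff, norm_smul, Real.norm_of_nonneg hN.le] at h2
  rw [mem_closedBall_zero_iff, le_div_iff₀ hN]
  linarith

theorem fderiv_scaleKernel {ρ : ℝ × ℝ → ℝ} (hρ : ContDiff ℝ 1 ρ) (N : ℝ) (w h : ℝ × ℝ) :
    fderiv ℝ (scaleKernel N ρ) w h = N * (N ^ 2 * fderiv ℝ ρ (N • w) h) := by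
  have h1 : HasFDerivAt (fun w : ℝ × ℝ => N • w) (N • ContinuousLinearMap.id ℝ (ℝ × ℝ)) w :=
    (hasFDerivAt_id w).const_smul N
  have h2 : HasFDerivAt (fun w => ρ (N • w)) _ w :=
    (hρ.differentiable (by norm_num) (N • w)).hasFDerivAt.comp w h1
  have h3 : HasFDerivAt (scaleKernel N ρ) _ w := h2.const_mul (N ^ 2)
  rw [h3.fderiv]
  simp
  ring

theorem dR_scaleKernel {ρ : ℝ × ℝ → ℝ} (hρ : ContDiff ℝ 1 ρ) (N : ℝ) :
    dR (scaleKernel N ρ) = fun w => N * scaleKernel N (dR ρ) w :=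
  funext fun w => fderiv_scaleKernel hρ N w _

theorem dZ_scaleKernel {ρ : ℝ × ℝ → ℝ} (hρ : ContDiff ℝ 1 ρ) (N : ℝ) :
    dZ (scaleKernel N ρ) = fun w => N * scaleKernel N (dZ ρ) w :=
  funext fun w => fderiv_scaleKernel hρ N w _

theorem mollify_const_mul (c : ℝ) (g f : ℝ × ℝ → ℝ) (x : ℝ × ℝ) :
    mollify (fun w => c * g w) f x = c * mollify g f x := by
  rw [mollify, mollify, ← integral_const_mul]
  refine integral_congr_ae (Eventually.of_forall fun w => ?_)
  beta_reduce
  ring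

theorem tendsto_inv_natCast_succ : Tendsto (fun n : ℕ => ((n : ℝ) + 1)⁻¹) atTop (𝓝 0) :=
  tendsto_inv_atTop_zero.comp (tendsto_natCast_atTop_atTop.atTop_add tendsto_const_nhds)

theorem tendsto_sub_inv_smul (x w : ℝ × ℝ) :
    Tendsto (fun n : ℕ => x - ((n : ℝ) + 1)⁻¹ • w) atTop (𝓝 x) := by
  have h : Tendsto (fun n : ℕ => x - ((n : ℝ) + 1)⁻¹ • w) atTop (𝓝 (x - (0 : ℝ) • w)) :=
    tendsto_const_nhds.sub (tendsto_inv_natCast_succ.smul_const w)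
  rwa [zero_smul, sub_zero] at h

theorem abs_mollify_scaleKernel_le {f : ℝ × ℝ → ℝ} {B : ℝ} (hB : ∀ q, |f q| ≤ B)
    {ρ : ℝ × ℝ → ℝ} (hρ : Integrable ρ) {N : ℝ} (hN : 0 < N) (x : ℝ × ℝ) :
    |mollify (scaleKernel N ρ) f x| ≤ ∫ w, B * |ρ w| := by
  rw [mollify_scaleKernel hN, ← Real.norm_eq_abs]
  refine norm_integral_le_of_norm_le (hρ.abs.const_mul B) (Eventually.of_forall fun w => ?_)
  rw [Real.norm_eq_abs, abs_mul]
  exact mul_le_mul_of_nonneg_right (hB _) (abs_nonneg _)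

theorem tendsto_mollify_scaleKernel {f : ℝ × ℝ → ℝ} (hf : Continuous f) {B : ℝ}
    (hB : ∀ q, |f q| ≤ B) {ρ : ℝ × ℝ → ℝ} (hρc : Continuous ρ) (hρ : Integrable ρ) (x : ℝ × ℝ) :
    Tendsto (fun n : ℕ => mollify (scaleKernel ((n : ℝ) + 1) ρ) f x) atTop
      (𝓝 (f x * ∫ w, ρ w)) := by
  rw [← integral_const_mul]
  simp_rw [fun n : ℕ => mollify_scaleKernel (show (0 : ℝ) < n + 1 by positivity) ρ f x]
  refine tendsto_integral_of_dominated_convergence (fun w => B * |ρ w|) (fun n => ?_)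
    (hρ.abs.const_mul B) (fun n => Eventually.of_forall fun w => ?_)
    (Eventually.of_forall fun w => ?_)
  · exact Continuous.aestronglyMeasurable (by fun_prop)
  · rw [Real.norm_eq_abs, abs_mul]
    exact mul_le_mul_of_nonneg_right (hB _) (abs_nonneg _)
  · exact ((hf.tendsto x).comp (tendsto_sub_inv_smul x w)).mul_const _

variable {d : ℕ} [NeZero d] {v : RSpace d → RSpace d}

/-- The factor N from differentiating the kernel combines with a velocity difference over distance
of order 1/N. This difference quotient keeps the commutator bounded for a C^1 velocity. -/
theorem transportDefect_scaleKernel (hv : ContDiff ℝ 1 v) {ρ : ℝ × ℝ → ℝ} (hρ : ContDiff ℝ 1 ρ)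
    (hρc : HasCompactSupport ρ) {N : ℝ} (hN : 0 < N) (x : ℝ × ℝ) :
    transportDefect v (scaleKernel N ρ) x = ∫ w, vort v (x - N⁻¹ • w) *
      (N * (rad v x - rad v (x - N⁻¹ • w)) * dR ρ w +
        N * (axl v x - axl v (x - N⁻¹ • w)) * dZ ρ w) := by
  have cw := continuous_vort hv
  have ca := (contDiff_rad hv).continuous
  have cb := (contDiff_axl hv).continuous
  have cR := continuous_dR hρ
  have cZ := continuous_dZ hρ
  have hR := hasCompactSupport_dR hρc
  have hZ := hasCompactSupport_dZ hρc
  have i1 : Integrable fun w => vort v (x - N⁻¹ • w) * dR ρ w :=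
    Continuous.integrable_of_hasCompactSupport (by fun_prop) hR.mul_left
  have i2 : Integrable fun w => vort v (x - N⁻¹ • w) * dZ ρ w :=
    Continuous.integrable_of_hasCompactSupport (by fun_prop) hZ.mul_left
  have i3 : Integrable fun w => vort v (x - N⁻¹ • w) * rad v (x - N⁻¹ • w) * dR ρ w :=
    Continuous.integrable_of_hasCompactSupport (by fun_prop) hR.mul_left
  have i4 : Integrable fun w => vort v (x - N⁻¹ • w) * axl v (x - N⁻¹ • w) * dZ ρ w :=
    Continuous.integrable_of_hasCompactSupport (by fun_prop) hZ.mul_left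
  rw [transportDefect, dR_scaleKernel hρ, dZ_scaleKernel hρ]
  simp_rw [mollify_const_mul, mollify_scaleKernel hN]
  have e1 : Integrable fun w => rad v x * N * (vort v (x - N⁻¹ • w) * dR ρ w) +
      axl v x * N * (vort v (x - N⁻¹ • w) * dZ ρ w) := (i1.const_mul _).add (i2.const_mul _)
  have e2 : Integrable fun w => N * (vort v (x - N⁻¹ • w) * rad v (x - N⁻¹ • w) * dR ρ w) +
      N * (vort v (x - N⁻¹ • w) * axl v (x - N⁻¹ • w) * dZ ρ w) :=
    (i3.const_mul _).add (i4.const_mul _)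
  rw [← mul_assoc, ← mul_assoc, ← integral_const_mul, ← integral_const_mul, ← integral_const_mul,
    ← integral_const_mul, ← integral_add (i1.const_mul _) (i2.const_mul _),
    ← integral_add (i3.const_mul _) (i4.const_mul _), ← integral_sub e1 e2]
  refine integral_congr_ae (Eventually.of_forall fun w => ?_)
  beta_reduce
  ring

/-- Uniform bounds for the components, their first derivatives and the vorticity of `v`. -/
structure MeridianBound (v : RSpace d → RSpace d) (B : ℝ) : Prop where
  rad_le : ∀ q, |rad v q| ≤ B
  axl_le : ∀ q, |axl v q| ≤ B
  vort_le : ∀ q, |vort v q| ≤ B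
  fderiv_rad_le : ∀ q, ‖fderiv ℝ (rad v) q‖ ≤ B
  fderiv_axl_le : ∀ q, ‖fderiv ℝ (axl v) q‖ ≤ B

theorem abs_scaled_sub_le {f : ℝ × ℝ → ℝ} (hf : ContDiff ℝ 1 f) {B : ℝ}
    (hB : ∀ q, ‖fderiv ℝ f q‖ ≤ B) {N : ℝ} (hN : 0 < N) (x w : ℝ × ℝ) :
    |N * (f x - f (x - N⁻¹ • w))| ≤ B * ‖w‖ := by
  have h := Convex.norm_image_sub_le_of_norm_fderiv_le (𝕜 := ℝ) (f := f) (s := univ)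
    (fun q _ => hf.differentiable (by norm_num) q) (fun q _ => hB q) convex_univ
    (mem_univ (x - N⁻¹ • w)) (mem_univ x)
  rw [sub_sub_cancel, norm_smul, norm_inv, Real.norm_of_nonneg hN.le] at h
  rw [abs_mul, abs_of_pos hN]
  calc N * |f x - f (x - N⁻¹ • w)| ≤ N * (B * (N⁻¹ * ‖w‖)) :=
        mul_le_mul_of_nonneg_left h hN.le
    _ = B * ‖w‖ := by field_simp

theorem tendsto_scaled_sub {f : ℝ × ℝ → ℝ} (hf : ContDiff ℝ 1 f) (x w : ℝ × ℝ) :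
    Tendsto (fun n : ℕ => ((n : ℝ) + 1) * (f x - f (x - ((n : ℝ) + 1)⁻¹ • w))) atTop
      (𝓝 (w.1 * dR f x + w.2 * dZ f x)) := by
  have h := (hf.differentiable (by norm_num) x).hasFDerivAt.lim w (l := atTop)
    (c := fun n : ℕ => -((n : ℝ) + 1)) (by
      simp only [norm_neg]
      refine tendsto_norm_atTop_atTop.comp ?_
      exact tendsto_natCast_atTop_atTop.atTop_add tendsto_const_nhds)
  rw [fderiv_eq_dR_dZ] at h
  refine h.congr fun n => ?_
  rw [inv_neg, neg_smul ((n : ℝ) + 1)⁻¹ w, ← sub_eq_add_neg, smul_eq_mul]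
  ring

theorem norm_transportIntegrand_le {B : ℝ} (hv : ContDiff ℝ 1 v) (hB : MeridianBound v B)
    (ρ : ℝ × ℝ → ℝ) {N : ℝ} (hN : 0 < N) (x w : ℝ × ℝ) :
    ‖vort v (x - N⁻¹ • w) * (N * (rad v x - rad v (x - N⁻¹ • w)) * dR ρ w +
        N * (axl v x - axl v (x - N⁻¹ • w)) * dZ ρ w)‖ ≤
      B * (B * ‖w‖ * |dR ρ w| + B * ‖w‖ * |dZ ρ w|) := by
  have h0 : 0 ≤ B := (abs_nonneg _).trans (hB.rad_le 0)
  rw [norm_mul]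
  refine mul_le_mul (hB.vort_le _) ?_ (norm_nonneg _) h0
  refine (norm_add_le _ _).trans (add_le_add ?_ ?_)
  · rw [norm_mul]
    exact mul_le_mul_of_nonneg_right
      (abs_scaled_sub_le (contDiff_rad hv) hB.fderiv_rad_le hN x w) (abs_nonneg _)
  · rw [norm_mul]
    exact mul_le_mul_of_nonneg_right
      (abs_scaled_sub_le (contDiff_axl hv) hB.fderiv_axl_le hN x w) (abs_nonneg _)

theorem integrable_transportBound (B : ℝ) {ρ : ℝ × ℝ → ℝ} (hρ : ContDiff ℝ 1 ρ)
    (hρc : HasCompactSupport ρ) :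
    Integrable fun w => B * (B * ‖w‖ * |dR ρ w| + B * ‖w‖ * |dZ ρ w|) := by
  have cR := continuous_dR hρ
  have cZ := continuous_dZ hρ
  refine Continuous.integrable_of_hasCompactSupport (by fun_prop) (HasCompactSupport.mul_left ?_)
  exact ((hasCompactSupport_dR hρc).abs.mul_left).add ((hasCompactSupport_dZ hρc).abs.mul_left)

theorem abs_transportDefect_le {B : ℝ} (hv : ContDiff ℝ 1 v) (hB : MeridianBound v B)
    {ρ : ℝ × ℝ → ℝ} (hρ : ContDiff ℝ 1 ρ) (hρc : HasCompactSupport ρ) {N : ℝ} (hN : 0 < N)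
    (x : ℝ × ℝ) : |transportDefect v (scaleKernel N ρ) x| ≤
      ∫ w, B * (B * ‖w‖ * |dR ρ w| + B * ‖w‖ * |dZ ρ w|) := by
  rw [transportDefect_scaleKernel hv hρ hρc hN]
  exact norm_integral_le_of_norm_le (integrable_transportBound B hρ hρc)
    (Eventually.of_forall fun w => norm_transportIntegrand_le hv hB ρ hN x w)

theorem integral_moment_dR {ρ : ℝ × ℝ → ℝ} (hρ : ContDiff ℝ 1 ρ) (hρc : HasCompactSupport ρ)
    (a b : ℝ) : ∫ w : ℝ × ℝ, (w.1 * a + w.2 * b) * dR ρ w = -(a * ∫ w, ρ w) := by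
  have hg : ContDiff ℝ 1 fun w : ℝ × ℝ => w.1 * a + w.2 * b := by fun_prop
  have h := integral_mul_dR hρ hg hρc
  have e : ∀ w, dR (fun w : ℝ × ℝ => w.1 * a + w.2 * b) w = a := fun w => by
    have : HasFDerivAt (fun w : ℝ × ℝ => w.1 * a + w.2 * b) _ w :=
      (((ContinuousLinearMap.fst ℝ ℝ ℝ).hasFDerivAt (x := w)).mul_const a).add
        (((ContinuousLinearMap.snd ℝ ℝ ℝ).hasFDerivAt (x := w)).mul_const b)
    rw [dR, this.fderiv]; simp
  simp_rw [e] at h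
  rw [integral_mul_const] at h
  simp_rw [mul_comm _ (dR ρ _)]
  linarith

theorem integral_moment_dZ {ρ : ℝ × ℝ → ℝ} (hρ : ContDiff ℝ 1 ρ) (hρc : HasCompactSupport ρ)
    (a b : ℝ) : ∫ w : ℝ × ℝ, (w.1 * a + w.2 * b) * dZ ρ w = -(b * ∫ w, ρ w) := by
  have hg : ContDiff ℝ 1 fun w : ℝ × ℝ => w.1 * a + w.2 * b := by fun_prop
  have h := integral_mul_dZ hρ hg hρc
  have e : ∀ w, dZ (fun w : ℝ × ℝ => w.1 * a + w.2 * b) w = b := fun w => by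
    have : HasFDerivAt (fun w : ℝ × ℝ => w.1 * a + w.2 * b) _ w :=
      (((ContinuousLinearMap.fst ℝ ℝ ℝ).hasFDerivAt (x := w)).mul_const a).add
        (((ContinuousLinearMap.snd ℝ ℝ ℝ).hasFDerivAt (x := w)).mul_const b)
    rw [dZ, this.fderiv]; simp
  simp_rw [e] at h
  rw [integral_mul_const] at h
  simp_rw [mul_comm _ (dZ ρ _)]
  linarith

/-- The difference quotients converge to the derivative of the velocity, and the first moments of
the derivatives of ρ select its trace. The limit is -ω div v and not zero because the equation is in
conservation form. -/
theorem tendsto_transportDefect {B : ℝ} (hv : ContDiff ℝ 1 v) (hB : MeridianBound v B)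
    {ρ : ℝ × ℝ → ℝ} (hρ : ContDiff ℝ 1 ρ) (hρc : HasCompactSupport ρ) (h1 : ∫ w, ρ w = 1)
    (x : ℝ × ℝ) :
    Tendsto (fun n : ℕ => transportDefect v (scaleKernel ((n : ℝ) + 1) ρ) x) atTop
      (𝓝 (-(vort v x * (dR (rad v) x + dZ (axl v) x)))) := by
  have cw := continuous_vort hv
  have ca := (contDiff_rad hv).continuous
  have cb := (contDiff_axl hv).continuous
  have cR := continuous_dR hρ
  have cZ := continuous_dZ hρ
  have hlim : -(vort v x * (dR (rad v) x + dZ (axl v) x)) =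
      ∫ w, vort v x * ((w.1 * dR (rad v) x + w.2 * dZ (rad v) x) * dR ρ w +
        (w.1 * dR (axl v) x + w.2 * dZ (axl v) x) * dZ ρ w) := by
    rw [integral_const_mul, integral_add, integral_moment_dR hρ hρc, integral_moment_dZ hρ hρc, h1]
    · ring
    · exact Continuous.integrable_of_hasCompactSupport (by fun_prop)
        (hasCompactSupport_dR hρc).mul_left
    · exact Continuous.integrable_of_hasCompactSupport (by fun_prop)
        (hasCompactSupport_dZ hρc).mul_left
  rw [hlim]
  simp_rw [fun n : ℕ =>
    transportDefect_scaleKernel hv hρ hρc (show (0 : ℝ) < n + 1 by positivity) x]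
  refine tendsto_integral_of_dominated_convergence _ (fun n => ?_)
    (integrable_transportBound B hρ hρc)
    (fun n => Eventually.of_forall fun w =>
      norm_transportIntegrand_le hv hB ρ (by positivity) x w)
    (Eventually.of_forall fun w => ?_)
  · exact Continuous.aestronglyMeasurable (by fun_prop)
  · exact ((cw.tendsto x).comp (tendsto_sub_inv_smul x w)).mul
      (((tendsto_scaled_sub (contDiff_rad hv) x w).mul_const _).add
        ((tendsto_scaled_sub (contDiff_axl hv) x w).mul_const _))

namespace IsRegularFlow

variable {t₁ : ℝ} {U : ℝ → RSpace d → RSpace d}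

theorem exists_meridianBound (hU : IsRegularFlow t₁ U) :
    ∃ B, ∀ τ, MeridianBound (U τ) B := by
  obtain ⟨B, hB⟩ := hU.bound
  have hB0 : 0 ≤ B := (norm_nonneg _).trans (hB 0 0).1
  set C := B + B * ‖merMap d‖ + (B * ‖merMap d‖ + B * ‖merMap d‖) with hC
  have hm := norm_nonneg (merMap d)
  have hBm : 0 ≤ B * ‖merMap d‖ := by positivity
  have hv := fun τ => hU.contDiff τ
  have f1 : ∀ τ q, ‖fderiv ℝ (rad (U τ)) q‖ ≤ B * ‖merMap d‖ := fun τ q => by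
    refine ContinuousLinearMap.opNorm_le_bound _ hBm fun p => ?_
    rw [fderiv_rad_apply ((hv τ).differentiable (by norm_num)), mul_assoc]
    refine (PiLp.norm_apply_le _ _).trans ((ContinuousLinearMap.le_opNorm _ _).trans ?_)
    exact mul_le_mul (hB _ _).2 (ContinuousLinearMap.le_opNorm _ _) (norm_nonneg _) hB0
  have f2 : ∀ τ q, ‖fderiv ℝ (axl (U τ)) q‖ ≤ B * ‖merMap d‖ := fun τ q => by
    refine ContinuousLinearMap.opNorm_le_bound _ hBm fun p => ?_
    rw [fderiv_axl_apply ((hv τ).differentiable (by norm_num)), mul_assoc]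
    refine (PiLp.norm_apply_le _ _).trans ((ContinuousLinearMap.le_opNorm _ _).trans ?_)
    exact mul_le_mul (hB _ _).2 (ContinuousLinearMap.le_opNorm _ _) (norm_nonneg _) hB0
  have n1 : ‖((0, 1) : ℝ × ℝ)‖ ≤ 1 := by simp [Prod.norm_def]
  have n2 : ‖((1, 0) : ℝ × ℝ)‖ ≤ 1 := by simp [Prod.norm_def]
  refine ⟨C, fun τ => ⟨fun q => ?_, fun q => ?_, fun q => ?_, fun q => ?_, fun q => ?_⟩⟩
  · rw [rad_eq]
    exact ((PiLp.norm_apply_le _ _).trans (hB _ _).1).trans (by linarith)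
  · rw [axl_eq]
    exact ((PiLp.norm_apply_le _ _).trans (hB _ _).1).trans (by linarith)
  · rw [vort_eq (hv τ)]
    refine (abs_sub _ _).trans ?_
    have a1 := ((fderiv ℝ (rad (U τ)) q).le_opNorm (0, 1)).trans
      (mul_le_mul (f1 τ q) n1 (norm_nonneg _) hBm)
    have a2 := ((fderiv ℝ (axl (U τ)) q).le_opNorm (1, 0)).trans
      (mul_le_mul (f2 τ q) n2 (norm_nonneg _) hBm)
    rw [Real.norm_eq_abs] at a1 a2
    linarith
  · exact (f1 τ q).trans (by linarith)
  · exact (f2 τ q).trans (by linarith)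

/-- The renormalised equation for β(ω), obtained by shrinking the mollification kernel. All terms
are bounded uniformly in the scale on the support of χ, so dominated convergence applies. -/
theorem integral_comp_vort_sub (hd : 2 ≤ d) (hU : IsRegularFlow t₁ U) {χ : ℝ × ℝ → ℝ}
    (hχ : ContDiff ℝ 1 χ) (hχc : HasCompactSupport χ) (hχs : tsupport χ ⊆ {q | 0 < q.1})
    {β β' : ℝ → ℝ} (hβ : ∀ s, HasDerivAt β (β' s) s) (hβ' : Continuous β') {t : ℝ}
    (ht : t ∈ Icc 0 t₁) :
    (∫ q, χ q * β (vort (U t) q)) - ∫ q, χ q * β (vort (U 0) q) =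
      ∫ p, (χ p.2 * β' (vort (U p.1) p.2) *
          -(vort (U p.1) p.2 * (dR (rad (U p.1)) p.2 + dZ (axl (U p.1)) p.2)) +
        β (vort (U p.1) p.2) * (rad (U p.1) p.2 * dR χ p.2 +
          axl (U p.1) p.2 * dZ χ p.2 + χ p.2 * (dR (rad (U p.1)) p.2 + dZ (axl (U p.1)) p.2)))
        ∂slab t := by
  obtain ⟨B, hB⟩ := hU.exists_meridianBound
  have hB0 : 0 ≤ B := (abs_nonneg _).trans ((hB 0).rad_le 0)
  have hβc : Continuous β := continuous_iff_continuousAt.2 fun s => (hβ s).continuousAt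
  -- A unit-mass bump supported in the ball of radius 2; at scale n + 1 its support has radius 2 /
  -- (n + 1).
  let φ : ContDiffBump (0 : ℝ × ℝ) := ⟨1, 2, one_pos, one_lt_two⟩
  set ρ : ℝ × ℝ → ℝ := φ.normed volume with hρd
  have hρ : ContDiff ℝ 2 ρ := φ.contDiff_normed
  have hρ1 : ContDiff ℝ 1 ρ := hρ.of_le (by norm_num)
  have hρc : HasCompactSupport ρ := φ.hasCompactSupport_normed
  have hρi : Integrable ρ := hρ.continuous.integrable_of_hasCompactSupport hρc
  have hρs : tsupport ρ ⊆ Metric.closedBall 0 2 := (φ.tsupport_normed_eq).subset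
  have h1 : ∫ w, ρ w = 1 := φ.integral_normed
  -- By compactness the support of χ keeps a positive distance from the axis, so all sufficiently
  -- small kernels are admissible.
  obtain ⟨δ, hδ, hδχ⟩ : ∃ δ > 0, ∀ q ∈ tsupport χ, δ < q.1 := by
    rcases (tsupport χ).eq_empty_or_nonempty with h | h
    · exact ⟨1, one_pos, by simp [h]⟩
    · obtain ⟨q, hq, hm⟩ := hχc.isCompact.exists_isMinOn h continuous_fst.continuousOn
      have : 0 < q.1 := hχs hq
      exact ⟨q.1 / 2, by positivity, fun p hp => by
        have : q.1 ≤ p.1 := hm hp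
        linarith⟩
  set M := ∫ w, B * |ρ w| with hM
  set D := ∫ w, B * (B * ‖w‖ * |dR ρ w| + B * ‖w‖ * |dZ ρ w|) with hD
  -- The mollified vorticities all take values in [-M, M], so β and β' only matter on that compact
  -- interval.
  obtain ⟨b, hb⟩ := (isCompact_Icc (a := -M) (b := M)).exists_bound_of_continuousOn
    (f := β) hβc.continuousOn
  obtain ⟨b', hb'⟩ := (isCompact_Icc (a := -M) (b := M)).exists_bound_of_continuousOn
    (f := β') hβ'.continuousOn
  have hM0 : 0 ≤ M := integral_nonneg fun w => mul_nonneg hB0 (abs_nonneg _)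
  have hb0 : 0 ≤ b := (norm_nonneg _).trans (hb 0 ⟨by linarith, hM0⟩)
  have hb'0 : 0 ≤ b' := (norm_nonneg _).trans (hb' 0 ⟨by linarith, hM0⟩)
  set m : ℕ → ℝ → ℝ × ℝ → ℝ := fun n τ => mollify (scaleKernel ((n : ℝ) + 1) ρ) (vort (U τ))
    with hm
  have hmM : ∀ n τ q, m n τ q ∈ Icc (-M) M := fun n τ q =>
    abs_le.1 (abs_mollify_scaleKernel_le (hB τ).vort_le hρi (by positivity) q)
  have hml : ∀ τ q, Tendsto (fun n => m n τ q) atTop (𝓝 (vort (U τ) q)) := fun τ q => by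
    have := tendsto_mollify_scaleKernel (_root_.continuous_vort (hU.contDiff τ)) (hB τ).vort_le
      hρ.continuous hρi q
    rwa [h1, mul_one] at this
  have c0 := hU.continuous_rad
  have c1 := hU.continuous_axl
  have c2 := hU.continuous_vort
  have c3 : ∀ n, Continuous fun p : ℝ × (ℝ × ℝ) => m n p.1 p.2 := fun n =>
    continuous_mollify_param (contDiff_scaleKernel hρ _).continuous
      (hasCompactSupport_scaleKernel hρc (by positivity)) (f := fun τ => vort (U τ)) c2
  have c4 := fun n : ℕ => hU.continuous_transportDefect
    (contDiff_scaleKernel hρ1 ((n : ℝ) + 1)) (hasCompactSupport_scaleKernel hρc (by positivity))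
  have c7 := hU.continuous_fderiv_rad (1, 0)
  have c8 := hU.continuous_fderiv_axl (0, 1)
  have c9 := hχ.continuous
  have c10 := continuous_dR hχ
  have c11 := continuous_dZ hχ
  have hL : ∀ τ, Tendsto (fun n => ∫ q, χ q * β (m n τ q)) atTop
      (𝓝 (∫ q, χ q * β (vort (U τ) q))) := fun τ => by
    refine tendsto_integral_of_dominated_convergence (fun q => |χ q| * b) (fun n => ?_)
      ((c9.integrable_of_hasCompactSupport hχc).abs.mul_const b)
      (fun n => Eventually.of_forall fun q => ?_) (Eventually.of_forall fun q => ?_)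
    · have : Continuous fun q => m n τ q := (c3 n).comp (continuous_const.prodMk continuous_id)
      exact Continuous.aestronglyMeasurable (by fun_prop)
    · rw [norm_mul, Real.norm_eq_abs]
      exact mul_le_mul_of_nonneg_left (hb _ (hmM n τ q)) (abs_nonneg _)
    · exact ((hβc.tendsto _).comp (hml τ q)).const_mul _
  have hdom : Integrable (fun p : ℝ × (ℝ × ℝ) => |χ p.2| * b' * D + b *
      (|rad (U p.1) p.2| * |dR χ p.2| + |axl (U p.1) p.2| * |dZ χ p.2| +
        |χ p.2| * (|dR (rad (U p.1)) p.2| + |dZ (axl (U p.1)) p.2|))) (slab t) := by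
    refine integrable_slab (K := tsupport χ) (by unfold dR dZ at *; fun_prop) hχc.isCompact
      (fun τ q hq => ?_) t
    simp [image_eq_zero_of_notMem_tsupport hq, dR_eq_zero hq, dZ_eq_zero hq]
  have hR := tendsto_integral_of_dominated_convergence (μ := slab t) (F := fun (n : ℕ) p =>
      χ p.2 * β' (m n p.1 p.2) * transportDefect (U p.1) (scaleKernel ((n : ℝ) + 1) ρ) p.2 +
        β (m n p.1 p.2) * (rad (U p.1) p.2 * dR χ p.2 +
          axl (U p.1) p.2 * dZ χ p.2 + χ p.2 * (dR (rad (U p.1)) p.2 + dZ (axl (U p.1)) p.2)))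
    (f := fun p => χ p.2 * β' (vort (U p.1) p.2) *
          -(vort (U p.1) p.2 * (dR (rad (U p.1)) p.2 + dZ (axl (U p.1)) p.2)) +
        β (vort (U p.1) p.2) * (rad (U p.1) p.2 * dR χ p.2 +
          axl (U p.1) p.2 * dZ χ p.2 + χ p.2 * (dR (rad (U p.1)) p.2 + dZ (axl (U p.1)) p.2))) _
    (fun n => by
      have := c3 n
      have := c4 n
      exact Continuous.aestronglyMeasurable (by unfold dR dZ at *; fun_prop)) hdom
    (fun n => Eventually.of_forall fun p => by
      refine (norm_add_le _ _).trans (add_le_add ?_ ?_)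
      · rw [norm_mul, norm_mul, Real.norm_eq_abs (χ p.2)]
        exact mul_le_mul (mul_le_mul_of_nonneg_left (hb' _ (hmM _ _ _)) (abs_nonneg _))
          (abs_transportDefect_le (hU.contDiff _) (hB _) hρ1 hρc (by positivity) _)
          (norm_nonneg _) (by positivity)
      · rw [norm_mul]
        refine mul_le_mul (hb _ (hmM _ _ _)) ?_ (norm_nonneg _) hb0
        refine (norm_add₃_le).trans ?_
        rw [norm_mul, norm_mul, norm_mul]
        have := norm_add_le (dR (rad (U p.1)) p.2) (dZ (axl (U p.1)) p.2)
        simp only [Real.norm_eq_abs] at *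
        gcongr)
    (Eventually.of_forall fun p => by
      refine Tendsto.add ?_ ?_
      · exact (((hβ'.tendsto _).comp (hml p.1 p.2)).const_mul _).mul
          (tendsto_transportDefect (hU.contDiff _) (hB _) hρ1 hρc h1 _)
      · exact ((hβc.tendsto _).comp (hml p.1 p.2)).mul_const _)
  refine tendsto_nhds_unique (((hL t).sub (hL 0)).congr' ?_) hR
  have hsmall : ∀ᶠ n : ℕ in atTop, 2 / ((n : ℝ) + 1) < δ := by
    have := (tendsto_inv_natCast_succ.const_mul 2).eventually_lt_const (u := δ) (by simpa using hδ)
    simpa [div_eq_mul_inv] using this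
  filter_upwards [hsmall] with n hn
  exact hU.integral_comp_mollify_sub hd (contDiff_scaleKernel hρ _)
    (hasCompactSupport_scaleKernel hρc (by positivity))
    (tsupport_scaleKernel_subset hρs (by positivity)) hχ hχc
    (fun q hq => hn.trans (hδχ q hq)) hβ hβ' ht

end IsRegularFlow

end Renormalization

/-! ### Cutoffs of the half-plane with scale-invariant derivative bounds. -/

section Cutoff

open Filter Topology

/-- A smooth function on the line which is `1` near `0` and vanishes outside of `(-2, 2)`. -/
def plateau (x : ℝ) : ℝ := Real.smoothTransition (4 - x ^ 2)

/-- A smooth function on the line which vanishes on `x ≤ 1` and is `1` on `x ≥ 2`. -/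
def ramp (x : ℝ) : ℝ := Real.smoothTransition (x - 1)

theorem contDiff_plateau {n : ℕ∞} : ContDiff ℝ n plateau :=
  Real.smoothTransition.contDiff.comp (contDiff_const.sub (contDiff_id.pow 2))

theorem contDiff_ramp {n : ℕ∞} : ContDiff ℝ n ramp :=
  Real.smoothTransition.contDiff.comp (contDiff_id.sub contDiff_const)

theorem plateau_of_abs_ge {x : ℝ} (hx : 2 ≤ |x|) : plateau x = 0 :=
  Real.smoothTransition.zero_of_nonpos (by nlinarith [sq_abs x])

theorem plateau_of_abs_le {x : ℝ} (hx : |x| ≤ 3 / 2) : plateau x = 1 :=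
  Real.smoothTransition.one_of_one_le (by nlinarith [sq_abs x, abs_nonneg x])

theorem plateau_nonneg (x : ℝ) : 0 ≤ plateau x := Real.smoothTransition.nonneg _
theorem plateau_le_one (x : ℝ) : plateau x ≤ 1 := Real.smoothTransition.le_one _
theorem ramp_nonneg (x : ℝ) : 0 ≤ ramp x := Real.smoothTransition.nonneg _
theorem ramp_le_one (x : ℝ) : ramp x ≤ 1 := Real.smoothTransition.le_one _

theorem ramp_of_le {x : ℝ} (hx : x ≤ 1) : ramp x = 0 :=
  Real.smoothTransition.zero_of_nonpos (by linarith)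

theorem ramp_of_ge {x : ℝ} (hx : 2 ≤ x) : ramp x = 1 :=
  Real.smoothTransition.one_of_one_le (by linarith)

theorem deriv_eq_zero_of_eqOn {f : ℝ → ℝ} {s : Set ℝ} (hs : IsOpen s) {c : ℝ}
    (h : ∀ x ∈ s, f x = c) {x : ℝ} (hx : x ∈ s) : deriv f x = 0 := by
  have : f =ᶠ[𝓝 x] fun _ => c := eventually_of_mem (hs.mem_nhds hx) h
  rw [this.deriv_eq, deriv_const]

theorem deriv_plateau_of_abs_gt {x : ℝ} (hx : 2 < |x|) : deriv plateau x = 0 :=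
  deriv_eq_zero_of_eqOn (s := {x | 2 < |x|}) (isOpen_lt continuous_const continuous_abs)
    (fun _ h => plateau_of_abs_ge (le_of_lt h)) hx

theorem deriv_plateau_of_abs_lt {x : ℝ} (hx : |x| < 3 / 2) : deriv plateau x = 0 :=
  deriv_eq_zero_of_eqOn (s := {x | |x| < 3 / 2}) (isOpen_lt continuous_abs continuous_const)
    (fun _ h => plateau_of_abs_le (le_of_lt h)) hx

theorem deriv_ramp_of_lt {x : ℝ} (hx : x < 1) : deriv ramp x = 0 :=
  deriv_eq_zero_of_eqOn isOpen_Iio (fun _ h => ramp_of_le (le_of_lt h)) hx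

theorem deriv_ramp_of_gt {x : ℝ} (hx : 2 < x) : deriv ramp x = 0 :=
  deriv_eq_zero_of_eqOn isOpen_Ioi (fun _ h => ramp_of_ge (le_of_lt h)) hx

theorem exists_bound_deriv {f : ℝ → ℝ} (hf : ContDiff ℝ 1 f)
    (h : ∀ x, 2 < |x| → deriv f x = 0) : ∃ D, ∀ x, |deriv f x| ≤ D ∧ |x * deriv f x| ≤ D := by
  have hc := hf.continuous_deriv (by norm_num)
  obtain ⟨D, hD⟩ := (isCompact_Icc (a := (-2 : ℝ)) (b := 2)).exists_bound_of_continuousOn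
    hc.continuousOn
  have hD0 : 0 ≤ D := (norm_nonneg _).trans (hD 0 (by norm_num))
  -- Where the derivative does not vanish, |x| ≤ 2.
  refine ⟨2 * D, fun x => ?_⟩
  by_cases hx : 2 < |x|
  · rw [h x hx]; simp; positivity
  · have hx := not_lt.1 hx
    have h1 : |deriv f x| ≤ D := hD x (abs_le.1 hx)
    refine ⟨by linarith, ?_⟩
    rw [abs_mul]
    exact mul_le_mul hx h1 (abs_nonneg _) (by norm_num)

theorem exists_bound_deriv_ramp : ∃ D, ∀ x, |deriv ramp x| ≤ D ∧ |x * deriv ramp x| ≤ D :=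
  exists_bound_deriv (contDiff_ramp (n := 1)) fun x hx => by
    rcases lt_abs.1 hx with h | h
    · exact deriv_ramp_of_gt h
    · exact deriv_ramp_of_lt (by linarith)

theorem exists_bound_deriv_plateau :
    ∃ D, ∀ x, |deriv plateau x| ≤ D ∧ |x * deriv plateau x| ≤ D :=
  exists_bound_deriv (contDiff_plateau (n := 1)) fun _ hx => deriv_plateau_of_abs_gt hx

/-- Smooth cutoff functions exhausting the half-plane `r > 0`. -/
def cutoff (N : ℝ) (q : ℝ × ℝ) : ℝ := ramp (N * q.1) * (plateau (q.1 / N) * plateau (q.2 / N))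

theorem contDiff_cutoff (N : ℝ) : ContDiff ℝ 2 (cutoff N) :=
  ((contDiff_ramp (n := 2)).comp (contDiff_const.mul contDiff_fst)).mul
    (((contDiff_plateau (n := 2)).comp (contDiff_fst.div_const N)).mul
      ((contDiff_plateau (n := 2)).comp (contDiff_snd.div_const N)))

theorem cutoff_nonneg (N : ℝ) (q : ℝ × ℝ) : 0 ≤ cutoff N q :=
  mul_nonneg (ramp_nonneg _) (mul_nonneg (plateau_nonneg _) (plateau_nonneg _))

theorem cutoff_le_one (N : ℝ) (q : ℝ × ℝ) : cutoff N q ≤ 1 :=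
  mul_le_one₀ (ramp_le_one _) (mul_nonneg (plateau_nonneg _) (plateau_nonneg _))
    (mul_le_one₀ (plateau_le_one _) (plateau_nonneg _) (plateau_le_one _))

theorem tsupport_cutoff_subset {N : ℝ} (hN : 0 < N) :
    tsupport (cutoff N) ⊆ Icc N⁻¹ (2 * N) ×ˢ Icc (-(2 * N)) (2 * N) := by
  refine closure_minimal (fun q hq => ?_) (isClosed_Icc.prod isClosed_Icc)
  have h1 : ¬ N * q.1 ≤ 1 := fun h => hq (by simp [cutoff, ramp_of_le h])
  have h2 : ¬ 2 ≤ |q.1 / N| := fun h => hq (by simp [cutoff, plateau_of_abs_ge h])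
  have h3 : ¬ 2 ≤ |q.2 / N| := fun h => hq (by simp [cutoff, plateau_of_abs_ge h])
  rw [not_le, abs_div, abs_of_pos hN, div_lt_iff₀ hN] at h2 h3
  rw [not_le] at h1
  have h4 : N⁻¹ ≤ q.1 := by
    rw [inv_le_iff_one_le_mul₀ hN]; linarith
  exact ⟨⟨h4, (le_abs_self _).trans h2.le⟩, abs_le.1 h3.le⟩

theorem hasCompactSupport_cutoff {N : ℝ} (hN : 0 < N) : HasCompactSupport (cutoff N) :=
  (isCompact_Icc.prod isCompact_Icc).of_isClosed_subset (isClosed_tsupport _)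
    (tsupport_cutoff_subset hN)

theorem tsupport_cutoff_subset_halfPlane {N : ℝ} (hN : 0 < N) :
    tsupport (cutoff N) ⊆ {q | 0 < q.1} := fun _ hq =>
  (inv_pos.2 hN).trans_le (tsupport_cutoff_subset hN hq).1.1

theorem dR_cutoff (N : ℝ) (q : ℝ × ℝ) : dR (cutoff N) q =
    N * deriv ramp (N * q.1) * (plateau (q.1 / N) * plateau (q.2 / N)) +
      ramp (N * q.1) * (deriv plateau (q.1 / N) / N * plateau (q.2 / N)) := by
  have e : HasDerivAt (fun r : ℝ => cutoff N (r, q.2)) (N * deriv ramp (N * q.1) *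
      (plateau (q.1 / N) * plateau (q.2 / N)) +
      ramp (N * q.1) * (deriv plateau (q.1 / N) / N * plateau (q.2 / N))) q.1 := by
    have h1 : HasDerivAt (fun r : ℝ => ramp (N * r)) (N * deriv ramp (N * q.1)) q.1 := by
      have := ((contDiff_ramp (n := 1)).differentiable (by norm_num) (N * q.1)).hasDerivAt.comp
        q.1 ((hasDerivAt_id q.1).const_mul N)
      simpa [mul_comm, Function.comp_def] using this
    have h2 : HasDerivAt (fun r : ℝ => plateau (r / N)) (deriv plateau (q.1 / N) / N) q.1 := by
      have := ((contDiff_plateau (n := 1)).differentiable (by norm_num) (q.1 / N)).hasDerivAt.comp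
        q.1 ((hasDerivAt_id q.1).div_const N)
      simpa [div_eq_mul_inv, Function.comp_def] using this
    exact h1.mul (h2.mul_const (plateau (q.2 / N)))
  have h := (((contDiff_cutoff N).differentiable (by norm_num) q).hasFDerivAt.comp_hasDerivAt
    (f := fun r : ℝ => (r, q.2)) q.1 ((hasDerivAt_id q.1).prodMk (hasDerivAt_const q.1 q.2)))
  exact h.unique e

theorem dZ_cutoff (N : ℝ) (q : ℝ × ℝ) : dZ (cutoff N) q =
    ramp (N * q.1) * (plateau (q.1 / N) * (deriv plateau (q.2 / N) / N)) := by
  have e : HasDerivAt (fun z : ℝ => cutoff N (q.1, z))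
      (ramp (N * q.1) * (plateau (q.1 / N) * (deriv plateau (q.2 / N) / N))) q.2 := by
    have h2 : HasDerivAt (fun r : ℝ => plateau (r / N)) (deriv plateau (q.2 / N) / N) q.2 := by
      have := ((contDiff_plateau (n := 1)).differentiable (by norm_num) (q.2 / N)).hasDerivAt.comp
        q.2 ((hasDerivAt_id q.2).div_const N)
      simpa [div_eq_mul_inv, Function.comp_def] using this
    exact (h2.const_mul (plateau (q.1 / N))).const_mul (ramp (N * q.1))
  have h := (((contDiff_cutoff N).differentiable (by norm_num) q).hasFDerivAt.comp_hasDerivAt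
    (f := fun z : ℝ => (q.1, z)) q.2 ((hasDerivAt_const q.2 q.1).prodMk (hasDerivAt_id q.2)))
  exact h.unique e

/-- The cutoff depends on N r near the axis and on r/N, z/N at infinity, so r ∂_r is bounded
independently of N. The third bound uses that the support has r ≤ 2N while ∂_z costs 1/N. -/
theorem exists_bound_cutoff : ∃ D : ℝ, ∀ N : ℝ, 1 ≤ N → ∀ q : ℝ × ℝ, 0 < q.1 →
    |q.1 * dR (cutoff N) q| ≤ D ∧ |dZ (cutoff N) q| ≤ D ∧ |q.1 * dZ (cutoff N) q| ≤ D := by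
  obtain ⟨D₁, h₁⟩ := exists_bound_deriv_ramp
  obtain ⟨D₂, h₂⟩ := exists_bound_deriv_plateau
  have p1 : 0 ≤ D₁ := (abs_nonneg _).trans (h₁ 0).1
  have p2 : 0 ≤ D₂ := (abs_nonneg _).trans (h₂ 0).1
  have bd : ∀ {a b c A : ℝ}, |a| ≤ A → 0 ≤ b → b ≤ 1 → 0 ≤ c → c ≤ 1 → |a * (b * c)| ≤ A := by
    intro a b c A ha hb hb' hc hc'
    have hbc : 0 ≤ b * c := mul_nonneg hb hc
    rw [abs_mul, abs_of_nonneg hbc]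
    exact (mul_le_of_le_one_right (abs_nonneg _) (mul_le_one₀ hb' hc hc')).trans ha
  refine ⟨D₁ + 2 * D₂, fun N hN q hq => ?_⟩
  have hN0 : 0 < N := by linarith
  have hdz : |deriv plateau (q.2 / N) / N| ≤ D₂ := by
    rw [abs_div, abs_of_pos hN0]
    exact (div_le_self (abs_nonneg _) hN).trans (h₂ _).1
  refine ⟨?_, ?_, ?_⟩
  · rw [dR_cutoff]
    have e : q.1 * (N * deriv ramp (N * q.1) * (plateau (q.1 / N) * plateau (q.2 / N)) +
        ramp (N * q.1) * (deriv plateau (q.1 / N) / N * plateau (q.2 / N))) =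
        (N * q.1 * deriv ramp (N * q.1)) * (plateau (q.1 / N) * plateau (q.2 / N)) +
        (q.1 / N * deriv plateau (q.1 / N)) * (ramp (N * q.1) * plateau (q.2 / N)) := by
      field_simp
    rw [e]
    have a1 := bd (h₁ (N * q.1)).2 (plateau_nonneg (q.1 / N)) (plateau_le_one _)
      (plateau_nonneg (q.2 / N)) (plateau_le_one _)
    have a2 := bd (h₂ (q.1 / N)).2 (ramp_nonneg (N * q.1)) (ramp_le_one _)
      (plateau_nonneg (q.2 / N)) (plateau_le_one _)
    exact (abs_add_le _ _).trans (by linarith)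
  · rw [dZ_cutoff, show ramp (N * q.1) * (plateau (q.1 / N) * (deriv plateau (q.2 / N) / N)) =
      (deriv plateau (q.2 / N) / N) * (ramp (N * q.1) * plateau (q.1 / N)) by ring]
    have := bd hdz (ramp_nonneg (N * q.1)) (ramp_le_one _) (plateau_nonneg (q.1 / N))
      (plateau_le_one _)
    linarith
  · by_cases hr : 2 ≤ |q.1 / N|
    · rw [dZ_cutoff, plateau_of_abs_ge hr]
      simp; positivity
    · have hr' : q.1 / N ≤ 2 := (le_abs_self _).trans (not_le.1 hr).le
      have hr0 : 0 ≤ q.1 / N := by positivity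
      rw [dZ_cutoff, show q.1 * (ramp (N * q.1) * (plateau (q.1 / N) *
        (deriv plateau (q.2 / N) / N))) = (q.1 / N * deriv plateau (q.2 / N)) *
          (ramp (N * q.1) * plateau (q.1 / N)) by field_simp]
      have h5 : |q.1 / N * deriv plateau (q.2 / N)| ≤ 2 * D₂ := by
        rw [abs_mul, abs_of_nonneg hr0]
        exact mul_le_mul hr' (h₂ _).1 (abs_nonneg _) (by norm_num)
      have := bd h5 (ramp_nonneg (N * q.1)) (ramp_le_one _) (plateau_nonneg (q.1 / N))
        (plateau_le_one _)
      linarith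

theorem eventually_cutoff {q : ℝ × ℝ} (hq : 0 < q.1) : ∀ᶠ n : ℕ in atTop,
    cutoff ((n : ℝ) + 1) q = 1 ∧ dR (cutoff ((n : ℝ) + 1)) q = 0 ∧
      dZ (cutoff ((n : ℝ) + 1)) q = 0 := by
  have hT : Tendsto (fun n : ℕ => (n : ℝ) + 1) atTop atTop :=
    tendsto_natCast_atTop_atTop.atTop_add tendsto_const_nhds
  filter_upwards [hT.eventually_gt_atTop (2 / q.1), hT.eventually_gt_atTop |q.1|,
    hT.eventually_gt_atTop |q.2|] with n h1 h2 h3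
  have hN : (0 : ℝ) < n + 1 := by positivity
  rw [div_lt_iff₀ hq] at h1
  have h2' : |q.1 / ((n : ℝ) + 1)| < 3 / 2 := by
    rw [abs_div, abs_of_pos hN, div_lt_iff₀ hN]; linarith
  have h3' : |q.2 / ((n : ℝ) + 1)| < 3 / 2 := by
    rw [abs_div, abs_of_pos hN, div_lt_iff₀ hN]; linarith
  refine ⟨?_, ?_, ?_⟩
  · rw [cutoff, ramp_of_ge h1.le, plateau_of_abs_le h2'.le, plateau_of_abs_le h3'.le]; norm_num
  · rw [dR_cutoff, deriv_ramp_of_gt h1, deriv_plateau_of_abs_lt h2']; simp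
  · rw [dZ_cutoff, deriv_plateau_of_abs_lt h3']; simp

/-- The product of a function of `r` with a cutoff function. -/
def radialCutoff (f : ℝ → ℝ) (N : ℝ) (q : ℝ × ℝ) : ℝ := f q.1 * cutoff N q

theorem contDiff_radialCutoff {f : ℝ → ℝ} (hf : ContDiff ℝ 2 f) (N : ℝ) :
    ContDiff ℝ 2 (radialCutoff f N) := (hf.comp contDiff_fst).mul (contDiff_cutoff N)

theorem hasCompactSupport_radialCutoff (f : ℝ → ℝ) {N : ℝ} (hN : 0 < N) :
    HasCompactSupport (radialCutoff f N) := (hasCompactSupport_cutoff hN).mul_left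

theorem tsupport_radialCutoff_subset (f : ℝ → ℝ) {N : ℝ} (hN : 0 < N) :
    tsupport (radialCutoff f N) ⊆ {q | 0 < q.1} :=
  (tsupport_mul_subset_right).trans (tsupport_cutoff_subset_halfPlane hN)

theorem fderiv_radialCutoff {f : ℝ → ℝ} (hf : ContDiff ℝ 2 f) (N : ℝ) (q h : ℝ × ℝ) :
    fderiv ℝ (radialCutoff f N) q h =
      h.1 * deriv f q.1 * cutoff N q + f q.1 * fderiv ℝ (cutoff N) q h := by
  have h1 := (hf.differentiable (by norm_num) q.1).hasDerivAt.comp_hasFDerivAt q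
    ((ContinuousLinearMap.fst ℝ ℝ ℝ).hasFDerivAt (x := q))
  have h2 : HasFDerivAt (radialCutoff f N) _ q :=
    h1.mul ((contDiff_cutoff N).differentiable (by norm_num) q).hasFDerivAt
  rw [h2.fderiv]
  simp
  ring

theorem dR_radialCutoff {f : ℝ → ℝ} (hf : ContDiff ℝ 2 f) (N : ℝ) (q : ℝ × ℝ) :
    dR (radialCutoff f N) q = deriv f q.1 * cutoff N q + f q.1 * dR (cutoff N) q := by
  rw [dR, fderiv_radialCutoff hf, one_mul]; rfl

theorem dZ_radialCutoff {f : ℝ → ℝ} (hf : ContDiff ℝ 2 f) (N : ℝ) (q : ℝ × ℝ) :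
    dZ (radialCutoff f N) q = f q.1 * dZ (cutoff N) q := by
  rw [dZ, fderiv_radialCutoff hf, zero_mul, zero_mul, zero_add]; rfl

end Cutoff

/-! ### Iterated integral inequalities. -/

section IteratedIntegral

/-- Induction on `p`, applied to the shifted sequence. With a constant sequence and p → ∞ it
replaces Grönwall's inequality; with a sequence of decreasing radii it produces the final decay. -/
theorem iterated_integral_bound {A L t₁ : ℝ} (hL : 0 ≤ L) (p : ℕ) (N : ℕ → ℝ → ℝ)
    (hi : ∀ j, IntervalIntegrable (N j) volume 0 t₁)
    (h : ∀ j < p, ∀ t ∈ Icc 0 t₁, N j t ≤ L * ∫ τ in 0..t, N (j + 1) τ)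
    (hA : ∀ t ∈ Icc 0 t₁, N p t ≤ A) :
    ∀ t ∈ Icc 0 t₁, N 0 t ≤ A * (L * t) ^ p / p.factorial := by
  induction p generalizing N with
  | zero => intro t ht; simpa using hA t ht
  | succ p ih =>
    intro t ht
    have h1 := ih (fun j => N (j + 1)) (fun j => hi (j + 1))
      (fun j hj => h (j + 1) (by omega)) hA
    have hsub : uIcc 0 t ⊆ uIcc 0 t₁ := by
      rw [uIcc_of_le ht.1, uIcc_of_le (ht.1.trans ht.2)]
      exact Icc_subset_Icc_right ht.2
    have h2 : ∫ τ in 0..t, N 1 τ ≤ ∫ τ in 0..t, A * (L * τ) ^ p / p.factorial :=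
      intervalIntegral.integral_mono_on ht.1 ((hi 1).mono_set hsub)
        ((by fun_prop : Continuous fun τ => A * (L * τ) ^ p / p.factorial).intervalIntegrable _ _)
        fun τ hτ => h1 τ ⟨hτ.1, hτ.2.trans ht.2⟩
    have h3 : ∫ τ in 0..t, A * (L * τ) ^ p / p.factorial =
        A * L ^ p / p.factorial * (t ^ (p + 1) / (p + 1)) := by
      have : ∀ τ : ℝ, A * (L * τ) ^ p / p.factorial = A * L ^ p / p.factorial * τ ^ p := fun τ => by
        rw [mul_pow]; ring
      simp_rw [this]
      rw [intervalIntegral.integral_const_mul, integral_pow]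
      simp
    refine (h 0 (by omega) t ht).trans ((mul_le_mul_of_nonneg_left (h2.trans h3.le) hL).trans ?_)
    rw [Nat.factorial_succ]
    push_cast
    rw [mul_pow, pow_succ]
    have : (p.factorial : ℝ) ≠ 0 := by positivity
    have : (p : ℝ) + 1 ≠ 0 := by positivity
    apply le_of_eq
    field_simp
    ring

end IteratedIntegral

/-! ### Weighted L^2 bounds that dominate all boundary terms. -/

section Energy

variable {d : ℕ} [NeZero d] {v : RSpace d → RSpace d}

theorem ae_cylRadius_pos (hd : 2 ≤ d) : ∀ᵐ x : RSpace d, 0 < cylRadius x := by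
  have h1 : ∀ᵐ q ∂(meridianMeasure d), 0 < q.1 :=
    (withDensity_absolutelyContinuous _ _).ae_le (ae_restrict_mem measurableSet_halfPlane)
  have h2 : ∀ᵐ q ∂(Measure.map (cylCoord : RSpace d → ℝ × ℝ) volume), 0 < q.1 := by
    rw [map_cylCoord hd]
    exact Measure.ae_smul_measure h1 _
  exact ae_of_ae_map (continuous_cylCoord d).aemeasurable h2

/-- The sum of the squares of the velocity components, of the vorticity and of `v^r / r`, with the
weight `r^(d-2)`. -/
def energyDensity (v : RSpace d → RSpace d) (q : ℝ × ℝ) : ℝ :=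
  q.1 ^ (d - 2) * (rad v q ^ 2 + axl v q ^ 2 + vort v q ^ 2 + (rad v q / q.1) ^ 2)

theorem energyDensity_nonneg {q : ℝ × ℝ} (hq : 0 < q.1) : 0 ≤ energyDensity v q := by
  unfold energyDensity; positivity

/-- Pointwise, each velocity component is at most |v|, which gives 2, while ω and v^r / r are each
at most 2 |∇v|, which gives 4 + 4 after squaring. -/
theorem lintegral_energyDensity_le (hd : 3 ≤ d) (hv : ContDiff ℝ 1 v)
    (hax : IsAxisymmetricSwirlFree v) (hdiv : ∀ x, divergence v x = 0) :
    sphereArea d * ∫⁻ q in {q : ℝ × ℝ | 0 < q.1}, ENNReal.ofReal (energyDensity v q) ≤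
      2 * eLpNorm v 2 volume ^ 2 + 8 * eLpNorm (fun x => fderiv ℝ v x) 2 volume ^ 2 := by
  have ma : Measurable (rad v) := (contDiff_rad hv).continuous.measurable
  have mb : Measurable (axl v) := (contDiff_axl hv).continuous.measurable
  have mw : Measurable (vort v) := (continuous_vort hv).measurable
  set S : ℝ × ℝ → ℝ := fun q => rad v q ^ 2 + axl v q ^ 2 + vort v q ^ 2 + (rad v q / q.1) ^ 2
    with hS
  have mS : Measurable S := by fun_prop
  have h1 : ∫⁻ q in {q : ℝ × ℝ | 0 < q.1}, ENNReal.ofReal (energyDensity v q) =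
      ∫⁻ q, ENNReal.ofReal (S q) ∂meridianMeasure d := by
    rw [lintegral_meridianMeasure mS.ennreal_ofReal]
    refine setLIntegral_congr_fun measurableSet_halfPlane fun q hq => ?_
    have hq : 0 < q.1 := hq
    exact ENNReal.ofReal_mul (by positivity)
  have hL2 : ∀ {E : Type} [NormedAddCommGroup E] (f : RSpace d → E),
      eLpNorm f 2 volume ^ 2 = ∫⁻ x, ENNReal.ofReal (‖f x‖ ^ 2) := fun f => by
    have := eLpNorm_nnreal_pow_eq_lintegral (f := f) (μ := (volume : Measure (RSpace d)))
      (p := 2) two_ne_zero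
    simp only [NNReal.coe_ofNat, ENNReal.rpow_ofNat, ENNReal.coe_ofNat] at this
    rw [this]
    refine lintegral_congr fun x => ?_
    rw [← ofReal_norm, ENNReal.ofReal_pow (norm_nonneg _)]
  have m1 : Measurable fun x => ENNReal.ofReal (‖v x‖ ^ 2) :=
    (hv.continuous.norm.pow 2).measurable.ennreal_ofReal
  have m2 : Measurable fun x => ENNReal.ofReal (‖fderiv ℝ v x‖ ^ 2) :=
    ((hv.continuous_fderiv (by norm_num)).norm.pow 2).measurable.ennreal_ofReal
  rw [h1, ← lintegral_comp_cylCoord (by omega) mS.ennreal_ofReal, hL2, hL2,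
    ← lintegral_const_mul _ m1, ← lintegral_const_mul _ m2, ← lintegral_add_left (m1.const_mul _)]
  refine lintegral_mono_ae ?_
  filter_upwards [ae_cylRadius_pos (d := d) (by omega)] with x hx
  have e : 2 * ENNReal.ofReal (‖v x‖ ^ 2) + 8 * ENNReal.ofReal (‖fderiv ℝ v x‖ ^ 2) =
      ENNReal.ofReal (2 * ‖v x‖ ^ 2 + 8 * ‖fderiv ℝ v x‖ ^ 2) := by
    rw [ENNReal.ofReal_add (by positivity) (by positivity), ENNReal.ofReal_mul (by norm_num),
      ENNReal.ofReal_mul (by norm_num)]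
    simp
  rw [e]
  refine ENNReal.ofReal_le_ofReal ?_
  have a1 := hax.abs_rad_le hx
  have a2 := hax.abs_axl_le x
  have a3 := hax.abs_vort_le hv hx
  have a4 := hax.abs_rad_div_le hd hv hdiv hx
  have b1 := sq_le_sq₀ (abs_nonneg _) (norm_nonneg _) |>.2 a1
  have b2 := sq_le_sq₀ (abs_nonneg _) (norm_nonneg _) |>.2 a2
  have b3 := sq_le_sq₀ (abs_nonneg _) (by positivity) |>.2 a3
  have b4 := sq_le_sq₀ (abs_nonneg _) (by positivity) |>.2 a4
  rw [sq_abs] at b1 b2 b3 b4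
  have : (cylCoord x).1 = cylRadius x := rfl
  simp only [hS, this]
  nlinarith

namespace IsRegularFlow

variable {t₁ : ℝ} {U : ℝ → RSpace d → RSpace d}

theorem exists_energy_bound (hd : 3 ≤ d) (hU : IsRegularFlow t₁ U) : ∃ A : ℝ≥0, ∀ τ,
    ∫⁻ q in {q : ℝ × ℝ | 0 < q.1}, ENNReal.ofReal (energyDensity (U τ) q) ≤ A := by
  obtain ⟨N, hN⟩ := hU.bound_l2
  have hs0 : sphereArea d ≠ 0 := fun h => by
    have := sphereArea_pos (d := d) (by omega)
    rw [h] at this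
    simp at this
  refine ⟨((2 * N ^ 2 + 8 * N ^ 2 : ℝ≥0∞) / sphereArea d).toNNReal, fun τ => ?_⟩
  rw [ENNReal.coe_toNNReal]
  · rw [ENNReal.le_div_iff_mul_le (Or.inl hs0) (Or.inl sphereArea_ne_top), mul_comm]
    refine (lintegral_energyDensity_le hd (hU.contDiff τ) (hU.axi τ) (hU.div_free τ)).trans ?_
    have := hN τ
    gcongr
    · exact this.1
    · exact this.2
  · exact ENNReal.div_ne_top (by norm_cast; exact ENNReal.coe_ne_top) hs0

end IsRegularFlow

end Energy

/-! ### Propagation of the sign of the vorticity. -/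

section Positivity

open Filter Topology

/-- The product of Lebesgue measure on the time interval `(0, t]` with Lebesgue measure on the
half-plane `r > 0`. -/
def halfSlab (t : ℝ) : Measure (ℝ × (ℝ × ℝ)) :=
  (volume.restrict (Ioc 0 t)).prod (volume.restrict {q : ℝ × ℝ | 0 < q.1})

theorem ae_halfSlab_pos (t : ℝ) : ∀ᵐ p ∂halfSlab t, 0 < p.2.1 := by
  have h : (Prod.snd : ℝ × (ℝ × ℝ) → ℝ × ℝ) ⁻¹' {q : ℝ × ℝ | 0 < q.1} ∈ ae (halfSlab t) :=
    Measure.quasiMeasurePreserving_snd.ae (ae_restrict_mem measurableSet_halfPlane)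
  exact h

/-- Passing to the open half-plane makes the divisions by r in the divergence identity legitimate
almost everywhere. -/
theorem integral_slab_eq_halfSlab {F : ℝ × (ℝ × ℝ) → ℝ}
    (hF : ∀ p : ℝ × (ℝ × ℝ), ¬ 0 < p.2.1 → F p = 0) (t : ℝ) :
    ∫ p, F p ∂slab t = ∫ p, F p ∂halfSlab t := by
  have h : halfSlab t = (slab t).restrict (univ ×ˢ {q : ℝ × ℝ | 0 < q.1}) := by
    rw [halfSlab, slab, ← Measure.prod_restrict, Measure.restrict_univ]
  rw [h, setIntegral_eq_integral_of_forall_compl_eq_zero]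
  intro p hp
  exact hF p fun h => hp ⟨mem_univ _, h⟩

theorem integrable_halfSlab {F : ℝ × (ℝ × ℝ) → ℝ} (hF : Measurable F) {A : ℝ≥0}
    {t : ℝ} (hA : ∀ τ ∈ Ioc 0 t, ∫⁻ q in {q : ℝ × ℝ | 0 < q.1}, ‖F (τ, q)‖ₑ ≤ A) :
    Integrable F (halfSlab t) := by
  refine ⟨hF.aestronglyMeasurable, ?_⟩
  rw [HasFiniteIntegral, halfSlab, lintegral_prod _ hF.enorm.aemeasurable]
  calc ∫⁻ τ in Ioc 0 t, ∫⁻ q in {q : ℝ × ℝ | 0 < q.1}, ‖F (τ, q)‖ₑ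
      ≤ ∫⁻ _ in Ioc 0 t, (A : ℝ≥0∞) := setLIntegral_mono measurable_const fun τ hτ => hA τ hτ
    _ = A * volume (Ioc 0 t) := by rw [setLIntegral_const]
    _ < ∞ := by rw [Real.volume_Ioc]; exact ENNReal.mul_lt_top (by simp) (by simp)

theorem integral_halfSlab {F : ℝ × (ℝ × ℝ) → ℝ} {t : ℝ} (ht : 0 ≤ t)
    (hF : Integrable F (halfSlab t)) :
    ∫ p, F p ∂halfSlab t = ∫ τ in 0..t, ∫ q in {q : ℝ × ℝ | 0 < q.1}, F (τ, q) := by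
  rw [halfSlab, integral_prod _ hF, intervalIntegral.integral_of_le ht]

theorem intervalIntegrable_of_halfSlab {F : ℝ × (ℝ × ℝ) → ℝ} {t : ℝ} (ht : 0 ≤ t)
    (hF : Integrable F (halfSlab t)) :
    IntervalIntegrable (fun τ => ∫ q in {q : ℝ × ℝ | 0 < q.1}, F (τ, q)) volume 0 t := by
  rw [intervalIntegrable_iff_integrableOn_Ioc_of_le ht]
  exact hF.integral_prod_left

theorem radialCutoff_eq_zero (f : ℝ → ℝ) {N : ℝ} (hN : 0 < N) {q : ℝ × ℝ} (hq : ¬ 0 < q.1) :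
    radialCutoff f N q = 0 ∧ dR (radialCutoff f N) q = 0 ∧ dZ (radialCutoff f N) q = 0 := by
  have h : q ∉ tsupport (radialCutoff f N) := fun h => hq (tsupport_radialCutoff_subset f hN h)
  exact ⟨image_eq_zero_of_notMem_tsupport h, dR_eq_zero h, dZ_eq_zero h⟩

theorem setIntegral_radialCutoff (f : ℝ → ℝ) {N : ℝ} (hN : 0 < N) (F : ℝ × ℝ → ℝ) :
    ∫ q in {q : ℝ × ℝ | 0 < q.1}, radialCutoff f N q * F q = ∫ q, radialCutoff f N q * F q := by
  refine setIntegral_eq_integral_of_forall_compl_eq_zero fun q hq => ?_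
  rw [(radialCutoff_eq_zero f hN hq).1, zero_mul]

theorem tendsto_integral_radialCutoff {f : ℝ → ℝ} (hf : ContDiff ℝ 2 f) {F : ℝ × ℝ → ℝ}
    (hF : Measurable F) (hi : IntegrableOn (fun q => f q.1 * F q) {q : ℝ × ℝ | 0 < q.1}) :
    Tendsto (fun n : ℕ => ∫ q, radialCutoff f ((n : ℝ) + 1) q * F q) atTop
      (𝓝 (∫ q in {q : ℝ × ℝ | 0 < q.1}, f q.1 * F q)) := by
  simp_rw [fun n : ℕ =>
    (setIntegral_radialCutoff f (show (0 : ℝ) < (n : ℝ) + 1 by positivity) F).symm]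
  refine tendsto_integral_of_dominated_convergence (fun q => ‖f q.1 * F q‖) (fun n => ?_) hi.norm
    (fun n => Eventually.of_forall fun q => ?_) ?_
  · exact ((contDiff_radialCutoff hf _).continuous.measurable.mul hF).aestronglyMeasurable
  · rw [radialCutoff, show f q.1 * cutoff ((n : ℝ) + 1) q * F q =
      f q.1 * F q * cutoff ((n : ℝ) + 1) q by ring, norm_mul _ (cutoff _ _),
      Real.norm_of_nonneg (cutoff_nonneg _ _)]
    exact mul_le_of_le_one_right (norm_nonneg _) (cutoff_le_one _ _)
  · filter_upwards [ae_restrict_mem measurableSet_halfPlane] with q hq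
    refine tendsto_const_nhds.congr' ?_
    filter_upwards [eventually_cutoff hq] with n hn
    rw [radialCutoff, hn.1, mul_one]

theorem deriv_pow_eq_div {m : ℕ} {r : ℝ} (hr : 0 < r) :
    deriv (fun r : ℝ => r ^ m) r = m * (r ^ m / r) := by
  rw [deriv_pow_field]
  rcases m with _ | m
  · simp
  · rw [Nat.add_sub_cancel, pow_succ, mul_div_cancel_right₀ _ hr.ne']

variable {d : ℕ} [NeZero d]

namespace IsRegularFlow

variable {t₁ : ℝ} {U : ℝ → RSpace d → RSpace d}

theorem measurable_rad (hU : IsRegularFlow t₁ U) :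
    Measurable fun p : ℝ × (ℝ × ℝ) => rad (U p.1) p.2 := hU.continuous_rad.measurable

theorem measurable_axl (hU : IsRegularFlow t₁ U) :
    Measurable fun p : ℝ × (ℝ × ℝ) => axl (U p.1) p.2 := hU.continuous_axl.measurable

theorem measurable_vort (hU : IsRegularFlow t₁ U) :
    Measurable fun p : ℝ × (ℝ × ℝ) => vort (U p.1) p.2 := hU.continuous_vort.measurable

theorem measurable_energyDensity (hU : IsRegularFlow t₁ U) :
    Measurable fun p : ℝ × (ℝ × ℝ) => energyDensity (U p.1) p.2 := by
  have := hU.measurable_rad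
  have := hU.measurable_axl
  have := hU.measurable_vort
  unfold energyDensity
  fun_prop

theorem lintegral_enorm_energyDensity (v : RSpace d → RSpace d) :
    ∫⁻ q in {q : ℝ × ℝ | 0 < q.1}, ‖energyDensity v q‖ₑ =
      ∫⁻ q in {q : ℝ × ℝ | 0 < q.1}, ENNReal.ofReal (energyDensity v q) := by
  refine setLIntegral_congr_fun measurableSet_halfPlane fun q hq => ?_
  exact Real.enorm_of_nonneg (energyDensity_nonneg hq)

theorem integrable_energyDensity_halfSlab (hd : 3 ≤ d) (hU : IsRegularFlow t₁ U) (t : ℝ) :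
    Integrable (fun p => energyDensity (U p.1) p.2) (halfSlab t) := by
  obtain ⟨A, hA⟩ := hU.exists_energy_bound hd
  refine integrable_halfSlab hU.measurable_energyDensity (A := A) (fun τ _ => ?_)
  exact (lintegral_enorm_energyDensity (U τ)).trans_le (hA τ)

theorem integrableOn_energyDensity (hd : 3 ≤ d) (hU : IsRegularFlow t₁ U) (τ : ℝ) :
    IntegrableOn (energyDensity (U τ)) {q : ℝ × ℝ | 0 < q.1} := by
  obtain ⟨A, hA⟩ := hU.exists_energy_bound hd
  refine ⟨(hU.measurable_energyDensity.comp measurable_prodMk_left).aestronglyMeasurable, ?_⟩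
  rw [HasFiniteIntegral, lintegral_enorm_energyDensity]
  exact (hA τ).trans_lt ENNReal.coe_lt_top

theorem exists_abs_rad_div_le (hd : 3 ≤ d) (hU : IsRegularFlow t₁ U) :
    ∃ L, 0 ≤ L ∧ ∀ τ, ∀ q : ℝ × ℝ, 0 < q.1 → |rad (U τ) q / q.1| ≤ L := by
  obtain ⟨B, hB⟩ := hU.bound
  have hB0 : 0 ≤ B := (norm_nonneg _).trans (hB 0 0).1
  refine ⟨2 * B, by positivity, fun τ q hq => ?_⟩
  have h2 : 2 ≤ d := by omega
  have hx : cylRadius (merMap d q) = q.1 := by rw [cylRadius_merMap h2, abs_of_pos hq]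
  have h := (hU.axi τ).abs_rad_div_le hd (hU.contDiff τ) (hU.div_free τ)
    (x := merMap d q) (by rw [hx]; exact hq)
  rw [cylCoord_merMap h2 hq.le, hx] at h
  exact h.trans (mul_le_mul_of_nonneg_left (hB _ _).2 (by norm_num))

/-- The weighted norm of the negative part, ∬ r^(d-2) min(ω, 0)^2, vanishes initially and satisfies
a linear integral inequality with constant 2(d - 2) sup |u^r / r|; hence it vanishes. -/
theorem vort_nonneg (hd : 3 ≤ d) (hU : IsRegularFlow t₁ U)
    (h0 : ∀ q : ℝ × ℝ, 0 < q.1 → 0 ≤ vort (U 0) q) {t : ℝ} (ht : t ∈ Icc 0 t₁) {q : ℝ × ℝ}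
    (hq : 0 < q.1) : 0 ≤ vort (U t) q := by
  have hd2 : 2 ≤ d := by omega
  obtain ⟨A, hA⟩ := hU.exists_energy_bound hd
  obtain ⟨L, hL0, hL⟩ := hU.exists_abs_rad_div_le hd
  obtain ⟨B, hB⟩ := hU.exists_meridianBound
  obtain ⟨D, hD⟩ := exists_bound_cutoff
  have hB0 : 0 ≤ B := (abs_nonneg _).trans ((hB 0).rad_le 0)
  have hD0 : 0 ≤ D := (abs_nonneg _).trans (hD 1 le_rfl (1, 0) one_pos).1
  -- The square makes β of class C^1 with s β'(s) = 2 β(s), so the renormalised equation closes.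
  set β : ℝ → ℝ := fun s => min s 0 ^ 2 with hβ
  have hβ0 : ∀ s, 0 ≤ β s := fun s => sq_nonneg _
  have hβs : ∀ s, β s ≤ s ^ 2 := fun s => by
    simp only [hβ]
    rcases min_cases s 0 with ⟨h, _⟩ | ⟨h, _⟩ <;> rw [h]
    simpa using sq_nonneg s
  have hβd : ∀ s, HasDerivAt β (2 * min s 0) s := fun s => by
    rcases lt_trichotomy s 0 with hs | hs | hs
    · have : β =ᶠ[𝓝 s] fun s => s ^ 2 := by
        filter_upwards [Iio_mem_nhds hs] with y hy
        have hy : y < 0 := hy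
        simp only [hβ, min_eq_left hy.le]
      rw [min_eq_left hs.le]
      refine HasDerivAt.congr_of_eventuallyEq ?_ this
      simpa using hasDerivAt_pow 2 s
    · subst hs
      rw [min_self, mul_zero, hasDerivAt_iff_isLittleO_nhds_zero]
      refine Asymptotics.IsBigO.trans_isLittleO (g := fun h : ℝ => h ^ 2) ?_ ?_
      · refine Asymptotics.IsBigO.of_norm_le fun h => ?_
        have h1 : β 0 = 0 := by simp [hβ]
        simp only [zero_add, h1, smul_zero, sub_zero]
        rw [Real.norm_of_nonneg (hβ0 h)]
        exact (hβs h)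
      · have := Asymptotics.isLittleO_pow_id (𝕜 := ℝ) (n := 2) (by norm_num)
        exact this
    · have : β =ᶠ[𝓝 s] fun _ => 0 := by
        filter_upwards [Ioi_mem_nhds hs] with y hy
        have hy : 0 < y := hy
        simp only [hβ, min_eq_right hy.le]
        norm_num
      rw [min_eq_right hs.le, mul_zero]
      exact (hasDerivAt_const s (0 : ℝ)).congr_of_eventuallyEq this
  have hβc : Continuous β := by simp only [hβ]; fun_prop
  have hβ' : ∀ s, 2 * min s 0 * s = 2 * β s := fun s => by
    simp only [hβ]
    rcases min_cases s 0 with ⟨h, _⟩ | ⟨h, _⟩ <;> rw [h] <;> ring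
  -- With this weight the measure is invariant under the flow: the transport of the weight cancels
  -- the plane divergence, and only the stretching term remains.
  set f : ℝ → ℝ := fun r => r ^ (d - 2) with hf
  have hfc : ContDiff ℝ 2 f := contDiff_id.pow _
  have hcast : ((d - 2 : ℕ) : ℝ) = (d : ℝ) - 2 := by
    rw [Nat.cast_sub hd2]; norm_num
  have hd0 : (0 : ℝ) ≤ (d : ℝ) - 2 := by rw [← hcast]; positivity
  have mβ : ∀ τ, Measurable fun q => β (vort (U τ) q) := fun τ =>
    hβc.measurable.comp (_root_.continuous_vort (hU.contDiff τ)).measurable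
  have le_energy : ∀ τ (q : ℝ × ℝ), 0 < q.1 →
      f q.1 * β (vort (U τ) q) ≤ energyDensity (U τ) q := fun τ q hq => by
    rw [energyDensity]
    refine mul_le_mul_of_nonneg_left ?_ (by positivity)
    have := hβs (vort (U τ) q)
    have := sq_nonneg (rad (U τ) q)
    have := sq_nonneg (axl (U τ) q)
    have := sq_nonneg (rad (U τ) q / q.1)
    linarith
  have hNi : ∀ τ, IntegrableOn (fun q => f q.1 * β (vort (U τ) q)) {q : ℝ × ℝ | 0 < q.1} :=
    fun τ => by
    refine (hU.integrableOn_energyDensity hd τ).mono'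
      ((hfc.continuous.measurable.comp measurable_fst).mul (mβ τ)).aestronglyMeasurable ?_
    filter_upwards [ae_restrict_mem measurableSet_halfPlane] with q hq
    have hq : 0 < q.1 := hq
    rw [Real.norm_of_nonneg (mul_nonneg (by simp only [hf]; positivity) (hβ0 _))]
    exact le_energy τ q hq
  set N : ℝ → ℝ := fun τ => ∫ q in {q : ℝ × ℝ | 0 < q.1}, f q.1 * β (vort (U τ) q) with hN
  have mw := hU.measurable_vort
  have ma := hU.measurable_rad
  have mb := hU.measurable_axl
  have hNs : Integrable (fun p : ℝ × (ℝ × ℝ) => f p.2.1 * β (vort (U p.1) p.2))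
      (halfSlab t₁) := by
    refine (hU.integrable_energyDensity_halfSlab hd t₁).mono' (by fun_prop) ?_
    filter_upwards [ae_halfSlab_pos t₁] with p hp
    rw [Real.norm_of_nonneg (mul_nonneg (by simp only [hf]; positivity) (hβ0 _))]
    exact le_energy _ _ hp
  have hNi' : IntervalIntegrable N volume 0 t₁ :=
    intervalIntegrable_of_halfSlab (ht.1.trans ht.2) hNs
  have key : ∀ t ∈ Icc 0 t₁, N t ≤ (2 * ((d : ℝ) - 2) * L) * ∫ τ in 0..t, N τ := by
    intro t ht
    -- A bound for the stretching factor and the two cutoff terms; ∂_r of the cutoff is paired with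
    -- u^r / r, so that r ∂_r stays bounded at the axis.
    set c : ℝ := 2 * ((d : ℝ) - 2) * L + (L * D + B * D) with hc
    have hlim := tendsto_integral_of_dominated_convergence (μ := halfSlab t)
      (F := fun (n : ℕ) p => f p.2.1 * β (vort (U p.1) p.2) *
        (2 * ((d : ℝ) - 2) * (rad (U p.1) p.2 / p.2.1) * cutoff ((n : ℝ) + 1) p.2 +
          ((rad (U p.1) p.2 / p.2.1) * (p.2.1 * dR (cutoff ((n : ℝ) + 1)) p.2) +
          axl (U p.1) p.2 * dZ (cutoff ((n : ℝ) + 1)) p.2)))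
      (f := fun p => f p.2.1 * β (vort (U p.1) p.2) *
        (2 * ((d : ℝ) - 2) * (rad (U p.1) p.2 / p.2.1)))
      (fun p => energyDensity (U p.1) p.2 * c) (fun n => by
        have m1 : Measurable (cutoff ((n : ℝ) + 1)) := (contDiff_cutoff _).continuous.measurable
        have m2 : Measurable (dR (cutoff ((n : ℝ) + 1))) :=
          (continuous_dR ((contDiff_cutoff _).of_le (by norm_num))).measurable
        have m3 : Measurable (dZ (cutoff ((n : ℝ) + 1))) :=
          (continuous_dZ ((contDiff_cutoff _).of_le (by norm_num))).measurable
        exact Measurable.aestronglyMeasurable (by fun_prop))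
      ((hU.integrable_energyDensity_halfSlab hd t).mul_const c)
      (fun n => by
        filter_upwards [ae_halfSlab_pos t] with p hp
        have hn : (1 : ℝ) ≤ (n : ℝ) + 1 := by linarith [(Nat.cast_nonneg n : (0 : ℝ) ≤ n)]
        obtain ⟨b1, b2, -⟩ := hD _ hn p.2 hp
        have b3 := hL p.1 p.2 hp
        rw [norm_mul, Real.norm_of_nonneg
          (mul_nonneg (by simp only [hf]; positivity) (hβ0 _))]
        refine mul_le_mul (le_energy _ _ hp) ?_ (norm_nonneg _) (energyDensity_nonneg hp)
        refine (norm_add_le _ _).trans (add_le_add ?_ ((norm_add_le _ _).trans (add_le_add ?_ ?_)))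
        · rw [norm_mul, norm_mul, Real.norm_of_nonneg (cutoff_nonneg _ _),
            Real.norm_of_nonneg (by positivity : (0 : ℝ) ≤ 2 * ((d : ℝ) - 2))]
          refine (mul_le_of_le_one_right (by positivity) (cutoff_le_one _ _)).trans ?_
          exact mul_le_mul_of_nonneg_left b3 (by positivity)
        · rw [norm_mul]
          exact mul_le_mul b3 b1 (norm_nonneg _) hL0
        · rw [norm_mul]
          exact mul_le_mul ((hB p.1).axl_le _) b2 (norm_nonneg _) hB0)
      (by
        filter_upwards [ae_halfSlab_pos t] with p hp
        refine tendsto_const_nhds.congr' ?_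
        filter_upwards [eventually_cutoff hp] with n hn
        rw [hn.1, hn.2.1, hn.2.2]
        ring)
    have hid : ∀ n : ℕ, ∫ q, radialCutoff f ((n : ℝ) + 1) q * β (vort (U t) q) =
        ∫ p, f p.2.1 * β (vort (U p.1) p.2) *
        (2 * ((d : ℝ) - 2) * (rad (U p.1) p.2 / p.2.1) * cutoff ((n : ℝ) + 1) p.2 +
          ((rad (U p.1) p.2 / p.2.1) * (p.2.1 * dR (cutoff ((n : ℝ) + 1)) p.2) +
          axl (U p.1) p.2 * dZ (cutoff ((n : ℝ) + 1)) p.2)) ∂halfSlab t := by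
      intro n
      have hn : (0 : ℝ) < (n : ℝ) + 1 := by positivity
      have h1 := hU.integral_comp_vort_sub hd2
        ((contDiff_radialCutoff hfc ((n : ℝ) + 1)).of_le (by norm_num))
        (hasCompactSupport_radialCutoff f hn) (tsupport_radialCutoff_subset f hn) hβd
        (by fun_prop) ht
      have h2 : ∫ q, radialCutoff f ((n : ℝ) + 1) q * β (vort (U 0) q) = 0 := by
        refine integral_eq_zero_of_ae (Eventually.of_forall fun q => ?_)
        by_cases hq : 0 < q.1
        · simp [hβ, min_eq_right (h0 q hq)]
        · simp [(radialCutoff_eq_zero f hn hq).1]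
      rw [h2, sub_zero] at h1
      rw [h1, integral_slab_eq_halfSlab]
      · refine integral_congr_ae ?_
        filter_upwards [ae_halfSlab_pos t] with p hp
        have hdv := (hU.axi p.1).div_merid hd2 (hU.contDiff p.1) (hU.div_free p.1) hp
        have hdv' : dR (rad (U p.1)) p.2 + dZ (axl (U p.1)) p.2 =
            -(((d : ℝ) - 2) * (rad (U p.1) p.2 / p.2.1)) := by
          unfold dR dZ; linarith
        have e := hβ' (vort (U p.1) p.2)
        rw [hdv', dR_radialCutoff hfc, dZ_radialCutoff hfc, deriv_pow_eq_div hp, hcast,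
          radialCutoff]
        have e2 : f p.2.1 * cutoff ((n : ℝ) + 1) p.2 * (2 * min (vort (U p.1) p.2) 0) *
            -(vort (U p.1) p.2 * -(((d : ℝ) - 2) * (rad (U p.1) p.2 / p.2.1))) =
            f p.2.1 * cutoff ((n : ℝ) + 1) p.2 * (2 * min (vort (U p.1) p.2) 0 *
              vort (U p.1) p.2) * (((d : ℝ) - 2) * (rad (U p.1) p.2 / p.2.1)) := by ring
        rw [e2, e]
        simp only [hf]
        field_simp
        ring
      · intro p hp
        obtain ⟨z1, z2, z3⟩ := radialCutoff_eq_zero f hn hp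
        rw [z1, z2, z3]
        ring
    have hl2 := tendsto_integral_radialCutoff hfc (mβ t) (hNi t)
    simp_rw [hid] at hl2
    have hNt : N t = _ := tendsto_nhds_unique hl2 hlim
    have hsub : Ioc 0 t ⊆ Ioc 0 t₁ := Ioc_subset_Ioc_right ht.2
    have hle : halfSlab t ≤ halfSlab t₁ := by
      rw [halfSlab, halfSlab, Measure.prod_restrict, Measure.prod_restrict]
      exact Measure.restrict_mono (prod_mono hsub le_rfl) le_rfl
    rw [hNt, hN, ← integral_halfSlab ht.1 (hNs.mono_measure hle), ← integral_const_mul]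
    refine integral_mono_ae ?_ ((hNs.mono_measure hle).const_mul _) ?_
    · refine ((hNs.mono_measure hle).const_mul (2 * ((d : ℝ) - 2) * L)).mono'
        (Measurable.aestronglyMeasurable (by fun_prop)) ?_
      filter_upwards [ae_halfSlab_pos t] with p hp
      have hp0 : 0 ≤ f p.2.1 * β (vort (U p.1) p.2) :=
        mul_nonneg (by simp only [hf]; positivity) (hβ0 _)
      rw [norm_mul, Real.norm_of_nonneg hp0, mul_comm (2 * ((d : ℝ) - 2) * L)]
      refine mul_le_mul_of_nonneg_left ?_ hp0
      rw [norm_mul, Real.norm_of_nonneg (by positivity : (0 : ℝ) ≤ 2 * ((d : ℝ) - 2))]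
      exact mul_le_mul_of_nonneg_left (hL _ _ hp) (by positivity)
    · filter_upwards [ae_halfSlab_pos t] with p hp
      have hp0 : 0 ≤ f p.2.1 * β (vort (U p.1) p.2) :=
        mul_nonneg (by simp only [hf]; positivity) (hβ0 _)
      rw [mul_comm (2 * ((d : ℝ) - 2) * L)]
      refine mul_le_mul_of_nonneg_left ?_ hp0
      exact mul_le_mul_of_nonneg_left ((le_abs_self _).trans (hL _ _ hp)) (by positivity)
  have hNA : ∀ τ, N τ ≤ A := fun τ => by
    have h1 : N τ ≤ ∫ q in {q : ℝ × ℝ | 0 < q.1}, energyDensity (U τ) q :=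
      setIntegral_mono_on (hNi τ) (hU.integrableOn_energyDensity hd τ) measurableSet_halfPlane
        fun q hq => le_energy τ q hq
    refine h1.trans ?_
    rw [integral_eq_lintegral_of_nonneg_ae]
    · exact ENNReal.toReal_le_coe_of_le_coe (hA τ)
    · filter_upwards [ae_restrict_mem measurableSet_halfPlane] with q hq
      exact energyDensity_nonneg hq
    · exact (hU.integrableOn_energyDensity hd τ).aestronglyMeasurable
  -- The same integral inequality is used p times with the same function, and (L' t)^p / p! tends to
  -- 0.
  have hfin : N t ≤ 0 := by
    have h1 : ∀ p : ℕ, N t ≤ A * (2 * ((d : ℝ) - 2) * L * t) ^ p / p.factorial := fun p =>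
      iterated_integral_bound (by positivity) p (fun _ => N) (fun _ => hNi') (fun _ _ => key)
        (fun τ _ => hNA τ) t ht
    have h2 := (FloorSemiring.tendsto_pow_div_factorial_atTop
      (2 * ((d : ℝ) - 2) * L * t)).const_mul (A : ℝ)
    rw [mul_zero] at h2
    refine ge_of_tendsto' h2 fun p => ?_
    rw [← mul_div_assoc]
    exact h1 p
  have hz : (fun q : ℝ × ℝ => f q.1 * β (vort (U t) q)) =ᵐ[volume.restrict {q | 0 < q.1}] 0 := by
    refine (setIntegral_eq_zero_iff_of_nonneg_ae ?_ (hNi t)).1 (le_antisymm hfin ?_)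
    · filter_upwards [ae_restrict_mem measurableSet_halfPlane] with q hq
      have hq : 0 < q.1 := hq
      exact mul_nonneg (by simp only [hf]; positivity) (hβ0 _)
    · refine setIntegral_nonneg measurableSet_halfPlane fun q hq => ?_
      have hq : 0 < q.1 := hq
      exact mul_nonneg (by simp only [hf]; positivity) (hβ0 _)
  -- The negative part vanishes almost everywhere, hence everywhere on the open half-plane by
  -- continuity.
  have hcont := _root_.continuous_vort (hU.contDiff t)
  have hq0 := Measure.eqOn_open_of_ae_eq hz (isOpen_lt continuous_const continuous_fst)
    (Continuous.continuousOn (by fun_prop)) continuousOn_const hq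
  have hq1 : β (vort (U t) q) = 0 := by
    have : f q.1 * β (vort (U t) q) = 0 := hq0
    rcases mul_eq_zero.1 this with h | h
    · exact absurd h (by simp only [hf]; positivity)
    · exact h
  have hq2 : min (vort (U t) q) 0 = 0 := by simpa [hβ] using hq1
  exact min_eq_right_iff.1 hq2

end IsRegularFlow

end Positivity

/-! ### The impulse bound and the mass bound at positive distance from the axis. -/

section Impulse

open Filter Topology

variable {d : ℕ} [NeZero d]

/-- The identity ω v^r = ∂_z((v^r)^2 - (v^z)^2)/2 - ∂_r(v^r v^z) + v^z (∂_r v^r + ∂_z v^z),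
integrated by parts. -/
theorem integral_mul_vort_mul_rad {v : RSpace d → RSpace d} (hv : ContDiff ℝ 1 v)
    {χ : ℝ × ℝ → ℝ} (hχ : ContDiff ℝ 1 χ) (hχc : HasCompactSupport χ) :
    ∫ q, χ q * (vort v q * rad v q) =
      ∫ q, (dZ χ q * ((axl v q ^ 2 - rad v q ^ 2) / 2) + dR χ q * (rad v q * axl v q) +
        χ q * (axl v q * (dR (rad v) q + dZ (axl v) q))) := by
  have ha := contDiff_rad hv
  have hb := contDiff_axl hv
  have hab : ContDiff ℝ 1 (rad v * axl v) := ha.mul hb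
  have haa : ContDiff ℝ 1 (rad v * rad v) := ha.mul ha
  have hbb : ContDiff ℝ 1 (axl v * axl v) := hb.mul hb
  have pr : ∀ {f g : ℝ × ℝ → ℝ}, ContDiff ℝ 1 f → ContDiff ℝ 1 g → ∀ q h,
      fderiv ℝ (f * g) q h = f q * fderiv ℝ g q h + g q * fderiv ℝ f q h := fun hf hg q h => by
    rw [fderiv_mul (hf.differentiable (by norm_num) q) (hg.differentiable (by norm_num) q)]
    simp
  have j1 := integral_mul_dZ hχ haa hχc
  have j2 := integral_mul_dZ hχ hbb hχc
  have j3 := integral_mul_dR hχ hab hχc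
  have ca := ha.continuous
  have cb := hb.continuous
  have cχ := hχ.continuous
  have c1 := continuous_dR hχ
  have c2 := continuous_dZ hχ
  have c3 := continuous_dR ha
  have c4 := continuous_dZ hb
  have c5 := continuous_dZ ha
  have c6 := continuous_dR hb
  have k1 : Integrable fun q => χ q * dZ (rad v * rad v) q :=
    (cχ.mul (continuous_dZ haa)).integrable_of_hasCompactSupport hχc.mul_right
  have k2 : Integrable fun q => χ q * dZ (axl v * axl v) q :=
    (cχ.mul (continuous_dZ hbb)).integrable_of_hasCompactSupport hχc.mul_right
  have k3 : Integrable fun q => χ q * dR (rad v * axl v) q :=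
    (cχ.mul (continuous_dR hab)).integrable_of_hasCompactSupport hχc.mul_right
  have k4 : Integrable fun q => χ q * (axl v q * (dR (rad v) q + dZ (axl v) q)) :=
    Continuous.integrable_of_hasCompactSupport (by fun_prop) hχc.mul_right
  have k5 : Integrable fun q => dZ χ q * (rad v * rad v) q :=
    Continuous.integrable_of_hasCompactSupport (by fun_prop) (hasCompactSupport_dZ hχc).mul_right
  have k6 : Integrable fun q => dZ χ q * (axl v * axl v) q :=
    Continuous.integrable_of_hasCompactSupport (by fun_prop) (hasCompactSupport_dZ hχc).mul_right
  have k7 : Integrable fun q => dR χ q * (rad v * axl v) q :=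
    Continuous.integrable_of_hasCompactSupport (by fun_prop) (hasCompactSupport_dR hχc).mul_right
  have k12 : Integrable fun q => 2⁻¹ * (χ q * dZ (rad v * rad v) q) -
      2⁻¹ * (χ q * dZ (axl v * axl v) q) := (k1.const_mul _).sub (k2.const_mul _)
  have k34 : Integrable fun q => χ q * dR (rad v * axl v) q -
      χ q * (axl v q * (dR (rad v) q + dZ (axl v) q)) := k3.sub k4
  have k56 : Integrable fun q => 2⁻¹ * (dZ χ q * (axl v * axl v) q) -
      2⁻¹ * (dZ χ q * (rad v * rad v) q) := (k6.const_mul _).sub (k5.const_mul _)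
  have k74 : Integrable fun q => dR χ q * (rad v * axl v) q +
      χ q * (axl v q * (dR (rad v) q + dZ (axl v) q)) := k7.add k4
  calc ∫ q, χ q * (vort v q * rad v q)
      = ∫ q, ((2⁻¹ * (χ q * dZ (rad v * rad v) q) - 2⁻¹ * (χ q * dZ (axl v * axl v) q)) -
          (χ q * dR (rad v * axl v) q - χ q * (axl v q * (dR (rad v) q + dZ (axl v) q)))) := by
        refine integral_congr_ae (Eventually.of_forall fun q => ?_)
        have e1 : dZ (rad v * rad v) q = _ := pr ha ha q _
        have e2 : dZ (axl v * axl v) q = _ := pr hb hb q _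
        have e3 : dR (rad v * axl v) q = _ := pr ha hb q _
        beta_reduce
        rw [e1, e2, e3, vort_eq_dZ_sub_dR hv]
        simp only [dR, dZ]
        ring
    _ = ∫ q, ((2⁻¹ * (dZ χ q * (axl v * axl v) q) - 2⁻¹ * (dZ χ q * (rad v * rad v) q)) +
          (dR χ q * (rad v * axl v) q + χ q * (axl v q * (dR (rad v) q + dZ (axl v) q)))) := by
        rw [integral_sub k12 k34, integral_sub (k1.const_mul _) (k2.const_mul _),
          integral_sub k3 k4, integral_add k56 k74,
          integral_sub (k6.const_mul _) (k5.const_mul _), integral_add k7 k4,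
          integral_const_mul, integral_const_mul, integral_const_mul, integral_const_mul, j1, j2, j3]
        ring
    _ = _ := by
        refine integral_congr_ae (Eventually.of_forall fun q => ?_)
        simp only [Pi.mul_apply]
        ring

theorem abs_mul_le_sq_add_sq (x y : ℝ) : |x * y| ≤ x ^ 2 + y ^ 2 := by
  rw [abs_mul]
  nlinarith [sq_nonneg (|x| - |y|), sq_abs x, sq_abs y, sq_nonneg x, sq_nonneg y]

namespace IsRegularFlow

variable {t₁ : ℝ} {U : ℝ → RSpace d → RSpace d}

theorem abs_weight_mul_le {v : RSpace d → RSpace d} {q : ℝ × ℝ} (hq : 0 < q.1) :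
    |q.1 ^ (d - 2) * (vort v q * rad v q)| ≤ energyDensity v q ∧
    |q.1 ^ (d - 2) * (vort v q * axl v q)| ≤ energyDensity v q ∧
    |q.1 ^ (d - 2) * ((axl v q ^ 2 - rad v q ^ 2) / 2)| ≤ energyDensity v q ∧
    |q.1 ^ (d - 2) * (rad v q / q.1 * axl v q)| ≤ energyDensity v q := by
  have h0 : 0 ≤ q.1 ^ (d - 2) := by positivity
  have h1 := sq_nonneg (rad v q)
  have h2 := sq_nonneg (axl v q)
  have h3 := sq_nonneg (vort v q)
  have h4 := sq_nonneg (rad v q / q.1)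
  unfold energyDensity
  simp_rw [abs_mul (q.1 ^ (d - 2)), abs_of_nonneg h0]
  refine ⟨mul_le_mul_of_nonneg_left ?_ h0, mul_le_mul_of_nonneg_left ?_ h0,
    mul_le_mul_of_nonneg_left ?_ h0, mul_le_mul_of_nonneg_left ?_ h0⟩
  · exact (abs_mul_le_sq_add_sq _ _).trans (by linarith)
  · exact (abs_mul_le_sq_add_sq _ _).trans (by linarith)
  · rw [abs_le]; constructor <;> linarith
  · exact (abs_mul_le_sq_add_sq _ _).trans (by linarith)

theorem integrableOn_vort_mul_rad (hd : 3 ≤ d) (hU : IsRegularFlow t₁ U) (τ : ℝ) :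
    IntegrableOn (fun q : ℝ × ℝ => q.1 ^ (d - 2) * (vort (U τ) q * rad (U τ) q))
      {q : ℝ × ℝ | 0 < q.1} := by
  have c1 := _root_.continuous_vort (hU.contDiff τ)
  have c2 := (contDiff_rad (hU.contDiff τ)).continuous
  refine (hU.integrableOn_energyDensity hd τ).mono'
    (Continuous.aestronglyMeasurable (by fun_prop)) ?_
  filter_upwards [ae_restrict_mem measurableSet_halfPlane] with q hq
  exact (abs_weight_mul_le hq).1

/-- With the weight r^(d-2), the derivative of the weight cancels the divergence term, so ω v^r
integrates to zero. The boundary terms vanish because the energy density is integrable. -/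
theorem integral_vort_mul_rad (hd : 3 ≤ d) (hU : IsRegularFlow t₁ U) (τ : ℝ) :
    ∫ q in {q : ℝ × ℝ | 0 < q.1}, q.1 ^ (d - 2) * (vort (U τ) q * rad (U τ) q) = 0 := by
  have hd2 : 2 ≤ d := by omega
  obtain ⟨D, hD⟩ := exists_bound_cutoff
  have hD0 : 0 ≤ D := (abs_nonneg _).trans (hD 1 le_rfl (1, 0) one_pos).1
  have hv := hU.contDiff τ
  have c1 := _root_.continuous_vort hv
  have c2 := (contDiff_rad hv).continuous
  have c3 := (contDiff_axl hv).continuous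
  have hfc : ContDiff ℝ 2 fun r : ℝ => r ^ (d - 2) := contDiff_id.pow _
  have hcast : ((d - 2 : ℕ) : ℝ) = (d : ℝ) - 2 := by
    rw [Nat.cast_sub hd2]; norm_num
  have h1 := tendsto_integral_radialCutoff hfc (c1.mul c2).measurable
    (hU.integrableOn_vort_mul_rad hd τ)
  refine tendsto_nhds_unique h1 ?_
  have h2 : ∀ n : ℕ, ∫ q, radialCutoff (fun r : ℝ => r ^ (d - 2)) ((n : ℝ) + 1) q *
      (vort (U τ) q * rad (U τ) q) = ∫ q in {q : ℝ × ℝ | 0 < q.1},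
      (q.1 ^ (d - 2) * ((axl (U τ) q ^ 2 - rad (U τ) q ^ 2) / 2) *
          dZ (cutoff ((n : ℝ) + 1)) q +
        q.1 ^ (d - 2) * (rad (U τ) q / q.1 * axl (U τ) q) *
          (q.1 * dR (cutoff ((n : ℝ) + 1)) q)) := by
    intro n
    have hn : (0 : ℝ) < (n : ℝ) + 1 := by positivity
    rw [integral_mul_vort_mul_rad hv ((contDiff_radialCutoff hfc _).of_le (by norm_num))
      (hasCompactSupport_radialCutoff _ hn), ← setIntegral_eq_integral_of_forall_compl_eq_zero
        (s := {q : ℝ × ℝ | 0 < q.1})]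
    · refine setIntegral_congr_fun measurableSet_halfPlane fun q hq => ?_
      have hq : 0 < q.1 := hq
      have hdv := (hU.axi τ).div_merid hd2 hv (hU.div_free τ) hq
      have hdv' : dR (rad (U τ)) q + dZ (axl (U τ)) q =
          -(((d : ℝ) - 2) * (rad (U τ) q / q.1)) := by
        unfold dR dZ; linarith
      rw [hdv', dR_radialCutoff hfc, dZ_radialCutoff hfc, deriv_pow_eq_div hq, hcast, radialCutoff]
      field_simp
      ring
    · intro q hq
      obtain ⟨z1, z2, z3⟩ := radialCutoff_eq_zero (fun r : ℝ => r ^ (d - 2)) hn hq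
      rw [z1, z2, z3]
      ring
  refine Tendsto.congr (fun n => (h2 n).symm) ?_
  rw [show 𝓝 (0 : ℝ) = 𝓝 (∫ q in {q : ℝ × ℝ | 0 < q.1}, (0 : ℝ)) by simp]
  have hE := hU.integrableOn_energyDensity hd τ
  refine tendsto_integral_of_dominated_convergence
    (fun q => energyDensity (U τ) q * D + energyDensity (U τ) q * D) (fun n => ?_)
    ((hE.mul_const D).add (hE.mul_const D)) (fun n => ?_) ?_
  · have m2 : Measurable (dR (cutoff ((n : ℝ) + 1))) :=
      (continuous_dR ((contDiff_cutoff _).of_le (by norm_num))).measurable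
    have m3 : Measurable (dZ (cutoff ((n : ℝ) + 1))) :=
      (continuous_dZ ((contDiff_cutoff _).of_le (by norm_num))).measurable
    have := c2.measurable
    have := c3.measurable
    exact Measurable.aestronglyMeasurable (by fun_prop)
  · filter_upwards [ae_restrict_mem measurableSet_halfPlane] with q hq
    have hn : (1 : ℝ) ≤ (n : ℝ) + 1 := by linarith [(Nat.cast_nonneg n : (0 : ℝ) ≤ n)]
    obtain ⟨b1, b2, -⟩ := hD _ hn q hq
    obtain ⟨-, -, e1, e2⟩ := abs_weight_mul_le (v := U τ) hq
    have hE0 := energyDensity_nonneg (v := U τ) hq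
    refine (norm_add_le _ _).trans (add_le_add ?_ ?_)
    · rw [norm_mul]
      exact mul_le_mul e1 b2 (norm_nonneg _) hE0
    · rw [norm_mul]
      exact mul_le_mul e2 b1 (norm_nonneg _) hE0
  · filter_upwards [ae_restrict_mem measurableSet_halfPlane] with q hq
    refine tendsto_const_nhds.congr' ?_
    filter_upwards [eventually_cutoff hq] with n hn
    rw [hn.2.1, hn.2.2]
    ring

/-- Formally the impulse changes at the rate (d - 1) ∬ r^(d-2) ω u^r = 0. The truncated impulses
converge to the initial impulse, and Fatou gives the inequality for the full one; no decay of ω at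
time t has to be known beforehand. -/
theorem impulse_le (hd : 3 ≤ d) (hU : IsRegularFlow t₁ U)
    (h0 : ∀ q : ℝ × ℝ, 0 < q.1 → 0 ≤ vort (U 0) q)
    (hi : IntegrableOn (fun q : ℝ × ℝ => q.1 ^ (d - 1) * vort (U 0) q) {q : ℝ × ℝ | 0 < q.1})
    {t : ℝ} (ht : t ∈ Icc 0 t₁) :
    ∫⁻ q in {q : ℝ × ℝ | 0 < q.1}, ENNReal.ofReal (q.1 ^ (d - 1) * vort (U t) q) ≤
      ENNReal.ofReal (∫ q in {q : ℝ × ℝ | 0 < q.1}, q.1 ^ (d - 1) * vort (U 0) q) := by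
  have hd2 : 2 ≤ d := by omega
  obtain ⟨D, hD⟩ := exists_bound_cutoff
  have hD0 : 0 ≤ D := (abs_nonneg _).trans (hD 1 le_rfl (1, 0) one_pos).1
  set f : ℝ → ℝ := fun r => r ^ (d - 1) with hf
  have hfc : ContDiff ℝ 2 f := contDiff_id.pow _
  have hcast : ((d - 1 : ℕ) : ℝ) = (d : ℝ) - 1 := by
    rw [Nat.cast_sub (by omega)]; norm_num
  have hd0 : (0 : ℝ) ≤ (d : ℝ) - 1 := by rw [← hcast]; positivity
  have hpow : ∀ r : ℝ, r ^ (d - 1) = r ^ (d - 2) * r := fun r => by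
    rw [← pow_succ]; congr 1; omega
  have mw := hU.measurable_vort
  have ma := hU.measurable_rad
  have mb := hU.measurable_axl
  have mE := hU.integrable_energyDensity_halfSlab hd t
  have hlim := tendsto_integral_of_dominated_convergence (μ := halfSlab t)
    (F := fun (n : ℕ) p =>
      p.2.1 ^ (d - 2) * (vort (U p.1) p.2 * rad (U p.1) p.2) *
        (((d : ℝ) - 1) * cutoff ((n : ℝ) + 1) p.2 +
          p.2.1 * dR (cutoff ((n : ℝ) + 1)) p.2) +
      p.2.1 ^ (d - 2) * (vort (U p.1) p.2 * axl (U p.1) p.2) *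
        (p.2.1 * dZ (cutoff ((n : ℝ) + 1)) p.2))
    (f := fun p => p.2.1 ^ (d - 2) * (vort (U p.1) p.2 * rad (U p.1) p.2) * ((d : ℝ) - 1))
    (fun p => energyDensity (U p.1) p.2 * (((d : ℝ) - 1) + D) + energyDensity (U p.1) p.2 * D)
    (fun n => by
      have m1 : Measurable (cutoff ((n : ℝ) + 1)) := (contDiff_cutoff _).continuous.measurable
      have m2 : Measurable (dR (cutoff ((n : ℝ) + 1))) :=
        (continuous_dR ((contDiff_cutoff _).of_le (by norm_num))).measurable
      have m3 : Measurable (dZ (cutoff ((n : ℝ) + 1))) :=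
        (continuous_dZ ((contDiff_cutoff _).of_le (by norm_num))).measurable
      exact Measurable.aestronglyMeasurable (by fun_prop))
    ((mE.mul_const _).add (mE.mul_const _))
    (fun n => by
      filter_upwards [ae_halfSlab_pos t] with p hp
      have hn : (1 : ℝ) ≤ (n : ℝ) + 1 := by linarith [(Nat.cast_nonneg n : (0 : ℝ) ≤ n)]
      obtain ⟨b1, -, b2⟩ := hD _ hn p.2 hp
      obtain ⟨e1, e2, -, -⟩ := abs_weight_mul_le (v := U p.1) hp
      have hE0 := energyDensity_nonneg (v := U p.1) hp
      refine (norm_add_le _ _).trans (add_le_add ?_ ?_)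
      · rw [norm_mul]
        refine mul_le_mul e1 ((norm_add_le _ _).trans (add_le_add ?_ b1)) (norm_nonneg _) hE0
        rw [norm_mul, Real.norm_of_nonneg hd0, Real.norm_of_nonneg (cutoff_nonneg _ _)]
        exact mul_le_of_le_one_right hd0 (cutoff_le_one _ _)
      · rw [norm_mul]
        exact mul_le_mul e2 b2 (norm_nonneg _) hE0)
    (by
      filter_upwards [ae_halfSlab_pos t] with p hp
      refine tendsto_const_nhds.congr' ?_
      filter_upwards [eventually_cutoff hp] with n hn
      rw [hn.1, hn.2.1, hn.2.2]
      ring)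
  have hzero : ∫ p, p.2.1 ^ (d - 2) * (vort (U p.1) p.2 * rad (U p.1) p.2) * ((d : ℝ) - 1)
      ∂halfSlab t = 0 := by
    rw [integral_mul_const, integral_halfSlab ht.1]
    · simp_rw [hU.integral_vort_mul_rad hd]
      simp
    · refine mE.mono' (Measurable.aestronglyMeasurable (by fun_prop)) ?_
      filter_upwards [ae_halfSlab_pos t] with p hp
      exact (abs_weight_mul_le hp).1
  rw [hzero] at hlim
  have hid : ∀ n : ℕ, (∫ q, radialCutoff f ((n : ℝ) + 1) q * vort (U t) q) -
      ∫ q, radialCutoff f ((n : ℝ) + 1) q * vort (U 0) q = ∫ p,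
      (p.2.1 ^ (d - 2) * (vort (U p.1) p.2 * rad (U p.1) p.2) *
        (((d : ℝ) - 1) * cutoff ((n : ℝ) + 1) p.2 +
          p.2.1 * dR (cutoff ((n : ℝ) + 1)) p.2) +
      p.2.1 ^ (d - 2) * (vort (U p.1) p.2 * axl (U p.1) p.2) *
        (p.2.1 * dZ (cutoff ((n : ℝ) + 1)) p.2)) ∂halfSlab t := by
    intro n
    have hn : (0 : ℝ) < (n : ℝ) + 1 := by positivity
    rw [hU.integral_vort_sub_slab hd2 (contDiff_radialCutoff hfc ((n : ℝ) + 1))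
      (hasCompactSupport_radialCutoff f hn) (tsupport_radialCutoff_subset f hn) ht,
      integral_slab_eq_halfSlab]
    · refine integral_congr_ae ?_
      filter_upwards [ae_halfSlab_pos t] with p hp
      rw [dR_radialCutoff hfc, dZ_radialCutoff hfc, deriv_pow_eq_div hp, hcast]
      simp only [hf, hpow]
      field_simp
    · intro p hp
      obtain ⟨z1, z2, z3⟩ := radialCutoff_eq_zero f hn hp
      rw [z2, z3]
      ring
  have hl0 := tendsto_integral_radialCutoff hfc
    (_root_.continuous_vort (hU.contDiff 0)).measurable hi
  have hlt : Tendsto (fun n : ℕ => ∫ q, radialCutoff f ((n : ℝ) + 1) q * vort (U t) q) atTop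
      (𝓝 (∫ q in {q : ℝ × ℝ | 0 < q.1}, q.1 ^ (d - 1) * vort (U 0) q)) := by
    have := (hlim.congr fun n => (hid n).symm).add hl0
    simpa using this
  have hw0 : ∀ q : ℝ × ℝ, 0 < q.1 → 0 ≤ vort (U t) q := fun q hq => hU.vort_nonneg hd h0 ht hq
  have cw := _root_.continuous_vort (hU.contDiff t)
  -- Nonnegativity of ω allows Fatou's lemma here.
  have hfat : ∫⁻ q in {q : ℝ × ℝ | 0 < q.1}, ENNReal.ofReal (q.1 ^ (d - 1) * vort (U t) q) ≤
      liminf (fun n : ℕ => ∫⁻ q in {q : ℝ × ℝ | 0 < q.1},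
        ENNReal.ofReal (radialCutoff f ((n : ℝ) + 1) q * vort (U t) q)) atTop := by
    refine le_trans (lintegral_mono_ae ?_) (lintegral_liminf_le fun n => ?_)
    · filter_upwards [ae_restrict_mem measurableSet_halfPlane] with q hq
      have hev : ∀ᶠ n : ℕ in atTop, ENNReal.ofReal (radialCutoff f ((n : ℝ) + 1) q *
          vort (U t) q) = ENNReal.ofReal (q.1 ^ (d - 1) * vort (U t) q) := by
        filter_upwards [eventually_cutoff hq] with n hn
        rw [radialCutoff, hn.1, mul_one]
      rw [(tendsto_const_nhds.congr' (hev.mono fun _ h => h.symm)).liminf_eq]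
    · have := (contDiff_radialCutoff hfc ((n : ℝ) + 1)).continuous
      exact (this.mul cw).measurable.ennreal_ofReal
  refine hfat.trans (le_of_eq ?_)
  refine Tendsto.liminf_eq ?_
  refine ((ENNReal.continuous_ofReal.tendsto _).comp hlt).congr fun n => ?_
  have hn : (0 : ℝ) < (n : ℝ) + 1 := by positivity
  simp only [Function.comp_apply]
  rw [← setIntegral_radialCutoff f hn, ofReal_integral_eq_lintegral_ofReal]
  · refine (Continuous.integrable_of_hasCompactSupport ?_ ?_).integrableOn
    · exact (contDiff_radialCutoff hfc ((n : ℝ) + 1)).continuous.mul cw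
    · exact (hasCompactSupport_radialCutoff f hn).mul_right
  · filter_upwards [ae_restrict_mem measurableSet_halfPlane] with q hq
    have hq : 0 < q.1 := hq
    refine mul_nonneg (mul_nonneg ?_ (cutoff_nonneg _ _)) (hw0 q hq)
    simp only [hf]; positivity

/-- Chebyshev: r^(d-1) ≥ α^(d-1) on the outer region, and ω ≥ 0. -/
theorem lintegral_outer_vort_le (hd : 3 ≤ d) (hU : IsRegularFlow t₁ U)
    (h0 : ∀ q : ℝ × ℝ, 0 < q.1 → 0 ≤ vort (U 0) q)
    (hi : IntegrableOn (fun q : ℝ × ℝ => q.1 ^ (d - 1) * vort (U 0) q) {q : ℝ × ℝ | 0 < q.1})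
    {t : ℝ} (ht : t ∈ Icc 0 t₁) {α : ℝ} (hα : 0 < α) :
    ∫⁻ q in {q : ℝ × ℝ | α ≤ q.1}, ENNReal.ofReal (vort (U t) q) ≤
      ENNReal.ofReal ((∫ q in {q : ℝ × ℝ | 0 < q.1}, q.1 ^ (d - 1) * vort (U 0) q) /
        α ^ (d - 1)) := by
  have cw := _root_.continuous_vort (hU.contDiff t)
  have hαd : 0 < α ^ (d - 1) := by positivity
  rw [ENNReal.ofReal_div_of_pos hαd, ENNReal.le_div_iff_mul_le
    (Or.inl (by simpa using hαd)) (Or.inl ENNReal.ofReal_ne_top)]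
  refine le_trans ?_ (hU.impulse_le hd h0 hi ht)
  rw [← lintegral_mul_const _ cw.measurable.ennreal_ofReal]
  refine le_trans ?_ (lintegral_mono_set (s := {q : ℝ × ℝ | α ≤ q.1}) fun q hq =>
    hα.trans_le hq)
  refine setLIntegral_mono' (measurableSet_le measurable_const measurable_fst) fun q hq => ?_
  have hq : α ≤ q.1 := hq
  have hw := hU.vort_nonneg hd h0 ht (hα.trans_le hq)
  rw [← ENNReal.ofReal_mul hw, mul_comm]
  refine ENNReal.ofReal_le_ofReal (mul_le_mul_of_nonneg_right ?_ hw)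
  gcongr

theorem integrableOn_outer_vort (hd : 3 ≤ d) (hU : IsRegularFlow t₁ U)
    (h0 : ∀ q : ℝ × ℝ, 0 < q.1 → 0 ≤ vort (U 0) q)
    (hi : IntegrableOn (fun q : ℝ × ℝ => q.1 ^ (d - 1) * vort (U 0) q) {q : ℝ × ℝ | 0 < q.1})
    {t : ℝ} (ht : t ∈ Icc 0 t₁) {α : ℝ} (hα : 0 < α) :
    IntegrableOn (vort (U t)) {q : ℝ × ℝ | α ≤ q.1} ∧
      ∫ q in {q : ℝ × ℝ | α ≤ q.1}, vort (U t) q ≤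
        (∫ q in {q : ℝ × ℝ | 0 < q.1}, q.1 ^ (d - 1) * vort (U 0) q) / α ^ (d - 1) := by
  have cw := _root_.continuous_vort (hU.contDiff t)
  have hm : MeasurableSet {q : ℝ × ℝ | α ≤ q.1} := measurableSet_le measurable_const measurable_fst
  have hle := hU.lintegral_outer_vort_le hd h0 hi ht hα
  have hnn : 0 ≤ᵐ[volume.restrict {q : ℝ × ℝ | α ≤ q.1}] vort (U t) := by
    filter_upwards [ae_restrict_mem hm] with q hq
    exact hU.vort_nonneg hd h0 ht (hα.trans_le hq)
  refine ⟨⟨cw.aestronglyMeasurable, ?_⟩, ?_⟩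
  · rw [hasFiniteIntegral_iff_ofReal hnn]
    exact hle.trans_lt ENNReal.ofReal_lt_top
  · rw [integral_eq_lintegral_of_nonneg_ae hnn cw.aestronglyMeasurable]
    refine ENNReal.toReal_le_of_le_ofReal (div_nonneg ?_ (by positivity)) hle
    exact setIntegral_nonneg measurableSet_halfPlane fun q hq => by
      have hq : 0 < q.1 := hq
      exact mul_nonneg (by positivity) (h0 q hq)

end IsRegularFlow

end Impulse

/-! ### Averages of the singular kernel over rotations about the axis. -/

section SphereKernel

open scoped Pointwise

/-- The measure of a cap is the volume of the cone over it, up to the dimension. This cone is a tube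
of width ρ around a segment of length 1, covered by about 1/ρ balls of radius 2ρ. For ρ > 1 the
whole sphere is used. -/
theorem exists_toSphere_cap_le (n : ℕ) (hn : 1 ≤ n) : ∃ C : ℝ≥0, ∀ e : RSpace n, ‖e‖ = 1 →
    ∀ ρ : ℝ, 0 < ρ → (volume : Measure (RSpace n)).toSphere
      {θ : Metric.sphere (0 : RSpace n) 1 | ‖(θ : RSpace n) - e‖ < ρ} ≤
        C * ENNReal.ofReal (ρ ^ (n - 1)) := by
  set b := volume (Metric.ball (0 : RSpace n) 1) with hb
  have hbt : b ≠ ∞ := measure_ball_lt_top.ne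
  set C₁ : ℝ≥0∞ := n * (2 * ENNReal.ofReal (2 ^ n) * b) with hC₁
  set C₂ : ℝ≥0∞ := (volume : Measure (RSpace n)).toSphere univ with hC₂
  have hC₁t : C₁ ≠ ∞ := ENNReal.mul_ne_top (by simp)
    (ENNReal.mul_ne_top (ENNReal.mul_ne_top (by simp) ENNReal.ofReal_ne_top) hbt)
  have hC₂t : C₂ ≠ ∞ := measure_ne_top _ _
  refine ⟨(C₁ + C₂).toNNReal, fun e he ρ hρ => ?_⟩
  rw [ENNReal.coe_toNNReal (ENNReal.add_ne_top.2 ⟨hC₁t, hC₂t⟩)]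
  rcases le_or_gt ρ 1 with h1 | h1
  · refine le_trans ?_ (mul_le_mul_left (le_self_add (a := C₁) (b := C₂)) _)
    have hm : MeasurableSet {θ : Metric.sphere (0 : RSpace n) 1 | ‖(θ : RSpace n) - e‖ < ρ} :=
      measurableSet_lt (by fun_prop) measurable_const
    rw [Measure.toSphere_apply' _ hm, finrank_euclideanSpace, Fintype.card_fin, hC₁, mul_assoc]
    refine mul_le_mul_right ?_ _
    -- The centres are the multiples of ρ on the axis of the cone; the point tθ lies near the
    -- multiple with index ⌊t/ρ⌋.
    have hsub : Ioo (0 : ℝ) 1 • ((↑) '' {θ : Metric.sphere (0 : RSpace n) 1 |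
        ‖(θ : RSpace n) - e‖ < ρ} : Set (RSpace n)) ⊆
        ⋃ j ∈ Finset.range (⌊1 / ρ⌋₊ + 1), Metric.ball ((j * ρ) • e) (2 * ρ) := by
      rintro y ⟨t, ht, _, ⟨θ, hθ, rfl⟩, rfl⟩
      simp only [mem_iUnion, Finset.mem_range]
      have hθ : ‖(θ : RSpace n) - e‖ < ρ := hθ
      refine ⟨⌊t / ρ⌋₊, ?_, ?_⟩
      · refine Nat.lt_succ_of_le (Nat.floor_le_floor ?_)
        exact div_le_div_of_nonneg_right ht.2.le hρ.le
      · have h2 : (⌊t / ρ⌋₊ : ℝ) * ρ ≤ t := by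
          rw [← le_div_iff₀ hρ]
          exact Nat.floor_le (div_nonneg ht.1.le hρ.le)
        have h3 : t - (⌊t / ρ⌋₊ : ℝ) * ρ ≤ ρ := by
          have := Nat.lt_floor_add_one (t / ρ)
          rw [div_lt_iff₀ hρ] at this
          linarith
        rw [mem_ball_iff_norm]
        have e1 : t • (θ : RSpace n) - ((⌊t / ρ⌋₊ : ℝ) * ρ) • e =
            t • ((θ : RSpace n) - e) + (t - (⌊t / ρ⌋₊ : ℝ) * ρ) • e := by
          rw [smul_sub, sub_smul]; abel
        change ‖t • (θ : RSpace n) - ((⌊t / ρ⌋₊ : ℝ) * ρ) • e‖ < 2 * ρ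
        rw [e1]
        refine (norm_add_le _ _).trans_lt ?_
        rw [norm_smul, norm_smul, he, Real.norm_of_nonneg ht.1.le,
          Real.norm_of_nonneg (by linarith)]
        have : t * ‖(θ : RSpace n) - e‖ < 1 * ρ :=
          mul_lt_mul'' ht.2 hθ ht.1.le (norm_nonneg _)
        linarith
    refine (measure_mono hsub).trans ((measure_biUnion_finset_le _ _).trans ?_)
    have h4 : ∀ j ∈ Finset.range (⌊1 / ρ⌋₊ + 1), volume (Metric.ball (((j : ℝ) * ρ) • e) (2 * ρ)) ≤
        ENNReal.ofReal ((2 * ρ) ^ n) * b := fun j _ => by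
      rw [Measure.addHaar_ball_of_pos _ _ (by positivity), finrank_euclideanSpace, Fintype.card_fin]
    refine (Finset.sum_le_card_nsmul _ _ _ h4).trans ?_
    rw [Finset.card_range, nsmul_eq_mul]
    have h5 : ((⌊1 / ρ⌋₊ + 1 : ℕ) : ℝ≥0∞) ≤ ENNReal.ofReal (2 / ρ) := by
      rw [← ENNReal.ofReal_natCast]
      refine ENNReal.ofReal_le_ofReal ?_
      push_cast
      have h6 : (⌊1 / ρ⌋₊ : ℝ) ≤ 1 / ρ := Nat.floor_le (by positivity)
      have h7 : 1 ≤ 1 / ρ := by rw [le_div_iff₀ hρ]; linarith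
      have h8 : 2 / ρ = 1 / ρ + 1 / ρ := by ring
      linarith
    refine (mul_le_mul_left h5 _).trans (le_of_eq ?_)
    have h9 : ENNReal.ofReal (2 / ρ) * ENNReal.ofReal ((2 * ρ) ^ n) =
        2 * ENNReal.ofReal (2 ^ n) * ENNReal.ofReal (ρ ^ (n - 1)) := by
      rw [show (2 : ℝ≥0∞) = ENNReal.ofReal 2 by simp, ← ENNReal.ofReal_mul (by positivity),
        ← ENNReal.ofReal_mul (by positivity), ← ENNReal.ofReal_mul (by positivity)]
      congr 1
      obtain ⟨m, rfl⟩ : ∃ m, n = m + 1 := ⟨n - 1, by omega⟩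
      rw [Nat.add_sub_cancel, mul_pow, pow_succ ρ m]
      field_simp
    rw [← mul_assoc, h9]
    ring
  · refine (measure_mono (subset_univ _)).trans ?_
    have h2 : (1 : ℝ≥0∞) ≤ ENNReal.ofReal (ρ ^ (n - 1)) := by
      rw [ENNReal.one_le_ofReal]
      exact one_le_pow₀ h1.le
    calc C₂ ≤ (C₁ + C₂) * 1 := by rw [mul_one]; exact le_add_self
      _ ≤ _ := mul_le_mul_right h2 _

/-- Dyadic decomposition in the size of D = |R e - s θ|, which is at least δ = |R - s|. Where D is
about 2^k δ, the point θ lies in a cap of radius about 2^k δ / s, and the contribution is a constant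
times s^(-(n-1)) 2^(-k). The numerator δ is just enough to make the series converge; without it the
bound would blow up as R → s. -/
theorem exists_sphere_integral_le (n : ℕ) (hn : 1 ≤ n) : ∃ C : ℝ≥0, ∀ e : RSpace n, ‖e‖ = 1 →
    ∀ R : ℝ, 0 ≤ R → ∀ s : ℝ, 0 < s → ∫⁻ θ : Metric.sphere (0 : RSpace n) 1,
      ENNReal.ofReal (|R - s| / ‖R • e - s • (θ : RSpace n)‖ ^ n)
        ∂(volume : Measure (RSpace n)).toSphere ≤ C * ENNReal.ofReal ((s ^ (n - 1))⁻¹) := by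
  obtain ⟨C, hC⟩ := exists_toSphere_cap_le n hn
  refine ⟨C * (2 * 4 ^ (n - 1)), fun e he R hR s hs => ?_⟩
  rcases eq_or_ne R s with rfl | hRs
  · simp
  set δ := |R - s| with hδ
  have hδ0 : 0 < δ := abs_pos.2 (sub_ne_zero.2 hRs)
  set cap : ℕ → Set (Metric.sphere (0 : RSpace n) 1) := fun k =>
    {θ | ‖(θ : RSpace n) - e‖ < 4 * 2 ^ k * δ / s} with hcap
  have hcm : ∀ k, MeasurableSet (cap k) := fun k =>
    measurableSet_lt (by fun_prop) measurable_const
  have hpt : ∀ θ : Metric.sphere (0 : RSpace n) 1,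
      ENNReal.ofReal (δ / ‖R • e - s • (θ : RSpace n)‖ ^ n) ≤
      ∑' k : ℕ, (cap k).indicator (fun _ => ENNReal.ofReal (δ / (2 ^ k * δ) ^ n)) θ := by
    intro θ
    have hθ : ‖(θ : RSpace n)‖ = 1 := by simp
    set D := ‖R • e - s • (θ : RSpace n)‖ with hD
    have hDδ : δ ≤ D := by
      have := abs_norm_sub_norm_le (R • e) (s • (θ : RSpace n))
      rwa [norm_smul, norm_smul, he, hθ, mul_one, mul_one, Real.norm_of_nonneg hR,
        Real.norm_of_nonneg hs.le] at this
    -- Moving from R e to s e costs |R - s| ≤ D.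
    have hDs : s * ‖(θ : RSpace n) - e‖ ≤ 2 * D := by
      have e1 : s • ((θ : RSpace n) - e) = -(R • e - s • (θ : RSpace n)) + (R - s) • e := by
        rw [smul_sub, sub_smul]; abel
      calc s * ‖(θ : RSpace n) - e‖ = ‖s • ((θ : RSpace n) - e)‖ := by
            rw [norm_smul, Real.norm_of_nonneg hs.le]
        _ ≤ D + δ := by
            rw [e1]
            refine (norm_add_le _ _).trans ?_
            rw [norm_neg, norm_smul, he, mul_one, Real.norm_eq_abs]
        _ ≤ 2 * D := by linarith
    obtain ⟨k, hk1, hk2⟩ := exists_nat_pow_near (x := D / δ) (y := 2)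
      (by rw [le_div_iff₀ hδ0]; linarith) one_lt_two
    rw [le_div_iff₀ hδ0] at hk1
    rw [div_lt_iff₀ hδ0] at hk2
    have hmem : θ ∈ cap k := by
      change ‖(θ : RSpace n) - e‖ < 4 * 2 ^ k * δ / s
      rw [lt_div_iff₀ hs]
      rw [pow_succ] at hk2
      linarith
    refine le_trans ?_ (ENNReal.le_tsum k)
    rw [indicator_of_mem hmem]
    refine ENNReal.ofReal_le_ofReal ?_
    gcongr
  -- The powers of δ cancel and leave a geometric series of ratio 1/2.
  have hterm : ∀ k : ℕ, δ / (2 ^ k * δ) ^ n * (4 * 2 ^ k * δ / s) ^ (n - 1) =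
      4 ^ (n - 1) * (s ^ (n - 1))⁻¹ * (1 / 2) ^ k := fun k => by
    obtain ⟨m, rfl⟩ : ∃ m, n = m + 1 := ⟨n - 1, by omega⟩
    rw [Nat.add_sub_cancel, div_pow, mul_pow, mul_pow, mul_pow, pow_succ, pow_succ, one_div, inv_pow]
    field_simp
  calc ∫⁻ θ : Metric.sphere (0 : RSpace n) 1, ENNReal.ofReal (δ / ‖R • e - s • (θ : RSpace n)‖ ^ n)
        ∂(volume : Measure (RSpace n)).toSphere
      ≤ ∫⁻ θ : Metric.sphere (0 : RSpace n) 1,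
          ∑' k : ℕ, (cap k).indicator (fun _ => ENNReal.ofReal (δ / (2 ^ k * δ) ^ n)) θ
          ∂(volume : Measure (RSpace n)).toSphere := lintegral_mono hpt
    _ = ∑' k : ℕ, ENNReal.ofReal (δ / (2 ^ k * δ) ^ n) *
          (volume : Measure (RSpace n)).toSphere (cap k) := by
        rw [lintegral_tsum fun k => (measurable_const.indicator (hcm k)).aemeasurable]
        exact tsum_congr fun k => lintegral_indicator_const (hcm k) _
    _ ≤ ∑' k : ℕ, C * ENNReal.ofReal (4 ^ (n - 1) * (s ^ (n - 1))⁻¹ * (1 / 2) ^ k) := by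
        refine ENNReal.tsum_le_tsum fun k => ?_
        refine (mul_le_mul_right (hC e he _ (by positivity)) _).trans (le_of_eq ?_)
        rw [← hterm, ENNReal.ofReal_mul (by positivity)]
        ring
    _ = _ := by
        rw [ENNReal.tsum_mul_left, ← ENNReal.ofReal_tsum_of_nonneg (fun k => by positivity)
          (summable_geometric_two.mul_left _), tsum_mul_left, tsum_geometric_two]
        push_cast
        rw [mul_assoc (C : ℝ≥0∞)]
        congr 1
        rw [show (2 * 4 ^ (n - 1) : ℝ≥0∞) = ENNReal.ofReal (2 * 4 ^ (n - 1)) by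
          rw [ENNReal.ofReal_mul (by norm_num), ENNReal.ofReal_pow (by norm_num)]; simp,
          ← ENNReal.ofReal_mul (by positivity)]
        congr 1
        ring

/-- The spherical estimate at each radius |y| = s, multiplied by f(s) and integrated. The division
by the sphere's area appears because the right side is also integrated over the sphere. -/
theorem exists_radial_integral_le (n : ℕ) (hn : 1 ≤ n) : ∃ C : ℝ≥0, ∀ x : RSpace n, 0 < ‖x‖ →
    ∀ f : ℝ → ℝ≥0∞, Measurable f →
      ∫⁻ y : RSpace n, f ‖y‖ * ENNReal.ofReal (|‖x‖ - ‖y‖| / ‖x - y‖ ^ n) ≤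
        C * ∫⁻ y : RSpace n, f ‖y‖ * ENNReal.ofReal ((‖y‖ ^ (n - 1))⁻¹) := by
  obtain ⟨C, hC⟩ := exists_sphere_integral_le n hn
  have hn0 : n ≠ 0 := by omega
  have : Nonempty (Fin n) := ⟨⟨0, by omega⟩⟩
  set σ := (volume : Measure (RSpace n)).toSphere univ with hσ
  have hσ0 : σ ≠ 0 := by
    rw [hσ, Measure.toSphere_apply_univ, finrank_euclideanSpace, Fintype.card_fin]
    exact mul_ne_zero (by exact_mod_cast hn0) (Metric.measure_ball_pos _ _ one_pos).ne'
  have hσt : σ ≠ ∞ := measure_ne_top _ _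
  refine ⟨(C / σ).toNNReal, fun x hx f hf => ?_⟩
  rw [ENNReal.coe_toNNReal (ENNReal.div_ne_top ENNReal.coe_ne_top hσ0)]
  rw [lintegral_polar hn0 (F := fun y => f ‖y‖ * ENNReal.ofReal (|‖x‖ - ‖y‖| / ‖x - y‖ ^ n))
      (by fun_prop),
    lintegral_polar hn0 (F := fun y => f ‖y‖ * ENNReal.ofReal ((‖y‖ ^ (n - 1))⁻¹)) (by fun_prop),
    ← lintegral_const_mul' _ _ (ENNReal.div_ne_top ENNReal.coe_ne_top hσ0)]
  refine setLIntegral_mono' measurableSet_Ioi fun s hs => ?_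
  have hs : 0 < s := hs
  have hns : ∀ θ : Metric.sphere (0 : RSpace n) 1, ‖s • (θ : RSpace n)‖ = s := fun θ => by
    rw [norm_smul, Real.norm_of_nonneg hs.le]; simp
  simp_rw [hns]
  rw [lintegral_const, lintegral_const_mul _ (by fun_prop), ← hσ]
  have h1 := hC (‖x‖⁻¹ • x) (by rw [norm_smul, norm_inv, norm_norm, inv_mul_cancel₀ hx.ne'])
    ‖x‖ hx.le s hs
  rw [smul_inv_smul₀ hx.ne'] at h1
  calc ENNReal.ofReal (s ^ (n - 1)) * (f s * ∫⁻ θ : Metric.sphere (0 : RSpace n) 1,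
        ENNReal.ofReal (|‖x‖ - s| / ‖x - s • (θ : RSpace n)‖ ^ n)
          ∂(volume : Measure (RSpace n)).toSphere)
      ≤ ENNReal.ofReal (s ^ (n - 1)) * (f s * (C * ENNReal.ofReal ((s ^ (n - 1))⁻¹))) := by
        gcongr
    _ = C / σ * (ENNReal.ofReal (s ^ (n - 1)) *
          (f s * ENNReal.ofReal ((s ^ (n - 1))⁻¹) * σ)) := by
        have : (C : ℝ≥0∞) = C / σ * σ := (ENNReal.div_mul_cancel hσ0 hσt).symm
        conv_lhs => rw [this]
        ring

/-- Dropping the axial separation only decreases |x - y|, and the power d - 1 is the dimension of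
the horizontal space, where the radial estimate applies on each slice. -/
theorem exists_axisymmetric_integral_le (d : ℕ) [NeZero d] (hd : 2 ≤ d) : ∃ C : ℝ≥0,
    ∀ x : RSpace d, 0 < cylRadius x → ∀ f : ℝ × ℝ → ℝ≥0∞, Measurable f →
      ∫⁻ y : RSpace d, f (cylCoord y) *
          ENNReal.ofReal (|cylRadius x - cylRadius y| / ‖x - y‖ ^ (d - 1)) ≤
        C * ∫⁻ y : RSpace d, f (cylCoord y) * ENNReal.ofReal ((cylRadius y ^ (d - 2))⁻¹) := by
  obtain ⟨n, rfl⟩ : ∃ n, d = n + 1 := ⟨d - 1, by omega⟩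
  obtain ⟨C, hC⟩ := exists_radial_integral_le n (by omega)
  refine ⟨C, fun x hx f hf => ?_⟩
  rw [cylRadius_eq_norm_horizontal] at hx
  have hh : ∀ x y : RSpace (n + 1), ‖horizontal x - horizontal y‖ ≤ ‖x - y‖ := fun x y => by
    have h1 : horizontal x - horizontal y = horizontal (x - y) := rfl
    rw [h1, ← cylRadius_eq_norm_horizontal]
    refine abs_le_of_sq_le_sq' ?_ (norm_nonneg _) |>.2
    rw [cylRadius_sq, EuclideanSpace.norm_sq_eq]
    simp only [Real.norm_eq_abs, sq_abs]
    exact Finset.sum_le_univ_sum_of_nonneg fun i => sq_nonneg _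
  have e1 : ∀ y : RSpace (n + 1), cylCoord y = (‖horizontal y‖, axialCoord y) := fun y => by
    rw [← cylRadius_eq_norm_horizontal]; rfl
  have e2 := lintegral_axialSplit (n := n) (F := fun p => f (‖p.2‖, p.1) *
    ENNReal.ofReal (|‖horizontal x‖ - ‖p.2‖| / ‖horizontal x - p.2‖ ^ n)) (by fun_prop)
  have e3 := lintegral_axialSplit (n := n) (F := fun p => f (‖p.2‖, p.1) *
    ENNReal.ofReal ((‖p.2‖ ^ (n - 1))⁻¹)) (by fun_prop)
  simp_rw [e1, cylRadius_eq_norm_horizontal]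
  rw [show n + 1 - 2 = n - 1 by omega, Nat.add_sub_cancel, e3,
    ← lintegral_const_mul' _ _ ENNReal.coe_ne_top]
  refine le_trans (lintegral_mono fun y => ?_) (e2.le.trans (lintegral_mono fun z => ?_))
  · refine mul_le_mul_right (ENNReal.ofReal_le_ofReal ?_) _
    rcases eq_or_ne (horizontal x) (horizontal y) with h | h
    · rw [h]; simp
    · have : 0 < ‖horizontal x - horizontal y‖ := norm_pos_iff.2 (sub_ne_zero.2 h)
      gcongr
      exact hh x y
  · exact hC (horizontal x) hx (fun r => f (r, z)) (by fun_prop)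

end SphereKernel

/-! ### A regularised Biot–Savart law. -/

section BiotSavart

open Filter Topology

/-- The function `t ↦ t^(-m/2)`. -/
def invSqrtPow (m : ℕ) (t : ℝ) : ℝ := (Real.sqrt t ^ m)⁻¹

theorem invSqrtPow_nonneg (m : ℕ) (t : ℝ) : 0 ≤ invSqrtPow m t := by
  unfold invSqrtPow; positivity

theorem hasDerivAt_invSqrtPow (m : ℕ) {t : ℝ} (ht : 0 < t) :
    HasDerivAt (invSqrtPow m) (-(m / 2 * invSqrtPow (m + 2) t)) t := by
  have h0 : 0 < Real.sqrt t := Real.sqrt_pos.2 ht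
  have h1 := ((Real.hasDerivAt_sqrt ht.ne').pow m).inv (pow_pos h0 m).ne'
  have h2 : HasDerivAt (invSqrtPow m) _ t := h1
  convert h2 using 1
  rw [invSqrtPow]
  rcases m with _ | m
  · simp
  · rw [Nat.add_sub_cancel]
    push_cast
    simp only [Pi.pow_apply]
    field_simp
    ring

theorem contDiffOn_invSqrtPow (m : ℕ) : ContDiffOn ℝ 1 (invSqrtPow m) (Ioi 0) := by
  intro t ht
  have ht : 0 < t := ht
  have h0 : 0 < Real.sqrt t := Real.sqrt_pos.2 ht
  exact (((Real.contDiffAt_sqrt ht.ne').pow m).inv (pow_pos h0 m).ne').contDiffWithinAt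

theorem invSqrtPow_sq (m : ℕ) {t : ℝ} (ht : 0 ≤ t) : invSqrtPow m t ^ 2 = (t ^ m)⁻¹ := by
  rw [invSqrtPow, inv_pow, ← pow_mul, mul_comm m 2, pow_mul, Real.sq_sqrt ht]

variable {d : ℕ} [NeZero d]

/-- The regularisation `(ε^2 + |x|^2)^(-m/2)` of `|x|^(-m)`. -/
def softInv (ε : ℝ) (m : ℕ) (x : RSpace d) : ℝ := invSqrtPow m (ε ^ 2 + ‖x‖ ^ 2)

/-- The regularised gradient of the Newtonian potential, up to a constant. -/
def softKernel (ε : ℝ) (i : Fin d) (x : RSpace d) : ℝ := x i * softInv ε d x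

theorem softInv_nonneg (ε : ℝ) (m : ℕ) (x : RSpace d) : 0 ≤ softInv ε m x :=
  invSqrtPow_nonneg _ _

variable {ε : ℝ}

theorem contDiff_softInv (hε : 0 < ε) (m : ℕ) : ContDiff ℝ 1 (softInv ε m : RSpace d → ℝ) := by
  refine (contDiffOn_invSqrtPow m).comp_contDiff
    (contDiff_const.add (contDiff_norm_sq ℝ)) fun x => ?_
  change 0 < ε ^ 2 + ‖x‖ ^ 2
  positivity

theorem contDiff_softKernel (hε : 0 < ε) (i : Fin d) : ContDiff ℝ 1 (softKernel ε i) :=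
  (EuclideanSpace.proj i : RSpace d →L[ℝ] ℝ).contDiff.mul (contDiff_softInv hε d)

theorem fderiv_softKernel (hε : 0 < ε) (i : Fin d) (x h : RSpace d) :
    fderiv ℝ (softKernel ε i) x h =
      h i * softInv ε d x - d * (x i * inner ℝ x h) * softInv ε (d + 2) x := by
  have hq : 0 < ε ^ 2 + ‖x‖ ^ 2 := by positivity
  have h1 := (hasDerivAt_invSqrtPow d hq).comp_hasFDerivAt x
    ((hasStrictFDerivAt_norm_sq x).hasFDerivAt.const_add (ε ^ 2))
  have h2 : HasFDerivAt (softKernel ε i) _ x :=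
    ((EuclideanSpace.proj i : RSpace d →L[ℝ] ℝ).hasFDerivAt (x := x)).mul h1
  rw [h2.fderiv]
  simp [softInv]
  ring

/-- A coordinate is at most the regularised distance, so it lowers the order of the singularity by
one. The degenerate case of zero distance is included. -/
theorem abs_apply_mul_softInv_le (m : ℕ) (i : Fin d) (x : RSpace d) :
    |x i| * softInv ε (m + 1) x ≤ softInv ε m x := by
  rcases eq_or_ne (Real.sqrt (ε ^ 2 + ‖x‖ ^ 2)) 0 with h | h
  · have h1 : ε ^ 2 + ‖x‖ ^ 2 ≤ 0 := Real.sqrt_eq_zero'.1 h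
    have h2 : ‖x‖ ^ 2 ≤ 0 := by nlinarith [sq_nonneg ε]
    have h3 : ‖x‖ = 0 := by nlinarith [norm_nonneg x, sq_nonneg ‖x‖]
    have h4 : x = 0 := norm_eq_zero.1 h3
    subst h4
    simpa using softInv_nonneg ε m 0
  · have h0 : 0 < Real.sqrt (ε ^ 2 + ‖x‖ ^ 2) := lt_of_le_of_ne (Real.sqrt_nonneg _) h.symm
    have h1 : |x i| ≤ Real.sqrt (ε ^ 2 + ‖x‖ ^ 2) :=
      (abs_coord_le_norm x i).trans (Real.le_sqrt_of_sq_le (by nlinarith [sq_nonneg ε]))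
    rw [softInv, softInv, invSqrtPow, invSqrtPow, pow_succ, mul_inv]
    calc |x i| * ((Real.sqrt (ε ^ 2 + ‖x‖ ^ 2) ^ m)⁻¹ * (Real.sqrt (ε ^ 2 + ‖x‖ ^ 2))⁻¹)
        ≤ Real.sqrt (ε ^ 2 + ‖x‖ ^ 2) *
          ((Real.sqrt (ε ^ 2 + ‖x‖ ^ 2) ^ m)⁻¹ * (Real.sqrt (ε ^ 2 + ‖x‖ ^ 2))⁻¹) := by gcongr
      _ = _ := by field_simp

theorem memLp_softInv (hε : 0 < ε) (hε1 : ε ≤ 1) {m : ℕ} (hm : d < 2 * m) :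
    MemLp (softInv ε m : RSpace d → ℝ) 2 volume := by
  rw [memLp_two_iff_integrable_sq (contDiff_softInv hε m).continuous.aestronglyMeasurable]
  have h1 : Integrable (fun x : RSpace d => (1 + ‖x‖ ^ 2) ^ (-((2 * m : ℕ) : ℝ) / 2)) :=
    integrable_rpow_neg_one_add_norm_sq (by simpa using (by exact_mod_cast hm : (d : ℝ) < (2 * m : ℕ)))
  refine (h1.const_mul ((ε ^ 2) ^ m)⁻¹).mono'
    ((contDiff_softInv hε m).continuous.pow 2).aestronglyMeasurable
    (Eventually.of_forall fun x => ?_)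
  have hq : 0 < ε ^ 2 + ‖x‖ ^ 2 := by positivity
  have e : (1 + ‖x‖ ^ 2) ^ (-((2 * m : ℕ) : ℝ) / 2) = ((1 + ‖x‖ ^ 2) ^ m)⁻¹ := by
    rw [show -((2 * m : ℕ) : ℝ) / 2 = -(m : ℝ) by push_cast; ring,
      Real.rpow_neg (by positivity), Real.rpow_natCast]
  rw [e, Real.norm_of_nonneg (sq_nonneg _), softInv, invSqrtPow_sq m hq.le, ← mul_inv, ← mul_pow]
  refine inv_anti₀ (by positivity) (pow_le_pow_left₀ (by positivity) ?_ m)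
  have : ε ^ 2 ≤ 1 := pow_le_one₀ hε.le hε1
  nlinarith [sq_nonneg ‖x‖]

theorem abs_softKernel_le (hd : 1 ≤ d) (i : Fin d) (x : RSpace d) :
    |softKernel ε i x| ≤ softInv ε (d - 1) x := by
  have := abs_apply_mul_softInv_le (ε := ε) (d - 1) i x
  rw [Nat.sub_add_cancel hd] at this
  rwa [softKernel, abs_mul, abs_of_nonneg (softInv_nonneg _ _ _)]

/-- The kernel decays like |x|^(-(d-1)), which is square integrable at infinity because 2(d - 1) > d
for d ≥ 3. -/
theorem memLp_softKernel (hd : 3 ≤ d) (hε : 0 < ε) (hε1 : ε ≤ 1) (i : Fin d) :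
    MemLp (softKernel ε i : RSpace d → ℝ) 2 volume := by
  refine (memLp_softInv (m := d - 1) hε hε1 (by omega)).of_le
    (contDiff_softKernel hε i).continuous.aestronglyMeasurable (Eventually.of_forall fun x => ?_)
  rw [Real.norm_eq_abs, Real.norm_of_nonneg (softInv_nonneg _ _ _)]
  exact abs_softKernel_le (by omega) i x

theorem memLp_fderiv_softKernel (hd : 3 ≤ d) (hε : 0 < ε) (hε1 : ε ≤ 1) (i j : Fin d) :
    MemLp (fun x : RSpace d => fderiv ℝ (softKernel ε i) x (EuclideanSpace.single j 1)) 2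
      volume := by
  refine ((memLp_softInv (d := d) (m := d) hε hε1 (by omega)).const_mul (1 + d : ℝ)).of_le
    (((contDiff_softKernel hε i).continuous_fderiv (by norm_num)).clm_apply
      continuous_const).aestronglyMeasurable (Eventually.of_forall fun x => ?_)
  rw [fderiv_softKernel hε, Real.norm_of_nonneg (mul_nonneg (by positivity) (softInv_nonneg _ _ _)),
    EuclideanSpace.inner_single_right]
  refine (norm_sub_le _ _).trans ?_
  rw [add_mul, one_mul]
  refine add_le_add ?_ ?_
  · rw [norm_mul, Real.norm_of_nonneg (softInv_nonneg ε d x)]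
    refine mul_le_mul_of_nonneg_right ?_ (softInv_nonneg ε d x)
    refine (abs_coord_le_norm (EuclideanSpace.single j (1 : ℝ)) i).trans ?_
    simp
  · have h1 := abs_apply_mul_softInv_le (ε := ε) (d + 1) i x
    have h2 := abs_apply_mul_softInv_le (ε := ε) d j x
    rw [norm_mul, norm_mul, norm_mul, Real.norm_of_nonneg (softInv_nonneg _ _ _)]
    simp only [Real.norm_eq_abs, Nat.abs_cast, conj_trivial]
    calc (d : ℝ) * (|x i| * |x j|) * softInv ε (d + 2) x
        = d * (|x j| * (|x i| * softInv ε (d + 1 + 1) x)) := by ring_nf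
      _ ≤ d * (|x j| * softInv ε (d + 1) x) := by gcongr
      _ ≤ d * softInv ε d x := by gcongr

/-- The divergence of the regularised Newtonian gradient is an approximate identity with mass
`softMass d`. -/
theorem sum_fderiv_softKernel (hε : 0 < ε) (x : RSpace d) :
    ∑ j, fderiv ℝ (softKernel ε j) x (EuclideanSpace.single j 1) =
      d * ε ^ 2 * softInv ε (d + 2) x := by
  have hq : 0 < ε ^ 2 + ‖x‖ ^ 2 := by positivity
  have h0 : 0 < Real.sqrt (ε ^ 2 + ‖x‖ ^ 2) := Real.sqrt_pos.2 hq
  have h1 : softInv ε d x = (ε ^ 2 + ‖x‖ ^ 2) * softInv ε (d + 2) x := by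
    rw [softInv, softInv, invSqrtPow, invSqrtPow, pow_add, Real.sq_sqrt hq.le]
    field_simp
  have h2 : ∀ j, fderiv ℝ (softKernel ε j) x (EuclideanSpace.single j 1) =
      softInv ε d x - d * softInv ε (d + 2) x * ‖x j‖ ^ 2 := fun j => by
    rw [fderiv_softKernel hε, EuclideanSpace.inner_single_right]
    simp
    ring
  simp_rw [h2]
  rw [Finset.sum_sub_distrib, ← Finset.mul_sum, ← EuclideanSpace.norm_sq_eq, Finset.sum_const,
    Finset.card_univ, Fintype.card_fin, nsmul_eq_mul, h1]
  ring

theorem fderiv_softKernel_comm (hε : 0 < ε) (i j : Fin d) (x : RSpace d) :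
    fderiv ℝ (softKernel ε i) x (EuclideanSpace.single j 1) =
      fderiv ℝ (softKernel ε j) x (EuclideanSpace.single i 1) := by
  rw [fderiv_softKernel hε, fderiv_softKernel hε, EuclideanSpace.inner_single_right,
    EuclideanSpace.inner_single_right]
  simp only [conj_trivial, one_mul, PiLp.single_apply]
  rcases eq_or_ne i j with rfl | h
  · rfl
  · rw [if_neg h, if_neg h.symm]; ring

theorem memLp_comp_sub_left {K : RSpace d → ℝ} (hK : MemLp K 2 volume) (x : RSpace d) :
    MemLp (fun y => K (x - y)) 2 volume :=
  hK.comp_measurePreserving (Measure.measurePreserving_sub_left volume x)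

/-- Kernel, field and their derivatives are all in L^2, so every product is integrable and no
boundary terms occur. The sign is absorbed by the reflection y ↦ x - y. -/
theorem integral_fderiv_comp_sub_mul {K u : RSpace d → ℝ} (hK : ContDiff ℝ 1 K)
    (hu : ContDiff ℝ 1 u) {h : RSpace d} (K2 : MemLp K 2 volume)
    (K2' : MemLp (fun x => fderiv ℝ K x h) 2 volume) (u2 : MemLp u 2 volume)
    (u2' : MemLp (fun x => fderiv ℝ u x h) 2 volume) (x : RSpace d) :
    ∫ y, fderiv ℝ K (x - y) h * u y = ∫ y, K (x - y) * fderiv ℝ u y h := by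
  have e : ∀ y, fderiv ℝ (fun y => K (x - y)) y h = -fderiv ℝ K (x - y) h := fun y => by
    have h1 : HasFDerivAt (fun y : RSpace d => x - y) (-ContinuousLinearMap.id ℝ (RSpace d)) y :=
      (hasFDerivAt_id y).const_sub x
    have h2 : HasFDerivAt (fun y => K (x - y)) _ y :=
      (hK.differentiable (by norm_num) (x - y)).hasFDerivAt.comp y h1
    rw [h2.fderiv]
    simp
  have i1 : Integrable fun y => fderiv ℝ K (x - y) h * u y :=
    (memLp_comp_sub_left K2' x).integrable_mul u2
  have i2 : Integrable fun y => K (x - y) * fderiv ℝ u y h :=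
    (memLp_comp_sub_left K2 x).integrable_mul u2'
  have i3 : Integrable fun y => K (x - y) * u y := (memLp_comp_sub_left K2 x).integrable_mul u2
  have i1' : Integrable fun y => fderiv ℝ (fun y => K (x - y)) y h * u y := by
    simp_rw [e, neg_mul]
    exact i1.neg
  have := integral_mul_fderiv_eq_neg_fderiv_mul_of_integrable i1' i2 i3
    (fun y _ => (hK.differentiable (by norm_num) (x - y)).comp y
      ((differentiable_const x).sub differentiable_id y))
    (fun y _ => hu.differentiable (by norm_num) y)
  rw [this]
  simp_rw [e, neg_mul]
  rw [integral_neg, neg_neg]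

/-- A divergence-free axisymmetric swirl-free field without growth at infinity. -/
structure IsTameField (v : RSpace d → RSpace d) : Prop where
  contDiff : ContDiff ℝ 1 v
  axi : IsAxisymmetricSwirlFree v
  div_free : ∀ x, divergence v x = 0
  bound : ∃ B : ℝ, ∀ x, ‖v x‖ ≤ B
  memLp : MemLp v 2 volume
  memLp_fderiv : MemLp (fun x => fderiv ℝ v x) 2 volume

namespace IsTameField

variable {v : RSpace d → RSpace d}

theorem contDiff_apply (hv : IsTameField v) (i : Fin d) : ContDiff ℝ 1 fun y => v y i :=
  (EuclideanSpace.proj i : RSpace d →L[ℝ] ℝ).contDiff.comp hv.contDiff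

theorem memLp_apply (hv : IsTameField v) (i : Fin d) : MemLp (fun y => v y i) 2 volume :=
  hv.memLp.of_le (hv.contDiff_apply i).continuous.aestronglyMeasurable
    (Eventually.of_forall fun x => PiLp.norm_apply_le (v x) i)

theorem memLp_fderiv_apply (hv : IsTameField v) (i : Fin d) (j : Fin d) :
    MemLp (fun y => fderiv ℝ (fun y => v y i) y (EuclideanSpace.single j 1)) 2 volume := by
  refine hv.memLp_fderiv.of_le (((hv.contDiff_apply i).continuous_fderiv (by norm_num)).clm_apply
    continuous_const).aestronglyMeasurable (Eventually.of_forall fun x => ?_)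
  rw [← fderiv_apply_comp (hv.contDiff.differentiable (by norm_num))]
  refine (PiLp.norm_apply_le _ i).trans ((ContinuousLinearMap.le_opNorm _ _).trans ?_)
  simp

/-- The horizontal components of the vorticity `ω e^r`. -/
theorem memLp_curl (hd : 2 ≤ d) (hv : IsTameField v) {i : Fin d} (hi : i ≠ axisIdx d) :
    MemLp (fun y => vort v (cylCoord y) * (y i / cylRadius y)) 2 volume := by
  refine ((hv.memLp_fderiv_apply i (axisIdx d)).sub (hv.memLp_fderiv_apply (axisIdx d) i)).ae_eq ?_
  filter_upwards [ae_cylRadius_pos hd] with y hy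
  rw [← hv.axi.curl_axis hv.contDiff hy hi]
  simp only [Pi.sub_apply, fderiv_apply_comp (hv.contDiff.differentiable (by norm_num))]

/-- Convolving v_i with the divergence of the kernel K gives Σ_j K_j * ∂_j v_i. Subtracting Σ_j K_j
* ∂_i v_j, which vanishes, leaves K_j against the antisymmetric gradient, of which only the axial
index j survives. -/
theorem biotSavart (hd : 3 ≤ d) (hv : IsTameField v) (hε : 0 < ε) (hε1 : ε ≤ 1) {i : Fin d}
    (hi : i ≠ axisIdx d) (x : RSpace d) :
    ∫ y, d * ε ^ 2 * softInv ε (d + 2) (x - y) * v y i =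
      ∫ y, softKernel ε (axisIdx d) (x - y) * (vort v (cylCoord y) * (y i / cylRadius y)) := by
  have hvd := hv.contDiff.differentiable (by norm_num)
  have kK := fun j => contDiff_softKernel (d := d) hε j
  have ibp : ∀ j l m : Fin d, ∫ y, fderiv ℝ (softKernel ε j) (x - y)
      (EuclideanSpace.single l 1) * v y m =
      ∫ y, softKernel ε j (x - y) * fderiv ℝ (fun y => v y m) y (EuclideanSpace.single l 1) :=
    fun j l m => integral_fderiv_comp_sub_mul (kK j) (hv.contDiff_apply m)
      (memLp_softKernel hd hε hε1 j) (memLp_fderiv_softKernel hd hε hε1 j l) (hv.memLp_apply m)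
      (hv.memLp_fderiv_apply m l) x
  have int1 : ∀ j l m : Fin d, Integrable fun y => fderiv ℝ (softKernel ε j) (x - y)
      (EuclideanSpace.single l 1) * v y m := fun j l m =>
    (memLp_comp_sub_left (memLp_fderiv_softKernel hd hε hε1 j l) x).integrable_mul
      (hv.memLp_apply m)
  have int2 : ∀ j l m : Fin d, Integrable fun y => softKernel ε j (x - y) *
      fderiv ℝ (fun y => v y m) y (EuclideanSpace.single l 1) := fun j l m =>
    (memLp_comp_sub_left (memLp_softKernel hd hε hε1 j) x).integrable_mul
      (hv.memLp_fderiv_apply m l)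
  have step1 : ∫ y, d * ε ^ 2 * softInv ε (d + 2) (x - y) * v y i =
      ∑ j, ∫ y, softKernel ε j (x - y) *
        fderiv ℝ (fun y => v y i) y (EuclideanSpace.single j 1) := by
    simp_rw [← ibp, ← sum_fderiv_softKernel hε, Finset.sum_mul]
    rw [integral_finsetSum _ fun j _ => int1 j j i]
  -- Since ∂_i K_j = ∂_j K_i, two integrations by parts turn this sum into K_i * div v = 0.
  have step2 : ∑ j, ∫ y, softKernel ε j (x - y) *
      fderiv ℝ (fun y => v y j) y (EuclideanSpace.single i 1) = 0 := by
    simp_rw [← ibp, fun j y => fderiv_softKernel_comm hε j i (x - y), ibp]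
    rw [← integral_finsetSum _ fun j _ => int2 i j j]
    refine integral_eq_zero_of_ae (Eventually.of_forall fun y => ?_)
    beta_reduce
    rw [← Finset.mul_sum]
    have : ∑ j, fderiv ℝ (fun y => v y j) y (EuclideanSpace.single j 1) = 0 := by
      rw [← hv.div_free y, divergence]
      exact Finset.sum_congr rfl fun j _ => (fderiv_apply_comp hvd _ _ _).symm
    rw [this, mul_zero]
    rfl
  rw [step1, ← sub_zero (∑ j, _), ← step2, ← Finset.sum_sub_distrib,
    Finset.sum_eq_single (axisIdx d)]
  · rw [← integral_sub (int2 _ _ _) (int2 _ _ _)]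
    refine integral_congr_ae ?_
    filter_upwards [ae_cylRadius_pos (d := d) (by omega)] with y hy
    rw [← mul_sub, ← hv.axi.curl_axis hv.contDiff hy hi, fderiv_apply_comp hvd,
      fderiv_apply_comp hvd]
  · intro j _ hj
    rw [sub_eq_zero]
    refine integral_congr_ae ?_
    filter_upwards [ae_cylRadius_pos (d := d) (by omega)] with y hy
    have := hv.axi.curl_horizontal hv.contDiff hy hi hj
    rw [fderiv_apply_comp hvd, fderiv_apply_comp hvd] at this
    rw [this]
  · simp

end IsTameField

theorem integrable_softInv (d : ℕ) [NeZero d] :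
    Integrable (softInv 1 (d + 2) : RSpace d → ℝ) := by
  have h1 : Integrable (fun x : RSpace d => (1 + ‖x‖ ^ 2) ^ (-((d + 2 : ℕ) : ℝ) / 2)) :=
    integrable_rpow_neg_one_add_norm_sq (by simp)
  refine h1.congr (Eventually.of_forall fun x => ?_)
  have hq : (0 : ℝ) ≤ 1 + ‖x‖ ^ 2 := by positivity
  beta_reduce
  rw [softInv, invSqrtPow, one_pow, Real.sqrt_eq_rpow, ← Real.rpow_mul_natCast hq, ← Real.rpow_neg hq]
  congr 1
  ring

/-- The total mass of the approximate identity `d ε^2 (ε^2 + |x|^2)^(-(d+2)/2)`. -/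
def softMass (d : ℕ) [NeZero d] : ℝ := ∫ w : RSpace d, d * softInv 1 (d + 2) w

theorem softMass_pos (d : ℕ) [NeZero d] : 0 < softMass d := by
  have hpos : ∀ w : RSpace d, 0 < d * softInv 1 (d + 2) w := fun w => by
    have hd : (0 : ℝ) < d := by exact_mod_cast NeZero.pos d
    refine mul_pos hd (inv_pos.2 (pow_pos (Real.sqrt_pos.2 ?_) _))
    positivity
  rw [softMass, integral_pos_iff_support_of_nonneg (fun w => (hpos w).le)
    ((integrable_softInv d).const_mul _)]
  have : Function.support (fun w : RSpace d => d * softInv 1 (d + 2) w) = univ :=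
    eq_univ_of_forall fun w => (hpos w).ne'
  rw [this]
  simp

theorem softInv_smul (hε : 0 < ε) (m : ℕ) (w : RSpace d) :
    softInv ε m (ε • w) = (ε ^ m)⁻¹ * softInv 1 m w := by
  have : ε ^ 2 + ‖ε • w‖ ^ 2 = ε ^ 2 * (1 ^ 2 + ‖w‖ ^ 2) := by
    rw [norm_smul, Real.norm_of_nonneg hε.le]; ring
  rw [softInv, softInv, this, invSqrtPow, invSqrtPow, Real.sqrt_mul (by positivity),
    Real.sqrt_sq hε.le, mul_pow, mul_inv]

/-- Rescaling by ε exhibits the approximate identity with a fixed profile, independent of ε. -/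
theorem integral_softInv_mul (hε : 0 < ε) (u : RSpace d → ℝ) (x : RSpace d) :
    ∫ y, d * ε ^ 2 * softInv ε (d + 2) (x - y) * u y =
      ∫ w, d * softInv 1 (d + 2) w * u (x - ε • w) := by
  have h1 : ∫ y, d * ε ^ 2 * softInv ε (d + 2) (x - y) * u y =
      ∫ y, d * ε ^ 2 * softInv ε (d + 2) y * u (x - y) := by
    rw [← integral_sub_left_eq_self _ volume x]
    simp
  have h2 := Measure.integral_comp_smul (volume : Measure (RSpace d))
    (fun y => d * ε ^ 2 * softInv ε (d + 2) y * u (x - y)) ε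
  rw [h1]
  simp_rw [softInv_smul hε] at h2
  rw [finrank_euclideanSpace, Fintype.card_fin, abs_of_pos (by positivity), smul_eq_mul] at h2
  have h3 : ∫ y, d * ε ^ 2 * softInv ε (d + 2) y * u (x - y) = ε ^ d *
      ∫ w, d * ε ^ 2 * ((ε ^ (d + 2))⁻¹ * softInv 1 (d + 2) w) * u (x - ε • w) := by
    rw [h2]
    field_simp
  rw [h3, ← integral_const_mul]
  refine integral_congr_ae (Eventually.of_forall fun w => ?_)
  beta_reduce
  rw [pow_add]
  field_simp

theorem abs_integral_softInv_mul_le (hε : 0 < ε) {u : RSpace d → ℝ} {B : ℝ} (hB : ∀ y, |u y| ≤ B)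
    (x : RSpace d) :
    |∫ y, d * ε ^ 2 * softInv ε (d + 2) (x - y) * u y| ≤ softMass d * B := by
  rw [integral_softInv_mul hε, softMass, ← integral_mul_const, ← Real.norm_eq_abs]
  refine norm_integral_le_of_norm_le (((integrable_softInv d).const_mul _).mul_const B)
    (Eventually.of_forall fun w => ?_)
  rw [norm_mul, Real.norm_of_nonneg (mul_nonneg (by positivity) (softInv_nonneg _ _ _))]
  exact mul_le_mul_of_nonneg_left (hB _) (mul_nonneg (by positivity) (softInv_nonneg _ _ _))

theorem tendsto_integral_softInv_mul {u : RSpace d → ℝ} (hu : Continuous u) {B : ℝ}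
    (hB : ∀ y, |u y| ≤ B) (x : RSpace d) :
    Tendsto (fun n : ℕ => ∫ y, d * (((n : ℝ) + 1)⁻¹) ^ 2 *
      softInv (((n : ℝ) + 1)⁻¹) (d + 2) (x - y) * u y) atTop (𝓝 (softMass d * u x)) := by
  rw [softMass, ← integral_mul_const]
  simp_rw [fun n : ℕ => integral_softInv_mul
    (show (0 : ℝ) < ((n : ℝ) + 1)⁻¹ by positivity) u x]
  have hc : Continuous (softInv 1 (d + 2) : RSpace d → ℝ) := (contDiff_softInv one_pos _).continuous
  refine tendsto_integral_of_dominated_convergence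
    (fun w => d * softInv 1 (d + 2) w * B) (fun n => ?_)
    (((integrable_softInv d).const_mul _).mul_const B) (fun n => Eventually.of_forall fun w => ?_)
    (Eventually.of_forall fun w => ?_)
  · exact Continuous.aestronglyMeasurable (by fun_prop)
  · rw [norm_mul, Real.norm_of_nonneg (mul_nonneg (by positivity) (softInv_nonneg _ _ _))]
    exact mul_le_mul_of_nonneg_left (hB _) (mul_nonneg (by positivity) (softInv_nonneg _ _ _))
  · have h : Tendsto (fun n : ℕ => x - ((n : ℝ) + 1)⁻¹ • w) atTop (𝓝 (x - (0 : ℝ) • w)) :=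
      tendsto_const_nhds.sub (tendsto_inv_natCast_succ.smul_const w)
    rw [zero_smul, sub_zero] at h
    exact ((hu.tendsto x).comp h).const_mul _

end BiotSavart

/-! ### Vorticity near the axis: cancellation under reflection. -/

section KeyEstimate

open Filter Topology

variable {d : ℕ} [NeZero d]

theorem abs_sqrt_add_sq_sub_le (ε a b : ℝ) (ha : 0 ≤ a) (hb : 0 ≤ b) :
    |Real.sqrt (ε ^ 2 + a ^ 2) - Real.sqrt (ε ^ 2 + b ^ 2)| ≤ |a - b| := by
  wlog hab : b ≤ a generalizing a b
  · rw [abs_sub_comm, abs_sub_comm a]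
    exact this b a hb ha (le_of_not_ge hab)
  have h1 : Real.sqrt (ε ^ 2 + b ^ 2) ≤ Real.sqrt (ε ^ 2 + a ^ 2) :=
    Real.sqrt_le_sqrt (by nlinarith)
  rw [abs_of_nonneg (sub_nonneg.2 h1), abs_of_nonneg (sub_nonneg.2 hab), sub_le_iff_le_add]
  have h2 : b ≤ Real.sqrt (ε ^ 2 + b ^ 2) := Real.le_sqrt_of_sq_le (by nlinarith [sq_nonneg ε])
  have h3 := Real.sq_sqrt (show 0 ≤ ε ^ 2 + b ^ 2 by positivity)
  refine Real.sqrt_le_iff.2 ⟨by linarith, ?_⟩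
  nlinarith

/-- Only the regularised distances a and b of the two points differ. Factoring a^(-d) - b^(-d) gains
|a - b| ≤ ‖p - q‖, and the common coordinate absorbs one inverse distance; the bound is free of ε.
-/
theorem abs_softKernel_sub_le {ε : ℝ} {i : Fin d} {p q : RSpace d} (h : p i = q i) {m : ℝ}
    (hm : 0 < m) (hp : m ≤ ‖p‖) (hq : m ≤ ‖q‖) :
    |softKernel ε i p - softKernel ε i q| ≤ d * ‖p - q‖ * (m ^ d)⁻¹ := by
  set a := Real.sqrt (ε ^ 2 + ‖p‖ ^ 2) with ha
  set b := Real.sqrt (ε ^ 2 + ‖q‖ ^ 2) with hb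
  have hap : ‖p‖ ≤ a := Real.le_sqrt_of_sq_le (by nlinarith [sq_nonneg ε])
  have hbq : ‖q‖ ≤ b := Real.le_sqrt_of_sq_le (by nlinarith [sq_nonneg ε])
  have hma : m ≤ a := hp.trans hap
  have hmb : m ≤ b := hq.trans hbq
  have ha0 : 0 < a := hm.trans_le hma
  have hb0 : 0 < b := hm.trans_le hmb
  have hab : |a - b| ≤ ‖p - q‖ :=
    (abs_sqrt_add_sq_sub_le ε _ _ (norm_nonneg _) (norm_nonneg _)).trans (abs_norm_sub_norm_le p q)
  have hpa : |p i| ≤ a := (abs_coord_le_norm p i).trans hap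
  have hpb : |p i| ≤ b := h ▸ (abs_coord_le_norm q i).trans hbq
  have e1 : softKernel ε i p - softKernel ε i q = p i * (a⁻¹ ^ d - b⁻¹ ^ d) := by
    rw [softKernel, softKernel, softInv, softInv, invSqrtPow, invSqrtPow, ← h, ← ha, ← hb,
      inv_pow, inv_pow]
    ring
  have e2 : |a⁻¹ - b⁻¹| = |a - b| * (a⁻¹ * b⁻¹) := by
    rw [inv_sub_inv ha0.ne' hb0.ne', abs_div, abs_of_pos (mul_pos ha0 hb0), abs_sub_comm,
      div_eq_mul_inv, mul_inv]
  have e3 := abs_pow_sub_pow_le a⁻¹ b⁻¹ d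
  rw [e2, abs_of_pos (inv_pos.2 ha0), abs_of_pos (inv_pos.2 hb0)] at e3
  have hd : d - 1 + 1 = d := Nat.sub_add_cancel (NeZero.pos d)
  have key : |p i| * ((a⁻¹ * b⁻¹) * max a⁻¹ b⁻¹ ^ (d - 1)) ≤ (m ^ d)⁻¹ := by
    have hmx : max a⁻¹ b⁻¹ ≤ m⁻¹ := max_le (inv_anti₀ hm hma) (inv_anti₀ hm hmb)
    have hmx0 : 0 ≤ max a⁻¹ b⁻¹ := le_max_of_le_left (inv_nonneg.2 ha0.le)
    have h1 : |p i| * (a⁻¹ * b⁻¹) ≤ max a⁻¹ b⁻¹ := by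
      have : |p i| * a⁻¹ ≤ 1 := by rw [← div_eq_mul_inv]; exact (div_le_one ha0).2 hpa
      calc |p i| * (a⁻¹ * b⁻¹) = (|p i| * a⁻¹) * b⁻¹ := by ring
        _ ≤ 1 * b⁻¹ := by gcongr
        _ ≤ max a⁻¹ b⁻¹ := by rw [one_mul]; exact le_max_right _ _
    calc |p i| * ((a⁻¹ * b⁻¹) * max a⁻¹ b⁻¹ ^ (d - 1))
        = |p i| * (a⁻¹ * b⁻¹) * max a⁻¹ b⁻¹ ^ (d - 1) := by ring
      _ ≤ max a⁻¹ b⁻¹ * max a⁻¹ b⁻¹ ^ (d - 1) := by gcongr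
      _ = max a⁻¹ b⁻¹ ^ d := by rw [← pow_succ', hd]
      _ ≤ m⁻¹ ^ d := by gcongr
      _ = _ := inv_pow _ _
  rw [e1, abs_mul]
  calc |p i| * |a⁻¹ ^ d - b⁻¹ ^ d|
      ≤ |p i| * (|a - b| * (a⁻¹ * b⁻¹) * d * max a⁻¹ b⁻¹ ^ (d - 1)) := by gcongr
    _ = d * |a - b| * (|p i| * ((a⁻¹ * b⁻¹) * max a⁻¹ b⁻¹ ^ (d - 1))) := by ring
    _ ≤ d * ‖p - q‖ * (m ^ d)⁻¹ := by gcongr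

theorem abs_cylRadius_sub_le (x y : RSpace d) : |cylRadius x - cylRadius y| ≤ ‖x - y‖ := by
  obtain ⟨n, rfl⟩ : ∃ n, d = n + 1 := ⟨d - 1, (Nat.sub_add_cancel (NeZero.pos d)).symm⟩
  rw [cylRadius_eq_norm_horizontal, cylRadius_eq_norm_horizontal]
  refine (abs_norm_sub_norm_le _ _).trans ?_
  have h1 : horizontal x - horizontal y = horizontal (x - y) := rfl
  rw [h1, ← cylRadius_eq_norm_horizontal]
  refine abs_le_of_sq_le_sq' ?_ (norm_nonneg _) |>.2
  rw [cylRadius_sq, EuclideanSpace.norm_sq_eq]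
  simp only [Real.norm_eq_abs, sq_abs]
  exact Finset.sum_le_univ_sum_of_nonneg fun i => sq_nonneg _

variable (d) in
/-- The reflection across the axis. -/
def axisReflection : RSpace d ≃ₗᵢ[ℝ] RSpace d :=
  (ℝ ∙ (EuclideanSpace.single (axisIdx d) (1 : ℝ) : RSpace d)).reflection

theorem axisReflection_apply (y : RSpace d) (i : Fin d) :
    axisReflection d y i = if i = axisIdx d then y i else -y i := by
  rw [axisReflection, Submodule.reflection_singleton_apply, EuclideanSpace.inner_single_left]
  by_cases h : i = axisIdx d
  · subst h; simp; ring
  · simp [h]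

theorem cylRadius_axisReflection (y : RSpace d) :
    cylRadius (axisReflection d y) = cylRadius y := by
  rw [cylRadius, cylRadius]
  congr 1
  refine Finset.sum_congr rfl fun i hi => ?_
  rw [axisReflection_apply, if_neg (Finset.ne_of_mem_erase hi), neg_sq]

theorem cylCoord_axisReflection (y : RSpace d) : cylCoord (axisReflection d y) = cylCoord y := by
  refine Prod.ext (cylRadius_axisReflection y) ?_
  change axisReflection d y (axisIdx d) = y (axisIdx d)
  rw [axisReflection_apply, if_pos rfl]

theorem norm_sub_axisReflection (y : RSpace d) : ‖y - axisReflection d y‖ = 2 * cylRadius y := by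
  have h : ‖y - axisReflection d y‖ ^ 2 = (2 * cylRadius y) ^ 2 := by
    rw [EuclideanSpace.norm_sq_eq, ← Finset.add_sum_erase _ _ (Finset.mem_univ (axisIdx d)),
      mul_pow, cylRadius_sq, Finset.mul_sum]
    have h1 : (y - axisReflection d y) (axisIdx d) = 0 := by
      rw [PiLp.sub_apply, axisReflection_apply, if_pos rfl, sub_self]
    rw [h1, norm_zero, zero_pow two_ne_zero, zero_add]
    refine Finset.sum_congr rfl fun i hi => ?_
    rw [PiLp.sub_apply, axisReflection_apply, if_neg (Finset.ne_of_mem_erase hi),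
      Real.norm_eq_abs, sq_abs]
    ring
  exact (pow_left_inj₀ (norm_nonneg _) (mul_nonneg zero_le_two (cylRadius_nonneg _))
    two_ne_zero).1 h

theorem abs_div_cylRadius_le (x : RSpace d) {i : Fin d} (hi : i ≠ axisIdx d) :
    |x i / cylRadius x| ≤ 1 := by
  rw [abs_div, abs_of_nonneg (cylRadius_nonneg x)]
  refine div_le_one_of_le₀ ?_ (cylRadius_nonneg x)
  refine Real.le_sqrt_of_sq_le ?_
  rw [sq_abs]
  exact Finset.single_le_sum (f := fun i => x i ^ 2) (fun i _ => sq_nonneg _)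
    (Finset.mem_erase.2 ⟨hi, Finset.mem_univ _⟩)

theorem measurable_cylRadius : Measurable (cylRadius : RSpace d → ℝ) :=
  (continuous_fst.comp (continuous_cylCoord d)).measurable

theorem measurableSet_outer (α : ℝ) : MeasurableSet {x : RSpace d | α ≤ cylRadius x} :=
  measurableSet_le measurable_const measurable_cylRadius

theorem softInv_le_inv_pow (ε : ℝ) (m : ℕ) {x : RSpace d} (hx : x ≠ 0) :
    softInv ε m x ≤ (‖x‖ ^ m)⁻¹ := by
  have h : ‖x‖ ≤ Real.sqrt (ε ^ 2 + ‖x‖ ^ 2) := Real.le_sqrt_of_sq_le (by nlinarith [sq_nonneg ε])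
  have h0 : 0 < ‖x‖ := norm_pos_iff.2 hx
  rw [softInv, invSqrtPow]
  gcongr

theorem softInv_le_const {ε : ℝ} (hε : 0 < ε) (m : ℕ) (x : RSpace d) :
    softInv ε m x ≤ (ε ^ m)⁻¹ := by
  have h : ε ≤ Real.sqrt (ε ^ 2 + ‖x‖ ^ 2) := Real.le_sqrt_of_sq_le (by nlinarith [sq_nonneg ‖x‖])
  rw [softInv, invSqrtPow]
  gcongr

theorem softKernel_neg (ε : ℝ) (i : Fin d) (x : RSpace d) :
    softKernel ε i (-x) = -softKernel ε i x := by
  rw [softKernel, softKernel, softInv, softInv, norm_neg, PiLp.neg_apply, neg_mul]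

/-- A tame field with non-negative vorticity of finite impulse. -/
structure IsPositiveTameField (v : RSpace d → RSpace d) : Prop extends IsTameField v where
  nonneg : ∀ q : ℝ × ℝ, 0 ≤ q.1 → 0 ≤ vort v q
  impulse : Integrable fun x : RSpace d => cylRadius x * vort v (cylCoord x)

namespace IsPositiveTameField

variable {v : RSpace d → RSpace d}

theorem nonneg_cylCoord (hv : IsPositiveTameField v) (x : RSpace d) : 0 ≤ vort v (cylCoord x) :=
  hv.nonneg _ (cylRadius_nonneg x)

theorem continuous_vort_cylCoord (hv : IsPositiveTameField v) :
    Continuous fun x : RSpace d => vort v (cylCoord x) :=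
  (continuous_vort hv.contDiff).comp (continuous_cylCoord d)

theorem integrableOn_outer (hv : IsPositiveTameField v) {α : ℝ} (hα : 0 < α) :
    IntegrableOn (fun x : RSpace d => vort v (cylCoord x)) {x | α ≤ cylRadius x} := by
  refine (hv.impulse.integrableOn.const_mul α⁻¹).mono'
    hv.continuous_vort_cylCoord.aestronglyMeasurable ?_
  filter_upwards [ae_restrict_mem (measurableSet_outer α)] with x hx
  have hx : α ≤ cylRadius x := hx
  rw [Real.norm_of_nonneg (hv.nonneg_cylCoord x), ← mul_assoc]
  refine le_mul_of_one_le_left (hv.nonneg_cylCoord x) ?_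
  rw [inv_mul_eq_div]
  exact (one_le_div hα).2 hx

theorem abs_curl_le (hv : IsPositiveTameField v) {i : Fin d} (hi : i ≠ axisIdx d) (x : RSpace d) :
    |vort v (cylCoord x) * (x i / cylRadius x)| ≤ vort v (cylCoord x) := by
  rw [abs_mul, abs_of_nonneg (hv.nonneg_cylCoord x)]
  exact mul_le_of_le_one_right (hv.nonneg_cylCoord x) (abs_div_cylRadius_le x hi)

theorem measurable_curl (hv : IsPositiveTameField v) (i : Fin d) :
    Measurable fun x : RSpace d => vort v (cylCoord x) * (x i / cylRadius x) := by
  have := hv.continuous_vort_cylCoord.measurable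
  have := measurable_cylRadius (d := d)
  fun_prop

/-- The contribution of the vorticity near the axis to the velocity away from it. -/
theorem abs_far_integral_le (hd : 3 ≤ d) (hv : IsPositiveTameField v) {ε : ℝ} (hε : 0 < ε)
    (hε1 : ε ≤ 1) {i : Fin d} (hi : i ≠ axisIdx d) {δ : ℝ} (hδ : 0 < δ) {x : RSpace d}
    (hx : 2 * δ ≤ cylRadius x) :
    |∫ y in {y : RSpace d | δ ≤ cylRadius y}ᶜ, softKernel ε (axisIdx d) (x - y) *
        (vort v (cylCoord y) * (y i / cylRadius y))| ≤
      d * (δ ^ d)⁻¹ * ∫ y : RSpace d, cylRadius y * vort v (cylCoord y) := by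
  set s : Set (RSpace d) := {y | δ ≤ cylRadius y}ᶜ with hs
  have hsm : MeasurableSet s := (measurableSet_outer δ).compl
  set F : RSpace d → ℝ := fun y => softKernel ε (axisIdx d) (x - y) *
    (vort v (cylCoord y) * (y i / cylRadius y)) with hF
  have hFi : Integrable F :=
    (memLp_comp_sub_left (memLp_softKernel hd hε hε1 (axisIdx d)) x).integrable_mul
      (hv.memLp_curl (by omega) hi)
  set σ := axisReflection d with hσ
  have hmp : MeasurePreserving σ volume volume := σ.measurePreserving
  have hme : MeasurableEmbedding σ := σ.toHomeomorph.measurableEmbedding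
  have hpre : σ ⁻¹' s = s := by
    ext y
    simp only [hs, mem_preimage, mem_compl_iff, mem_ofPred_eq, hσ, cylRadius_axisReflection]
  have hsw : ∫ y in s, F (σ y) = ∫ y in s, F y := by
    have := hmp.setIntegral_preimage_emb hme F s
    rwa [hpre] at this
  have hFσ : IntegrableOn (fun y => F (σ y)) s := (hmp.integrable_comp_of_integrable hFi).integrableOn
  -- The reflection preserves the region and flips the horizontal direction e^r, so averaging with
  -- it produces a difference of kernels.
  have h2 : 2 * ∫ y in s, F y = ∫ y in s, (F y + F (σ y)) := by
    rw [integral_add hFi.integrableOn hFσ, hsw]; ring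
  have hb : |∫ y in s, (F y + F (σ y))| ≤
      ∫ y in s, d * 2 * (δ ^ d)⁻¹ * (cylRadius y * vort v (cylCoord y)) := by
    rw [← Real.norm_eq_abs]
    refine norm_integral_le_of_norm_le (hv.impulse.integrableOn.const_mul _) ?_
    filter_upwards [ae_restrict_mem hsm] with y hy
    have hy : cylRadius y < δ := not_le.1 hy
    have e1 : F y + F (σ y) = (softKernel ε (axisIdx d) (x - y) -
        softKernel ε (axisIdx d) (x - σ y)) * (vort v (cylCoord y) * (y i / cylRadius y)) := by
      simp only [hF, hσ, cylCoord_axisReflection, cylRadius_axisReflection]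
      rw [axisReflection_apply y i, if_neg hi]
      ring
    -- Since r_x ≥ 2δ and r_y < δ. The reflected point has the same radius, so it obeys the same
    -- bound.
    have b1 : δ ≤ ‖x - y‖ := by
      have := (le_abs_self _).trans (abs_cylRadius_sub_le x y)
      linarith
    have b2 : δ ≤ ‖x - σ y‖ := by
      have := (le_abs_self _).trans (abs_cylRadius_sub_le x (σ y))
      rw [hσ, cylRadius_axisReflection] at this
      linarith
    have b3 := abs_softKernel_sub_le (ε := ε) (i := axisIdx d) (p := x - y) (q := x - σ y)
      (by rw [PiLp.sub_apply, PiLp.sub_apply, hσ, axisReflection_apply, if_pos rfl]) hδ b1 b2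
    -- The two reflected points are 2 r_y apart, which supplies the weight of the impulse.
    rw [sub_sub_sub_cancel_left, norm_sub_rev, hσ, norm_sub_axisReflection] at b3
    rw [e1, norm_mul]
    calc ‖softKernel ε (axisIdx d) (x - y) - softKernel ε (axisIdx d) (x - σ y)‖ *
          ‖vort v (cylCoord y) * (y i / cylRadius y)‖
        ≤ (d * (2 * cylRadius y) * (δ ^ d)⁻¹) * vort v (cylCoord y) :=
          mul_le_mul b3 (hv.abs_curl_le hi y) (norm_nonneg _)
            (mul_nonneg (mul_nonneg (Nat.cast_nonneg _)
              (mul_nonneg zero_le_two (cylRadius_nonneg _))) (by positivity))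
      _ = _ := by ring
  have hc : ∫ y in s, d * 2 * (δ ^ d)⁻¹ * (cylRadius y * vort v (cylCoord y)) ≤
      2 * (d * (δ ^ d)⁻¹ * ∫ y : RSpace d, cylRadius y * vort v (cylCoord y)) := by
    rw [integral_const_mul]
    have := setIntegral_le_integral (s := s) hv.impulse (Eventually.of_forall fun y =>
      mul_nonneg (cylRadius_nonneg y) (hv.nonneg_cylCoord y))
    calc d * 2 * (δ ^ d)⁻¹ * ∫ y in s, cylRadius y * vort v (cylCoord y)
        ≤ d * 2 * (δ ^ d)⁻¹ * ∫ y : RSpace d, cylRadius y * vort v (cylCoord y) := by gcongr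
      _ = _ := by ring
  rw [← h2, abs_mul, abs_of_pos (two_pos : (0 : ℝ) < 2)] at hb
  linarith

end IsPositiveTameField

end KeyEstimate

/-! ### Vorticity away from the axis: antisymmetry of the kernel. -/

section KeyBound

open Filter Topology

variable {d : ℕ} [NeZero d]

/-- On r_y ≥ δ the weight r_y^(-(d-2)) = r_y^(-(d-1)) r_y is at most δ^(-(d-1)) r_y, so the kernel
average is controlled by the impulse. -/
theorem lintegral_near_kernel_le {C : ℝ≥0} (hC : ∀ x : RSpace d, 0 < cylRadius x →
    ∀ f : ℝ × ℝ → ℝ≥0∞, Measurable f → ∫⁻ y : RSpace d, f (cylCoord y) *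
      ENNReal.ofReal (|cylRadius x - cylRadius y| / ‖x - y‖ ^ (d - 1)) ≤
        C * ∫⁻ y : RSpace d, f (cylCoord y) * ENNReal.ofReal ((cylRadius y ^ (d - 2))⁻¹))
    (hd : 3 ≤ d) {v : RSpace d → RSpace d} (hv : IsPositiveTameField v) {δ : ℝ} (hδ : 0 < δ)
    {x : RSpace d} (hx : 0 < cylRadius x) :
    ∫⁻ y in {y : RSpace d | δ ≤ cylRadius y}, ENNReal.ofReal (vort v (cylCoord y)) *
      ENNReal.ofReal (|cylRadius x - cylRadius y| / ‖x - y‖ ^ (d - 1)) ≤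
      C * ENNReal.ofReal ((δ ^ (d - 1))⁻¹ * ∫ y : RSpace d, cylRadius y * vort v (cylCoord y)) := by
  have hmw := (continuous_vort hv.contDiff).measurable
  have hms : MeasurableSet {q : ℝ × ℝ | δ ≤ q.1} := measurableSet_le measurable_const measurable_fst
  have h1 := hC x hx ({q : ℝ × ℝ | δ ≤ q.1}.indicator fun q => ENNReal.ofReal (vort v q))
    (hmw.ennreal_ofReal.indicator hms)
  rw [← lintegral_indicator (measurableSet_outer δ)]
  refine le_trans (le_of_eq ?_) (h1.trans ?_)
  · refine lintegral_congr fun y => ?_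
    by_cases hy : δ ≤ cylRadius y
    · rw [indicator_of_mem (show y ∈ {y : RSpace d | δ ≤ cylRadius y} from hy),
        indicator_of_mem (show cylCoord y ∈ {q : ℝ × ℝ | δ ≤ q.1} from hy)]
    · rw [indicator_of_notMem (show y ∉ {y : RSpace d | δ ≤ cylRadius y} from hy),
        indicator_of_notMem (show cylCoord y ∉ {q : ℝ × ℝ | δ ≤ q.1} from hy), zero_mul]
  · refine mul_le_mul_right ?_ _
    rw [← integral_const_mul, ofReal_integral_eq_lintegral_ofReal (hv.impulse.const_mul _)
      (Eventually.of_forall fun y => mul_nonneg (by positivity)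
        (mul_nonneg (cylRadius_nonneg y) (hv.nonneg_cylCoord y)))]
    refine lintegral_mono fun y => ?_
    by_cases hy : δ ≤ cylRadius y
    · rw [indicator_of_mem (show cylCoord y ∈ {q : ℝ × ℝ | δ ≤ q.1} from hy),
        ← ENNReal.ofReal_mul (hv.nonneg_cylCoord y)]
      refine ENNReal.ofReal_le_ofReal ?_
      have hy0 : 0 < cylRadius y := hδ.trans_le hy
      have e : (cylRadius y ^ (d - 2))⁻¹ = (cylRadius y ^ (d - 1))⁻¹ * cylRadius y := by
        rw [show d - 1 = d - 2 + 1 by omega, pow_succ, mul_inv]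
        field_simp
      calc vort v (cylCoord y) * (cylRadius y ^ (d - 2))⁻¹
          = (cylRadius y ^ (d - 1))⁻¹ * (cylRadius y * vort v (cylCoord y)) := by rw [e]; ring
        _ ≤ (δ ^ (d - 1))⁻¹ * (cylRadius y * vort v (cylCoord y)) := by
            have := hv.nonneg_cylCoord y
            gcongr
    · rw [indicator_of_notMem (show cylCoord y ∉ {q : ℝ × ℝ | δ ≤ q.1} from hy), zero_mul]
      exact zero_le

/-- Exchanging x and y changes the sign of the kernel, so the double integral J is half of one with
g(r_x) - g(r_y). The Lipschitz bound makes the kernel |r_x - r_y| / |x - y|^(d-1), whose average is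
bounded. As g lives on the shell, one of the two points lies there, which produces the factor of
shell mass. The Lipschitz bound is needed only for radii at least δ, where both points lie. -/
theorem abs_near_integral_le {C : ℝ≥0} (hC : ∀ x : RSpace d, 0 < cylRadius x →
    ∀ f : ℝ × ℝ → ℝ≥0∞, Measurable f → ∫⁻ y : RSpace d, f (cylCoord y) *
      ENNReal.ofReal (|cylRadius x - cylRadius y| / ‖x - y‖ ^ (d - 1)) ≤
        C * ∫⁻ y : RSpace d, f (cylCoord y) * ENNReal.ofReal ((cylRadius y ^ (d - 2))⁻¹))
    (hd : 3 ≤ d) {v : RSpace d → RSpace d} (hv : IsPositiveTameField v) {ε : ℝ} (hε : 0 < ε)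
    {i : Fin d} (hi : i ≠ axisIdx d) {δ α : ℝ} (hδ : 0 < δ) (hδα : δ ≤ α) {g : ℝ → ℝ}
    (hg : Measurable g) {S Λ : ℝ} (hΛ : 0 ≤ Λ) (hgS : ∀ s, |g s| ≤ S)
    (hgL : ∀ s s', δ ≤ s → δ ≤ s' → |g s - g s'| ≤ Λ * |s - s'|) {β : ℝ} (hg0 : ∀ s ∉ Icc α β, g s = 0) :
    Integrable (fun x : RSpace d => g (cylRadius x) *
      (vort v (cylCoord x) * (x i / cylRadius x) *
        ∫ y in {y : RSpace d | δ ≤ cylRadius y}, softKernel ε (axisIdx d) (x - y) *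
          (vort v (cylCoord y) * (y i / cylRadius y)))) ∧
    |∫ x : RSpace d, g (cylRadius x) * (vort v (cylCoord x) * (x i / cylRadius x) *
      ∫ y in {y : RSpace d | δ ≤ cylRadius y}, softKernel ε (axisIdx d) (x - y) *
        (vort v (cylCoord y) * (y i / cylRadius y)))| ≤
      Λ * C * ((δ ^ (d - 1))⁻¹ * ∫ y : RSpace d, cylRadius y * vort v (cylCoord y)) *
        ∫ x in {x : RSpace d | cylRadius x ∈ Icc α β}, vort v (cylCoord x) := by
  set N : Set (RSpace d) := {y : RSpace d | δ ≤ cylRadius y} with hN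
  set A : Set (RSpace d) := {x : RSpace d | cylRadius x ∈ Icc α β} with hA
  set ν := (volume : Measure (RSpace d)).restrict N with hν
  set W : RSpace d → ℝ := fun x => vort v (cylCoord x) * (x i / cylRadius x) with hWd
  set k : RSpace d → ℝ := softKernel ε (axisIdx d) with hk
  set P := ∫ y : RSpace d, cylRadius y * vort v (cylCoord y) with hP
  set m := ∫ x in A, vort v (cylCoord x) with hm
  have mR := measurable_cylRadius (d := d)
  have mw := hv.continuous_vort_cylCoord.measurable
  have mW : Measurable W := hv.measurable_curl i
  have mA : MeasurableSet A := mR measurableSet_Icc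
  have kc : Continuous k := (contDiff_softKernel hε _).continuous
  have hW : Integrable W ν := (hv.integrableOn_outer hδ).mono' mW.aestronglyMeasurable
    (Eventually.of_forall fun x => hv.abs_curl_le hi x)
  -- For fixed ε the kernel is bounded, which suffices for integrability; the final bound does not
  -- involve ε.
  have hWW : Integrable (fun p : RSpace d × RSpace d => W p.1 * W p.2 * k (p.1 - p.2))
      (ν.prod ν) :=
    (hW.mul_prod hW).mul_bdd (c := (ε ^ (d - 1))⁻¹)
      (kc.comp (continuous_fst.sub continuous_snd)).aestronglyMeasurable
      (Eventually.of_forall fun p => (abs_softKernel_le (by omega) _ _).trans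
        (softInv_le_const hε _ _))
  have hH1 : Integrable (fun p : RSpace d × RSpace d => g (cylRadius p.1) *
      (W p.1 * W p.2 * k (p.1 - p.2))) (ν.prod ν) :=
    hWW.bdd_mul (c := S) (hg.comp (mR.comp measurable_fst)).aestronglyMeasurable
      (Eventually.of_forall fun p => hgS _)
  have hH2 : Integrable (fun p : RSpace d × RSpace d => g (cylRadius p.2) *
      (W p.1 * W p.2 * k (p.1 - p.2))) (ν.prod ν) :=
    hWW.bdd_mul (c := S) (hg.comp (mR.comp measurable_snd)).aestronglyMeasurable
      (Eventually.of_forall fun p => hgS _)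
  have hinner : ∀ x, ∫ y, g (cylRadius x) * (W x * W y * k (x - y)) ∂ν =
      g (cylRadius x) * (W x * ∫ y in N, k (x - y) * W y) := fun x => by
    rw [integral_const_mul, ← integral_const_mul (W x)]
    congr 1
    refine integral_congr_ae (Eventually.of_forall fun y => ?_)
    beta_reduce
    ring
  have hoff : ∀ x ∉ N, g (cylRadius x) * (W x * ∫ y in N, k (x - y) * W y) = 0 := fun x hx => by
    rw [hg0 _ fun h => hx (hδα.trans h.1), zero_mul]
  have hint : Integrable (fun x => g (cylRadius x) * (W x * ∫ y in N, k (x - y) * W y)) := by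
    have h1 := hH1.integral_prod_left
    simp only [hinner] at h1
    have h2 : IntegrableOn (fun x => g (cylRadius x) * (W x * ∫ y in N, k (x - y) * W y)) N := h1
    exact integrableOn_univ.1 (h2.of_forall_sdiff_eq_zero MeasurableSet.univ fun x hx => hoff x hx.2)
  refine ⟨hint, ?_⟩
  set J := ∫ x, g (cylRadius x) * (W x * ∫ y in N, k (x - y) * W y) with hJ
  have hJ1 : J = ∫ p, g (cylRadius p.1) * (W p.1 * W p.2 * k (p.1 - p.2)) ∂ν.prod ν := by
    rw [integral_prod _ hH1]
    simp only [hinner]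
    rw [hν, setIntegral_eq_integral_of_forall_compl_eq_zero hoff]
  have hJ2 : ∫ p, g (cylRadius p.2) * (W p.1 * W p.2 * k (p.1 - p.2)) ∂ν.prod ν = -J := by
    rw [hJ1, ← integral_prod_swap, ← integral_neg]
    refine integral_congr_ae (Eventually.of_forall fun p => ?_)
    simp only [Prod.fst_swap, Prod.snd_swap]
    have : k (p.2 - p.1) = -k (p.1 - p.2) := by
      rw [← neg_sub, hk, softKernel_neg]
    rw [this]
    ring
  have h2J : 2 * J = ∫ p, (g (cylRadius p.1) * (W p.1 * W p.2 * k (p.1 - p.2)) -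
      g (cylRadius p.2) * (W p.1 * W p.2 * k (p.1 - p.2))) ∂ν.prod ν := by
    rw [integral_sub hH1 hH2, hJ2, ← hJ1]; ring
  -- The contribution of the pairs whose first point lies in the shell; the other pairs are obtained
  -- by exchanging the points.
  set T : RSpace d × RSpace d → ℝ≥0∞ := fun p => A.indicator (fun _ => ENNReal.ofReal Λ) p.1 *
    (ENNReal.ofReal (vort v (cylCoord p.1)) * (ENNReal.ofReal (vort v (cylCoord p.2)) *
      ENNReal.ofReal (|cylRadius p.1 - cylRadius p.2| / ‖p.1 - p.2‖ ^ (d - 1)))) with hT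
  have mT : Measurable T := by
    refine ((measurable_const.indicator (mA)).comp measurable_fst).mul ?_
    refine (mw.comp measurable_fst).ennreal_ofReal.mul
      ((mw.comp measurable_snd).ennreal_ofReal.mul (Measurable.ennreal_ofReal ?_))
    have h1 := ((mR.comp measurable_fst).sub (mR.comp (measurable_snd (α := RSpace d)))).norm
    exact h1.div ((measurable_fst.sub measurable_snd).norm.pow_const _)
  have hTle : ∫⁻ p, T p ∂ν.prod ν ≤ ENNReal.ofReal (Λ * C * ((δ ^ (d - 1))⁻¹ * P) * m) := by
    have hP0 : 0 ≤ P := integral_nonneg fun y =>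
      mul_nonneg (cylRadius_nonneg y) (hv.nonneg_cylCoord y)
    have hmE : ENNReal.ofReal m = ∫⁻ x in A, ENNReal.ofReal (vort v (cylCoord x)) :=
      ofReal_integral_eq_lintegral_ofReal ((hv.integrableOn_outer hδ).mono_set fun x hx => hδα.trans hx.1)
        (Eventually.of_forall fun x => hv.nonneg_cylCoord x)
    rw [lintegral_prod _ mT.aemeasurable]
    calc ∫⁻ x, ∫⁻ y, T (x, y) ∂ν ∂ν
        ≤ ∫⁻ x, A.indicator (fun x => ENNReal.ofReal (vort v (cylCoord x))) x *
            (ENNReal.ofReal Λ * (C * ENNReal.ofReal ((δ ^ (d - 1))⁻¹ * P))) ∂ν := by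
          refine lintegral_mono_ae ?_
          filter_upwards [ae_restrict_mem (measurableSet_outer δ)] with x hx
          have hx0 : 0 < cylRadius x := hδ.trans_le hx
          simp only [hT]
          rw [lintegral_const_mul _ (by fun_prop), lintegral_const_mul _ (by fun_prop)]
          by_cases hxA : x ∈ A
          · rw [indicator_of_mem hxA, indicator_of_mem hxA]
            calc ENNReal.ofReal Λ * (ENNReal.ofReal (vort v (cylCoord x)) *
                  ∫⁻ y, ENNReal.ofReal (vort v (cylCoord y)) *
                    ENNReal.ofReal (|cylRadius x - cylRadius y| / ‖x - y‖ ^ (d - 1)) ∂ν)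
                ≤ ENNReal.ofReal Λ * (ENNReal.ofReal (vort v (cylCoord x)) *
                  (C * ENNReal.ofReal ((δ ^ (d - 1))⁻¹ * P))) := by
                  gcongr
                  exact lintegral_near_kernel_le hC hd hv hδ hx0
              _ = _ := by ring
          · rw [indicator_of_notMem hxA, indicator_of_notMem hxA, zero_mul, zero_mul]
      _ ≤ ENNReal.ofReal m * (ENNReal.ofReal Λ * (C * ENNReal.ofReal ((δ ^ (d - 1))⁻¹ * P))) := by
          rw [lintegral_mul_const _ (mw.ennreal_ofReal.indicator (mA)), hmE,
            ← lintegral_indicator (mA)]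
          gcongr
          exact Measure.restrict_le_self
      _ = _ := by
          have hm0 : 0 ≤ m := integral_nonneg fun x => hv.nonneg_cylCoord x
          rw [← ENNReal.ofReal_coe_nnreal, ← ENNReal.ofReal_mul (NNReal.coe_nonneg _),
            ← ENNReal.ofReal_mul hΛ, ← ENNReal.ofReal_mul hm0]
          congr 1
          ring
  have hpt : ∀ᵐ p ∂ν.prod ν, ‖g (cylRadius p.1) * (W p.1 * W p.2 * k (p.1 - p.2)) -
      g (cylRadius p.2) * (W p.1 * W p.2 * k (p.1 - p.2))‖ₑ ≤ T p + T p.swap := by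
    rw [hν, Measure.prod_restrict]
    filter_upwards [ae_restrict_mem ((measurableSet_outer δ).prod (measurableSet_outer δ))] with p hp
    have hp1 : δ ≤ cylRadius p.1 := hp.1
    have hp2 : δ ≤ cylRadius p.2 := hp.2
    rw [← sub_mul]
    by_cases hR : cylRadius p.1 = cylRadius p.2
    · rw [hR, sub_self, zero_mul, enorm_zero]
      exact zero_le
    have hne : p.1 - p.2 ≠ 0 := sub_ne_zero.2 fun h => hR (by rw [h])
    have hn0 : 0 < ‖p.1 - p.2‖ := norm_pos_iff.2 hne
    have w1 := hv.nonneg_cylCoord p.1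
    have w2 := hv.nonneg_cylCoord p.2
    have hb : |(g (cylRadius p.1) - g (cylRadius p.2)) * (W p.1 * W p.2 * k (p.1 - p.2))| ≤
        Λ * (vort v (cylCoord p.1) * (vort v (cylCoord p.2) *
          (|cylRadius p.1 - cylRadius p.2| / ‖p.1 - p.2‖ ^ (d - 1)))) := by
      rw [abs_mul, abs_mul, abs_mul]
      calc |g (cylRadius p.1) - g (cylRadius p.2)| * (|W p.1| * |W p.2| * |k (p.1 - p.2)|)
          ≤ (Λ * |cylRadius p.1 - cylRadius p.2|) * (vort v (cylCoord p.1) *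
              vort v (cylCoord p.2) * (‖p.1 - p.2‖ ^ (d - 1))⁻¹) := by
            gcongr
            · exact hgL _ _ hp1 hp2
            · exact hv.abs_curl_le hi p.1
            · exact hv.abs_curl_le hi p.2
            · exact (abs_softKernel_le (by omega) _ _).trans (softInv_le_inv_pow ε _ hne)
        _ = _ := by rw [div_eq_mul_inv]; ring
    have hq0 : 0 ≤ |cylRadius p.1 - cylRadius p.2| / ‖p.1 - p.2‖ ^ (d - 1) := by positivity
    have hb2 : ‖(g (cylRadius p.1) - g (cylRadius p.2)) * (W p.1 * W p.2 * k (p.1 - p.2))‖ₑ ≤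
        ENNReal.ofReal Λ * (ENNReal.ofReal (vort v (cylCoord p.1)) *
          (ENNReal.ofReal (vort v (cylCoord p.2)) *
          ENNReal.ofReal (|cylRadius p.1 - cylRadius p.2| / ‖p.1 - p.2‖ ^ (d - 1)))) := by
      rw [← ENNReal.ofReal_mul w2, ← ENNReal.ofReal_mul w1, ← ENNReal.ofReal_mul hΛ,
        Real.enorm_eq_ofReal_abs]
      exact ENNReal.ofReal_le_ofReal hb
    by_cases h1 : cylRadius p.1 ∈ Icc α β
    · refine le_trans (hb2.trans (le_of_eq ?_)) le_self_add
      simp only [hT]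
      rw [indicator_of_mem (show p.1 ∈ A from h1)]
    by_cases h2 : cylRadius p.2 ∈ Icc α β
    · refine le_trans (hb2.trans (le_of_eq ?_)) le_add_self
      simp only [hT, Prod.fst_swap, Prod.snd_swap]
      rw [indicator_of_mem (show p.2 ∈ A from h2), abs_sub_comm, norm_sub_rev]
      ring
    · rw [hg0 _ h1, hg0 _ h2, sub_self, zero_mul, enorm_zero]
      exact zero_le
  have hfin : ENNReal.ofReal |2 * J| ≤
      ENNReal.ofReal (2 * (Λ * C * ((δ ^ (d - 1))⁻¹ * P) * m)) := by
    rw [← Real.enorm_eq_ofReal_abs, h2J]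
    refine (enorm_integral_le_lintegral_enorm _).trans ((lintegral_mono_ae hpt).trans ?_)
    rw [lintegral_add_left mT, lintegral_prod_swap, ← two_mul, ENNReal.ofReal_mul (by norm_num)]
    simpa using mul_le_mul_right hTle 2
  have hR0 : 0 ≤ 2 * (Λ * C * ((δ ^ (d - 1))⁻¹ * P) * m) := by
    have hP0 : 0 ≤ P := integral_nonneg fun y =>
      mul_nonneg (cylRadius_nonneg y) (hv.nonneg_cylCoord y)
    have hm0 : 0 ≤ m := integral_nonneg fun x => hv.nonneg_cylCoord x
    positivity
  have := (ENNReal.ofReal_le_ofReal_iff hR0).1 hfin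
  rw [abs_mul, abs_of_pos (two_pos : (0 : ℝ) < 2)] at this
  linarith

end KeyBound

/-! ### Passing to the limit in the regularisation: the flux of vorticity through a shell. -/

section VelocityBound

open Filter Topology

variable {d : ℕ} [NeZero d]

theorem measurable_integral_softInv_mul {ε : ℝ} (hε : 0 < ε) {u : RSpace d → ℝ}
    (hu : Continuous u) :
    Measurable fun x => ∫ y, d * ε ^ 2 * softInv ε (d + 2) (x - y) * u y := by
  have hc : Continuous (softInv ε (d + 2) : RSpace d → ℝ) := (contDiff_softInv hε _).continuous
  refine (StronglyMeasurable.integral_prod_right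
    (f := fun x y => d * ε ^ 2 * softInv ε (d + 2) (x - y) * u y) ?_).measurable
  refine Continuous.stronglyMeasurable ?_
  unfold Function.uncurry
  fun_prop

namespace IsPositiveTameField

variable {v : RSpace d → RSpace d}

/-- The component v_i is the limit of its convolutions, to which the regularised Biot–Savart law
applies. The near and far bounds are uniform in ε and survive the limit. -/
theorem abs_integral_vort_mul_apply_le {C : ℝ≥0} (hC : ∀ x : RSpace d, 0 < cylRadius x →
    ∀ f : ℝ × ℝ → ℝ≥0∞, Measurable f → ∫⁻ y : RSpace d, f (cylCoord y) *
      ENNReal.ofReal (|cylRadius x - cylRadius y| / ‖x - y‖ ^ (d - 1)) ≤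
        C * ∫⁻ y : RSpace d, f (cylCoord y) * ENNReal.ofReal ((cylRadius y ^ (d - 2))⁻¹))
    (hd : 3 ≤ d) (hv : IsPositiveTameField v) {i : Fin d} (hi : i ≠ axisIdx d) {δ α β : ℝ}
    (hδ : 0 < δ) (hδα : 2 * δ ≤ α) {g : ℝ → ℝ}
    (hg : Measurable g) {S Λ : ℝ} (hΛ : 0 ≤ Λ) (hgS : ∀ s, |g s| ≤ S)
    (hgL : ∀ s s', δ ≤ s → δ ≤ s' → |g s - g s'| ≤ Λ * |s - s'|) (hg0 : ∀ s ∉ Icc α β, g s = 0) :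
    Integrable (fun x : RSpace d => g (cylRadius x) *
      (vort v (cylCoord x) * (x i / cylRadius x) * v x i)) ∧
    softMass d * |∫ x : RSpace d, g (cylRadius x) *
      (vort v (cylCoord x) * (x i / cylRadius x) * v x i)| ≤
      (Λ * C * (δ ^ (d - 1))⁻¹ + S * (d * (δ ^ d)⁻¹)) *
        (∫ y : RSpace d, cylRadius y * vort v (cylCoord y)) *
        ∫ x in {x : RSpace d | cylRadius x ∈ Icc α β}, vort v (cylCoord x) := by
  obtain ⟨B, hB⟩ := hv.bound
  have hB' : ∀ y, |v y i| ≤ B := fun y => (PiLp.norm_apply_le (v y) i).trans (hB y)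
  have hB0 : 0 ≤ B := (norm_nonneg _).trans (hB 0)
  have hS0 : 0 ≤ S := (abs_nonneg _).trans (hgS 0)
  set A : Set (RSpace d) := {x : RSpace d | cylRadius x ∈ Icc α β} with hA
  set W : RSpace d → ℝ := fun x => vort v (cylCoord x) * (x i / cylRadius x) with hWd
  set P := ∫ y : RSpace d, cylRadius y * vort v (cylCoord y) with hP
  set m := ∫ x in A, vort v (cylCoord x) with hm
  have mR := measurable_cylRadius (d := d)
  have mA : MeasurableSet A := mR measurableSet_Icc
  have mW : Measurable W := hv.measurable_curl i
  have mgR : Measurable fun x : RSpace d => g (cylRadius x) := hg.comp mR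
  have hwA : IntegrableOn (fun x : RSpace d => vort v (cylCoord x)) A :=
    (hv.integrableOn_outer hδ).mono_set fun x hx => (by linarith [hx.1] : δ ≤ cylRadius x)
  -- A single domination for all integrands: everything vanishes off the shell, where ω is
  -- integrable.
  have hdom : ∀ {c X : ℝ} (x : RSpace d), 0 ≤ c → (x ∈ A → |X| ≤ c) →
      |g (cylRadius x) * (W x * X)| ≤ A.indicator (fun x => S * c * vort v (cylCoord x)) x := by
    intro c X x hc hX
    by_cases hx : x ∈ A
    · rw [indicator_of_mem hx, abs_mul, abs_mul]
      calc |g (cylRadius x)| * (|W x| * |X|) ≤ S * (vort v (cylCoord x) * c) := by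
            have := hv.nonneg_cylCoord x
            gcongr
            · exact hgS _
            · exact hv.abs_curl_le hi x
            · exact hX hx
        _ = _ := by ring
    · rw [indicator_of_notMem hx, hg0 _ hx, zero_mul, abs_zero]
  have hdomi : ∀ c : ℝ, Integrable (A.indicator fun x => S * c * vort v (cylCoord x)) :=
    fun c => (integrable_indicator_iff mA).2 (hwA.const_mul _)
  have hcont : Continuous fun x => v x i := (hv.contDiff_apply i).continuous
  refine ⟨(hdomi B).mono' (mgR.mul (mW.mul hcont.measurable)).aestronglyMeasurable
    (Eventually.of_forall fun x => hdom x hB0 fun _ => hB' x), ?_⟩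
  have hsm := softMass_pos d
  set e : ℕ → ℝ := fun n => ((n : ℝ) + 1)⁻¹ with he
  have he0 : ∀ n, 0 < e n := fun n => by rw [he]; positivity
  have he1 : ∀ n, e n ≤ 1 := fun n => inv_le_one_of_one_le₀ (by simp)
  set V : ℕ → RSpace d → ℝ := fun n x =>
    ∫ y, d * e n ^ 2 * softInv (e n) (d + 2) (x - y) * v y i with hV
  have mV : ∀ n, Measurable (V n) := fun n => measurable_integral_softInv_mul (he0 n) hcont
  have hVb : ∀ n x, |V n x| ≤ softMass d * B := fun n x =>
    abs_integral_softInv_mul_le (he0 n) hB' x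
  have hVint : ∀ n, Integrable fun x => g (cylRadius x) * (W x * V n x) := fun n =>
    (hdomi (softMass d * B)).mono' (mgR.mul (mW.mul (mV n))).aestronglyMeasurable
      (Eventually.of_forall fun x => hdom x (mul_nonneg hsm.le hB0) fun _ => hVb n x)
  have hlim : Tendsto (fun n => ∫ x, g (cylRadius x) * (W x * V n x)) atTop
      (𝓝 (∫ x, g (cylRadius x) * (W x * (softMass d * v x i)))) := by
    refine tendsto_integral_of_dominated_convergence _
      (fun n => (mgR.mul (mW.mul (mV n))).aestronglyMeasurable) (hdomi (softMass d * B))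
      (fun n => Eventually.of_forall fun x => hdom x (mul_nonneg hsm.le hB0) fun _ => hVb n x)
      (Eventually.of_forall fun x => ?_)
    exact ((tendsto_integral_softInv_mul hcont hB' x).const_mul _).const_mul _
  have hlim' : ∫ x, g (cylRadius x) * (W x * (softMass d * v x i)) =
      softMass d * ∫ x, g (cylRadius x) * (W x * v x i) := by
    rw [← integral_const_mul]
    refine integral_congr_ae (Eventually.of_forall fun x => ?_)
    beta_reduce
    ring
  have hP0 : 0 ≤ P := integral_nonneg fun y =>
    mul_nonneg (cylRadius_nonneg y) (hv.nonneg_cylCoord y)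
  have hbd : ∀ n, |∫ x, g (cylRadius x) * (W x * V n x)| ≤
      (Λ * C * (δ ^ (d - 1))⁻¹ + S * (d * (δ ^ d)⁻¹)) * P * m := by
    intro n
    set N : Set (RSpace d) := {y : RSpace d | δ ≤ cylRadius y} with hN
    set F : RSpace d → RSpace d → ℝ := fun x y => softKernel (e n) (axisIdx d) (x - y) * W y with hF
    have hFi : ∀ x, Integrable (F x) := fun x =>
      (memLp_comp_sub_left (memLp_softKernel hd (he0 n) (he1 n) (axisIdx d)) x).integrable_mul
        (hv.memLp_curl (by omega) hi)
    -- Near and far refer to the distance of y from the axis; x itself is at distance at least 2δ.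
    have hsplit : ∀ x, V n x = (∫ y in N, F x y) + ∫ y in Nᶜ, F x y := fun x => by
      rw [integral_add_compl (measurableSet_outer δ) (hFi x)]
      exact hv.biotSavart hd (he0 n) (he1 n) hi x
    obtain ⟨n1, n2⟩ := abs_near_integral_le hC hd hv (he0 n) hi hδ (by linarith) hg hΛ hgS hgL hg0
    have f1 : Integrable fun x => g (cylRadius x) * (W x * ∫ y in Nᶜ, F x y) := by
      refine ((hVint n).sub n1).congr (Eventually.of_forall fun x => ?_)
      simp only [Pi.sub_apply]
      rw [hsplit x]
      ring
    have f2 : |∫ x, g (cylRadius x) * (W x * ∫ y in Nᶜ, F x y)| ≤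
        S * (d * (δ ^ d)⁻¹ * P) * m := by
      rw [hm, ← integral_const_mul, ← integral_indicator mA, ← Real.norm_eq_abs]
      refine norm_integral_le_of_norm_le (hdomi _) (Eventually.of_forall fun x => ?_)
      exact hdom x (by positivity) fun hx =>
        hv.abs_far_integral_le hd (he0 n) (he1 n) hi hδ (hδα.trans hx.1)
    have hsum : ∫ x, g (cylRadius x) * (W x * V n x) =
        (∫ x, g (cylRadius x) * (W x * ∫ y in N, F x y)) +
          ∫ x, g (cylRadius x) * (W x * ∫ y in Nᶜ, F x y) := by
      rw [← integral_add n1 f1]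
      refine integral_congr_ae (Eventually.of_forall fun x => ?_)
      beta_reduce
      rw [hsplit x]
      ring
    rw [hsum]
    refine (abs_add_le _ _).trans ((add_le_add n2 f2).trans (le_of_eq ?_))
    ring
  rw [hlim'] at hlim
  have := le_of_tendsto hlim.abs (Eventually.of_forall hbd)
  rwa [abs_mul, abs_of_pos hsm] at this

/-- The antisymmetry of the Biot–Savart kernel bounds the radial transport of vorticity. -/
theorem abs_integral_vort_mul_rad_le {C : ℝ≥0} (hC : ∀ x : RSpace d, 0 < cylRadius x →
    ∀ f : ℝ × ℝ → ℝ≥0∞, Measurable f → ∫⁻ y : RSpace d, f (cylCoord y) *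
      ENNReal.ofReal (|cylRadius x - cylRadius y| / ‖x - y‖ ^ (d - 1)) ≤
        C * ∫⁻ y : RSpace d, f (cylCoord y) * ENNReal.ofReal ((cylRadius y ^ (d - 2))⁻¹))
    (hd : 3 ≤ d) (hv : IsPositiveTameField v) {δ α β : ℝ}
    (hδ : 0 < δ) (hδα : 2 * δ ≤ α) {g : ℝ → ℝ}
    (hg : Measurable g) {S Λ : ℝ} (hΛ : 0 ≤ Λ) (hgS : ∀ s, |g s| ≤ S)
    (hgL : ∀ s s', δ ≤ s → δ ≤ s' → |g s - g s'| ≤ Λ * |s - s'|) (hg0 : ∀ s ∉ Icc α β, g s = 0) :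
    softMass d * |∫ x : RSpace d, g (cylRadius x) *
      (vort v (cylCoord x) * rad v (cylCoord x))| ≤
      d * ((Λ * C * (δ ^ (d - 1))⁻¹ + S * (d * (δ ^ d)⁻¹)) *
        (∫ y : RSpace d, cylRadius y * vort v (cylCoord y)) *
        ∫ x in {x : RSpace d | cylRadius x ∈ Icc α β}, vort v (cylCoord x)) := by
  have key := fun (i : Fin d) (hi : i ∈ Finset.univ.erase (axisIdx d)) =>
    hv.abs_integral_vort_mul_apply_le hC hd (Finset.ne_of_mem_erase hi) hδ hδα hg hΛ hgS hgL hg0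
  have hS0 : 0 ≤ S := (abs_nonneg _).trans (hgS 0)
  set Q := (Λ * C * (δ ^ (d - 1))⁻¹ + S * (d * (δ ^ d)⁻¹)) *
        (∫ y : RSpace d, cylRadius y * vort v (cylCoord y)) *
        ∫ x in {x : RSpace d | cylRadius x ∈ Icc α β}, vort v (cylCoord x) with hQ
  have hQ0 : 0 ≤ Q := by
    have hP0 : 0 ≤ ∫ y : RSpace d, cylRadius y * vort v (cylCoord y) := integral_nonneg fun y =>
      mul_nonneg (cylRadius_nonneg y) (hv.nonneg_cylCoord y)
    have hm0 : 0 ≤ ∫ x in {x : RSpace d | cylRadius x ∈ Icc α β}, vort v (cylCoord x) :=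
      integral_nonneg fun x => hv.nonneg_cylCoord x
    positivity
  -- The radial velocity is the sum of (x_i / r) v_i over the horizontal indices.
  have hsum : ∫ x : RSpace d, g (cylRadius x) * (vort v (cylCoord x) * rad v (cylCoord x)) =
      ∑ i ∈ Finset.univ.erase (axisIdx d), ∫ x : RSpace d, g (cylRadius x) *
        (vort v (cylCoord x) * (x i / cylRadius x) * v x i) := by
    rw [← integral_finsetSum _ fun i hi => (key i hi).1]
    refine integral_congr_ae ?_
    filter_upwards [ae_cylRadius_pos (d := d) (by omega)] with x hx
    rw [← Finset.mul_sum]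
    congr 1
    have : ∀ i ∈ Finset.univ.erase (axisIdx d), vort v (cylCoord x) * (x i / cylRadius x) * v x i =
        vort v (cylCoord x) * rad v (cylCoord x) * (x i / cylRadius x) ^ 2 := fun i hi => by
      rw [hv.axi.apply x (Finset.ne_of_mem_erase hi)]
      ring
    rw [Finset.sum_congr rfl this, ← Finset.mul_sum, sum_div_cylRadius_sq hx, mul_one]
  rw [hsum]
  have hs := (softMass_pos d).le
  calc softMass d * |∑ i ∈ Finset.univ.erase (axisIdx d), ∫ x : RSpace d, g (cylRadius x) *
        (vort v (cylCoord x) * (x i / cylRadius x) * v x i)|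
      ≤ softMass d * ∑ i ∈ Finset.univ.erase (axisIdx d), |∫ x : RSpace d, g (cylRadius x) *
        (vort v (cylCoord x) * (x i / cylRadius x) * v x i)| := by
        gcongr
        exact Finset.abs_sum_le_sum_abs _ _
    _ ≤ ∑ i ∈ Finset.univ.erase (axisIdx d), Q := by
        rw [Finset.mul_sum]
        exact Finset.sum_le_sum fun i hi => (key i hi).2
    _ ≤ d * Q := by
        rw [Finset.sum_const, nsmul_eq_mul]
        gcongr
        exact (Finset.card_erase_le).trans (by simp)

end IsPositiveTameField

end VelocityBound

/-! ### Radial steps and the transport bound for one shell. -/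

section RadialStep

open Filter Topology

theorem exists_bound_deriv_deriv_ramp :
    ∃ D, ∀ x y, |deriv ramp x - deriv ramp y| ≤ D * |x - y| := by
  have h2 : ContDiff ℝ 2 ramp := contDiff_ramp (n := 2)
  have h1 : ContDiff ℝ 1 (deriv ramp) :=
    (contDiff_succ_iff_deriv (n := 1) (f := ramp)).1 (by rw [one_add_one_eq_two]; exact h2) |>.2.2
  obtain ⟨D, hD⟩ := exists_bound_deriv h1 fun x hx => by
    rcases lt_abs.1 hx with h | h
    · exact deriv_eq_zero_of_eqOn isOpen_Ioi (fun _ h => deriv_ramp_of_gt h) h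
    · exact deriv_eq_zero_of_eqOn isOpen_Iio (fun _ h => deriv_ramp_of_lt h)
        (show x < 1 by linarith)
  refine ⟨D, fun x y => ?_⟩
  exact Convex.norm_image_sub_le_of_norm_deriv_le (𝕜 := ℝ) (f := deriv ramp) (s := univ)
    (fun z _ => h1.differentiable (by norm_num) z) (fun z _ => (hD z).1) convex_univ
    (mem_univ y) (mem_univ x)

/-- A smooth function which vanishes on `s ≤ α` and is `1` on `s ≥ α + h`. -/
def radialStep (α h s : ℝ) : ℝ := ramp (1 + (s - α) / h)

variable {α h : ℝ}

theorem contDiff_radialStep {n : ℕ∞} (α h : ℝ) : ContDiff ℝ n (radialStep α h) :=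
  contDiff_ramp.comp (contDiff_const.add ((contDiff_id.sub contDiff_const).div_const h))

theorem radialStep_nonneg (α h s : ℝ) : 0 ≤ radialStep α h s := ramp_nonneg _

theorem radialStep_le_one (α h s : ℝ) : radialStep α h s ≤ 1 := ramp_le_one _

theorem radialStep_of_le (hh : 0 < h) {s : ℝ} (hs : s ≤ α) : radialStep α h s = 0 := by
  refine ramp_of_le ?_
  have : (s - α) / h ≤ 0 := div_nonpos_of_nonpos_of_nonneg (by linarith) hh.le
  linarith

theorem radialStep_of_ge (hh : 0 < h) {s : ℝ} (hs : α + h ≤ s) : radialStep α h s = 1 := by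
  refine ramp_of_ge ?_
  have : 1 ≤ (s - α) / h := (one_le_div hh).2 (by linarith)
  linarith

theorem deriv_radialStep (α h s : ℝ) :
    deriv (radialStep α h) s = deriv ramp (1 + (s - α) / h) / h := by
  have h1 : HasDerivAt (fun s : ℝ => 1 + (s - α) / h) (1 / h) s :=
    (((hasDerivAt_id s).sub_const α).div_const h).const_add 1
  have h2 := (((contDiff_ramp (n := 1)).differentiable (by norm_num)
    (1 + (s - α) / h)).hasDerivAt.comp s h1).deriv
  rw [show radialStep α h = ramp ∘ fun s : ℝ => 1 + (s - α) / h from rfl, h2]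
  ring

theorem deriv_radialStep_of_notMem (hh : 0 < h) {s : ℝ} (hs : s ∉ Icc α (α + h)) :
    deriv (radialStep α h) s = 0 := by
  by_cases h1 : s < α
  · exact deriv_eq_zero_of_eqOn isOpen_Iio (fun _ h => radialStep_of_le hh (le_of_lt h)) h1
  · have h2 : α + h < s := not_le.1 fun h2 => hs ⟨not_lt.1 h1, h2⟩
    exact deriv_eq_zero_of_eqOn isOpen_Ioi (fun _ h => radialStep_of_ge hh (le_of_lt h)) h2

theorem exists_bound_deriv_radialStep : ∃ D : ℝ, 0 ≤ D ∧ ∀ α h : ℝ, 0 < h →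
    (∀ s, |deriv (radialStep α h) s| ≤ D / h) ∧
    ∀ s s', |deriv (radialStep α h) s - deriv (radialStep α h) s'| ≤ D / h ^ 2 * |s - s'| := by
  obtain ⟨D₁, h₁⟩ := exists_bound_deriv_ramp
  obtain ⟨D₂, h₂⟩ := exists_bound_deriv_deriv_ramp
  refine ⟨max D₁ D₂, le_max_of_le_left ((abs_nonneg _).trans (h₁ 0).1), fun α h hh => ⟨fun s => ?_,
    fun s s' => ?_⟩⟩
  · rw [deriv_radialStep, abs_div, abs_of_pos hh]
    gcongr
    exact (h₁ _).1.trans (le_max_left _ _)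
  · rw [deriv_radialStep, deriv_radialStep, ← sub_div, abs_div, abs_of_pos hh]
    have e : 1 + (s - α) / h - (1 + (s' - α) / h) = (s - s') / h := by ring
    have := h₂ (1 + (s - α) / h) (1 + (s' - α) / h)
    rw [e, abs_div, abs_of_pos hh] at this
    calc |deriv ramp (1 + (s - α) / h) - deriv ramp (1 + (s' - α) / h)| / h
        ≤ (max D₁ D₂ * (|s - s'| / h)) / h := by
          gcongr
          refine this.trans ?_
          gcongr
          exact le_max_right _ _
      _ = _ := by field_simp

/-- Lipschitz estimate for a quotient by a power, for radii bounded below by δ. -/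
theorem abs_div_pow_sub_div_pow_le {a a' A L s s' δ : ℝ} (k : ℕ) (hδ : 0 < δ) (hs : δ ≤ s)
    (hs' : δ ≤ s') (ha : |a'| ≤ A) (hL : |a - a'| ≤ L * |s - s'|) :
    |a / s ^ k - a' / s' ^ k| ≤ (L + A * k * δ⁻¹) * (δ ^ k)⁻¹ * |s - s'| := by
  have hs0 : 0 < s := hδ.trans_le hs
  have hs0' : 0 < s' := hδ.trans_le hs'
  have e : a / s ^ k - a' / s' ^ k = (a - a') * s⁻¹ ^ k + a' * (s⁻¹ ^ k - s'⁻¹ ^ k) := by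
    rw [inv_pow, inv_pow]; ring
  have i1 : s⁻¹ ≤ δ⁻¹ := inv_anti₀ hδ hs
  have i2 : s'⁻¹ ≤ δ⁻¹ := inv_anti₀ hδ hs'
  have h1 : |s⁻¹ ^ k - s'⁻¹ ^ k| ≤ |s - s'| * (k * δ⁻¹ * (δ ^ k)⁻¹) := by
    rcases Nat.eq_zero_or_pos k with rfl | hk
    · simp
    have h2 := abs_pow_sub_pow_le s⁻¹ s'⁻¹ k
    rw [abs_of_pos (inv_pos.2 hs0), abs_of_pos (inv_pos.2 hs0'), inv_sub_inv hs0.ne' hs0'.ne',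
      abs_div, abs_of_pos (mul_pos hs0 hs0'), abs_sub_comm s', div_eq_mul_inv, mul_inv] at h2
    refine h2.trans ?_
    calc |s - s'| * (s⁻¹ * s'⁻¹) * k * max s⁻¹ s'⁻¹ ^ (k - 1)
        ≤ |s - s'| * (δ⁻¹ * δ⁻¹) * k * δ⁻¹ ^ (k - 1) := by
          gcongr
          exact max_le i1 i2
      _ = |s - s'| * (k * δ⁻¹ * (δ⁻¹ ^ (k - 1) * δ⁻¹)) := by ring
      _ = _ := by rw [← pow_succ, Nat.sub_add_cancel hk, inv_pow]
  have hA : 0 ≤ A := (abs_nonneg _).trans ha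
  rw [e]
  refine (abs_add_le _ _).trans ?_
  rw [abs_mul, abs_mul, abs_of_nonneg (pow_nonneg (inv_nonneg.2 hs0.le) k)]
  calc |a - a'| * s⁻¹ ^ k + |a'| * |s⁻¹ ^ k - s'⁻¹ ^ k|
      ≤ (L * |s - s'|) * δ⁻¹ ^ k + A * (|s - s'| * (k * δ⁻¹ * (δ ^ k)⁻¹)) := by
        gcongr
        exact (abs_nonneg _).trans hL
    _ = _ := by rw [inv_pow]; ring

variable {d : ℕ} [NeZero d]

/-- In the shell the volume weight r^(d-2) is at most β^(d-2), so mass in ℝ^d is controlled by mass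
for dr dz. -/
theorem IsPositiveTameField.setIntegral_shell_le (hd : 3 ≤ d) {v : RSpace d → RSpace d}
    (hv : IsPositiveTameField v) {α β : ℝ} (hα : 0 < α) (hβ : 0 ≤ β)
    (hm : IntegrableOn (vort v) {q : ℝ × ℝ | α ≤ q.1}) :
    ∫ x in {x : RSpace d | cylRadius x ∈ Icc α β}, vort v (cylCoord x) ≤
      (sphereArea d).toReal * (β ^ (d - 2) * ∫ q in {q : ℝ × ℝ | α ≤ q.1}, vort v q) := by
  have mw := (continuous_vort hv.contDiff).measurable
  have ms : MeasurableSet {q : ℝ × ℝ | q.1 ∈ Icc α β} := measurable_fst measurableSet_Icc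
  have mo : MeasurableSet {q : ℝ × ℝ | α ≤ q.1} := measurableSet_le measurable_const measurable_fst
  have mA : MeasurableSet {x : RSpace d | cylRadius x ∈ Icc α β} :=
    measurable_cylRadius measurableSet_Icc
  have e1 : ∫ x in {x : RSpace d | cylRadius x ∈ Icc α β}, vort v (cylCoord x) =
      ∫ x : RSpace d, {q : ℝ × ℝ | q.1 ∈ Icc α β}.indicator (vort v) (cylCoord x) := by
    rw [← integral_indicator mA]
    rfl
  have hsub : {q : ℝ × ℝ | 0 < q.1} ∩ {q : ℝ × ℝ | α ≤ q.1} = {q : ℝ × ℝ | α ≤ q.1} :=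
    inter_eq_right.2 fun q hq => hα.trans_le hq
  have hi : IntegrableOn ({q : ℝ × ℝ | α ≤ q.1}.indicator fun q => β ^ (d - 2) * vort v q)
      {q : ℝ × ℝ | 0 < q.1} := by
    rw [IntegrableOn, integrable_indicator_iff mo, IntegrableOn, Measure.restrict_restrict mo,
      inter_comm, hsub]
    exact hm.const_mul _
  have hle : ∀ q ∈ {q : ℝ × ℝ | 0 < q.1},
      0 ≤ q.1 ^ (d - 2) * {q : ℝ × ℝ | q.1 ∈ Icc α β}.indicator (vort v) q ∧
      q.1 ^ (d - 2) * {q : ℝ × ℝ | q.1 ∈ Icc α β}.indicator (vort v) q ≤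
        {q : ℝ × ℝ | α ≤ q.1}.indicator (fun q => β ^ (d - 2) * vort v q) q := by
    intro q hq
    have hq : 0 < q.1 := hq
    have hw := hv.nonneg q hq.le
    by_cases h1 : q ∈ {q : ℝ × ℝ | q.1 ∈ Icc α β}
    · have h2 : q.1 ∈ Icc α β := h1
      rw [indicator_of_mem h1, indicator_of_mem (show q ∈ {q : ℝ × ℝ | α ≤ q.1} from h2.1)]
      refine ⟨by positivity, ?_⟩
      gcongr
      exact h2.2
    · rw [indicator_of_notMem h1, mul_zero]
      refine ⟨le_rfl, ?_⟩
      by_cases h2 : α ≤ q.1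
      · rw [indicator_of_mem (show q ∈ {q : ℝ × ℝ | α ≤ q.1} from h2)]
        positivity
      · rw [indicator_of_notMem (show q ∉ {q : ℝ × ℝ | α ≤ q.1} from h2)]
  rw [e1, integral_comp_cylCoord (by omega) (mw.indicator ms), integral_meridianMeasure]
  refine mul_le_mul_of_nonneg_left ?_ ENNReal.toReal_nonneg
  rw [← integral_const_mul, ← hsub, ← setIntegral_indicator mo]
  refine setIntegral_mono_on ?_ hi measurableSet_halfPlane fun q hq => (hle q hq).2
  refine hi.mono' (((measurable_fst.pow_const _).mul (mw.indicator ms)).aestronglyMeasurable) ?_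
  filter_upwards [ae_restrict_mem measurableSet_halfPlane] with q hq
  rw [Real.norm_of_nonneg (hle q hq).1]
  exact (hle q hq).2

/-- The radial transport of vorticity through a shell is controlled by the impulse and by the
vorticity outside of the shell. -/
theorem exists_transport_bound (hd : 3 ≤ d) : ∃ C : ℝ, 0 ≤ C ∧ ∀ v : RSpace d → RSpace d,
    IsPositiveTameField v → ∀ δ h α : ℝ, 0 < δ → 0 < h → h ≤ 2 * δ → 2 * δ ≤ α →
    α + h ≤ 4 * δ → IntegrableOn (vort v) {q : ℝ × ℝ | α ≤ q.1} →
    |∫ q in {q : ℝ × ℝ | 0 < q.1}, deriv (radialStep α h) q.1 * (vort v q * rad v q)| ≤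
      C * (∫ y : RSpace d, cylRadius y * vort v (cylCoord y)) / (h ^ 2 * δ ^ (d - 1)) *
        ∫ q in {q : ℝ × ℝ | α ≤ q.1}, vort v q := by
  obtain ⟨C, hC⟩ := exists_axisymmetric_integral_le d (by omega)
  obtain ⟨D, hD0, hD⟩ := exists_bound_deriv_radialStep
  have hs := softMass_pos d
  have hσ := sphereArea_pos (d := d) (by omega)
  set σ := (sphereArea d).toReal with hσd
  set E : ℝ := D * ((1 + 2 * (d - 2 : ℕ)) * C + 2 * d) with hE
  have hE0 : 0 ≤ E := by positivity
  refine ⟨(softMass d)⁻¹ * (d * E * 4 ^ (d - 2)), by positivity,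
    fun v hv δ h α hδ hh hhδ hδα hα4 hm => ?_⟩
  obtain ⟨hb, hL⟩ := hD α h hh
  have hα : 0 < α := by linarith
  set k := d - 2 with hk
  -- Dividing by r^(d-2) cancels the volume weight, so that the integral over ℝ^d is the wanted
  -- integral for dr dz.
  set g : ℝ → ℝ := fun s => deriv (radialStep α h) s / s ^ k with hg
  have hdc : Continuous (deriv (radialStep α h)) :=
    (contDiff_radialStep (n := 1) α h).continuous_deriv (by norm_num)
  have mg : Measurable g := hdc.measurable.div (measurable_id.pow_const k)
  have hg0 : ∀ s ∉ Icc α (α + h), g s = 0 := fun s hs => by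
    rw [hg]; beta_reduce; rw [deriv_radialStep_of_notMem hh hs, zero_div]
  have hgS : ∀ s, |g s| ≤ D / h * (δ ^ k)⁻¹ := fun s => by
    by_cases hs : s ∈ Icc α (α + h)
    · have h1 : δ ≤ s := by linarith [hs.1]
      have h2 : 0 < s := hδ.trans_le h1
      rw [hg]; beta_reduce
      rw [abs_div, abs_of_pos (pow_pos h2 k), div_eq_mul_inv]
      gcongr
      exact hb s
    · rw [hg0 s hs, abs_zero]; positivity
  have hgL : ∀ s s', δ ≤ s → δ ≤ s' →
      |g s - g s'| ≤ ((D / h ^ 2 + D / h * k * δ⁻¹) * (δ ^ k)⁻¹) * |s - s'| := fun s s' h1 h2 =>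
    abs_div_pow_sub_div_pow_le k hδ h1 h2 (hb s') (hL s s')
  have key := hv.abs_integral_vort_mul_rad_le hC hd hδ hδα mg (by positivity) hgS hgL hg0
  set P := ∫ y : RSpace d, cylRadius y * vort v (cylCoord y) with hP
  set m := ∫ q in {q : ℝ × ℝ | α ≤ q.1}, vort v q with hmd
  have hP0 : 0 ≤ P := integral_nonneg fun y =>
    mul_nonneg (cylRadius_nonneg y) (hv.nonneg_cylCoord y)
  have mo : MeasurableSet {q : ℝ × ℝ | α ≤ q.1} := measurableSet_le measurable_const measurable_fst
  have hm0 : 0 ≤ m := setIntegral_nonneg mo fun q hq => hv.nonneg q (hα.le.trans hq)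
  have mw := (continuous_vort hv.contDiff).measurable
  have ma := (contDiff_rad hv.contDiff).continuous.measurable
  have e1 : ∫ x : RSpace d, g (cylRadius x) * (vort v (cylCoord x) * rad v (cylCoord x)) =
      σ * ∫ q in {q : ℝ × ℝ | 0 < q.1}, deriv (radialStep α h) q.1 * (vort v q * rad v q) := by
    have := integral_comp_cylCoord (d := d) (by omega)
      (f := fun q => g q.1 * (vort v q * rad v q)) ((mg.comp measurable_fst).mul (mw.mul ma))
    rw [integral_meridianMeasure] at this
    refine this.trans ?_
    congr 1
    refine setIntegral_congr_fun measurableSet_halfPlane fun q hq => ?_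
    have hq : 0 < q.1 := hq
    simp only [hg, ← hk]
    field_simp
  rw [e1, abs_mul, abs_of_pos hσ] at key
  have hshell : ∫ x in {x : RSpace d | cylRadius x ∈ Icc α (α + h)}, vort v (cylCoord x) ≤
      σ * ((4 * δ) ^ k * m) := by
    refine (hv.setIntegral_shell_le hd hα (by positivity) hm).trans ?_
    gcongr
  have hs0 : 0 ≤ ∫ x in {x : RSpace d | cylRadius x ∈ Icc α (α + h)}, vort v (cylCoord x) :=
    integral_nonneg fun x => hv.nonneg_cylCoord x
  -- Since h ≤ 2δ gives 1/δ ≤ 2/h, all terms are of the order h^(-2) δ^(-(d-1)) of the leading one.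
  have hcoef : (D / h ^ 2 + D / h * k * δ⁻¹) * (δ ^ k)⁻¹ * C * (δ ^ (d - 1))⁻¹ +
      D / h * (δ ^ k)⁻¹ * (d * (δ ^ d)⁻¹) ≤ E / (h ^ 2 * δ ^ (d - 1)) * (δ ^ k)⁻¹ := by
    have r1 : δ⁻¹ ≤ 2 / h := by
      rw [inv_eq_one_div, div_le_div_iff₀ hδ hh]; linarith
    have r2 : (δ ^ d)⁻¹ = δ⁻¹ * (δ ^ (d - 1))⁻¹ := by
      rw [← mul_inv, ← pow_succ']; congr 2; omega
    rw [r2]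
    calc (D / h ^ 2 + D / h * k * δ⁻¹) * (δ ^ k)⁻¹ * C * (δ ^ (d - 1))⁻¹ +
          D / h * (δ ^ k)⁻¹ * (d * (δ⁻¹ * (δ ^ (d - 1))⁻¹))
        ≤ (D / h ^ 2 + D / h * k * (2 / h)) * (δ ^ k)⁻¹ * C * (δ ^ (d - 1))⁻¹ +
          D / h * (δ ^ k)⁻¹ * (d * (2 / h * (δ ^ (d - 1))⁻¹)) := by gcongr
      _ = _ := by rw [hE]; field_simp
  have hfin : σ * (softMass d * |∫ q in {q : ℝ × ℝ | 0 < q.1},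
      deriv (radialStep α h) q.1 * (vort v q * rad v q)|) ≤
      σ * (d * E * 4 ^ k * P / (h ^ 2 * δ ^ (d - 1)) * m) := by
    calc _ = softMass d * (σ * |∫ q in {q : ℝ × ℝ | 0 < q.1},
          deriv (radialStep α h) q.1 * (vort v q * rad v q)|) := by ring
      _ ≤ _ := key
      -- The shell lies below 4δ, so its volume weight (4δ)^(d-2) cancels the factor δ^(-(d-2)) in
      -- front.
      _ ≤ d * ((E / (h ^ 2 * δ ^ (d - 1)) * (δ ^ k)⁻¹) * P * (σ * ((4 * δ) ^ k * m))) := by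
          gcongr
      _ = _ := by rw [mul_pow]; field_simp
  have h2 := le_of_mul_le_mul_left hfin hσ
  have h3 := (le_div_iff₀' hs).2 h2
  refine h3.trans (le_of_eq ?_)
  ring

end RadialStep

/-! ### Balance of vorticity mass across a smooth radial step. -/

section MassDecay

open Filter Topology

variable {d : ℕ} [NeZero d]

theorem ae_halfSlab_time (t : ℝ) : ∀ᵐ p ∂halfSlab t, p.1 ∈ Ioc 0 t := by
  have h : (Prod.fst : ℝ × (ℝ × ℝ) → ℝ) ⁻¹' Ioc 0 t ∈ ae (halfSlab t) :=
    Measure.quasiMeasurePreserving_fst.ae (ae_restrict_mem measurableSet_Ioc)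
  exact h

namespace IsRegularFlow

variable {t₁ : ℝ} {U : ℝ → RSpace d → RSpace d}

theorem vort_nonneg_of_nonneg (hd : 3 ≤ d) (hU : IsRegularFlow t₁ U)
    (h0 : ∀ q : ℝ × ℝ, 0 < q.1 → 0 ≤ vort (U 0) q) {t : ℝ} (ht : t ∈ Icc 0 t₁) {q : ℝ × ℝ}
    (hq : 0 ≤ q.1) : 0 ≤ vort (U t) q := by
  have h : Tendsto (fun n : ℕ => q - ((n : ℝ) + 1)⁻¹ • ((-1, 0) : ℝ × ℝ)) atTop (𝓝 q) :=
    tendsto_sub_inv_smul q (-1, 0)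
  refine ge_of_tendsto' (((_root_.continuous_vort (hU.contDiff t)).tendsto q).comp h) fun n => ?_
  refine hU.vort_nonneg hd h0 ht ?_
  have : 0 < ((n : ℝ) + 1)⁻¹ := by positivity
  simp only [Prod.fst_sub, Prod.smul_fst, smul_eq_mul]
  linarith

/-- Each time slice satisfies the hypotheses of the transport bound, with an impulse controlled by
the initial one. -/
theorem isPositiveTameField (hd : 3 ≤ d) (hU : IsRegularFlow t₁ U)
    (h0 : ∀ q : ℝ × ℝ, 0 < q.1 → 0 ≤ vort (U 0) q)
    (hi : IntegrableOn (fun q : ℝ × ℝ => q.1 ^ (d - 1) * vort (U 0) q) {q : ℝ × ℝ | 0 < q.1})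
    {t : ℝ} (ht : t ∈ Icc 0 t₁) :
    IsPositiveTameField (U t) ∧ ∫ x : RSpace d, cylRadius x * vort (U t) (cylCoord x) ≤
      (sphereArea d).toReal * ∫ q in {q : ℝ × ℝ | 0 < q.1}, q.1 ^ (d - 1) * vort (U 0) q := by
  have hd2 : 2 ≤ d := by omega
  have cw := _root_.continuous_vort (hU.contDiff t)
  have hle := hU.impulse_le hd h0 hi ht
  have hnn : ∀ s ∈ Icc 0 t₁, 0 ≤ᵐ[volume.restrict {q : ℝ × ℝ | 0 < q.1}]
      fun q : ℝ × ℝ => q.1 ^ (d - 1) * vort (U s) q := fun s hs => by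
    filter_upwards [ae_restrict_mem measurableSet_halfPlane] with q hq
    have hq : 0 < q.1 := hq
    have := hU.vort_nonneg hd h0 hs hq
    positivity
  have ms : AEStronglyMeasurable (fun q : ℝ × ℝ => q.1 ^ (d - 1) * vort (U t) q)
      (volume.restrict {q : ℝ × ℝ | 0 < q.1}) := Continuous.aestronglyMeasurable (by fun_prop)
  have hit : IntegrableOn (fun q : ℝ × ℝ => q.1 ^ (d - 1) * vort (U t) q)
      {q : ℝ × ℝ | 0 < q.1} := by
    refine ⟨ms, ?_⟩
    rw [hasFiniteIntegral_iff_ofReal (hnn t ht)]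
    exact hle.trans_lt ENNReal.ofReal_lt_top
  have epow : (fun q : ℝ × ℝ => q.1 ^ (d - 2) * (q.1 * vort (U t) q)) =
      fun q : ℝ × ℝ => q.1 ^ (d - 1) * vort (U t) q := funext fun q => by
    rw [← mul_assoc, ← pow_succ]; congr 2; omega
  have mf : Measurable fun q : ℝ × ℝ => q.1 * vort (U t) q := measurable_fst.mul cw.measurable
  refine ⟨{
    contDiff := hU.contDiff t
    axi := hU.axi t
    div_free := hU.div_free t
    bound := ?_
    memLp := ?_
    memLp_fderiv := ?_
    nonneg := fun q hq => hU.vort_nonneg_of_nonneg hd h0 ht hq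
    impulse := ?_ }, ?_⟩
  · obtain ⟨B, hB⟩ := hU.bound
    exact ⟨B, fun x => (hB t x).1⟩
  · obtain ⟨N, hN⟩ := hU.bound_l2
    exact ⟨(hU.contDiff t).continuous.aestronglyMeasurable,
      (hN t).1.trans_lt ENNReal.coe_lt_top⟩
  · obtain ⟨N, hN⟩ := hU.bound_l2
    exact ⟨((hU.contDiff t).continuous_fderiv (by norm_num)).aestronglyMeasurable,
      (hN t).2.trans_lt ENNReal.coe_lt_top⟩
  · have := integrable_comp_cylCoord_iff hd2 mf
    refine this.2 ?_
    rw [integrable_meridianMeasure_iff, epow]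
    exact hit
  · have := integral_comp_cylCoord hd2 mf
    rw [integral_meridianMeasure, epow] at this
    refine (le_of_eq this).trans (mul_le_mul_of_nonneg_left ?_ ENNReal.toReal_nonneg)
    rw [integral_eq_lintegral_of_nonneg_ae (hnn t ht) ms]
    refine ENNReal.toReal_le_of_le_ofReal (integral_nonneg_of_ae (hnn 0 ⟨le_rfl, ?_⟩)) hle
    exact ht.1.trans ht.2

theorem integrable_outer_halfSlab (hd : 3 ≤ d) (hU : IsRegularFlow t₁ U)
    (h0 : ∀ q : ℝ × ℝ, 0 < q.1 → 0 ≤ vort (U 0) q)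
    (hi : IntegrableOn (fun q : ℝ × ℝ => q.1 ^ (d - 1) * vort (U 0) q) {q : ℝ × ℝ | 0 < q.1})
    {t : ℝ} (ht : t ∈ Icc 0 t₁) {α : ℝ} (hα : 0 < α) :
    Integrable (fun p : ℝ × (ℝ × ℝ) => {q : ℝ × ℝ | α ≤ q.1}.indicator (vort (U p.1)) p.2)
      (halfSlab t) := by
  have mo : MeasurableSet {q : ℝ × ℝ | α ≤ q.1} := measurableSet_le measurable_const measurable_fst
  have hm : Measurable fun p : ℝ × (ℝ × ℝ) =>
      {q : ℝ × ℝ | α ≤ q.1}.indicator (vort (U p.1)) p.2 :=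
    hU.measurable_vort.indicator (mo.preimage measurable_snd)
  refine integrable_halfSlab hm (A := Real.toNNReal
    ((∫ q in {q : ℝ × ℝ | 0 < q.1}, q.1 ^ (d - 1) * vort (U 0) q) / α ^ (d - 1))) fun τ hτ => ?_
  have hτ' : τ ∈ Icc 0 t₁ := ⟨hτ.1.le, hτ.2.trans ht.2⟩
  refine le_trans ?_ (hU.lintegral_outer_vort_le hd h0 hi hτ' hα)
  rw [← lintegral_indicator mo]
  refine (setLIntegral_le_lintegral _ _).trans (lintegral_mono fun q => ?_)
  by_cases hq : q ∈ {q : ℝ × ℝ | α ≤ q.1}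
  · beta_reduce
    rw [indicator_of_mem hq, indicator_of_mem hq, Real.enorm_of_nonneg]
    exact hU.vort_nonneg hd h0 hτ' (hα.trans_le hq)
  · simp [indicator_of_notMem hq]

theorem abs_radialStep_mul_le {v : RSpace d → RSpace d} {α h : ℝ} (hh : 0 < h) {q : ℝ × ℝ}
    (hv : 0 ≤ vort v q) :
    |radialStep α h q.1 * vort v q| ≤ {q : ℝ × ℝ | α ≤ q.1}.indicator (vort v) q := by
  by_cases hq : α ≤ q.1
  · rw [indicator_of_mem (show q ∈ {q : ℝ × ℝ | α ≤ q.1} from hq),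
      abs_of_nonneg (mul_nonneg (radialStep_nonneg _ _ _) hv)]
    exact mul_le_of_le_one_left hv (radialStep_le_one _ _ _)
  · rw [radialStep_of_le hh (not_le.1 hq).le, zero_mul, abs_zero,
      indicator_of_notMem (show q ∉ {q : ℝ × ℝ | α ≤ q.1} from hq)]

/-- The weak equation for a radial step, whose axial transport vanishes. The step is not compactly
supported, so cutoffs are inserted and removed by dominated convergence, using that ω is integrable
beyond α uniformly in time. -/
theorem integral_radialStep_vort_sub (hd : 3 ≤ d) (hU : IsRegularFlow t₁ U)
    (h0 : ∀ q : ℝ × ℝ, 0 < q.1 → 0 ≤ vort (U 0) q)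
    (hi : IntegrableOn (fun q : ℝ × ℝ => q.1 ^ (d - 1) * vort (U 0) q) {q : ℝ × ℝ | 0 < q.1})
    {t : ℝ} (ht : t ∈ Icc 0 t₁) {α h : ℝ} (hα : 0 < α) (hh : 0 < h) :
    (∫ q in {q : ℝ × ℝ | 0 < q.1}, radialStep α h q.1 * vort (U t) q) -
      ∫ q in {q : ℝ × ℝ | 0 < q.1}, radialStep α h q.1 * vort (U 0) q =
      ∫ τ in 0..t, ∫ q in {q : ℝ × ℝ | 0 < q.1},
        deriv (radialStep α h) q.1 * (vort (U τ) q * rad (U τ) q) := by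
  have hd2 : 2 ≤ d := by omega
  obtain ⟨D, hD⟩ := exists_bound_cutoff
  obtain ⟨D₁, hD₁0, hD₁⟩ := exists_bound_deriv_radialStep
  obtain ⟨B, hB⟩ := hU.exists_meridianBound
  have hD0 : 0 ≤ D := (abs_nonneg _).trans (hD 1 le_rfl (1, 0) one_pos).1
  have hB0 : 0 ≤ B := (abs_nonneg _).trans ((hB 0).rad_le 0)
  set f : ℝ → ℝ := radialStep α h with hf
  have hfc : ContDiff ℝ 2 f := contDiff_radialStep (n := 2) α h
  have hfm : Measurable f := hfc.continuous.measurable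
  have hfm' : Measurable (deriv f) := (hfc.continuous_deriv (by norm_num)).measurable
  have mw := hU.measurable_vort
  have ma := hU.measurable_rad
  have mb := hU.measurable_axl
  have hI := hU.integrable_outer_halfSlab hd h0 hi ht hα
  have hdf : ∀ r, r ∉ {r : ℝ | α ≤ r} → f r = 0 ∧ deriv f r = 0 := fun r hr =>
    ⟨radialStep_of_le hh (not_le.1 hr).le,
      deriv_radialStep_of_notMem hh fun h => hr h.1⟩
  have hw : ∀ᵐ p ∂halfSlab t, 0 < p.2.1 ∧ 0 ≤ vort (U p.1) p.2 := by
    filter_upwards [ae_halfSlab_pos t, ae_halfSlab_time t] with p hp hpt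
    exact ⟨hp, hU.vort_nonneg hd h0 ⟨hpt.1.le, hpt.2.trans ht.2⟩ hp⟩
  have hbound : ∀ (p : ℝ × (ℝ × ℝ)) (X c : ℝ), 0 ≤ vort (U p.1) p.2 →
      (α ≤ p.2.1 → |X| ≤ c) → (¬ α ≤ p.2.1 → X = 0) →
      ‖vort (U p.1) p.2 * X‖ ≤ {q : ℝ × ℝ | α ≤ q.1}.indicator (vort (U p.1)) p.2 * c := by
    intro p X c hp h1 h2
    by_cases hq : α ≤ p.2.1
    · rw [indicator_of_mem (show p.2 ∈ {q : ℝ × ℝ | α ≤ q.1} from hq), norm_mul,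
        Real.norm_of_nonneg hp]
      exact mul_le_mul_of_nonneg_left (h1 hq) hp
    · rw [h2 hq, mul_zero, norm_zero,
        indicator_of_notMem (show p.2 ∉ {q : ℝ × ℝ | α ≤ q.1} from hq), zero_mul]
  have hinit : ∀ s ∈ Icc 0 t₁, IntegrableOn (fun q : ℝ × ℝ => f q.1 * vort (U s) q)
      {q : ℝ × ℝ | 0 < q.1} := fun s hs => by
    have mo : MeasurableSet {q : ℝ × ℝ | α ≤ q.1} :=
      measurableSet_le measurable_const measurable_fst
    have h1 := ((integrable_indicator_iff mo).2
      (hU.integrableOn_outer_vort hd h0 hi hs hα).1).integrableOn (s := {q : ℝ × ℝ | 0 < q.1})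
    have cw := _root_.continuous_vort (hU.contDiff s)
    refine h1.mono' ((hfm.comp measurable_fst).mul cw.measurable).aestronglyMeasurable ?_
    filter_upwards [ae_restrict_mem measurableSet_halfPlane] with q hq
    exact abs_radialStep_mul_le hh (hU.vort_nonneg hd h0 hs hq)
  have hlim := tendsto_integral_of_dominated_convergence (μ := halfSlab t)
    (F := fun (n : ℕ) p => vort (U p.1) p.2 * (rad (U p.1) p.2 *
      (deriv f p.2.1 * cutoff ((n : ℝ) + 1) p.2 + f p.2.1 * dR (cutoff ((n : ℝ) + 1)) p.2) +
      axl (U p.1) p.2 * (f p.2.1 * dZ (cutoff ((n : ℝ) + 1)) p.2)))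
    (f := fun p => vort (U p.1) p.2 * (rad (U p.1) p.2 * deriv f p.2.1))
    (fun p => {q : ℝ × ℝ | α ≤ q.1}.indicator (vort (U p.1)) p.2 *
      (B * (D₁ / h + D / α) + B * D))
    (fun n => by
      have m1 : Measurable (cutoff ((n : ℝ) + 1)) := (contDiff_cutoff _).continuous.measurable
      have m2 : Measurable (dR (cutoff ((n : ℝ) + 1))) :=
        (continuous_dR ((contDiff_cutoff _).of_le (by norm_num))).measurable
      have m3 : Measurable (dZ (cutoff ((n : ℝ) + 1))) :=
        (continuous_dZ ((contDiff_cutoff _).of_le (by norm_num))).measurable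
      exact Measurable.aestronglyMeasurable (by fun_prop))
    (hI.mul_const _)
    (fun n => by
      filter_upwards [hw] with p hp
      refine hbound p _ _ hp.2 (fun hα' => ?_) fun hα' => ?_
      · have hn : (1 : ℝ) ≤ (n : ℝ) + 1 := by linarith [(Nat.cast_nonneg n : (0 : ℝ) ≤ n)]
        obtain ⟨b1, b2, -⟩ := hD _ hn p.2 hp.1
        -- Beyond α the bound on r ∂_r of the cutoff gives one on ∂_r alone.
        have b3 : |dR (cutoff ((n : ℝ) + 1)) p.2| ≤ D / α := by
          rw [le_div_iff₀ hα]
          refine le_trans ?_ b1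
          rw [abs_mul, abs_of_pos hp.1, mul_comm]
          exact mul_le_mul_of_nonneg_right hα' (abs_nonneg _)
        have b4 : |f p.2.1| ≤ 1 := by
          rw [abs_of_nonneg (radialStep_nonneg _ _ _)]; exact radialStep_le_one _ _ _
        have b5 : |cutoff ((n : ℝ) + 1) p.2| ≤ 1 := by
          rw [abs_of_nonneg (cutoff_nonneg _ _)]; exact cutoff_le_one _ _
        refine (abs_add_le _ _).trans (add_le_add ?_ ?_)
        · rw [abs_mul]
          refine mul_le_mul ((hB p.1).rad_le _) ((abs_add_le _ _).trans (add_le_add ?_ ?_))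
            (abs_nonneg _) hB0
          · rw [abs_mul]
            exact (mul_le_of_le_one_right (abs_nonneg _) b5).trans ((hD₁ α h hh).1 _)
          · rw [abs_mul]
            exact (mul_le_of_le_one_left (abs_nonneg _) b4).trans b3
        · rw [abs_mul, abs_mul]
          exact mul_le_mul ((hB p.1).axl_le _)
            ((mul_le_of_le_one_left (abs_nonneg _) b4).trans b2) (by positivity) hB0
      · obtain ⟨z1, z2⟩ := hdf _ hα'
        rw [z1, z2]; ring)
    (by
      filter_upwards [ae_halfSlab_pos t] with p hp
      refine tendsto_const_nhds.congr' ?_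
      filter_upwards [eventually_cutoff hp] with n hn
      rw [hn.1, hn.2.1, hn.2.2]
      ring)
  have hid : ∀ n : ℕ, (∫ q, radialCutoff f ((n : ℝ) + 1) q * vort (U t) q) -
      ∫ q, radialCutoff f ((n : ℝ) + 1) q * vort (U 0) q = ∫ p,
      vort (U p.1) p.2 * (rad (U p.1) p.2 *
      (deriv f p.2.1 * cutoff ((n : ℝ) + 1) p.2 + f p.2.1 * dR (cutoff ((n : ℝ) + 1)) p.2) +
      axl (U p.1) p.2 * (f p.2.1 * dZ (cutoff ((n : ℝ) + 1)) p.2)) ∂halfSlab t := by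
    intro n
    have hn : (0 : ℝ) < (n : ℝ) + 1 := by positivity
    rw [hU.integral_vort_sub_slab hd2 (contDiff_radialCutoff hfc ((n : ℝ) + 1))
      (hasCompactSupport_radialCutoff f hn) (tsupport_radialCutoff_subset f hn) ht,
      integral_slab_eq_halfSlab]
    · refine integral_congr_ae (Eventually.of_forall fun p => ?_)
      beta_reduce
      rw [dR_radialCutoff hfc, dZ_radialCutoff hfc]
    · intro p hp
      obtain ⟨z1, z2, z3⟩ := radialCutoff_eq_zero f hn hp
      rw [z2, z3]
      ring
  simp_rw [← hid] at hlim
  have ht0 : (0 : ℝ) ∈ Icc 0 t₁ := ⟨le_rfl, ht.1.trans ht.2⟩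
  have hl := fun s hs => tendsto_integral_radialCutoff hfc
    (_root_.continuous_vort (hU.contDiff s)).measurable (hinit s hs)
  rw [tendsto_nhds_unique ((hl t ht).sub (hl 0 ht0)) hlim, integral_halfSlab ht.1]
  · refine intervalIntegral.integral_congr fun τ _ => ?_
    refine integral_congr_ae (Eventually.of_forall fun q => ?_)
    beta_reduce
    ring
  · refine (hI.mul_const (B * (D₁ / h))).mono' (Measurable.aestronglyMeasurable (by fun_prop)) ?_
    filter_upwards [hw] with p hp
    refine hbound p _ _ hp.2 (fun hα' => ?_) fun hα' => ?_
    · rw [abs_mul]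
      exact mul_le_mul ((hB p.1).rad_le _) ((hD₁ α h hh).1 _) (abs_nonneg _) hB0
    · rw [(hdf _ hα').2, mul_zero]

end IsRegularFlow

end MassDecay

/-! ### Iteration over p nested radii. -/

section Iteration

open Filter Topology

variable {d : ℕ} [NeZero d]

/-- From p^p / p! ≤ e^p; of the power p^(2p) caused by the shell width, the factorial removes half.
-/
theorem pow_two_mul_div_factorial_le (p : ℕ) :
    (p : ℝ) ^ (2 * p) / p.factorial ≤ Real.exp 1 ^ p * (p : ℝ) ^ p := by
  have h := Real.pow_div_factorial_le_exp (p : ℝ) (Nat.cast_nonneg p) p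
  rw [← Real.exp_nat_mul, mul_one]
  calc (p : ℝ) ^ (2 * p) / p.factorial = (p : ℝ) ^ p / p.factorial * (p : ℝ) ^ p := by
        rw [two_mul, pow_add]; ring
    _ ≤ _ := by gcongr

/-- The algebra which turns the iterated bound into the final one. -/
theorem iterated_bound_le {d p : ℕ} (hp : 1 ≤ p) {I L r t : ℝ} (hI : 0 ≤ I) (hL : 0 ≤ L)
    (hr : 0 < r) (ht : 0 ≤ t) :
    I / (r / 2) ^ (d - 1) *
      (L / ((r / (4 * p)) ^ 2 * (r / 4) ^ (d - 1)) * t) ^ p / p.factorial ≤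
      ((I * 2 ^ (d - 1) + 1) * (L * 16 * 4 ^ (d - 1) * Real.exp 1 + 1)) ^ p * (p : ℝ) ^ p * t ^ p /
        r ^ (p * (d - 1 + 2) + (d - 1)) := by
  have hp0 : (0 : ℝ) < p := by exact_mod_cast hp
  have e1 : I / (r / 2) ^ (d - 1) = I * 2 ^ (d - 1) / r ^ (d - 1) := by
    rw [div_pow]; field_simp
  have e2 : L / ((r / (4 * p)) ^ 2 * (r / 4) ^ (d - 1)) * t =
      (L * 16 * 4 ^ (d - 1)) * (p : ℝ) ^ 2 * t / r ^ (d - 1 + 2) := by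
    rw [div_pow, div_pow, mul_pow, pow_add]; field_simp; ring
  rw [e1, e2, div_pow, mul_pow, mul_pow, ← pow_mul, ← pow_mul, mul_comm (d - 1 + 2) p, pow_add]
  set G := L * 16 * 4 ^ (d - 1) with hG
  set J := I * 2 ^ (d - 1) with hJ
  have hG0 : 0 ≤ G := by positivity
  have hJ0 : 0 ≤ J := by positivity
  -- The prefactor occurs once but must be absorbed in a p-th power; adding 1 makes the base at
  -- least 1.
  have hJp : J ≤ (J + 1) ^ p := by
    calc J ≤ J + 1 := by linarith
      _ ≤ (J + 1) ^ p := le_self_pow₀ (by linarith) (by omega)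
  have h1 := pow_two_mul_div_factorial_le p
  calc J / r ^ (d - 1) * (G ^ p * (p : ℝ) ^ (2 * p) * t ^ p / r ^ (p * (d - 1 + 2))) / p.factorial
      = J * G ^ p * ((p : ℝ) ^ (2 * p) / p.factorial) * t ^ p /
          (r ^ (p * (d - 1 + 2)) * r ^ (d - 1)) := by
        field_simp
    _ ≤ (J + 1) ^ p * G ^ p * (Real.exp 1 ^ p * (p : ℝ) ^ p) * t ^ p /
          (r ^ (p * (d - 1 + 2)) * r ^ (d - 1)) := by gcongr
    _ = (J + 1) ^ p * (G * Real.exp 1) ^ p * (p : ℝ) ^ p * t ^ p /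
          (r ^ (p * (d - 1 + 2)) * r ^ (d - 1)) := by rw [mul_pow G]; ring
    _ ≤ (J + 1) ^ p * (G * Real.exp 1 + 1) ^ p * (p : ℝ) ^ p * t ^ p /
          (r ^ (p * (d - 1 + 2)) * r ^ (d - 1)) := by
        gcongr
        linarith
    _ = _ := by rw [mul_pow]

namespace IsRegularFlow

variable {t₁ : ℝ} {U : ℝ → RSpace d → RSpace d}

/-- The p-step iteration: smoothed masses at radii decreasing by h are linked by the transport
bound, start from zero, and the last one is bounded by the impulse. -/
theorem exists_outer_vort_le (hd : 3 ≤ d) {I : ℝ} (hI : 0 ≤ I) : ∃ C : ℝ, 0 < C ∧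
    ∀ (t₁ : ℝ) (U : ℝ → RSpace d → RSpace d), IsRegularFlow t₁ U →
    (∀ q : ℝ × ℝ, 0 < q.1 → 0 ≤ vort (U 0) q) →
    IntegrableOn (fun q : ℝ × ℝ => q.1 ^ (d - 1) * vort (U 0) q) {q : ℝ × ℝ | 0 < q.1} →
    ∫ q in {q : ℝ × ℝ | 0 < q.1}, q.1 ^ (d - 1) * vort (U 0) q ≤ I →
    ∀ S₀ : ℝ, (∀ q : ℝ × ℝ, 0 < q.1 → S₀ < q.1 → vort (U 0) q = 0) →
    ∀ p : ℕ, 1 ≤ p → ∀ t ∈ Icc 0 t₁, ∀ r : ℝ, 0 < r → 2 * S₀ ≤ r →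
      ∫ q in {q : ℝ × ℝ | r ≤ q.1}, vort (U t) q ≤
        C ^ p * (p : ℝ) ^ p * t ^ p / r ^ (p * (d + 1) + (d - 1)) := by
  obtain ⟨C, hC0, hC⟩ := exists_transport_bound hd
  set σ := (sphereArea d).toReal with hσd
  have hσ : 0 < σ := sphereArea_pos (d := d) (by omega)
  refine ⟨(I * 2 ^ (d - 1) + 1) * (C * (σ * I) * 16 * 4 ^ (d - 1) * Real.exp 1 + 1), by positivity,
    fun t₁ U hU h0 hi hiI S₀ hS p hp t ht r hr hrS => ?_⟩
  have hp0 : (0 : ℝ) < p := by exact_mod_cast hp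
  have ht0 : (0 : ℝ) ∈ Icc 0 t₁ := ⟨le_rfl, ht.1.trans ht.2⟩
  -- After p shells the radius has dropped by r/4, and one more width h ≤ r/4 still leaves r/2.
  set h := r / (4 * p) with hh
  have hh0 : 0 < h := by positivity
  have hph : p * h = r / 4 := by rw [hh]; field_simp
  have hp1 : (1 : ℝ) ≤ p := by exact_mod_cast hp
  have hhr : h ≤ r / 4 := by
    rw [← hph]; exact le_mul_of_one_le_left hh0.le hp1
  -- The index is truncated at p so that the radii stay positive for every natural number j.
  set b : ℕ → ℝ := fun j => r - (min j p : ℕ) * h with hb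
  have hbr : ∀ j, b j ≤ r := fun j => by
    have : 0 ≤ ((min j p : ℕ) : ℝ) * h := by positivity
    simp only [hb]; linarith
  have hbl : ∀ j, r / 2 ≤ b j - h := fun j => by
    have h1 : ((min j p : ℕ) : ℝ) * h ≤ p * h := by
      gcongr
      exact min_le_right _ _
    simp only [hb]; linarith
  set N : ℕ → ℝ → ℝ := fun j τ =>
    ∫ q in {q : ℝ × ℝ | 0 < q.1}, radialStep (b j - h) h q.1 * vort (U τ) q with hN
  have hα : ∀ j, 0 < b j - h := fun j => by linarith [hbl j]
  have mo : ∀ α : ℝ, MeasurableSet {q : ℝ × ℝ | α ≤ q.1} := fun α =>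
    measurableSet_le measurable_const measurable_fst
  have hsub : ∀ {α : ℝ}, 0 < α → {q : ℝ × ℝ | 0 < q.1} ∩ {q : ℝ × ℝ | α ≤ q.1} =
      {q : ℝ × ℝ | α ≤ q.1} := fun hα => inter_eq_right.2 fun q hq => hα.trans_le hq
  have mf : ∀ α : ℝ, Measurable (radialStep α h) := fun α =>
    (contDiff_radialStep (n := 1) α h).continuous.measurable
  have hind : ∀ {α : ℝ}, 0 < α → ∀ τ ∈ Icc 0 t₁, IntegrableOn
      ({q : ℝ × ℝ | α ≤ q.1}.indicator (vort (U τ))) {q : ℝ × ℝ | 0 < q.1} := fun hα τ hτ =>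
    ((integrable_indicator_iff (mo _)).2
      (hU.integrableOn_outer_vort hd h0 hi hτ hα).1).integrableOn
  have hfi : ∀ j, ∀ τ ∈ Icc 0 t₁, IntegrableOn
      (fun q : ℝ × ℝ => radialStep (b j - h) h q.1 * vort (U τ) q)
      {q : ℝ × ℝ | 0 < q.1} := fun j τ hτ => by
    refine (hind (hα j) τ hτ).mono' (((mf _).comp measurable_fst).mul
      (_root_.continuous_vort (hU.contDiff τ)).measurable).aestronglyMeasurable ?_
    filter_upwards [ae_restrict_mem measurableSet_halfPlane] with q hq
    exact abs_radialStep_mul_le hh0 (hU.vort_nonneg hd h0 hτ hq)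
  have hNle : ∀ j, ∀ τ ∈ Icc 0 t₁, N j τ ≤ ∫ q in {q : ℝ × ℝ | b j - h ≤ q.1}, vort (U τ) q := by
    intro j τ hτ
    rw [← hsub (hα j), ← setIntegral_indicator (mo _)]
    refine setIntegral_mono_on (hfi j τ hτ) (hind (hα j) τ hτ) measurableSet_halfPlane
      fun q hq => ?_
    exact (le_abs_self _).trans (abs_radialStep_mul_le hh0 (hU.vort_nonneg hd h0 hτ hq))
  -- The smooth mass N_j lies between the sharp masses beyond b_j and beyond b_j - h, and the latter
  -- radius is b_{j+1} for j < p. Thus the flux out of N_j is controlled by N_{j+1}.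
  have hleN : ∀ j, ∀ τ ∈ Icc 0 t₁, ∫ q in {q : ℝ × ℝ | b j ≤ q.1}, vort (U τ) q ≤ N j τ := by
    intro j τ hτ
    have hbj : 0 < b j := by linarith [hα j]
    rw [← hsub hbj, ← setIntegral_indicator (mo _)]
    refine setIntegral_mono_on (hind hbj τ hτ) (hfi j τ hτ) measurableSet_halfPlane
      fun q hq => ?_
    have hw := hU.vort_nonneg hd h0 hτ hq
    by_cases hq' : b j ≤ q.1
    · rw [indicator_of_mem (show q ∈ {q : ℝ × ℝ | b j ≤ q.1} from hq'),
        radialStep_of_ge hh0 (by linarith), one_mul]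
    · rw [indicator_of_notMem (show q ∉ {q : ℝ × ℝ | b j ≤ q.1} from hq')]
      exact mul_nonneg (radialStep_nonneg _ _ _) hw
  have hNi : ∀ j, IntervalIntegrable (N j) volume 0 t := fun j => by
    refine intervalIntegrable_of_halfSlab ht.1
      ((hU.integrable_outer_halfSlab hd h0 hi ht (hα j)).mono' (((mf _).comp
        (measurable_fst.comp measurable_snd)).mul hU.measurable_vort).aestronglyMeasurable ?_)
    filter_upwards [ae_halfSlab_pos t, ae_halfSlab_time t] with p hp hpt
    exact abs_radialStep_mul_le hh0
      (hU.vort_nonneg hd h0 ⟨hpt.1.le, hpt.2.trans ht.2⟩ hp)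
  -- The step is supported beyond r/2 ≥ S₀, where the initial vorticity vanishes.
  have hN0 : ∀ j, N j 0 = 0 := fun j => by
    refine integral_eq_zero_of_ae ?_
    filter_upwards [ae_restrict_mem measurableSet_halfPlane] with q hq
    by_cases hq' : q.1 ≤ b j - h
    · rw [radialStep_of_le hh0 hq', zero_mul]; rfl
    · rw [hS q hq (by linarith [hbl j]), mul_zero]; rfl
  -- With δ = r/4 every shell [b_j - h, b_j] lies in [2δ, 4δ], as the transport bound requires.
  have hδ : 0 < r / 4 := by positivity
  set L := C * (σ * I) / (h ^ 2 * (r / 4) ^ (d - 1)) with hL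
  have hL0 : 0 ≤ L := by positivity
  have hstep : ∀ j < p, ∀ s ∈ Icc 0 t, N j s ≤ L * ∫ τ in 0..s, N (j + 1) τ := by
    intro j hj s hs
    have hs' : s ∈ Icc 0 t₁ := ⟨hs.1, hs.2.trans ht.2⟩
    have hid := hU.integral_radialStep_vort_sub hd h0 hi hs' (hα j) hh0
    have hz := hN0 j
    simp only [hN] at hz
    rw [hz, sub_zero] at hid
    have hNj : N j s = _ := hid
    have hbb : b (j + 1) = b j - h := by
      simp only [hb]
      rw [min_eq_left (by omega : j + 1 ≤ p), min_eq_left (by omega : j ≤ p)]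
      push_cast; ring
    rw [hNj, ← intervalIntegral.integral_const_mul]
    refine (le_abs_self _).trans ?_
    rw [← Real.norm_eq_abs]
    refine intervalIntegral.norm_integral_le_of_norm_le hs.1 (Eventually.of_forall fun τ hτ => ?_)
      (((hNi (j + 1)).mono_set ?_).const_mul L)
    · have hτ' : τ ∈ Icc 0 t₁ := ⟨hτ.1.le, hτ.2.trans hs'.2⟩
      obtain ⟨hv, hvI⟩ := hU.isPositiveTameField hd h0 hi hτ'
      have hm := (hU.integrableOn_outer_vort hd h0 hi hτ' (hα j)).1
      have key := hC (U τ) hv (r / 4) h (b j - h) hδ hh0 (by linarith) (by linarith [hbl j])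
        (by linarith [hbr j]) hm
      rw [Real.norm_eq_abs]
      refine key.trans ?_
      have hm0 : 0 ≤ ∫ q in {q : ℝ × ℝ | b j - h ≤ q.1}, vort (U τ) q :=
        setIntegral_nonneg (mo _) fun q hq => hU.vort_nonneg hd h0 hτ' ((hα j).trans_le hq)
      have hNn := hleN (j + 1) τ hτ'
      rw [hbb] at hNn
      rw [hL]
      gcongr
      exact hvI.trans (by gcongr)
    · rw [uIcc_of_le hs.1, uIcc_of_le ht.1]
      exact Icc_subset_Icc_right hs.2
  -- The last mass is bounded by Chebyshev beyond radius r/2.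
  have hbase : ∀ s ∈ Icc 0 t, N p s ≤ I / (r / 2) ^ (d - 1) := by
    intro s hs
    have hs' : s ∈ Icc 0 t₁ := ⟨hs.1, hs.2.trans ht.2⟩
    refine (hNle p s hs').trans ((hU.integrableOn_outer_vort hd h0 hi hs' (hα p)).2.trans ?_)
    have := hbl p
    gcongr
  have hfin := iterated_integral_bound hL0 p N hNi hstep hbase t ⟨ht.1, le_rfl⟩
  have hb0 : b 0 = r := by simp [hb]
  have h1 := hleN 0 t ht
  rw [hb0] at h1
  refine h1.trans (hfin.trans ((iterated_bound_le hp hI (by positivity) hr ht.1).trans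
    (le_of_eq ?_)))
  rw [show d - 1 + 2 = d + 1 by omega]

end IsRegularFlow

end Iteration

end

/-! ### Translation of the hypotheses on the initial vorticity. -/

section Initial

variable {d : ℕ} [NeZero d]

theorem eq_zero_of_radialSupportSize_lt (hd : 2 ≤ d) {f : ℝ → ℝ → ℝ}
    (hf : HasCompactSupport (cylLift f : RSpace d → ℝ)) {q : ℝ × ℝ} (hq : 0 < q.1)
    (h : radialSupportSize d f < q.1) : f q.1 q.2 = 0 := by
  by_contra hne
  have hc : cylCoord (merMap d q) = q := cylCoord_merMap hd hq.le
  -- Compact support bounds the set of radii; for an unbounded set the real supremum would be the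
  -- default value 0 and carry no information.
  have hbdd : BddAbove {r : ℝ | 0 < r ∧
      ∃ x ∈ tsupport (cylLift f : RSpace d → ℝ), cylRadius x = r} := by
    refine (hf.isCompact.image (continuous_fst.comp (continuous_cylCoord d))).bddAbove.mono ?_
    rintro r ⟨-, x, hx, rfl⟩
    exact ⟨x, hx, rfl⟩
  refine absurd (le_csSup hbdd ⟨hq, merMap d q, subset_tsupport _ ?_, congrArg Prod.fst hc⟩)
    (not_le.2 h)
  have : cylLift f (merMap d q) = f (cylCoord (merMap d q)).1 (cylCoord (merMap d q)).2 := rfl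
  rw [Function.mem_support, this, hc]
  exact hne

/-- Cylindrical coordinates turn the L^1 norm of r ω on ℝ^d into the weight r^(d-1) on the
half-plane, up to the area of the sphere. -/
theorem impulse_of_eLpNorm (hd : 2 ≤ d) {v : RSpace d → RSpace d} (hv : ContDiff ℝ 1 v) {M : ℝ≥0}
    (hM : eLpNorm (fun x : RSpace d => cylRadius x * cylLift (scalarVorticity v) x) 1 volume = M) :
    IntegrableOn (fun q : ℝ × ℝ => q.1 ^ (d - 1) * vort v q) {q : ℝ × ℝ | 0 < q.1} ∧
      ∫ q in {q : ℝ × ℝ | 0 < q.1}, q.1 ^ (d - 1) * vort v q ≤ M / (sphereArea d).toReal := by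
  have mf : Measurable fun q : ℝ × ℝ => q.1 * vort v q :=
    measurable_fst.mul (continuous_vort hv).measurable
  have hM' : eLpNorm (fun x : RSpace d => (fun q : ℝ × ℝ => q.1 * vort v q) (cylCoord x)) 1
      volume = M := hM
  have hint : Integrable fun x : RSpace d => (fun q : ℝ × ℝ => q.1 * vort v q) (cylCoord x) :=
    memLp_one_iff_integrable.1
      ⟨(mf.comp (continuous_cylCoord d).measurable).aestronglyMeasurable, by rw [hM']; simp⟩
  have epow : (fun q : ℝ × ℝ => q.1 ^ (d - 2) * (q.1 * vort v q)) =
      fun q : ℝ × ℝ => q.1 ^ (d - 1) * vort v q := funext fun q => by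
    rw [← mul_assoc, ← pow_succ]; congr 2; omega
  have h1 := (integrable_comp_cylCoord_iff hd mf).1 hint
  have h2 := integral_comp_cylCoord hd mf
  rw [integrable_meridianMeasure_iff, epow] at h1
  rw [integral_meridianMeasure, epow] at h2
  refine ⟨h1, ?_⟩
  rw [le_div_iff₀' (sphereArea_pos hd), ← h2]
  have h3 := enorm_integral_le_lintegral_enorm
    (μ := (volume : Measure (RSpace d))) fun x => (fun q : ℝ × ℝ => q.1 * vort v q) (cylCoord x)
  rw [← eLpNorm_one_eq_lintegral_enorm, hM', Real.enorm_eq_ofReal_abs] at h3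
  refine (le_abs_self _).trans ?_
  exact_mod_cast (ENNReal.ofReal_le_iff_le_toReal (by simp)).1 h3

end Initial

theorem mainTheorem6 (d : ℕ) [NeZero d] (hd : 3 ≤ d) (M K : ℝ≥0) (S₀ : ℝ) :
    ∃ C : ℝ, 0 < C ∧
      ∀ (s : ℝ), 1 + (d : ℝ) / 2 < s →
      ∀ (T : EReal) (u : ℝ → RSpace d → RSpace d),
        IsEulerSolution s T u →
        (∀ t ∈ timeInterval T, IsAxisymmetricSwirlFree (u t)) →
        (∀ r z : ℝ, 0 ≤ r → 0 ≤ scalarVorticity (u 0) r z) →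
        HasCompactSupport (cylLift (scalarVorticity (u 0)) : RSpace d → ℝ) →
        eLpNorm (fun x : RSpace d => cylRadius x * cylLift (scalarVorticity (u 0)) x)
          1 volume = (M : ℝ≥0∞) →
        eLpNorm (fun x : RSpace d => cylLift (scalarVorticity (u 0)) x / cylRadius x ^ (d - 2))
          ∞ volume = (K : ℝ≥0∞) →
        radialSupportSize d (scalarVorticity (u 0)) = S₀ →
        ∀ p : ℕ, 1 ≤ p → ∀ t ∈ timeInterval T, ∀ r : ℝ, 0 < r → 2 * S₀ ≤ r →
          IntegrableOn (fun q : ℝ × ℝ => scalarVorticity (u t) q.1 q.2) (outerRegion r) ∧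
          outerMass (scalarVorticity (u t)) r
            ≤ C ^ p * (p : ℝ) ^ p * t ^ p / r ^ (p * (d + 1) + (d - 1)) := by
  have hd2 : 2 ≤ d := by omega
  have hσ := sphereArea_pos (d := d) hd2
  obtain ⟨C, hC0, hC⟩ := IsRegularFlow.exists_outer_vort_le (d := d) hd
    (I := M / (sphereArea d).toReal) (by positivity)
  refine ⟨C, hC0, fun s hs T u hu hax hpos hcs hM _ hS₀ p hp t ht r hr hrS => ?_⟩
  have ht₁ : t ∈ Icc 0 t := ⟨ht.1, le_rfl⟩
  -- Time is clamped at the given t itself, so the regular flow agrees with u at times 0 and t; the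
  -- constant was fixed before u and t were chosen.
  have hU := hu.isRegularFlow hs hax ht
  have hU0 : u (clampTime t 0) = u 0 := by rw [clampTime_of_mem ⟨le_rfl, ht.1⟩]
  have hUt : u (clampTime t t) = u t := by rw [clampTime_of_mem ht₁]
  have hv0 : ContDiff ℝ 1 (u 0) := hU0 ▸ hU.contDiff 0
  have h0 : ∀ q : ℝ × ℝ, 0 < q.1 → 0 ≤ vort (u (clampTime t 0)) q := fun q hq => by
    rw [hU0]; exact hpos q.1 q.2 hq.le
  obtain ⟨hi, hI⟩ := impulse_of_eLpNorm hd2 hv0 hM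
  rw [← hU0] at hi hI
  have hvan : ∀ q : ℝ × ℝ, 0 < q.1 → S₀ < q.1 → vort (u (clampTime t 0)) q = 0 :=
    fun q hq hq' => by
      rw [hU0]; exact eq_zero_of_radialSupportSize_lt hd2 hcs hq (hS₀.trans_lt hq')
  have hreg : outerRegion r = {q : ℝ × ℝ | r ≤ q.1} := by
    ext q
    exact ⟨fun h => h.2, fun h => ⟨hr.le.trans h, h⟩⟩
  have h1 := (hU.integrableOn_outer_vort hd h0 hi ht₁ hr).1
  have h2 := hC t _ hU h0 hi hI S₀ hvan p hp t ht₁ r hr hrS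
  beta_reduce at h1 h2
  rw [hUt] at h1 h2
  rw [outerMass, hreg]
  exact ⟨h1, h2⟩
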